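/- Let $\Omega^*=\{x\in\mathbb R^3:\|x\|<1\}$ and, for $\sigma\in(0,1)$, $\Omega^*_\sigma=\{x\in\mathbb R^3:\sigma<\|x\|<1\}$. For $\Omega$ one of these domains let $\mathcal V(\Omega)$ be the space of divergence-free fields in $C_c^\infty(\Omega)^3$, let $H(\Omega)$ and $V(\Omega)$ be its closures in $L_2(\Omega)^3$ and $W^1_2(\Omega)^3$, and let the Stokes operator $S$ on $\Omega$ be the Friedrichs extension in $H(\Omega)$ of $-\Delta$ on $\mathcal V(\Omega)$: $u\in D(S)$ and $Su=f$ mean that $u\in V(\Omega)$, $f\in H(\Omega)$ and $\int_\Omega\nabla u:\nabla v=\int_\Omega f\cdot v$ for all $v\in V(\Omega)$. Denote by $\lambda_{1,S}(0)$ and $\lambda_{1,S}(\sigma)$ the smallest eigenvalues of the Stokes operators on $\Omega^*$ and $\Omega^*_\sigma$. Let $\kappa_{1,S}(0)$ be the smallest positive zero of the Bessel function $J_{3/2}$, and let $\kappa_{1,S}(\sigma)$ be the smallest positive solution $\kappa$ of $$J_{3/2}(\kappa)J_{-3/2}(\kappa\sigma)-J_{3/2}(\kappa\sigma)J_{-3/2}(\kappa)=0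 .$$ With $r=\|x\|$, polar coordinates $r,\vartheta,\varphi$ and unit vectors $e_\vartheta,e_\varphi$, put $\mathfrak w_0=\sin\vartheta\, e_\varphi$, $\mathfrak w_{-1}=\cos\varphi\, e_\vartheta-\sin\varphi\cos\vartheta\, e_\varphi$, $\mathfrak w_1=\sin\varphi\, e_\vartheta+\cos\varphi\cos\vartheta\, e_\varphi$ (extended continuously to the polar axis away from the origin) and, for $\alpha\in\{-1,0,1\}$, $$w_{\alpha,0}(x)=\frac{c_{\alpha,0}}{\sqrt r}J_{3/2}(\kappa_{1,S}(0)r)\,\mathfrak w_\alpha ,\qquad w_{\alpha,0}(0)=0,$$ $$w_{\alpha,\sigma}(x)=\frac{c_{\alpha,\sigma}}{\sqrt r}\Big(J_{3/2}(\kappa\sigma)J_{-3/2}(\kappa r)-J_{-3/2}(\kappa\sigma)J_{3/2}(\kappa r)\Big)\mathfrak w_\alpha\quad(\sigma\le r\le 1,\ \kappa=\kappa_{1,S}(\sigma)),$$ $w_{\alpha,\sigma}(x)=0$ for $r<\sigma$, with positive constants $c_{\alpha,0}$, $c_{\alpha,\sigma}$ such that the fields have norm $1$ in $L_2(\Omega^*)^3$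 and $L_2(\Omega^*_\sigma)^3$, respectively. Then: (i) The numbers $\kappa_{1,S}(0)$, $\lambda_{1,S}(0)$ and, for all $\sigma\in(0,1)$, $\kappa_{1,S}(\sigma)$, $\lambda_{1,S}(\sigma)$ exist (the minima are attained), $\lambda_{1,S}(0)=\kappa_{1,S}(0)^2$ and $\lambda_{1,S}(\sigma)=\kappa_{1,S}(\sigma)^2$. These eigenvalues are triple: $(w_{\alpha,0})_{\alpha}$ and $(w_{\alpha,\sigma})_{\alpha}$ are $L_2$-orthonormal bases of the corresponding eigenspaces. (ii) $\sigma\mapsto\lambda_{1,S}(\sigma)$ is continuous and monotonically increasing (i.e. nondecreasing) on $(0,1)$, and $\lambda_{1,S}(0)\le\lambda_{1,S}(\sigma)$ for all $\sigma\in(0,1)$. (iii) $\displaystyle \kappa_{1,S}(0)^2=\lambda_{1,S}(0)=\lim_{\sigma\to0+}\lambda_{1,S}(\sigma)=\lim_{\sigma\to0+}\kappa_{1,S}(\sigma)^2$. (iv) For every $\alpha\in\{-1,0,1\}$, $\lim_{\sigma\to0+}w_{\alpha,\sigma}(x)=w_{\alpha,0}(x)$ for every $x$ with $\|x\|\le1$,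 and the convergence on the closed unit ball is also almost uniform (uniform off measurable sets of arbitrarily small measure). -/

import Mathlib

open MeasureTheory Set Filter Topology
open scoped ContDiff ENNReal

noncomputable section

/-! ### Domains and solenoidal function spaces -/

/-- Three-dimensional Euclidean space. -/
abbrev E3 : Type := EuclideanSpace ℝ (Fin 3)

/-- Real `3 × 3` matrices, carrying the Frobenius inner product. -/
abbrev Mat3 : Type := EuclideanSpace ℝ (Fin 3 × Fin 3)

/-- The open unit ball. -/
def unitBall3 : Set E3 := {x | ‖x‖ < 1}

/-- The annulus (spherical shell) with inner radius `σ` and outer radius `1`. -/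
def annulus3 (σ : ℝ) : Set E3 := {x | σ < ‖x‖ ∧ ‖x‖ < 1}

/-- The classical partial derivative `∂ u_j / ∂ x_k`, as the entry `(j, k)` of the Jacobian. -/
def jacobian (u : E3 → E3) (x : E3) : Mat3 :=
  WithLp.toLp 2 (fun p => (fderiv ℝ u x (EuclideanSpace.single p.2 (1 : ℝ))) p.1)

/-- Smooth functions with compact support in `Ω`. -/
def IsTestFunction {F : Type*} [NormedAddCommGroup F] [NormedSpace ℝ F]
    (Ω : Set E3) (η : E3 → F) : Prop :=
  ContDiff ℝ ∞ η ∧ HasCompactSupport η ∧ tsupport η ⊆ Ω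

/-- Smooth vector fields with compact support in `Ω` and zero divergence. -/
def IsSolenoidalTest (Ω : Set E3) (φ : E3 → E3) : Prop :=
  IsTestFunction Ω φ ∧ ∀ x, ∑ k : Fin 3, jacobian φ x (k, k) = 0

/-- `G` is the weak (distributional) Jacobian of `u` on `Ω`:
`∫_Ω u_j ∂_k η = - ∫_Ω G_{jk} η` for all scalar test functions `η`. -/
def HasWeakJacobian (Ω : Set E3) (u : E3 → E3) (G : E3 → Mat3) : Prop :=
  ∀ η : E3 → ℝ, IsTestFunction Ω η → ∀ j k : Fin 3,
    ∫ x in Ω, u x j * fderiv ℝ η x (EuclideanSpace.single k (1 : ℝ)) =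
      - ∫ x in Ω, G x (j, k) * η x

/-- `u` belongs to the vector-valued Sobolev space `W^1_2(Ω)` and has weak Jacobian `G`. -/
def MemSobolev (Ω : Set E3) (u : E3 → E3) (G : E3 → Mat3) : Prop :=
  MemLp u 2 (volume.restrict Ω) ∧ MemLp G 2 (volume.restrict Ω) ∧ HasWeakJacobian Ω u G

/-- `f` belongs to the closure, in `L_2(Ω)`, of the solenoidal test fields. -/
def MemH (Ω : Set E3) (f : E3 → E3) : Prop :=
  MemLp f 2 (volume.restrict Ω) ∧
    ∀ ε : ℝ≥0∞, 0 < ε → ∃ φ : E3 → E3, IsSolenoidalTest Ω φ ∧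
      eLpNorm (fun x => f x - φ x) 2 (volume.restrict Ω) < ε

/-- `u`, with weak Jacobian `G`, belongs to the closure, in `W^1_2(Ω)`, of the solenoidal
test fields. -/
def MemV (Ω : Set E3) (u : E3 → E3) (G : E3 → Mat3) : Prop :=
  MemSobolev Ω u G ∧
    ∀ ε : ℝ≥0∞, 0 < ε → ∃ φ : E3 → E3, IsSolenoidalTest Ω φ ∧
      eLpNorm (fun x => u x - φ x) 2 (volume.restrict Ω) < ε ∧
      eLpNorm (fun x => G x - jacobian φ x) 2 (volume.restrict Ω) < ε

/-! ### The Stokes operator and its first eigenvalue -/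

/-- The graph of the Stokes operator on `Ω`: `u ∈ D(S)` and `S u = f`.
`S` is the Friedrichs extension, in the Hilbert space `H(Ω)`, of `- Δ` on the solenoidal test
fields, i.e. the operator of the closed form `(u, v) ↦ ∫_Ω ∇u : ∇v` with form domain `V(Ω)`. -/
def StokesGraph (Ω : Set E3) (u f : E3 → E3) : Prop :=
  MemH Ω f ∧ ∃ G : E3 → Mat3, MemV Ω u G ∧
    ∀ (v : E3 → E3) (K : E3 → Mat3), MemV Ω v K →
      ∫ x in Ω, inner ℝ (G x) (K x) = ∫ x in Ω, inner ℝ (f x) (v x)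

/-- `u` lies in the kernel of `S - lam` (`u = 0` allowed). -/
def InStokesEigenspace (Ω : Set E3) (lam : ℝ) (u : E3 → E3) : Prop :=
  StokesGraph Ω u (fun x => lam • u x)

/-- The set of eigenvalues of the Stokes operator on `Ω`. -/
def stokesEigenvalues (Ω : Set E3) : Set ℝ :=
  {lam | ∃ u : E3 → E3, InStokesEigenspace Ω lam u ∧ ¬ (u =ᵐ[volume.restrict Ω] 0)}

/-- The first Stokes eigenvalue. -/
def firstStokesEigenvalue (Ω : Set E3) : ℝ := sInf (stokesEigenvalues Ω)

/-- The three fields `w α` (`α = -1, 0, 1`) form an `L_2(Ω)`-orthonormal basis of the eigenspace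
of the Stokes operator for `lam`. -/
def IsOrthonormalEigenbasis (Ω : Set E3) (lam : ℝ) (w : SignType → E3 → E3) : Prop :=
  (∀ α β : SignType, ∫ x in Ω, inner ℝ (w α x) (w β x) = if α = β then (1 : ℝ) else 0) ∧
    ∀ u : E3 → E3, InStokesEigenspace Ω lam u ↔
      ∃ c : SignType → ℝ, u =ᵐ[volume.restrict Ω] fun x => ∑ α, c α • w α x

/-! ### Bessel functions and the transcendental equations -/

/-- The Bessel function of the first kind of order `ν`, for arguments `t > 0` (and for `t = 0`
if `ν > 0`). -/
def besselJ (ν t : ℝ) : ℝ :=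
  ∑' m : ℕ, (-1 : ℝ) ^ m / ((m.factorial : ℝ) * Real.Gamma ((m : ℝ) + ν + 1)) *
    (t / 2) ^ (2 * (m : ℝ) + ν)

/-- Positive zeros of `J_{3/2}`. -/
def ballZeros : Set ℝ := {κ | 0 < κ ∧ besselJ (3 / 2) κ = 0}

/-- Positive solutions of the transcendental equation on the annulus with inner radius `σ`. -/
def annulusZeros (σ : ℝ) : Set ℝ :=
  {κ | 0 < κ ∧ besselJ (3 / 2) κ * besselJ (-(3 / 2)) (κ * σ) -
    besselJ (3 / 2) (κ * σ) * besselJ (-(3 / 2)) κ = 0}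

/-- The first positive zero of `J_{3/2}`. -/
def kappaBall : ℝ := sInf ballZeros

/-- The first positive solution of the transcendental equation on the annulus. -/
def kappaAnnulus (σ : ℝ) : ℝ := sInf (annulusZeros σ)

/-! ### The eigenfunctions -/

/-- The tangential surface fields, homogeneous of degree `0`, in Cartesian coordinates. The
lemmas below give them in polar coordinates. -/
def surfaceField (α : SignType) (x : E3) : E3 :=
  ‖x‖⁻¹ • match α with
    | .zero => !₂[-x 1, x 0, 0]
    | .neg => !₂[x 2, 0, -x 0]
    | .pos => !₂[0, x 2, -x 1]

/-- The point with polar coordinates `r, θ, φ`. -/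
def polarPoint (r θ φ : ℝ) : E3 :=
  !₂[r * (Real.sin θ * Real.cos φ), r * (Real.sin θ * Real.sin φ), r * Real.cos θ]

/-- The unit vector in the direction of the polar angle. -/
def unitTheta (θ φ : ℝ) : E3 :=
  !₂[Real.cos θ * Real.cos φ, Real.cos θ * Real.sin φ, -Real.sin θ]

/-- The unit vector in the direction of the azimuth. -/
def unitPhi (φ : ℝ) : E3 := !₂[-Real.sin φ, Real.cos φ, 0]

theorem norm_polarPoint {r : ℝ} (hr : 0 < r) (θ φ : ℝ) : ‖polarPoint r θ φ‖ = r := by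
  rw [EuclideanSpace.norm_eq, Fin.sum_univ_three]
  have h : ‖polarPoint r θ φ 0‖ ^ 2 + ‖polarPoint r θ φ 1‖ ^ 2 + ‖polarPoint r θ φ 2‖ ^ 2
      = r ^ 2 := by
    simp only [Real.norm_eq_abs, sq_abs]
    simp [polarPoint]
    linear_combination (r ^ 2 * Real.sin θ ^ 2) * Real.sin_sq_add_cos_sq φ
      + r ^ 2 * Real.sin_sq_add_cos_sq θ
  rw [h, Real.sqrt_sq hr.le]

theorem surfaceField_zero_polar {r : ℝ} (hr : 0 < r) (θ φ : ℝ) :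
    surfaceField .zero (polarPoint r θ φ) = Real.sin θ • unitPhi φ := by
  have hr' := hr.ne'
  ext i
  fin_cases i <;> simp [surfaceField, norm_polarPoint hr] <;> simp [polarPoint, unitPhi] <;>
    field_simp

theorem surfaceField_neg_polar {r : ℝ} (hr : 0 < r) (θ φ : ℝ) :
    surfaceField .neg (polarPoint r θ φ) =
      Real.cos φ • unitTheta θ φ - (Real.sin φ * Real.cos θ) • unitPhi φ := by
  have hr' := hr.ne'
  have h := Real.sin_sq_add_cos_sq φ
  ext i
  fin_cases i <;> simp [surfaceField, norm_polarPoint hr] <;>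
    simp [polarPoint, unitPhi, unitTheta] <;> field_simp <;> grind

theorem surfaceField_pos_polar {r : ℝ} (hr : 0 < r) (θ φ : ℝ) :
    surfaceField .pos (polarPoint r θ φ) =
      Real.sin φ • unitTheta θ φ + (Real.cos φ * Real.cos θ) • unitPhi φ := by
  have hr' := hr.ne'
  have h := Real.sin_sq_add_cos_sq φ
  ext i
  fin_cases i <;> simp [surfaceField, norm_polarPoint hr] <;>
    simp [polarPoint, unitPhi, unitTheta] <;> field_simp <;> grind

/-- Scaling to norm `1` in `L_2(Ω)`. -/
def normalizeL2 (Ω : Set E3) (W : E3 → E3) (x : E3) : E3 :=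
  (Real.sqrt (∫ y in Ω, ‖W y‖ ^ 2))⁻¹ • W x

/-- First eigenfunctions on the unit ball, before scaling. -/
def ballField (α : SignType) (x : E3) : E3 :=
  (besselJ (3 / 2) (kappaBall * ‖x‖) / Real.sqrt ‖x‖) • surfaceField α x

/-- First eigenfunctions on the annulus, before scaling, extended by zero to `‖x‖ < σ`.
With `κ = kappaAnnulus σ`, the radial profile is the positive or negative multiple
`- J_{-3/2}(κσ)` of `J_{3/2}(κr) - J_{3/2}(κσ) / J_{-3/2}(κσ) * J_{-3/2}(κr)` whenever the
denominator `J_{-3/2}(κσ)` does not vanish; it is negative for all small `σ`, so that the multiple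
is then positive. Without a denominator the profile is meaningful for every `σ`. -/
def annulusField (σ : ℝ) (α : SignType) (x : E3) : E3 :=
  if σ ≤ ‖x‖ then
    ((besselJ (3 / 2) (kappaAnnulus σ * σ) * besselJ (-(3 / 2)) (kappaAnnulus σ * ‖x‖) -
      besselJ (-(3 / 2)) (kappaAnnulus σ * σ) * besselJ (3 / 2) (kappaAnnulus σ * ‖x‖)) /
        Real.sqrt ‖x‖) • surfaceField α x
  else 0

/-- The normalized first eigenfunctions on the unit ball. -/
def ballEigenfield (α : SignType) : E3 → E3 := normalizeL2 unitBall3 (ballField α)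

/-- The normalized first eigenfunctions on the annulus, extended by zero to `‖x‖ < σ`. -/
def annulusEigenfield (σ : ℝ) (α : SignType) : E3 → E3 :=
  normalizeL2 (annulus3 σ) (annulusField σ α)

end

noncomputable section

/-! ### Spherical Bessel functions in closed form -/

/-! Write `W` for the radial profile solving `W'' + (4/r) W' + κ² W = 0` and vanishing on the
boundary spheres, with `κ = firstRoot σ`; the ball is the case `σ = 0`, where regularity at the
origin replaces the inner boundary condition. For an antisymmetric matrix `C` the field `W(|x|) C x`
is solenoidal and satisfies `-Δu = κ² u` without pressure. The theorem says that these fields, a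
space of dimension three, are exactly the first eigenfields.

The number `κ` is explicit. `J_{3/2}` and `J_{-3/2}` are elementary, and with the phase `θ(t) = t -
arctan t` both transcendental equations become `sin (θ(κ) - θ(κσ)) = 0`. The phase difference
increases in `κ` and decreases in `σ`, so the first root is where it equals `π`; monotonicity and
continuity in `σ` follow from this description.

The lower bound rests on a scalar fact. The function `h = W(|x|) ⟨n, x⟩` is positive on the half
shell `⟨n, x⟩ > 0` and satisfies `-Δh = κ² h`. Picone's identity (`picone_identity`) gives `∫ |∇ψ|²
- κ² ψ² = ∫ |∇ψ - ψ ∇h/h|²` for test functions vanishing on the plane orthogonal to `n`. Hence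
functions odd in some plane have nonnegative energy, and limits of vanishing energy are multiples of
`h` (`ae_eq_halfProfile_of_energy_tendsto`).

To use this for vector fields, an eigenfield is split by the three coordinate reflections into eight
parity classes. In five of them every component is odd in some coordinate, so the scalar fact
applies to each component. The other three are permutations of one class, in which one component is
even in every coordinate (`ae_eq_zero_of_third_class`). There the scalar fact, applied to odd parts
under vertical reflections, shows that the field is axially symmetric. It is then compared with its
rotational average `w`, which is the curl of an azimuthal potential `A` whose components are again
odd. Picone's identity for `A`, together with `0 ≤ ∫ |κ² A - curl φ|²`, gives `κ² ∫ |w|² ≤ ∫ |∇φ|²`.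
Equality in the limit is excluded, because curls of solenoidal test fields are orthogonal to linear
functions. So this class contributes nothing up to the level `κ²`.

No regularity theory and no pressure is needed: the arguments run along solenoidal test fields
approximating an eigenfield (`CritSeq`), and only their limits are identified. Solenoidality finally
forces `C` to be antisymmetric. Conversely, `W(|x|) C x` is shown to be an eigenfield by cutting it
off near the boundary; the same Picone identity shows that the energy lost by the cut-off tends to
zero.

The limit `σ → 0` reduces to continuity of `firstRoot`, of the phase shift and of the normalization
integral, plus uniform continuity away from the origin. -/

theorem factorial_mul_Gamma_add_half (m : ℕ) :
    (m.factorial : ℝ) * Real.Gamma (m + 1 / 2) = √Real.pi * (2 * m).factorial / 4 ^ m := by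
  induction m with
  | zero => simp [-one_div, Real.Gamma_one_half_eq]
  | succ m ih =>
    have h : Real.Gamma (((m + 1 : ℕ) : ℝ) + 1 / 2) = (m + 1 / 2) * Real.Gamma (m + 1 / 2) := by
      rw [← Real.Gamma_add_one (by positivity)]
      congr 1
      push_cast
      ring
    rw [h, show 2 * (m + 1) = 2 * m + 1 + 1 by ring, Nat.factorial_succ (2 * m + 1),
      Nat.factorial_succ (2 * m), Nat.factorial_succ m]
    push_cast
    rw [show ((m : ℝ) + 1) * m.factorial * ((m + 1 / 2) * Real.Gamma (m + 1 / 2)) =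
      (m + 1) * (m + 1 / 2) * (m.factorial * Real.Gamma (m + 1 / 2)) by ring, ih]
    field_simp
    ring

/-- The common positive prefactor of `J_{3/2}` and `J_{-3/2}`. -/
def besselPrefactor (t : ℝ) : ℝ := 4 / (√Real.pi * t ^ 3) * (t / 2) ^ (3 / 2 : ℝ)

theorem besselPrefactor_pos {t : ℝ} (ht : 0 < t) : 0 < besselPrefactor t := by
  unfold besselPrefactor
  have := Real.pi_pos
  positivity

theorem rpow_two_mul_add {t : ℝ} (ht : 0 < t) (m : ℕ) (ν : ℝ) :
    (t / 2) ^ (2 * (m : ℝ) + ν) = (t ^ (2 * m) / 4 ^ m) * (t / 2) ^ ν := by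
  rw [Real.rpow_add (by positivity)]
  congr 1
  rw [show 2 * (m : ℝ) = ((2 * m : ℕ) : ℝ) by push_cast; ring, Real.rpow_natCast, div_pow,
    pow_mul 2]
  norm_num

/-- The series are compared term by term. In `sin t - t cos t` the terms of index zero cancel, so
the Bessel term of index `m` corresponds to index `m + 1`. -/
theorem besselJ_three_halves {t : ℝ} (ht : 0 < t) :
    besselJ (3 / 2) t = besselPrefactor t * (Real.sin t - t * Real.cos t) := by
  have h := (Real.hasSum_sin t).sub ((Real.hasSum_cos t).mul_left t)
  rw [← hasSum_nat_add_iff' 1] at h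
  simp only [Finset.range_one, Finset.sum_singleton] at h
  have h2 := h.mul_left (besselPrefactor t)
  have hpi := Real.sqrt_pos.2 Real.pi_pos
  refine Eq.trans (tsum_congr fun m => ?_) (h2.tsum_eq.trans ?_)
  · have hG : Real.Gamma ((m : ℝ) + 3 / 2 + 1) =
        (m + 3 / 2) * ((m + 1 / 2) * Real.Gamma (m + 1 / 2)) := by
      rw [← Real.Gamma_add_one (by positivity), Real.Gamma_add_one (by positivity)]
      congr 2
      ring
    have hd : (m.factorial : ℝ) * Real.Gamma ((m : ℝ) + 3 / 2 + 1) =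
        (m + 3 / 2) * (m + 1 / 2) * (√Real.pi * (2 * m).factorial / 4 ^ m) := by
      rw [hG, ← factorial_mul_Gamma_add_half]
      ring
    rw [hd, rpow_two_mul_add ht]
    unfold besselPrefactor
    rw [show 2 * (m + 1) + 1 = 2 * m + 1 + 1 + 1 by ring, show 2 * (m + 1) = 2 * m + 1 + 1 by ring,
      Nat.factorial_succ (2 * m + 1 + 1), Nat.factorial_succ (2 * m + 1),
      Nat.factorial_succ (2 * m)]
    have hf : ((2 * m).factorial : ℝ) ≠ 0 := by positivity
    push_cast
    have h1 : (2 * (m : ℝ) + 1) ≠ 0 := by positivity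
    have h2 : (2 * (m : ℝ) + 1 + 1) ≠ 0 := by positivity
    have h3 : (2 * (m : ℝ) + 1 + 1 + 1) ≠ 0 := by positivity
    have h4 : ((m : ℝ) + 3 / 2) ≠ 0 := by positivity
    have h5 : ((m : ℝ) + 1 / 2) ≠ 0 := by positivity
    field_simp
    ring
  · simp

/-- Here the coefficient of `t ^ (2 m)` in `cos t + t sin t` is proportional to `(1 - 2 m) / (2
m)!`, and the factor `m - 1/2` comes from `Γ(m - 1/2) = Γ(m + 1/2) / (m - 1/2)`. -/
theorem besselJ_neg_three_halves {t : ℝ} (ht : 0 < t) :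
    besselJ (-(3 / 2)) t = - (besselPrefactor t * (Real.cos t + t * Real.sin t)) := by
  have hs := (Real.hasSum_sin t).mul_left t
  -- The series of `t sin t` is shifted by one index, to run over the same powers as the cosine
  -- series; the factor `2 m` makes the added term of index zero vanish.
  have hs' : HasSum (fun m : ℕ => - ((-1 : ℝ) ^ m * t ^ (2 * m) * (2 * m) / (2 * m).factorial))
      (t * Real.sin t) := by
    rw [← hasSum_nat_add_iff' 1]
    have e : ∀ m : ℕ, - ((-1 : ℝ) ^ (m + 1) * t ^ (2 * (m + 1)) * (2 * ((m + 1 : ℕ) : ℝ)) /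
        (2 * (m + 1)).factorial) = t * ((-1) ^ m * t ^ (2 * m + 1) / (2 * m + 1).factorial) := by
      intro m
      rw [show 2 * (m + 1) = 2 * m + 1 + 1 by ring, Nat.factorial_succ (2 * m + 1)]
      push_cast
      have h2 : (2 * (m : ℝ) + 1 + 1) ≠ 0 := by positivity
      field_simp
      ring
    simpa only [e, Finset.range_one, Finset.sum_singleton, Nat.cast_zero, mul_zero, zero_div,
      neg_zero, sub_zero] using hs
  have h2 := (((Real.hasSum_cos t).add hs').mul_left (besselPrefactor t)).neg
  have hpi := Real.sqrt_pos.2 Real.pi_pos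
  refine Eq.trans (tsum_congr fun m => ?_) h2.tsum_eq
  have hne : (m : ℝ) - 1 / 2 ≠ 0 := by
    intro h
    have h' : (2 * m : ℝ) = 1 := by linarith
    norm_cast at h'
    omega
  have hG : Real.Gamma ((m : ℝ) + -(3 / 2) + 1) = Real.Gamma (m + 1 / 2) / (m - 1 / 2) := by
    rw [eq_div_iff hne, show (m : ℝ) + 1 / 2 = (m - 1 / 2) + 1 by ring, Real.Gamma_add_one hne,
      show (m : ℝ) + -(3 / 2) + 1 = m - 1 / 2 by ring]
    ring
  have hd : (m.factorial : ℝ) * Real.Gamma ((m : ℝ) + -(3 / 2) + 1) =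
      (√Real.pi * (2 * m).factorial / 4 ^ m) / (m - 1 / 2) := by
    rw [hG, ← factorial_mul_Gamma_add_half]
    ring
  have hp : (t / 2) ^ (-(3 / 2) : ℝ) = 8 / t ^ 3 * (t / 2) ^ (3 / 2 : ℝ) := by
    rw [show (-(3 / 2) : ℝ) = 3 / 2 - (3 : ℕ) by norm_num, Real.rpow_sub (by positivity),
      Real.rpow_natCast]
    field_simp
    norm_num
  rw [hd, rpow_two_mul_add ht, hp]
  unfold besselPrefactor
  have hf : ((2 * m).factorial : ℝ) ≠ 0 := by positivity
  field_simp
  ring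

/-! ### The phase function and the first positive roots -/

/-- The phase of the spherical Bessel functions of order one. -/
def besselPhase (t : ℝ) : ℝ := t - Real.arctan t

/-- Amplitude and phase form. The companion formula for `cos t + t sin t` has the same amplitude, so
a cross product of the two functions collapses to the sine of a phase difference. -/
theorem sin_sub_mul_cos (t : ℝ) :
    Real.sin t - t * Real.cos t = √(1 + t ^ 2) * Real.sin (besselPhase t) := by
  have h : √(1 + t ^ 2) ≠ 0 := by positivity
  rw [besselPhase, Real.sin_sub, Real.cos_arctan, Real.sin_arctan]
  field_simp

theorem cos_add_mul_sin (t : ℝ) :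
    Real.cos t + t * Real.sin t = √(1 + t ^ 2) * Real.cos (besselPhase t) := by
  have h : √(1 + t ^ 2) ≠ 0 := by positivity
  rw [besselPhase, Real.cos_sub, Real.cos_arctan, Real.sin_arctan]
  field_simp

theorem hasDerivAt_besselPhase (t : ℝ) : HasDerivAt besselPhase (t ^ 2 / (1 + t ^ 2)) t := by
  refine HasDerivAt.congr_deriv ((hasDerivAt_id t).sub (Real.hasDerivAt_arctan t)) ?_
  have : 1 + t ^ 2 ≠ 0 := by positivity
  rw [sub_eq_iff_eq_add, ← add_div, add_comm, div_self this]

theorem continuous_besselPhase : Continuous besselPhase :=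
  continuous_id.sub Real.continuous_arctan

@[simp] theorem besselPhase_zero : besselPhase 0 = 0 := by simp [besselPhase]

theorem besselPhase_strictMonoOn : StrictMonoOn besselPhase (Ici 0) := by
  refine strictMonoOn_of_deriv_pos (convex_Ici 0) continuous_besselPhase.continuousOn fun t ht => ?_
  rw [(hasDerivAt_besselPhase t).deriv]
  rw [interior_Ici] at ht
  have : 0 < t := ht
  positivity

/-- The phase difference `κ ↦ θ(κ) - θ(κσ)` whose level `π` determines the first root. -/
def phaseGap (σ κ : ℝ) : ℝ := besselPhase κ - besselPhase (κ * σ)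

theorem continuous_phaseGap : Continuous fun p : ℝ × ℝ => phaseGap p.1 p.2 := by
  unfold phaseGap
  have := continuous_besselPhase
  fun_prop

/-- The phase has derivative `t² / (1 + t²)`. Over a common denominator the difference of the two
derivatives has numerator `κ² ((1 - σ³) + κ² σ² (1 - σ))`. -/
theorem phaseGap_strictMonoOn {σ : ℝ} (h0 : 0 ≤ σ) (h1 : σ < 1) :
    StrictMonoOn (phaseGap σ) (Ici 0) := by
  have hc : Continuous (phaseGap σ) := 
    continuous_phaseGap.comp (by fun_prop : Continuous fun κ : ℝ => (σ, κ))
  refine strictMonoOn_of_deriv_pos (convex_Ici 0) hc.continuousOn fun κ hκ => ?_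
  rw [interior_Ici] at hκ
  have hκ : 0 < κ := hκ
  have hd : HasDerivAt (phaseGap σ)
      (κ ^ 2 / (1 + κ ^ 2) - (κ * σ) ^ 2 / (1 + (κ * σ) ^ 2) * σ) κ := by
    have h := HasDerivAt.comp κ (hasDerivAt_besselPhase (κ * σ)) ((hasDerivAt_id' κ).mul_const σ)
    rw [one_mul] at h
    exact (hasDerivAt_besselPhase κ).sub h
  rw [hd.deriv]
  have e : κ ^ 2 / (1 + κ ^ 2) - (κ * σ) ^ 2 / (1 + (κ * σ) ^ 2) * σ =
      κ ^ 2 * ((1 - σ ^ 3) + κ ^ 2 * σ ^ 2 * (1 - σ)) / ((1 + κ ^ 2) * (1 + (κ * σ) ^ 2)) := by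
    have a1 : 1 + κ ^ 2 ≠ 0 := by positivity
    have a2 : 1 + (κ * σ) ^ 2 ≠ 0 := by positivity
    field_simp
    ring
  rw [e]
  have : σ ^ 3 < 1 := pow_lt_one₀ h0 h1 (by norm_num)
  have : 0 < 1 - σ ^ 3 := by linarith
  have : 0 < 1 - σ := by linarith
  positivity

theorem exists_phaseGap_eq_pi {σ : ℝ} (h0 : 0 ≤ σ) (h1 : σ < 1) :
    ∃ κ, 0 < κ ∧ phaseGap σ κ = Real.pi := by
  have hc : Continuous (phaseGap σ) := 
    continuous_phaseGap.comp (by fun_prop : Continuous fun κ : ℝ => (σ, κ))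
  have hd : 0 < 1 - σ := by linarith
  have hpi := Real.pi_pos
  -- The linear part of the phase difference at `b` is `2 π`, and the arctangents take away less
  -- than `π / 2`.
  set b := 2 * Real.pi / (1 - σ) with hb
  have hb0 : 0 < b := by positivity
  have hbig : Real.pi ≤ phaseGap σ b := by
    have h2 : b - b * σ = 2 * Real.pi := by rw [hb]; field_simp
    have h3 : 0 ≤ Real.arctan (b * σ) := Real.arctan_nonneg.2 (by positivity)
    have h4 := Real.arctan_lt_pi_div_two b
    unfold phaseGap besselPhase
    linarith
  obtain ⟨κ, hκ, hk⟩ := intermediate_value_Icc hb0.le hc.continuousOn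
    (show Real.pi ∈ Icc (phaseGap σ 0) (phaseGap σ b) from ⟨by simp [phaseGap, hpi.le], hbig⟩)
  refine ⟨κ, lt_of_le_of_ne hκ.1 fun h => ?_, hk⟩
  rw [← h] at hk
  simp [phaseGap] at hk
  exact hpi.ne hk

/-- The first root, for inner radius `σ ∈ [0, 1)`; the ball is the case `σ = 0`. -/
def firstRoot (σ : ℝ) : ℝ :=
  -- The default value `1` makes the root positive for every real `σ`.
  if h : 0 ≤ σ ∧ σ < 1 then (exists_phaseGap_eq_pi h.1 h.2).choose else 1

theorem firstRoot_pos (σ : ℝ) : 0 < firstRoot σ := by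
  unfold firstRoot
  split_ifs with h
  · exact (exists_phaseGap_eq_pi h.1 h.2).choose_spec.1
  · exact one_pos

theorem phaseGap_firstRoot {σ : ℝ} (h0 : 0 ≤ σ) (h1 : σ < 1) :
    phaseGap σ (firstRoot σ) = Real.pi := by
  unfold firstRoot
  rw [dif_pos ⟨h0, h1⟩]
  exact (exists_phaseGap_eq_pi h0 h1).choose_spec.2

theorem phaseGap_antitone {κ σ τ : ℝ} (hκ : 0 ≤ κ) (h0 : 0 ≤ σ) (h : σ ≤ τ) :
    phaseGap τ κ ≤ phaseGap σ κ := by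
  have := besselPhase_strictMonoOn.monotoneOn (a := κ * σ) (b := κ * τ)
    (mul_nonneg hκ h0) (mul_nonneg hκ (h0.trans h)) (by gcongr)
  unfold phaseGap
  linarith

/-- Comparison with the implicitly defined root becomes an inequality for the explicit function
`phaseGap` at a fixed `κ`; monotonicity and continuity in `σ` are read off from it. -/
theorem lt_firstRoot_iff {σ κ : ℝ} (h0 : 0 ≤ σ) (h1 : σ < 1) (hκ : 0 ≤ κ) :
    κ < firstRoot σ ↔ phaseGap σ κ < Real.pi := by
  rw [← phaseGap_firstRoot h0 h1]
  exact ((phaseGap_strictMonoOn h0 h1).lt_iff_lt hκ (firstRoot_pos σ).le).symm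

theorem firstRoot_lt_iff {σ κ : ℝ} (h0 : 0 ≤ σ) (h1 : σ < 1) (hκ : 0 ≤ κ) :
    firstRoot σ < κ ↔ Real.pi < phaseGap σ κ := by
  rw [← phaseGap_firstRoot h0 h1]
  exact ((phaseGap_strictMonoOn h0 h1).lt_iff_lt (firstRoot_pos σ).le hκ).symm

theorem firstRoot_monotoneOn : MonotoneOn firstRoot (Ico 0 1) := by
  intro σ hσ τ hτ h
  by_contra! hlt
  have h1 := (lt_firstRoot_iff hσ.1 hσ.2 (firstRoot_pos τ).le).1 hlt
  have h2 := phaseGap_antitone (firstRoot_pos τ).le hσ.1 h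
  rw [phaseGap_firstRoot hτ.1 hτ.2] at h2
  linarith

/-- For fixed `κ` a strict inequality between `phaseGap σ κ` and `π` persists for nearby `σ`, so
strict bounds on the root do too. -/
theorem firstRoot_continuousOn : ContinuousOn firstRoot (Ico 0 1) := by
  intro σ hσ
  have hcont : ∀ κ, Continuous fun τ => phaseGap τ κ := fun κ =>
    continuous_phaseGap.comp (by fun_prop : Continuous fun τ : ℝ => (τ, κ))
  refine tendsto_order.2 ⟨fun a ha => ?_, fun a ha => ?_⟩
  · by_cases h : 0 ≤ a
    · have h1 := (lt_firstRoot_iff hσ.1 hσ.2 h).1 ha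
      filter_upwards [((hcont a).tendsto σ).eventually_lt_const h1 |>.filter_mono nhdsWithin_le_nhds,
        self_mem_nhdsWithin] with τ h2 hτ
      exact (lt_firstRoot_iff hτ.1 hτ.2 h).2 h2
    · exact Eventually.of_forall fun τ => (not_le.1 h).trans (firstRoot_pos τ)
  · have h : 0 ≤ a := (firstRoot_pos σ).le.trans ha.le
    have h1 := (firstRoot_lt_iff hσ.1 hσ.2 h).1 ha
    filter_upwards [((hcont a).tendsto σ).eventually_const_lt h1 |>.filter_mono nhdsWithin_le_nhds,
      self_mem_nhdsWithin] with τ h2 hτ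
    exact (firstRoot_lt_iff hτ.1 hτ.2 h).2 h2

/-- Below the first root the phase difference lies strictly between `0` and `π`, where the sine is
positive. -/
theorem isLeast_sin_phaseGap {σ : ℝ} (h0 : 0 ≤ σ) (h1 : σ < 1) :
    IsLeast {κ | 0 < κ ∧ Real.sin (phaseGap σ κ) = 0} (firstRoot σ) := by
  refine ⟨⟨firstRoot_pos σ, by rw [phaseGap_firstRoot h0 h1, Real.sin_pi]⟩, fun κ hκ => ?_⟩
  by_contra! hlt
  have h2 := (lt_firstRoot_iff h0 h1 hκ.1.le).1 hlt
  have h3 := phaseGap_strictMonoOn h0 h1 (a := 0) (b := κ) (by simp) hκ.1.le hκ.1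
  simp only [phaseGap, zero_mul, sub_self] at h3
  exact (Real.sin_pos_of_pos_of_lt_pi h3 h2).ne' hκ.2

theorem besselPhase_sub_eq (κ σ : ℝ) :
    (Real.sin κ - κ * Real.cos κ) * (Real.cos (κ * σ) + κ * σ * Real.sin (κ * σ)) -
      (Real.sin (κ * σ) - κ * σ * Real.cos (κ * σ)) * (Real.cos κ + κ * Real.sin κ) =
      √(1 + κ ^ 2) * √(1 + (κ * σ) ^ 2) * Real.sin (phaseGap σ κ) := by
  rw [sin_sub_mul_cos, sin_sub_mul_cos, cos_add_mul_sin, cos_add_mul_sin, phaseGap, Real.sin_sub]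
  ring

theorem ballZeros_eq : ballZeros = {κ | 0 < κ ∧ Real.sin (phaseGap 0 κ) = 0} := by
  ext κ
  refine and_congr_right fun hκ => ?_
  have := besselPrefactor_pos hκ
  rw [besselJ_three_halves hκ, sin_sub_mul_cos, phaseGap, mul_zero, besselPhase_zero, sub_zero]
  have h : √(1 + κ ^ 2) ≠ 0 := by positivity
  simp [this.ne', h]

theorem annulusZeros_eq {σ : ℝ} (hσ : 0 < σ) :
    annulusZeros σ = {κ | 0 < κ ∧ Real.sin (phaseGap σ κ) = 0} := by
  ext κ
  refine and_congr_right fun hκ => ?_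
  have hκσ := mul_pos hκ hσ
  have p1 := (besselPrefactor_pos hκ).ne'
  have p2 := (besselPrefactor_pos hκσ).ne'
  rw [besselJ_three_halves hκ, besselJ_neg_three_halves hκσ, besselJ_three_halves hκσ,
    besselJ_neg_three_halves hκ]
  have e := besselPhase_sub_eq κ σ
  have h1 : √(1 + κ ^ 2) ≠ 0 := by positivity
  have h2 : √(1 + (κ * σ) ^ 2) ≠ 0 := by positivity
  rw [show ∀ a b c d p q : ℝ, p * a * -(q * b) - q * c * -(p * d) = -(p * q * (a * b - c * d)) by
    intros; ring, e]
  simp [p1, p2, h1, h2]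

theorem isLeast_ballZeros : IsLeast ballZeros (firstRoot 0) := by
  rw [ballZeros_eq]
  exact isLeast_sin_phaseGap le_rfl one_pos

theorem isLeast_annulusZeros {σ : ℝ} (h0 : 0 < σ) (h1 : σ < 1) :
    IsLeast (annulusZeros σ) (firstRoot σ) := by
  rw [annulusZeros_eq h0]
  exact isLeast_sin_phaseGap h0.le h1

theorem kappaBall_eq : kappaBall = firstRoot 0 := isLeast_ballZeros.csInf_eq

theorem kappaAnnulus_eq {σ : ℝ} (h0 : 0 < σ) (h1 : σ < 1) : kappaAnnulus σ = firstRoot σ :=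
  (isLeast_annulusZeros h0 h1).csInf_eq

end

noncomputable section

/-! ### The radial profile -/

/-- The annulus with inner radius `σ`, or the unit ball if `σ = 0`. -/
def shell (σ : ℝ) : Set E3 := {x | (0 < σ → σ < ‖x‖) ∧ ‖x‖ < 1}

theorem shell_zero : shell 0 = unitBall3 := by simp [shell, unitBall3]

theorem shell_of_pos {σ : ℝ} (h : 0 < σ) : shell σ = annulus3 σ := by simp [shell, annulus3, h]

/-- The shift of the phase caused by the inner boundary. -/
def phaseShift (σ : ℝ) : ℝ := besselPhase (firstRoot σ * σ)

/-- The spherical Bessel combination `sin (t - α) - t cos (t - α)`, whose zeros are the boundary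
points. -/
def radialNum (α t : ℝ) : ℝ := Real.sin (t - α) - t * Real.cos (t - α)

theorem radialNum_eq (α t : ℝ) :
    radialNum α t = √(1 + t ^ 2) * Real.sin (besselPhase t - α) := by
  rw [Real.sin_sub, mul_sub, ← mul_assoc, ← mul_assoc, ← sin_sub_mul_cos, ← cos_add_mul_sin,
    radialNum, Real.sin_sub, Real.cos_sub]
  ring

theorem hasDerivAt_radialNum (α t : ℝ) :
    HasDerivAt (radialNum α) (t * Real.sin (t - α)) t := by
  have h1 : HasDerivAt (fun t => t - α) 1 t := (hasDerivAt_id' t).sub_const α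
  have h2 := h1.sin.sub ((hasDerivAt_id' t).mul h1.cos)
  refine HasDerivAt.congr_deriv h2 ?_
  ring

theorem continuous_radialNum (α : ℝ) : Continuous (radialNum α) := by
  unfold radialNum; fun_prop

theorem radialNum_zero_zero : radialNum 0 0 = 0 := by simp [radialNum]

/-- The radial profile `W` of the first eigenfunctions `W(r) C x`. -/
def profile (σ r : ℝ) : ℝ := radialNum (phaseShift σ) (firstRoot σ * r) / r ^ 3

/-- The derivative of the radial profile. -/
def profileDeriv (σ r : ℝ) : ℝ :=
  firstRoot σ ^ 2 * Real.sin (firstRoot σ * r - phaseShift σ) / r ^ 2 -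
    3 * radialNum (phaseShift σ) (firstRoot σ * r) / r ^ 4

/-- The logarithmic derivative `W'(r) / (r W(r))` as a function of `s = r ^ 2`. -/
def profileLog (σ s : ℝ) : ℝ :=
  firstRoot σ ^ 2 * Real.sin (firstRoot σ * √s - phaseShift σ) /
    radialNum (phaseShift σ) (firstRoot σ * √s) - 3 / s

section
variable {σ : ℝ}

theorem phaseShift_zero : phaseShift 0 = 0 := by simp [phaseShift]

theorem radialNum_inner : radialNum (phaseShift σ) (firstRoot σ * σ) = 0 := by
  rw [radialNum_eq, phaseShift, sub_self, Real.sin_zero, mul_zero]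

theorem radialNum_outer (h0 : 0 ≤ σ) (h1 : σ < 1) :
    radialNum (phaseShift σ) (firstRoot σ * 1) = 0 := by
  have := phaseGap_firstRoot h0 h1
  rw [phaseGap] at this
  rw [radialNum_eq, phaseShift, mul_one, this, Real.sin_pi, mul_zero]

/-- Between the two boundary spheres the shifted phase runs strictly through the interval from `0`
to `π`. -/
theorem radialNum_pos (h0 : 0 ≤ σ) (h1 : σ < 1) {r : ℝ} (hr : σ < r) (hr1 : r < 1) :
    0 < radialNum (phaseShift σ) (firstRoot σ * r) := by
  have hk := firstRoot_pos σ
  have h2 : besselPhase (firstRoot σ * σ) < besselPhase (firstRoot σ * r) :=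
    besselPhase_strictMonoOn (mul_nonneg hk.le h0) (mul_nonneg hk.le (h0.trans hr.le))
      (by gcongr)
  have h3 : besselPhase (firstRoot σ * r) < besselPhase (firstRoot σ) :=
    besselPhase_strictMonoOn (mul_nonneg hk.le (h0.trans hr.le)) hk.le
      (by nlinarith)
  have h4 := phaseGap_firstRoot h0 h1
  rw [phaseGap] at h4
  rw [radialNum_eq]
  refine mul_pos (by positivity) (Real.sin_pos_of_pos_of_lt_pi ?_ ?_) <;> unfold phaseShift <;>
    linarith

theorem profile_pos (h0 : 0 ≤ σ) (h1 : σ < 1) {r : ℝ} (hr : σ < r) (hr1 : r < 1) :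
    0 < profile σ r :=
  div_pos (radialNum_pos h0 h1 hr hr1) (pow_pos (h0.trans_lt hr) 3)

theorem hasDerivAt_radialNum_mul (α k r : ℝ) :
    HasDerivAt (fun r => radialNum α (k * r)) (k ^ 2 * r * Real.sin (k * r - α)) r := by
  have h := HasDerivAt.comp r (hasDerivAt_radialNum α (k * r)) ((hasDerivAt_id' r).const_mul k)
  refine HasDerivAt.congr_deriv h ?_
  ring

theorem hasDerivAt_profile {r : ℝ} (hr : r ≠ 0) :
    HasDerivAt (profile σ) (profileDeriv σ r) r := by
  have h := (hasDerivAt_radialNum_mul (phaseShift σ) (firstRoot σ) r).div (hasDerivAt_pow 3 r)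
    (pow_ne_zero 3 hr)
  refine HasDerivAt.congr_deriv h ?_
  unfold profileDeriv
  field_simp
  push_cast
  ring

theorem profileDeriv_eq (h0 : 0 ≤ σ) (h1 : σ < 1) {r : ℝ} (hr : σ < r) (hr1 : r < 1) :
    profileDeriv σ r = r * profile σ r * profileLog σ (r ^ 2) := by
  have hN := (radialNum_pos h0 h1 hr hr1).ne'
  have hr0 : 0 < r := h0.trans_lt hr
  unfold profileDeriv profile profileLog
  rw [Real.sqrt_sq hr0.le]
  field_simp

/-- This is the Riccati form of `W'' + (4/r) W' + κ² W = 0`, the equation that makes `W(|x|) x_i` an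
eigenfunction of `-Δ`. Substituting `W' = r W B(r²)` gives `2 s B' = -5 B - κ² - s B²`. -/
theorem hasDerivAt_profileLog (h0 : 0 ≤ σ) (h1 : σ < 1) {s : ℝ} (hs : σ ^ 2 < s) (hs1 : s < 1) :
    HasDerivAt (profileLog σ)
      ((-5 * profileLog σ s - firstRoot σ ^ 2 - s * profileLog σ s ^ 2) / (2 * s)) s := by
  have hs0 : 0 < s := (sq_nonneg σ).trans_lt hs
  set r := √s with hr
  have hr0 : 0 < r := Real.sqrt_pos.2 hs0
  have hrs : s = r ^ 2 := (Real.sq_sqrt hs0.le).symm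
  have hσr : σ < r := lt_of_pow_lt_pow_left₀ 2 hr0.le (hrs ▸ hs)
  have hr1 : r < 1 := by
    rw [hr, Real.sqrt_lt' one_pos]; simpa using hs1
  have hN := (radialNum_pos h0 h1 hσr hr1).ne'
  have hsq : HasDerivAt (fun s => √s) (1 / (2 * r)) s := Real.hasDerivAt_sqrt hs0.ne'
  have hnum := HasDerivAt.comp s (hasDerivAt_radialNum_mul (phaseShift σ) (firstRoot σ) r) hsq
  have hsin := (((hsq.const_mul (firstRoot σ)).sub_const (phaseShift σ)).sin).const_mul
    (firstRoot σ ^ 2)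
  have hmain := (hsin.div hnum hN).sub ((hasDerivAt_const s (3 : ℝ)).div (hasDerivAt_id' s) hs0.ne')
  refine HasDerivAt.congr_deriv hmain ?_
  simp only [Function.comp_def, profileLog, ← hr]
  have hNe : radialNum (phaseShift σ) (firstRoot σ * r) = Real.sin (firstRoot σ * r - phaseShift σ)
    - firstRoot σ * r * Real.cos (firstRoot σ * r - phaseShift σ) := rfl
  -- This relation eliminates the cosine, so that only the sine and the numerator remain.
  have hNe' : Real.cos (firstRoot σ * r - phaseShift σ) * (firstRoot σ * r) =
    Real.sin (firstRoot σ * r - phaseShift σ) -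
      radialNum (phaseShift σ) (firstRoot σ * r) := by rw [hNe]; ring
  generalize radialNum (phaseShift σ) (firstRoot σ * r) = N at *
  generalize Real.sin (firstRoot σ * r - phaseShift σ) = S at *
  generalize Real.cos (firstRoot σ * r - phaseShift σ) = C at *
  rw [hrs]
  field_simp
  rw [← sub_eq_zero]
  ring_nf
  linear_combination (firstRoot σ ^ 2 * r ^ 2 * N) * hNe'

theorem abs_radialNum_sub_le {α t u : ℝ} (ht : 0 ≤ t) (htu : t ≤ u) :
    |radialNum α u - radialNum α t| ≤ u * (u - t) := by
  have h := (convex_Icc t u).norm_image_sub_le_of_norm_hasDerivWithin_le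
    (f := radialNum α) (f' := fun x => x * Real.sin (x - α)) (C := u) (x := t) (y := u)
    (fun x _ => (hasDerivAt_radialNum α x).hasDerivWithinAt) (fun x hx => ?_)
    ⟨le_rfl, htu⟩ ⟨htu, le_rfl⟩
  · simpa [Real.norm_eq_abs, abs_of_nonneg (sub_nonneg.2 htu)] using h
  · rw [Real.norm_eq_abs, abs_mul, abs_of_nonneg (ht.trans hx.1)]
    have := Real.abs_sin_le_one (x - α)
    have h3 : 0 ≤ x := ht.trans hx.1
    nlinarith [hx.2]

/-- The derivative is `x sin x ≤ x²`. The cubic order of vanishing compensates the factor `r⁻³` in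
the profile of the ball. -/
theorem abs_radialNum_zero_le {u : ℝ} (hu : 0 ≤ u) : |radialNum 0 u| ≤ u ^ 3 := by
  have h := (convex_Icc 0 u).norm_image_sub_le_of_norm_hasDerivWithin_le
    (f := radialNum 0) (f' := fun x => x * Real.sin (x - 0)) (C := u ^ 2) (x := 0) (y := u)
    (fun x _ => (hasDerivAt_radialNum 0 x).hasDerivWithinAt) (fun x hx => ?_)
    ⟨le_rfl, hu⟩ ⟨hu, le_rfl⟩
  · rw [radialNum_zero_zero] at h
    simpa [Real.norm_eq_abs, abs_of_nonneg hu, pow_succ] using h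
  · rw [Real.norm_eq_abs, abs_mul, abs_of_nonneg hx.1, sub_zero]
    have h1 := Real.abs_sin_le_abs (x := x)
    rw [abs_of_nonneg hx.1] at h1
    nlinarith [hx.1, hx.2, abs_nonneg (Real.sin x)]

/-- Weaker at the origin than the cubic bound for the ball, but of the same form for all `σ`; this
supplies the majorant in the limit `σ → 0`. -/
theorem abs_radialNum_le (h0 : 0 ≤ σ) {r : ℝ} (hr : σ ≤ r) :
    |radialNum (phaseShift σ) (firstRoot σ * r)| ≤ firstRoot σ ^ 2 * r ^ 2 := by
  have hk := firstRoot_pos σ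
  have h := abs_radialNum_sub_le (α := phaseShift σ) (mul_nonneg hk.le h0)
    (mul_le_mul_of_nonneg_left hr hk.le)
  rw [radialNum_inner, sub_zero] at h
  have h2 : 0 ≤ firstRoot σ * σ := mul_nonneg hk.le h0
  have h3 : 0 ≤ firstRoot σ * r := mul_nonneg hk.le (h0.trans hr)
  nlinarith

/-- In the ball the numerators vanish to sufficient order at the origin; in an annulus `1/r ≤ 1/σ`.
The derivative is weighted by `r`, which suffices because it is only used together with the factor
`⟨n, x⟩`. -/
theorem exists_profile_bound (h0 : 0 ≤ σ) :
    ∃ M, 0 < M ∧ ∀ r, σ < r → r < 1 → |profile σ r| ≤ M ∧ |r * profileDeriv σ r| ≤ M := by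
  have hk := firstRoot_pos σ
  obtain ⟨M, hM, hb⟩ : ∃ M, 0 < M ∧ ∀ r, σ < r → r < 1 → |profile σ r| ≤ M ∧
      |firstRoot σ ^ 2 * Real.sin (firstRoot σ * r - phaseShift σ) / r| ≤ M := by
    rcases h0.eq_or_lt with h | h
    · refine ⟨firstRoot σ ^ 3, by positivity, fun r hr hr1 => ?_⟩
      have hr0 : 0 < r := h0.trans_lt hr
      subst h
      rw [profile, phaseShift_zero, abs_div, abs_div, abs_mul, abs_of_pos (pow_pos hr0 3),
        abs_of_pos hr0, div_le_iff₀ (by positivity), div_le_iff₀ hr0, sub_zero,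
        abs_of_pos (by positivity : 0 < firstRoot 0 ^ 2)]
      refine ⟨by simpa [mul_pow] using abs_radialNum_zero_le (mul_pos hk hr0).le, ?_⟩
      have h1 := Real.abs_sin_le_abs (x := firstRoot 0 * r)
      rw [abs_of_pos (mul_pos hk hr0)] at h1
      nlinarith [sq_nonneg (firstRoot 0)]
    · refine ⟨firstRoot σ ^ 2 / σ, by positivity, fun r hr hr1 => ?_⟩
      have hr0 : 0 < r := h0.trans_lt hr
      have hle : firstRoot σ ^ 2 / r ≤ firstRoot σ ^ 2 / σ := by gcongr
      constructor
      · refine le_trans ?_ hle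
        rw [profile, abs_div, abs_of_pos (pow_pos hr0 3), div_le_div_iff₀ (by positivity) hr0]
        nlinarith [abs_radialNum_le h0 hr.le]
      · refine le_trans ?_ hle
        rw [abs_div, abs_mul, abs_of_pos hr0, abs_of_pos (by positivity : 0 < firstRoot σ ^ 2)]
        gcongr
        exact mul_le_of_le_one_right (by positivity) (Real.abs_sin_le_one _)
  refine ⟨4 * M, by positivity, fun r hr hr1 => ?_⟩
  have hr0 : 0 < r := h0.trans_lt hr
  obtain ⟨b1, b2⟩ := hb r hr hr1
  refine ⟨by linarith [abs_nonneg (profile σ r)], ?_⟩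
  have e : r * profileDeriv σ r =
      firstRoot σ ^ 2 * Real.sin (firstRoot σ * r - phaseShift σ) / r - 3 * profile σ r := by
    unfold profileDeriv profile
    field_simp
  rw [e]
  refine (abs_sub _ _).trans ?_
  rw [abs_mul, abs_of_pos (by norm_num : (0 : ℝ) < 3)]
  linarith

/-- The profile of the cut-off variable stays away from the boundary where it is not small. -/
theorem exists_radii_of_le_mul_profile (h0 : 0 ≤ σ) (h1 : σ < 1) {ε : ℝ} (hε : 0 < ε) :
    ∃ s₁ s₂, σ < s₁ ∧ s₂ < 1 ∧
      ∀ r, σ < r → r < 1 → ε ≤ r * profile σ r → s₁ ≤ r ∧ r ≤ s₂ := by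
  have hk := firstRoot_pos σ
  obtain ⟨s₁, hs₁, hb⟩ : ∃ s₁, σ < s₁ ∧ ∀ r, σ < r → r < 1 → ε ≤ r * profile σ r → s₁ ≤ r := by
    rcases h0.eq_or_lt with h | h
    · obtain ⟨M, hM, hb⟩ := exists_profile_bound h0
      refine ⟨ε / M, by rw [← h]; positivity, fun r hr hr1 hle => ?_⟩
      have hr0 : 0 < r := h0.trans_lt hr
      rw [div_le_iff₀ hM]
      have := (le_abs_self _).trans (hb r hr hr1).1
      nlinarith
    · have hpos : 0 < ε * σ ^ 2 / firstRoot σ ^ 2 := by positivity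
      refine ⟨σ + ε * σ ^ 2 / firstRoot σ ^ 2, by linarith, fun r hr hr1 hle => ?_⟩
      have hr0 : 0 < r := h0.trans_lt hr
      have h2 := abs_radialNum_sub_le (α := phaseShift σ) (mul_nonneg hk.le h0)
        (mul_le_mul_of_nonneg_left hr.le hk.le)
      rw [radialNum_inner, sub_zero] at h2
      have h3 := (le_abs_self _).trans h2
      have h4 : r * profile σ r = radialNum (phaseShift σ) (firstRoot σ * r) / r ^ 2 := by
        unfold profile; field_simp
      rw [h4, le_div_iff₀ (by positivity)] at hle
      have h5 : ε * σ ^ 2 ≤ firstRoot σ ^ 2 * (r - σ) := by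
        have : ε * σ ^ 2 ≤ ε * r ^ 2 := by gcongr
        have h6 : firstRoot σ * r * (firstRoot σ * r - firstRoot σ * σ) =
          firstRoot σ ^ 2 * (r - σ) * r := by ring
        have h7 : firstRoot σ ^ 2 * (r - σ) * r ≤ firstRoot σ ^ 2 * (r - σ) :=
          mul_le_of_le_one_right (mul_nonneg (by positivity) (by linarith)) hr1.le
        linarith
      have h8 : ε * σ ^ 2 / firstRoot σ ^ 2 ≤ r - σ := by
        rw [div_le_iff₀ (by positivity)]; linarith
      linarith
  have hs0 : 0 < s₁ := h0.trans_lt hs₁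
  have hpos : 0 < ε * s₁ ^ 2 / firstRoot σ ^ 2 := by positivity
  refine ⟨s₁, 1 - ε * s₁ ^ 2 / firstRoot σ ^ 2, hs₁, by linarith, fun r hr hr1 hle => ?_⟩
  have hsr := hb r hr hr1 hle
  refine ⟨hsr, ?_⟩
  have hr0 : 0 < r := h0.trans_lt hr
  have h2 := abs_radialNum_sub_le (α := phaseShift σ) (mul_nonneg hk.le hr0.le)
    (mul_le_mul_of_nonneg_left hr1.le hk.le)
  rw [radialNum_outer h0 h1, zero_sub, abs_neg] at h2
  have h3 := (le_abs_self _).trans h2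
  have h4 : r * profile σ r = radialNum (phaseShift σ) (firstRoot σ * r) / r ^ 2 := by
    unfold profile; field_simp
  rw [h4, le_div_iff₀ (by positivity)] at hle
  have h5 : ε * s₁ ^ 2 ≤ ε * r ^ 2 := by gcongr
  have h8 : ε * s₁ ^ 2 / firstRoot σ ^ 2 ≤ 1 - r := by
    rw [div_le_iff₀ (by positivity)]; nlinarith
  linarith

/-- The two terms of `profileLog` are singular at the origin, but with `t = κ √s` they combine to
`κ² (t² sin t - 3 N) / (t² N)`, where `N` is of order `t³` and the bracket is `O(t⁵)`. -/
theorem abs_profileLog_zero_le {s : ℝ} (hs : 0 < s) (hs1 : firstRoot 0 * √s ≤ 1) :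
    |profileLog 0 s| ≤ 5 * firstRoot 0 ^ 2 := by
  have hk := firstRoot_pos 0
  set k := firstRoot 0 with hkd
  set r := √s with hr
  have hr0 : 0 < r := Real.sqrt_pos.2 hs
  have hrs : s = r ^ 2 := (Real.sq_sqrt hs.le).symm
  set t := k * r with ht
  have ht0 : 0 < t := by positivity
  -- The constant `1/5` leaves room: it only requires `x sin x ≥ (3/5) x²` on the unit interval.
  have hNlow : t ^ 3 / 5 ≤ radialNum 0 t := by
    have hmono : MonotoneOn (fun t => radialNum 0 t - t ^ 3 / 5) (Icc 0 1) := by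
      refine monotoneOn_of_deriv_nonneg (convex_Icc 0 1)
        ((continuous_radialNum 0).sub (by fun_prop)).continuousOn
        (fun x _ => ((hasDerivAt_radialNum 0 x).differentiableAt.sub
          (by fun_prop)).differentiableWithinAt) fun x hx => ?_
      rw [interior_Icc] at hx
      have hd : HasDerivAt (fun t => radialNum 0 t - t ^ 3 / 5) _ x :=
        (hasDerivAt_radialNum 0 x).sub ((hasDerivAt_pow 3 x).div_const 5)
      rw [hd.deriv, sub_zero]
      have h1 := Real.sin_gt_sub_cube hx.1
      have h2 : x ^ 3 ≤ x := by
        have := hx.1; have := hx.2; nlinarith [mul_pos hx.1 hx.1]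
      push_cast
      nlinarith [hx.1]
    have := hmono (a := 0) (b := t) ⟨le_rfl, zero_le_one⟩ ⟨ht0.le, hs1⟩ ht0.le
    simp only [radialNum_zero_zero] at this
    norm_num at this
    linarith
  have hN0 : 0 < radialNum 0 t := lt_of_lt_of_le (by positivity) hNlow
  -- The derivative of `t² sin t - 3 N` is `-t N`, and `N ≤ t³`.
  have hup : |t ^ 2 * Real.sin t - 3 * radialNum 0 t| ≤ t ^ 5 := by
    have h := (convex_Icc 0 t).norm_image_sub_le_of_norm_hasDerivWithin_le
      (f := fun t => t ^ 2 * Real.sin t - 3 * radialNum 0 t)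
      (f' := fun x => - (x * radialNum 0 x)) (C := t ^ 4) (x := 0) (y := t)
      (fun x _ => HasDerivAt.hasDerivWithinAt ?_) (fun x hx => ?_)
      ⟨le_rfl, ht0.le⟩ ⟨ht0.le, le_rfl⟩
    · simpa [radialNum_zero_zero, abs_of_pos ht0, pow_succ] using h
    · refine HasDerivAt.congr_deriv (((hasDerivAt_pow 2 x).mul (Real.hasDerivAt_sin x)).sub
        ((hasDerivAt_radialNum 0 x).const_mul 3)) ?_
      simp only [radialNum, sub_zero]
      push_cast
      ring
    · rw [Real.norm_eq_abs, abs_neg, abs_mul, abs_of_nonneg hx.1]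
      calc x * |radialNum 0 x| ≤ x * x ^ 3 :=
            mul_le_mul_of_nonneg_left (abs_radialNum_zero_le hx.1) hx.1
        _ = x ^ 4 := by ring
        _ ≤ t ^ 4 := pow_le_pow_left₀ hx.1 hx.2 4
  have e : profileLog 0 s = k ^ 2 * (t ^ 2 * Real.sin t - 3 * radialNum 0 t) /
      (t ^ 2 * radialNum 0 t) := by
    rw [profileLog, phaseShift_zero, sub_zero, ← hkd, ← hr, ← ht, hrs]
    have : t ^ 2 = k ^ 2 * r ^ 2 := by rw [ht]; ring
    rw [this]
    field_simp
  rw [e, abs_div, abs_mul, abs_of_pos (by positivity : 0 < k ^ 2),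
    abs_of_pos (by positivity : 0 < t ^ 2 * radialNum 0 t), div_le_iff₀ (by positivity)]
  calc k ^ 2 * |t ^ 2 * Real.sin t - 3 * radialNum 0 t| ≤ k ^ 2 * t ^ 5 := by gcongr
    _ = 5 * k ^ 2 * (t ^ 2 * (t ^ 3 / 5)) := by ring
    _ ≤ 5 * k ^ 2 * (t ^ 2 * radialNum 0 t) := by gcongr

/-- Away from the boundary values this is compactness. For the ball the bound reaches down to the
origin, which is an interior point, and there the explicit estimate takes over; hence the
conditional lower bounds on `s`. -/
theorem exists_profileLog_bound (h0 : 0 ≤ σ) (h1 : σ < 1) {s₁ s₂ : ℝ} (hs₁ : 0 < σ → σ ^ 2 < s₁)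
    (hs₂ : s₂ < 1) :
    ∃ M, ∀ s, 0 < s → (0 < σ → s₁ ≤ s) → s ≤ s₂ → |profileLog σ s| ≤ M := by
  have hcont : ∀ a, σ ^ 2 < a → ∃ M, ∀ s, a ≤ s → s ≤ s₂ → |profileLog σ s| ≤ M := by
    intro a ha
    have hc : ContinuousOn (profileLog σ) (Icc a s₂) := fun s hs =>
      (hasDerivAt_profileLog h0 h1 (ha.trans_le hs.1)
        (hs.2.trans_lt hs₂)).continuousAt.continuousWithinAt
    obtain ⟨M, hM⟩ := isCompact_Icc.exists_bound_of_continuousOn hc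
    exact ⟨M, fun s h h' => hM s ⟨h, h'⟩⟩
  rcases h0.eq_or_lt with h | h
  · subst h
    have hk := firstRoot_pos 0
    obtain ⟨M, hM⟩ := hcont ((1 / firstRoot 0) ^ 2) (by simp [hk])
    refine ⟨max M (5 * firstRoot 0 ^ 2), fun s hs _ hs2 => ?_⟩
    rcases le_total ((1 / firstRoot 0) ^ 2) s with h | h
    · exact (hM s h hs2).trans (le_max_left _ _)
    · refine (abs_profileLog_zero_le hs ?_).trans (le_max_right _ _)
      have := Real.sqrt_le_sqrt h
      rw [Real.sqrt_sq (by positivity)] at this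
      calc firstRoot 0 * √s ≤ firstRoot 0 * (1 / firstRoot 0) := by gcongr
        _ = 1 := by field_simp
  · obtain ⟨M, hM⟩ := hcont s₁ (hs₁ h)
    exact ⟨M, fun s _ hs hs2 => hM s (hs h) hs2⟩

end

end

noncomputable section

/-! ### Functions with vanishing weak gradient -/

/-- Mollify. The derivative of a mollification at `x` is the pairing of `g` with the derivative of a
translated bump function, which vanishes by hypothesis. So each mollification is constant on the
small ball, and the mollifications converge to `g` almost everywhere. -/
theorem ae_eq_const_on_ball_of_weak_gradient_eq_zero {U : Set E3} {g : E3 → ℝ}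
    (hg : LocallyIntegrableOn g U)
    (hw : ∀ η : E3 → ℝ, IsTestFunction U η → ∀ v : E3, ∫ x, g x * fderiv ℝ η x v = 0)
    {x₀ : E3} {R : ℝ} (hR : 0 < R) (hU : Metric.closedBall x₀ (2 * R) ⊆ U) :
    ∃ c : ℝ, ∀ᵐ x, x ∈ Metric.ball x₀ R → g x = c := by
  set B := Metric.closedBall x₀ (2 * R) with hB
  set g' := B.indicator g with hg'
  have hgi : IntegrableOn g B := hg.integrableOn_compact_subset hU (isCompact_closedBall _ _)
  have hint : Integrable g' := (integrable_indicator_iff measurableSet_closedBall).2 hgi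
  -- Outer radii are at most `R`, so bumps centred in the ball of radius `R` stay in the closed ball
  -- of radius `2 R`; the fixed ratio of the two radii is needed for almost everywhere convergence.
  let φ : ℕ → ContDiffBump (0 : E3) := fun i =>
    { rIn := R / (2 * (i + 1)), rOut := R / (i + 1), rIn_pos := by positivity
      rIn_lt_rOut := by
        have : (0 : ℝ) < i + 1 := by positivity
        exact div_lt_div_of_pos_left hR this (by linarith) }
  have hφ0 : Tendsto (fun i => (φ i).rOut) atTop (𝓝 0) := by
    have := (tendsto_one_div_add_atTop_nhds_zero_nat (𝕜 := ℝ)).const_mul R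
    simpa [φ, div_eq_mul_inv] using this
  have hφK : ∀ᶠ i in atTop, (φ i).rOut ≤ 2 * (φ i).rIn := Eventually.of_forall fun i => by
    have : (0 : ℝ) < i + 1 := by positivity
    apply le_of_eq
    simp only [φ]
    field_simp
  have hconv := ContDiffBump.ae_convolution_tendsto_right_of_locallyIntegrable hφ0 hφK
    hint.locallyIntegrable (μ := (volume : Measure E3))
  set G : ℕ → E3 → ℝ := fun i =>
    convolution ((φ i).normed volume) g' (ContinuousLinearMap.lsmul ℝ ℝ) volume with hG
  have hconst : ∀ i, ∃ a, ∀ x ∈ Metric.ball x₀ R, G i x = a := by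
    intro i
    have hder := fun x => HasCompactSupport.hasFDerivAt_convolution_left (𝕜 := ℝ)
      (ContinuousLinearMap.lsmul ℝ ℝ) ((φ i).hasCompactSupport_normed (μ := volume))
      ((φ i).contDiff_normed (n := 1) (μ := volume)) hint.locallyIntegrable x (μ := (volume : Measure E3))
    refine Metric.isOpen_ball.exists_is_const_of_fderiv_eq_zero
      (convex_ball x₀ R).isPreconnected
      (fun x _ => (hder x).differentiableAt.differentiableWithinAt) fun x hx => ?_
    rw [(hder x).fderiv, Pi.zero_apply]
    ext v
    have hci : Integrable fun t => (ContinuousLinearMap.precompL E3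
        (ContinuousLinearMap.lsmul ℝ ℝ : ℝ →L[ℝ] ℝ →L[ℝ] ℝ))
        (fderiv ℝ ((φ i).normed volume) t) (g' (x - t)) :=
      ((φ i).hasCompactSupport_normed.fderiv (𝕜 := ℝ)).convolutionExists_left _
        (((φ i).contDiff_normed (n := 1)).continuous_fderiv (by norm_num))
        hint.locallyIntegrable x
    rw [convolution, ContinuousLinearMap.integral_apply hci]
    simp only [ContinuousLinearMap.precompL_apply, ContinuousLinearMap.lsmul_apply, smul_eq_mul,
      zero_apply]
    rw [← integral_sub_left_eq_self _ volume x]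
    simp only [sub_sub_cancel]
    set η : E3 → ℝ := fun y => (φ i).normed volume (x - y) with hη
    have hηsupp : ∀ y, η y ≠ 0 → y ∈ Metric.ball x R := by
      intro y hy
      have h1 : x - y ∈ Function.support ((φ i).normed volume) := hy
      rw [(φ i).support_normed_eq, Metric.mem_ball, dist_zero_right] at h1
      rw [Metric.mem_ball, dist_comm, dist_eq_norm]
      refine h1.trans_le ?_
      have : (1 : ℝ) ≤ i + 1 := by linarith [(Nat.cast_nonneg i : (0 : ℝ) ≤ i)]
      exact div_le_self hR.le this
    have hηt : tsupport η ⊆ B := by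
      refine (closure_mono (fun y hy => hηsupp y hy)).trans
        (Metric.closure_ball_subset_closedBall.trans ?_)
      refine Metric.closedBall_subset_closedBall' ?_
      rw [Metric.mem_ball] at hx
      linarith
    have hηT : IsTestFunction U η := by
      refine ⟨(φ i).contDiff_normed.comp (contDiff_const.sub contDiff_id), ?_, hηt.trans hU⟩
      exact HasCompactSupport.of_support_subset_isCompact (isCompact_closedBall x₀ (2 * R))
        (subset_closure.trans hηt)
    have hfd : ∀ y, fderiv ℝ η y v = - fderiv ℝ ((φ i).normed volume) (x - y) v := by
      intro y
      have h1 : HasFDerivAt (fun y => x - y) (- ContinuousLinearMap.id ℝ E3) y := by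
        simpa using (hasFDerivAt_id y).const_sub x
      have h2 := (((φ i).contDiff_normed (n := 1) (μ := volume)).differentiable (by norm_num)
        (x - y)).hasFDerivAt.comp y h1
      rw [show η = (φ i).normed volume ∘ fun y => x - y from rfl, h2.fderiv]
      simp
    have h0 := hw η hηT v
    have h1 : ∀ y, fderiv ℝ ((φ i).normed volume) (x - y) v * g' y = -(g y * fderiv ℝ η y v) := by
      intro y
      by_cases hy : y ∈ B
      · rw [hg', indicator_of_mem hy, hfd]; ring
      · have : fderiv ℝ η y = 0 := by
          refine image_eq_zero_of_notMem_tsupport fun h => hy (hηt (tsupport_fderiv_subset ℝ h))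
        have h3 := hfd y
        rw [this] at h3
        rw [hg', indicator_of_notMem hy, this]
        simp
    simp_rw [h1, integral_neg, h0, neg_zero]
  choose a ha using hconst
  have hae : ∀ᵐ x, x ∈ Metric.ball x₀ R → Tendsto a atTop (𝓝 (g x)) := by
    filter_upwards [hconv] with x hx hxB
    have h1 : g' x = g x := indicator_of_mem
      (Metric.ball_subset_closedBall.trans (Metric.closedBall_subset_closedBall (by linarith)) hxB) g
    rw [h1] at hx
    refine hx.congr fun i => ha i x hxB
  have hpos : volume (Metric.ball x₀ R) ≠ 0 := (Metric.measure_ball_pos volume x₀ hR).ne'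
  -- One point of convergence suffices: the value of `g` there is the limit of the constants.
  obtain ⟨y, hy, hyt⟩ : ∃ y, y ∈ Metric.ball x₀ R ∧ Tendsto a atTop (𝓝 (g y)) := by
    by_contra! h
    refine hpos (measure_mono_null (fun x hx => ?_) hae)
    simp only [mem_compl_iff, mem_ofPred_eq]
    exact fun h' => h x hx (h' hx)
  exact ⟨g y, hae.mono fun x hx hxB => tendsto_nhds_unique (hx hxB) hyt⟩

/-- A function with vanishing weak gradient on a connected open set is constant. -/
theorem ae_eq_const_of_weak_gradient_eq_zero {U : Set E3} (hUo : IsOpen U)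
    (hUc : IsPreconnected U) {g : E3 → ℝ} (hg : LocallyIntegrableOn g U)
    (hw : ∀ η : E3 → ℝ, IsTestFunction U η → ∀ v : E3, ∫ x, g x * fderiv ℝ η x v = 0) :
    ∃ c : ℝ, ∀ᵐ x, x ∈ U → g x = c := by
  have hloc : ∀ x ∈ U, ∃ R > 0, ∃ c : ℝ, Metric.ball x R ⊆ U ∧
      ∀ᵐ y, y ∈ Metric.ball x R → g y = c := by
    intro x hx
    obtain ⟨ε, hε, hb⟩ := Metric.isOpen_iff.1 hUo x hx
    have hsub : Metric.closedBall x (2 * (ε / 4)) ⊆ U :=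
      (Metric.closedBall_subset_ball (by linarith)).trans hb
    obtain ⟨c, hc⟩ := ae_eq_const_on_ball_of_weak_gradient_eq_zero hg hw
      (by linarith : 0 < ε / 4) hsub
    exact ⟨ε / 4, by linarith, c, (Metric.ball_subset_ball (by linarith)).trans hb, hc⟩
  rcases U.eq_empty_or_nonempty with rfl | ⟨x₀, hx₀⟩
  · exact ⟨0, by simp⟩
  choose! R hR c hRU hc using hloc
  -- Two overlapping balls meet in positive measure, so their constants agree; the choice of
  -- constants is therefore locally constant.
  have hcl : ∀ x ∈ U, ∀ y ∈ Metric.ball x (R x), c y = c x := by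
    intro x hx y hy
    have hyU := hRU x hx hy
    have hne : volume (Metric.ball x (R x) ∩ Metric.ball y (R y)) ≠ 0 :=
      ((Metric.isOpen_ball.inter Metric.isOpen_ball).measure_pos volume
        ⟨y, hy, Metric.mem_ball_self (hR y hyU)⟩).ne'
    by_contra hne'
    refine hne (measure_mono_null (fun z hz => ?_) ((hc x hx).and (hc y hyU)))
    simp only [mem_compl_iff, mem_ofPred_eq]
    exact fun h => hne' ((h.2 hz.2).symm.trans (h.1 hz.1))
  have hcont : ContinuousOn c U := fun x hx => by
    refine ContinuousAt.continuousWithinAt ?_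
    refine (continuousAt_const (y := c x)).congr ?_
    filter_upwards [Metric.ball_mem_nhds x (hR x hx)] with y hy
    exact (hcl x hx y hy).symm
  have hconst : ∀ x ∈ U, c x = c x₀ := by
    intro x hx
    have himg : ∀ t : ℝ, IsOpen (U ∩ c ⁻¹' {t}) := by
      intro t
      rw [Metric.isOpen_iff]
      rintro z ⟨hz, hzt⟩
      refine ⟨R z, hR z hz, fun y hy => ⟨hRU z hz hy, ?_⟩⟩
      exact (hcl z hz y hy).trans hzt
    by_contra hne
    have h2 : IsOpen (U ∩ c ⁻¹' {c x₀}ᶜ) := hcont.isOpen_inter_preimage hUo isOpen_compl_singleton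
    obtain ⟨z, hz⟩ := hUc _ _ (himg (c x₀)) h2
      (fun y hy => by by_cases h : c y = c x₀ <;> simp [hy])
      ⟨x₀, hx₀, hx₀, rfl⟩ ⟨x, hx, hx, hne⟩
    exact hz.2.2.2 hz.2.1.2
  refine ⟨c x₀, ?_⟩
  rw [ae_iff]
  refine measure_null_of_locally_null _ fun x hx => ?_
  have hxU : x ∈ U := by
    by_contra h
    exact hx fun h' => absurd h' h
  refine ⟨Metric.ball x (R x) ∩ {y | ¬(y ∈ U → g y = c x₀)},
    inter_mem (mem_nhdsWithin_of_mem_nhds (Metric.ball_mem_nhds x (hR x hxU)))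
      self_mem_nhdsWithin, ?_⟩
  refine measure_mono_null (fun y hy => ?_) (hc x hxU)
  simp only [mem_compl_iff, mem_ofPred_eq]
  intro h
  exact hy.2 fun _ => (h hy.1).trans (hconst x hxU)

end

noncomputable section

/-! ### Convergence in `L_2` of the whole space -/

section L2
set_option linter.unusedSectionVars false
variable {F F' : Type*} [NormedAddCommGroup F] [InnerProductSpace ℝ F]
  [NormedAddCommGroup F'] [InnerProductSpace ℝ F']

theorem inner_toLp {f g : E3 → F} (hf : MemLp f 2 volume) (hg : MemLp g 2 volume) :
    inner ℝ (hf.toLp f) (hg.toLp g) = ∫ x, inner ℝ (f x) (g x) := by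
  rw [L2.inner_def]
  refine integral_congr_ae ?_
  filter_upwards [hf.coeFn_toLp, hg.coeFn_toLp] with x h1 h2
  rw [h1, h2]

theorem norm_toLp_sq {f : E3 → F} (hf : MemLp f 2 volume) :
    ‖hf.toLp f‖ ^ 2 = ∫ x, ‖f x‖ ^ 2 := by
  rw [← real_inner_self_eq_norm_sq, inner_toLp]
  simp_rw [real_inner_self_eq_norm_sq]

theorem integrable_inner_of_memLp {f g : E3 → F} (hf : MemLp f 2 volume) (hg : MemLp g 2 volume) :
    Integrable fun x => inner ℝ (f x) (g x) := by
  refine (L2.integrable_inner (𝕜 := ℝ) (hf.toLp f) (hg.toLp g)).congr ?_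
  filter_upwards [hf.coeFn_toLp, hg.coeFn_toLp] with x h1 h2
  rw [h1, h2]

theorem integral_inner_sq_le {f g : E3 → F} (hf : MemLp f 2 volume) (hg : MemLp g 2 volume) :
    (∫ x, inner ℝ (f x) (g x)) ^ 2 ≤ (∫ x, ‖f x‖ ^ 2) * ∫ x, ‖g x‖ ^ 2 := by
  rw [← inner_toLp hf hg, ← norm_toLp_sq hf, ← norm_toLp_sq hg, ← mul_pow]
  generalize hf.toLp f = u
  generalize hg.toLp g = v
  rw [← sq_abs]
  exact pow_le_pow_left₀ (abs_nonneg _) (abs_real_inner_le_norm u v) 2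

theorem integral_normSq_eq_zero {f : E3 → F} (hf : MemLp f 2 volume) (h : ∫ x, ‖f x‖ ^ 2 = 0) :
    f =ᵐ[volume] 0 := by
  rw [integral_eq_zero_iff_of_nonneg (fun x => by positivity)
    ((memLp_two_iff_integrable_sq_norm hf.1).1 hf)] at h
  filter_upwards [h] with x hx
  simpa using hx

/-- Convergence in `L_2`, for sequences of square integrable functions. -/
def L2Lim (φ : ℕ → E3 → F) (f : E3 → F) : Prop :=
  ∃ (h : ∀ n, MemLp (φ n) 2 volume) (hf : MemLp f 2 volume),
    Tendsto (fun n => (h n).toLp (φ n)) atTop (𝓝 (hf.toLp f))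

variable {φ ψ : ℕ → E3 → F} {f g : E3 → F}

theorem L2Lim.memLp (h : L2Lim φ f) : MemLp f 2 volume := h.choose_spec.choose

theorem L2Lim.memLp_seq (h : L2Lim φ f) (n : ℕ) : MemLp (φ n) 2 volume := h.choose n

theorem L2Lim.inner (h : L2Lim φ f) (h' : L2Lim ψ g) :
    Tendsto (fun n => ∫ x, inner ℝ (φ n x) (ψ n x)) atTop (𝓝 (∫ x, inner ℝ (f x) (g x))) := by
  obtain ⟨a, b, c⟩ := h
  obtain ⟨a', b', c'⟩ := h'
  simp_rw [← inner_toLp b b', ← fun n => inner_toLp (a n) (a' n)]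
  exact c.inner c'

theorem L2Lim.normSq (h : L2Lim φ f) :
    Tendsto (fun n => ∫ x, ‖φ n x‖ ^ 2) atTop (𝓝 (∫ x, ‖f x‖ ^ 2)) := by
  simpa only [real_inner_self_eq_norm_sq] using h.inner h

theorem L2Lim.add (h : L2Lim φ f) (h' : L2Lim ψ g) :
    L2Lim (fun n x => φ n x + ψ n x) (fun x => f x + g x) := by
  obtain ⟨a, b, c⟩ := h
  obtain ⟨a', b', c'⟩ := h'
  refine ⟨fun n => (a n).add (a' n), b.add b', ?_⟩
  exact c.add c'

theorem L2Lim.const_smul (h : L2Lim φ f) (r : ℝ) :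
    L2Lim (fun n x => r • φ n x) (fun x => r • f x) := by
  obtain ⟨a, b, c⟩ := h
  exact ⟨fun n => (a n).const_smul r, b.const_smul r, Filter.Tendsto.const_smul c r⟩

theorem L2Lim.unique (h : L2Lim φ f) (h' : L2Lim φ g) : f =ᵐ[volume] g := by
  obtain ⟨a, b, c⟩ := h
  obtain ⟨a', b', c'⟩ := h'
  exact (MemLp.toLp_eq_toLp_iff b b').1 (tendsto_nhds_unique c c')

theorem l2Lim_const (hf : MemLp f 2 volume) : L2Lim (fun _ => f) f :=
  ⟨fun _ => hf, hf, tendsto_const_nhds⟩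

theorem l2Lim_iff (h : ∀ n, MemLp (φ n) 2 volume) (hf : MemLp f 2 volume) :
    L2Lim φ f ↔ Tendsto (fun n => ∫ x, ‖φ n x - f x‖ ^ 2) atTop (𝓝 0) := by
  have e : ∀ n, ∫ x, ‖φ n x - f x‖ ^ 2 = ‖(h n).toLp (φ n) - hf.toLp f‖ ^ 2 := fun n => by
    rw [← MemLp.toLp_sub, norm_toLp_sq]; rfl
  simp_rw [e]
  constructor
  · rintro ⟨a, b, c⟩
    have := (tendsto_iff_norm_sub_tendsto_zero.1 c).pow 2
    simpa using this
  · intro hlim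
    refine ⟨h, hf, tendsto_iff_norm_sub_tendsto_zero.2 ?_⟩
    have := hlim.sqrt
    simpa using this

theorem L2Lim.of_le (h : L2Lim φ f) {φ' : ℕ → E3 → F'} {f' : E3 → F'}
    (h1 : ∀ n, MemLp (φ' n) 2 volume) (h2 : MemLp f' 2 volume) {C : ℝ}
    (hle : ∀ n, ∫ x, ‖φ' n x - f' x‖ ^ 2 ≤ C * ∫ x, ‖φ n x - f x‖ ^ 2) : L2Lim φ' f' := by
  rw [l2Lim_iff h1 h2]
  refine squeeze_zero (fun n => integral_nonneg fun x => by positivity) hle ?_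
  simpa using ((l2Lim_iff h.memLp_seq h.memLp).1 h).const_mul C

theorem L2Lim.clm_comp (h : L2Lim φ f) (T : F →L[ℝ] F') :
    L2Lim (fun n x => T (φ n x)) (fun x => T (f x)) := by
  refine h.of_le (fun n => T.comp_memLp' (h.memLp_seq n)) (T.comp_memLp' h.memLp)
    (C := ‖T‖ ^ 2) fun n => ?_
  rw [← integral_const_mul]
  refine integral_mono_of_nonneg (Eventually.of_forall fun x => by positivity) ?_
    (Eventually.of_forall fun x => ?_)
  · exact ((memLp_two_iff_integrable_sq_norm
      ((h.memLp_seq n).sub h.memLp).1).1 ((h.memLp_seq n).sub h.memLp)).const_mul _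
  · simp only
    rw [← map_sub, ← mul_pow]
    exact pow_le_pow_left₀ (norm_nonneg _) (T.le_opNorm _) 2

theorem integral_comp_isometry {G : Type*} [NormedAddCommGroup G] [NormedSpace ℝ G]
    (Q : E3 ≃ₗᵢ[ℝ] E3) (f : E3 → G) : ∫ x, f (Q x) = ∫ x, f x :=
  Q.measurePreserving.integral_comp Q.toMeasurableEquiv.measurableEmbedding f

theorem L2Lim.comp_isometry (h : L2Lim φ f) (Q : E3 ≃ₗᵢ[ℝ] E3) :
    L2Lim (fun n x => φ n (Q x)) (fun x => f (Q x)) := by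
  refine h.of_le (fun n => (h.memLp_seq n).comp_measurePreserving Q.measurePreserving)
    (h.memLp.comp_measurePreserving Q.measurePreserving) (C := 1) fun n => ?_
  rw [one_mul]
  exact (integral_comp_isometry Q fun x => ‖φ n x - f x‖ ^ 2).le

theorem exists_l2Lim_of_cauchy [CompleteSpace F] (h : ∀ n, MemLp (φ n) 2 volume)
    (hc : ∀ ε > 0, ∃ N, ∀ m ≥ N, ∀ n ≥ N, ∫ x, ‖φ m x - φ n x‖ ^ 2 < ε) : ∃ f, L2Lim φ f := by
  have hcs : CauchySeq fun n => (h n).toLp (φ n) := by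
    refine Metric.cauchySeq_iff.2 fun ε hε => ?_
    obtain ⟨N, hN⟩ := hc (ε ^ 2) (by positivity)
    refine ⟨N, fun m hm n hn => ?_⟩
    have := hN m hm n hn
    have e : ∫ x, ‖φ m x - φ n x‖ ^ 2 = ‖(h m).toLp (φ m) - (h n).toLp (φ n)‖ ^ 2 := by
      rw [← MemLp.toLp_sub, norm_toLp_sq]; rfl
    rw [e] at this
    rw [dist_eq_norm]
    exact lt_of_pow_lt_pow_left₀ 2 hε.le this
  obtain ⟨L, hL⟩ := cauchySeq_tendsto_of_complete hcs
  refine ⟨L, h, Lp.memLp L, ?_⟩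
  rwa [Lp.toLp_coeFn]

theorem L2Lim.cauchy (h : L2Lim φ f) :
    ∀ ε > 0, ∃ N, ∀ m ≥ N, ∀ n ≥ N, ∫ x, ‖φ m x - φ n x‖ ^ 2 < ε := by
  obtain ⟨a, b, c⟩ := h
  intro ε hε
  obtain ⟨N, hN⟩ := Metric.cauchySeq_iff.1 c.cauchySeq (√ε) (Real.sqrt_pos.2 hε)
  refine ⟨N, fun m hm n hn => ?_⟩
  have := hN m hm n hn
  have e : ∫ x, ‖φ m x - φ n x‖ ^ 2 = ‖(a m).toLp (φ m) - (a n).toLp (φ n)‖ ^ 2 := by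
    rw [← MemLp.toLp_sub, norm_toLp_sq]; rfl
  rw [dist_eq_norm] at this
  rw [e]
  exact (Real.lt_sqrt (norm_nonneg _)).1 this

/-- Convergence is inherited through a bound for the differences. -/
theorem L2Lim.exists_of_le [CompleteSpace F'] (h : L2Lim φ f) {φ' : ℕ → E3 → F'}
    (h1 : ∀ n, MemLp (φ' n) 2 volume)
    (hle : ∀ m n, ∫ x, ‖φ' m x - φ' n x‖ ^ 2 ≤ ∫ x, ‖φ m x - φ n x‖ ^ 2) :
    ∃ f', L2Lim φ' f' := by
  refine exists_l2Lim_of_cauchy h1 fun ε hε => ?_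
  obtain ⟨N, hN⟩ := h.cauchy ε hε
  exact ⟨N, fun m hm n hn => (hle m n).trans_lt (hN m hm n hn)⟩

end L2

/-! ### Calculus of test functions -/

/-- The partial derivative of a scalar function. -/
def pd (k : Fin 3) (f : E3 → ℝ) (x : E3) : ℝ := fderiv ℝ f x (EuclideanSpace.single k (1 : ℝ))

section test
variable {F : Type*} [NormedAddCommGroup F] [NormedSpace ℝ F] {Ω : Set E3}

theorem IsTestFunction.add {f g : E3 → F} (hf : IsTestFunction Ω f) (hg : IsTestFunction Ω g) :
    IsTestFunction Ω fun x => f x + g x :=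
  ⟨hf.1.add hg.1, hf.2.1.add hg.2.1,
    (tsupport_add f g).trans (union_subset hf.2.2 hg.2.2)⟩

theorem IsTestFunction.const_smul {f : E3 → F} (hf : IsTestFunction Ω f) (c : ℝ) :
    IsTestFunction Ω fun x => c • f x :=
  ⟨contDiff_const.smul hf.1, hf.2.1.smul_left (f := fun _ => c),
    (closure_mono (Function.support_const_smul_subset c f)).trans hf.2.2⟩

theorem IsTestFunction.sub {f g : E3 → F} (hf : IsTestFunction Ω f) (hg : IsTestFunction Ω g) :
    IsTestFunction Ω fun x => f x - g x := by
  simpa [sub_eq_add_neg] using hf.add (hg.const_smul (-1))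

theorem IsTestFunction.clm_comp {F' : Type*} [NormedAddCommGroup F'] [NormedSpace ℝ F']
    {f : E3 → F} (hf : IsTestFunction Ω f) (T : F →L[ℝ] F') :
    IsTestFunction Ω fun x => T (f x) :=
  ⟨T.contDiff.comp hf.1, hf.2.1.comp_left (g := T) (map_zero T),
    (closure_mono (Function.support_comp_subset (map_zero T) f)).trans hf.2.2⟩

theorem IsTestFunction.fderiv_apply {f : E3 → F} (hf : IsTestFunction Ω f) (v : E3) :
    IsTestFunction Ω fun x => fderiv ℝ f x v :=
  ⟨(hf.1.fderiv_right (m := ∞) (by simp)).clm_apply contDiff_const, hf.2.1.fderiv_apply ℝ v,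
    (tsupport_fderiv_apply_subset ℝ v).trans hf.2.2⟩

theorem IsTestFunction.pd {f : E3 → ℝ} (hf : IsTestFunction Ω f) (k : Fin 3) :
    IsTestFunction Ω (pd k f) := hf.fderiv_apply _

theorem IsTestFunction.component {f : E3 → E3} (hf : IsTestFunction Ω f) (j : Fin 3) :
    IsTestFunction Ω fun x => f x j :=
  hf.clm_comp (EuclideanSpace.proj j : E3 →L[ℝ] ℝ)

theorem IsTestFunction.differentiable {f : E3 → F} (hf : IsTestFunction Ω f) :
    Differentiable ℝ f := hf.1.differentiable (by simp)

theorem IsTestFunction.memLp {f : E3 → F} (hf : IsTestFunction Ω f) : MemLp f 2 volume :=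
  hf.1.continuous.memLp_of_hasCompactSupport hf.2.1

theorem IsTestFunction.integrable_mul {f g : E3 → ℝ} (hf : IsTestFunction Ω f)
    (hg : Continuous g) : Integrable fun x => f x * g x :=
  (hf.1.continuous.mul hg).integrable_of_hasCompactSupport (hf.2.1.mul_right)

theorem IsTestFunction.eq_zero {f : E3 → F} (hf : IsTestFunction Ω f) {x : E3} (hx : x ∉ Ω) :
    f x = 0 := image_eq_zero_of_notMem_tsupport fun h => hx (hf.2.2 h)

theorem integral_pd_eq_zero {f : E3 → ℝ} (hf : ContDiff ℝ 1 f) (hc : HasCompactSupport f)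
    (k : Fin 3) : ∫ x, pd k f x = 0 := by
  have hi : Integrable fun x => fderiv ℝ f x (EuclideanSpace.single k (1 : ℝ)) :=
    ((hf.continuous_fderiv (by norm_num)).clm_apply continuous_const).integrable_of_hasCompactSupport
      (hc.fderiv_apply ℝ _)
  have h := integral_mul_fderiv_eq_neg_fderiv_mul_of_integrable (μ := (volume : Measure E3))
    (f := fun _ => (1 : ℝ)) (g := f) (v := EuclideanSpace.single k (1 : ℝ)) (by simp)
    (by simpa using hi) (by simpa using hf.continuous.integrable_of_hasCompactSupport hc)
    (by simp) (fun x _ => hf.differentiable (by norm_num) x)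
  simpa [pd] using h

theorem IsTestFunction.integral_mul_pd {f g : E3 → ℝ} (hf : IsTestFunction Ω f)
    (hg : ContDiff ℝ 1 g) (k : Fin 3) :
    ∫ x, f x * _root_.pd k g x = - ∫ x, _root_.pd k f x * g x :=
  integral_mul_fderiv_eq_neg_fderiv_mul_of_integrable
    ((hf.pd k).integrable_mul hg.continuous)
    (hf.integrable_mul ((hg.continuous_fderiv (by norm_num)).clm_apply continuous_const))
    (hf.integrable_mul hg.continuous)
    (fun x _ => hf.differentiable x) (fun x _ => hg.differentiable (by norm_num) x)

/-- Two integrations by parts and the symmetry of second derivatives. -/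
theorem IsTestFunction.integral_pd_mul_pd_comm {f g : E3 → ℝ} (hf : IsTestFunction Ω f)
    (hg : IsTestFunction Ω g) (j k : Fin 3) :
    ∫ x, _root_.pd j f x * _root_.pd k g x = ∫ x, _root_.pd k f x * _root_.pd j g x := by
  have h1 := hf.integral_mul_pd ((hg.pd k).1.of_le (by simp)) j
  have h2 := hf.integral_mul_pd ((hg.pd j).1.of_le (by simp)) k
  have h3 : ∀ x, _root_.pd j (_root_.pd k g) x = _root_.pd k (_root_.pd j g) x := by
    intro x
    have hs : IsSymmSndFDerivAt ℝ g x := (hg.1.contDiffAt).isSymmSndFDerivAt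
      (by simpa using WithTop.coe_le_coe.2 (le_top : (2 : ℕ∞) ≤ ⊤))
    have hd : DifferentiableAt ℝ (fderiv ℝ g) x :=
      (hg.1.fderiv_right (m := ∞) (by simp)).differentiable (by simp) x
    have e : ∀ a b : Fin 3, _root_.pd a (_root_.pd b g) x = fderiv ℝ (fderiv ℝ g) x
        (EuclideanSpace.single a (1 : ℝ)) (EuclideanSpace.single b (1 : ℝ)) := by
      intro a b
      unfold _root_.pd
      rw [fderiv_clm_apply hd (differentiableAt_const _)]
      simp
    rw [e, e, hs]
  simp_rw [h3] at h1
  rw [h1] at h2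
  linarith

end test

/-- The support of a test function keeps a positive distance from the boundary of the shell. -/
theorem exists_radii_of_compact {σ : ℝ} (h0 : 0 ≤ σ) {K : Set E3} (hK : IsCompact K)
    (hs : K ⊆ shell σ) :
    ∃ s₁ s₂, 0 ≤ s₁ ∧ (0 < σ → σ < s₁) ∧ 0 < s₂ ∧ s₂ < 1 ∧ ∀ x ∈ K, s₁ ≤ ‖x‖ ∧ ‖x‖ ≤ s₂ := by
  rcases K.eq_empty_or_nonempty with rfl | hne
  · exact ⟨σ + 1, 1 / 2, by linarith, fun _ => by linarith, by norm_num, by norm_num, by simp⟩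
  obtain ⟨a, ha, hamin⟩ := hK.exists_isMinOn hne continuous_norm.continuousOn
  obtain ⟨b, hb, hbmax⟩ := hK.exists_isMaxOn hne continuous_norm.continuousOn
  refine ⟨‖a‖, max ‖b‖ (1 / 2), norm_nonneg _, (hs ha).1, by positivity,
    max_lt (hs hb).2 (by norm_num), fun x hx => ⟨hamin hx, le_max_of_le_left (hbmax hx)⟩⟩

theorem isOpen_shell (σ : ℝ) : IsOpen (shell σ) := by
  by_cases h : 0 < σ
  · have : shell σ = (fun x : E3 => ‖x‖) ⁻¹' Ioo σ 1 := by ext x; simp [shell, h]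
    rw [this]
    exact isOpen_Ioo.preimage continuous_norm
  · have : shell σ = (fun x : E3 => ‖x‖) ⁻¹' Iio 1 := by ext x; simp [shell, h]
    rw [this]
    exact isOpen_Iio.preimage continuous_norm

end

noncomputable section

/-! ### The Picone identity -/

/-- The logarithmic gradient of `W(|x|) ⟨n, x⟩`, regularized with `ε`. -/
def piconeField (σ : ℝ) (n : E3) (ε : ℝ) (k : Fin 3) (x : E3) : ℝ :=
  profileLog σ (‖x‖ ^ 2 + ε ^ 2) * x k +
    inner ℝ n x / (inner ℝ n x ^ 2 + ε ^ 2) * n k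

theorem norm_sq_eq_sum_three (x : E3) : ‖x‖ ^ 2 = x 0 ^ 2 + x 1 ^ 2 + x 2 ^ 2 := by
  simp [EuclideanSpace.norm_sq_eq, Fin.sum_univ_three]

theorem inner_eq_sum_three (x y : E3) : inner ℝ x y = x 0 * y 0 + x 1 * y 1 + x 2 * y 2 := by
  simp [PiLp.inner_apply, Fin.sum_univ_three]; ring

theorem contDiffAt_profileLog {σ : ℝ} (h0 : 0 ≤ σ) (h1 : σ < 1) {s : ℝ} (hs : σ ^ 2 < s)
    (hs1 : s < 1) {m : WithTop ℕ∞} : ContDiffAt ℝ m (profileLog σ) s := by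
  have hs0 : 0 < s := (sq_nonneg σ).trans_lt hs
  have hσr : σ < √s := by rw [Real.lt_sqrt h0]; exact hs
  have hr1 : √s < 1 := by rw [Real.sqrt_lt' one_pos]; simpa using hs1
  have hN := (radialNum_pos h0 h1 hσr hr1).ne'
  have hsq : ContDiffAt ℝ m (fun s : ℝ => √s) s := contDiffAt_id.sqrt hs0.ne'
  have hnum : ContDiff ℝ m (radialNum (phaseShift σ)) := by
    unfold radialNum; fun_prop
  unfold profileLog
  refine ContDiffAt.sub (ContDiffAt.div (contDiffAt_const.mul
    ((contDiffAt_const.mul hsq).sub contDiffAt_const).sin) ?_ hN)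
    (contDiffAt_const.div contDiffAt_id hs0.ne')
  exact hnum.contDiffAt.comp s (contDiffAt_const.mul hsq)

theorem contDiffAt_piconeField {σ : ℝ} (h0 : 0 ≤ σ) (h1 : σ < 1) (n : E3) {ε : ℝ} (k : Fin 3)
    {x : E3} (hs : σ ^ 2 < ‖x‖ ^ 2 + ε ^ 2) (hs1 : ‖x‖ ^ 2 + ε ^ 2 < 1)
    (hq : inner ℝ n x ^ 2 + ε ^ 2 ≠ 0) {m : WithTop ℕ∞} :
    ContDiffAt ℝ m (piconeField σ n ε k) x := by
  have hin : ContDiff ℝ m fun x : E3 => inner ℝ n x := contDiff_const.inner ℝ contDiff_id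
  have hco : ContDiff ℝ m fun x : E3 => x k := (EuclideanSpace.proj k : E3 →L[ℝ] ℝ).contDiff
  have hns : ContDiff ℝ m fun x : E3 => ‖x‖ ^ 2 + ε ^ 2 :=
    (contDiff_norm_sq ℝ).add contDiff_const
  unfold piconeField
  refine ContDiffAt.add (ContDiffAt.mul ?_ hco.contDiffAt) (ContDiffAt.mul
    (hin.contDiffAt.div ((hin.contDiffAt.pow 2).add contDiffAt_const) hq) contDiffAt_const)
  exact (contDiffAt_profileLog h0 h1 hs hs1).comp x hns.contDiffAt

/-- The Riccati equation removes the derivative of `profileLog`, so the divergence of the field is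
an algebraic expression in its values. -/
theorem pd_piconeField {σ : ℝ} (h0 : 0 ≤ σ) (h1 : σ < 1) (n : E3) {ε : ℝ} (k : Fin 3)
    {x : E3} (hs : σ ^ 2 < ‖x‖ ^ 2 + ε ^ 2) (hs1 : ‖x‖ ^ 2 + ε ^ 2 < 1)
    (hq : inner ℝ n x ^ 2 + ε ^ 2 ≠ 0) :
    pd k (piconeField σ n ε k) x = profileLog σ (‖x‖ ^ 2 + ε ^ 2) +
      (-5 * profileLog σ (‖x‖ ^ 2 + ε ^ 2) - firstRoot σ ^ 2 -
        (‖x‖ ^ 2 + ε ^ 2) * profileLog σ (‖x‖ ^ 2 + ε ^ 2) ^ 2) / (‖x‖ ^ 2 + ε ^ 2) * x k ^ 2 +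
      (ε ^ 2 - inner ℝ n x ^ 2) / (inner ℝ n x ^ 2 + ε ^ 2) ^ 2 * n k ^ 2 := by
  have hs0 : 0 < ‖x‖ ^ 2 + ε ^ 2 := (sq_nonneg σ).trans_lt hs
  have hβ := (hasDerivAt_profileLog h0 h1 hs hs1).comp_hasFDerivAt x
    ((hasStrictFDerivAt_norm_sq x).hasFDerivAt.add_const (ε ^ 2))
  have hco : HasFDerivAt (fun x : E3 => x k) (EuclideanSpace.proj k : E3 →L[ℝ] ℝ) x :=
    (EuclideanSpace.proj k : E3 →L[ℝ] ℝ).hasFDerivAt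
  have hin : HasFDerivAt (fun x : E3 => inner ℝ n x) (innerSL ℝ n) x := (innerSL ℝ n).hasFDerivAt
  have hγ := (((hasDerivAt_id' (inner ℝ n x : ℝ)).div
    ((hasDerivAt_pow 2 (inner ℝ n x : ℝ)).add_const (ε ^ 2)) hq).comp_hasFDerivAt x hin).mul_const
    (n k)
  have h := (hβ.mul hco).add hγ
  have hf : HasFDerivAt (piconeField σ n ε k) _ x := h
  rw [pd, hf.fderiv]
  have e1 : inner ℝ x (EuclideanSpace.single k (1 : ℝ)) = x k := by
    simp [EuclideanSpace.inner_single_right]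
  have e2 : inner ℝ n (EuclideanSpace.single k (1 : ℝ)) = n k := by
    simp [EuclideanSpace.inner_single_right]
  simp [e1, e2]
  field_simp
  ring

/-- Allows singular factors, such as the logarithmic gradient, to be multiplied by test functions
supported away from the singularity. -/
theorem contDiff_mul_of_tsupport {f b : E3 → ℝ} {m : WithTop ℕ∞} (hf : ContDiff ℝ m f)
    (hb : ∀ x ∈ tsupport f, ContDiffAt ℝ m b x) : ContDiff ℝ m fun x => f x * b x := by
  rw [contDiff_iff_contDiffAt]
  intro x
  by_cases hx : x ∈ tsupport f
  · exact hf.contDiffAt.mul (hb x hx)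
  · refine contDiffAt_const (c := (0 : ℝ)) |>.congr_of_eventuallyEq ?_
    filter_upwards [(isClosed_tsupport f).isOpen_compl.mem_nhds hx] with y hy
    rw [image_eq_zero_of_notMem_tsupport hy, zero_mul]

theorem ae_inner_ne_zero {n : E3} (hn : n ≠ 0) : ∀ᵐ x : E3, inner ℝ n x ≠ 0 := by
  have h : (ℝ ∙ n)ᗮ ≠ ⊤ := by
    intro h
    have : n ∈ (ℝ ∙ n)ᗮ := h ▸ Submodule.mem_top
    rw [Submodule.mem_orthogonal_singleton_iff_inner_right] at this
    exact hn (inner_self_eq_zero.1 this)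
  have h0 := Measure.addHaar_submodule (volume : Measure E3) _ h
  refine measure_mono_null (fun x hx => ?_) h0
  simp only [mem_compl_iff, mem_ofPred_eq, not_not] at hx
  exact Submodule.mem_orthogonal_singleton_iff_inner_right.2 hx

theorem IsTestFunction.exists_bound {Ω : Set E3} {F : Type*} [NormedAddCommGroup F]
    [NormedSpace ℝ F] {f : E3 → F} (hf : IsTestFunction Ω f) : ∃ C, ∀ x, ‖f x‖ ≤ C :=
  hf.2.1.exists_bound_of_continuous hf.1.continuous

/-- A test function vanishing on a plane is bounded by the distance from the plane. -/
theorem exists_bound_of_vanish {Ω : Set E3} {n : E3} (hn : ‖n‖ = 1) {ψ : E3 → ℝ}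
    (hψ : IsTestFunction Ω ψ) (hz : ∀ x, inner ℝ n x = 0 → ψ x = 0) :
    ∃ C, 0 ≤ C ∧ (∀ x, |ψ x| ≤ C) ∧ (∀ x, |ψ x| ≤ C * |inner ℝ n x|) ∧
      ∀ k x, |pd k ψ x| ≤ C := by
  obtain ⟨C₁, h₁⟩ := hψ.exists_bound
  obtain ⟨C₂, h₂⟩ := (hψ.2.1.fderiv (𝕜 := ℝ)).exists_bound_of_continuous
    (hψ.1.continuous_fderiv (by simp))
  have hC₂ : 0 ≤ C₂ := (norm_nonneg _).trans (h₂ 0)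
  refine ⟨max C₁ C₂, hC₂.trans (le_max_right _ _), fun x => (h₁ x).trans (le_max_left _ _),
    fun x => ?_, fun k x => ?_⟩
  · have h := Convex.norm_image_sub_le_of_norm_fderiv_le (𝕜 := ℝ) (f := ψ) (s := univ) (C := C₂)
      (x := x - (inner ℝ n x : ℝ) • n) (y := x) (fun x _ => hψ.differentiable x)
      (fun x _ => h₂ x) convex_univ (mem_univ _) (mem_univ _)
    have h0 : ψ (x - (inner ℝ n x : ℝ) • n) = 0 := by
      refine hz _ ?_
      rw [inner_sub_right, inner_smul_right, real_inner_self_eq_norm_sq, hn]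
      ring
    rw [h0, sub_zero, sub_sub_cancel, norm_smul, hn, mul_one, Real.norm_eq_abs,
      Real.norm_eq_abs] at h
    exact h.trans (mul_le_mul_of_nonneg_right (le_max_right _ _) (abs_nonneg _))
  · refine ((fderiv ℝ ψ x).le_opNorm _).trans ?_
    simpa using (h₂ x).trans (le_max_right C₁ C₂)

/-- With `b` the regularized logarithmic gradient, `|d|² - λ p² - (2 p d·b + p² div b) = |d - p b|²
- p² (div b + |b|² + λ)`. For `ε = 0` the last bracket vanishes because `b = ∇h/h` with `-Δh = λ h`;
for `ε > 0` it is the explicit error displayed. -/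
theorem picone_algebra {lam p B s ε l x₀ x₁ x₂ n₀ n₁ n₂ d₀ d₁ d₂ : ℝ} (hs : s ≠ 0)
    (hq : l ^ 2 + ε ^ 2 ≠ 0) (hx : x₀ ^ 2 + x₁ ^ 2 + x₂ ^ 2 + ε ^ 2 = s)
    (hn : n₀ ^ 2 + n₁ ^ 2 + n₂ ^ 2 = 1) (hl : n₀ * x₀ + n₁ * x₁ + n₂ * x₂ = l) :
    d₀ ^ 2 + d₁ ^ 2 + d₂ ^ 2 - lam * p ^ 2 -
      ((2 * p * d₀ * (B * x₀ + l / (l ^ 2 + ε ^ 2) * n₀) +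
        p ^ 2 * (B + (-5 * B - lam - s * B ^ 2) / s * x₀ ^ 2 +
          (ε ^ 2 - l ^ 2) / (l ^ 2 + ε ^ 2) ^ 2 * n₀ ^ 2)) +
      (2 * p * d₁ * (B * x₁ + l / (l ^ 2 + ε ^ 2) * n₁) +
        p ^ 2 * (B + (-5 * B - lam - s * B ^ 2) / s * x₁ ^ 2 +
          (ε ^ 2 - l ^ 2) / (l ^ 2 + ε ^ 2) ^ 2 * n₁ ^ 2)) +
      (2 * p * d₂ * (B * x₂ + l / (l ^ 2 + ε ^ 2) * n₂) +
        p ^ 2 * (B + (-5 * B - lam - s * B ^ 2) / s * x₂ ^ 2 +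
          (ε ^ 2 - l ^ 2) / (l ^ 2 + ε ^ 2) ^ 2 * n₂ ^ 2))) =
    (d₀ - p * (B * x₀ + l / (l ^ 2 + ε ^ 2) * n₀)) ^ 2 +
      (d₁ - p * (B * x₁ + l / (l ^ 2 + ε ^ 2) * n₁)) ^ 2 +
      (d₂ - p * (B * x₂ + l / (l ^ 2 + ε ^ 2) * n₂)) ^ 2 +
    p ^ 2 * (2 * B * (ε ^ 2 / (l ^ 2 + ε ^ 2)) - ε ^ 2 / s * (5 * B + lam) -
      ε ^ 2 / (l ^ 2 + ε ^ 2) ^ 2) := by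
  -- The quotients are named so that the identity becomes polynomial modulo the relations `r₁` to
  -- `r₅`.
  obtain ⟨g, hg⟩ : ∃ g, l / (l ^ 2 + ε ^ 2) = g := ⟨_, rfl⟩
  obtain ⟨G, hG⟩ : ∃ G, (ε ^ 2 - l ^ 2) / (l ^ 2 + ε ^ 2) ^ 2 = G := ⟨_, rfl⟩
  obtain ⟨e₁, h₁⟩ : ∃ e, ε ^ 2 / (l ^ 2 + ε ^ 2) = e := ⟨_, rfl⟩
  obtain ⟨e₂, h₂⟩ : ∃ e, ε ^ 2 / s = e := ⟨_, rfl⟩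
  obtain ⟨e₃, h₃⟩ : ∃ e, ε ^ 2 / (l ^ 2 + ε ^ 2) ^ 2 = e := ⟨_, rfl⟩
  obtain ⟨D, hD⟩ : ∃ D, (-5 * B - lam - s * B ^ 2) / s = D := ⟨_, rfl⟩
  rw [hg, hG, h₁, h₂, h₃, hD]
  have r₁ : g * l = 1 - e₁ := by rw [← hg, ← h₁]; field_simp; ring
  have r₂ : G + g ^ 2 = e₃ := by rw [← hg, ← hG, ← h₃]; field_simp; ring
  have r₃ : D * s = -5 * B - lam - s * B ^ 2 := by rw [← hD]; field_simp
  have r₄ : D * ε ^ 2 = e₂ * (-5 * B - lam - s * B ^ 2) := by rw [← hD, ← h₂]; field_simp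
  have r₅ : e₂ * s = ε ^ 2 := by rw [← h₂]; field_simp
  linear_combination (-p ^ 2 * (G + g ^ 2)) * hn - p ^ 2 * r₂ + p ^ 2 * r₄ - p ^ 2 * r₃ -
    2 * p ^ 2 * B * g * hl - 2 * p ^ 2 * B * r₁ - p ^ 2 * (D + B ^ 2) * hx - p ^ 2 * B ^ 2 * r₅

end

/-! ### Picone's identity: integration and removal of the regularization. -/

noncomputable section

/-- Bounds independent of `ε`: they dominate the regularized quotients near the plane, once the test
function has paid for factors of `l`. -/
theorem abs_div_sq_add_sq_le {l ε : ℝ} : ε ^ 2 / (l ^ 2 + ε ^ 2) ≤ 1 ∧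
    |l| * (|l| / (l ^ 2 + ε ^ 2)) ≤ 1 ∧ l ^ 2 * (ε ^ 2 / (l ^ 2 + ε ^ 2) ^ 2) ≤ 1 := by
  have h1 : ε ^ 2 / (l ^ 2 + ε ^ 2) ≤ 1 := div_le_one_of_le₀ (by nlinarith [sq_nonneg l])
    (by positivity)
  have h2 : l ^ 2 / (l ^ 2 + ε ^ 2) ≤ 1 := div_le_one_of_le₀ (by nlinarith [sq_nonneg ε])
    (by positivity)
  refine ⟨h1, ?_, ?_⟩
  · rw [← mul_div_assoc, abs_mul_abs_self, ← sq]
    exact h2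
  · have : l ^ 2 * (ε ^ 2 / (l ^ 2 + ε ^ 2) ^ 2) =
        (l ^ 2 / (l ^ 2 + ε ^ 2)) * (ε ^ 2 / (l ^ 2 + ε ^ 2)) := by
      rw [div_mul_div_comm, ← sq, mul_div_assoc]
    rw [this]
    exact mul_le_one₀ h2 (by positivity) h1

theorem tendsto_div_zero {ι : Type*} {l : Filter ι} {u v : ι → ℝ} {L : ℝ}
    (hu : Tendsto u l (𝓝 0)) (hv : Tendsto v l (𝓝 L)) (hL : L ≠ 0) :
    Tendsto (fun j => u j / v j) l (𝓝 0) := by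
  have := hu.div hv hL
  rwa [zero_div] at this

/-- The gradient part of the deviation of `ψ` from a multiple of `W(|x|) ⟨n, x⟩`. -/
def piconeDefect (σ : ℝ) (n : E3) (ψ : E3 → ℝ) (k : Fin 3) (x : E3) : ℝ :=
  pd k ψ x - ψ x * piconeField σ n 0 k x

section
variable {σ : ℝ} {n : E3} {ψ : E3 → ℝ}

/-- The remainder in the regularized Picone identity. -/
def piconeRemainder (σ : ℝ) (n : E3) (ε : ℝ) (x : E3) : ℝ :=
  2 * profileLog σ (‖x‖ ^ 2 + ε ^ 2) * (ε ^ 2 / (inner ℝ n x ^ 2 + ε ^ 2)) -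
    ε ^ 2 / (‖x‖ ^ 2 + ε ^ 2) * (5 * profileLog σ (‖x‖ ^ 2 + ε ^ 2) + firstRoot σ ^ 2) -
      ε ^ 2 / (inner ℝ n x ^ 2 + ε ^ 2) ^ 2

/-- The pointwise identity is integrated; the divergence of `ψ² b` integrates to zero, since `ε`
keeps `b` smooth on the support, even on the plane and at the origin. -/
theorem picone_regularized (h0 : 0 ≤ σ) (h1 : σ < 1) (hn : ‖n‖ = 1)
    (hψ : IsTestFunction (shell σ) ψ) {ε : ℝ} (hε : 0 < ε)
    (hr : ∀ x ∈ tsupport ψ, σ ^ 2 < ‖x‖ ^ 2 + ε ^ 2 ∧ ‖x‖ ^ 2 + ε ^ 2 < 1) :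
    ∫ x, (∑ k, pd k ψ x ^ 2 - firstRoot σ ^ 2 * ψ x ^ 2) =
      ∫ x, (∑ k, (pd k ψ x - ψ x * piconeField σ n ε k x) ^ 2 +
        ψ x ^ 2 * piconeRemainder σ n ε x) := by
  have hq : ∀ x : E3, inner ℝ n x ^ 2 + ε ^ 2 ≠ 0 := fun x => by positivity
  have hsupp : ∀ x, x ∉ tsupport ψ → ψ x = 0 := fun x => image_eq_zero_of_notMem_tsupport
  set g : Fin 3 → E3 → ℝ := fun k x => ψ x ^ 2 * piconeField σ n ε k x with hg
  have hts : tsupport (fun x => ψ x ^ 2) ⊆ tsupport ψ :=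
    closure_mono fun x hx hx' => hx (by simp [hx'])
  have hgC : ∀ k, ContDiff ℝ 1 (g k) := fun k => contDiff_mul_of_tsupport
    ((hψ.1.pow 2).of_le (by simp)) fun x hx => contDiffAt_piconeField h0 h1 n k
      (hr x (hts hx)).1 (hr x (hts hx)).2 (hq x)
  have hgc : ∀ k, HasCompactSupport (g k) := fun k =>
    HasCompactSupport.intro hψ.2.1 fun x hx => by simp [hg, hsupp x hx]
  have hpi : ∀ k, Integrable (pd k (g k)) := fun k =>
    (((hgC k).continuous_fderiv (by norm_num)).clm_apply
      continuous_const).integrable_of_hasCompactSupport ((hgc k).fderiv_apply ℝ _)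
  have hpz : ∀ x, x ∉ tsupport ψ → ∀ k, pd k ψ x = 0 := fun x hx k =>
    image_eq_zero_of_notMem_tsupport fun h => hx (tsupport_fderiv_apply_subset ℝ _ h)
  have hpg : ∀ x, x ∉ tsupport ψ → ∀ k, pd k (g k) x = 0 := fun x hx k => by
    have h2 : tsupport (g k) ⊆ tsupport ψ := closure_minimal
      (fun y hy => by by_contra h; exact hy (by simp [hg, hsupp y h])) (isClosed_tsupport ψ)
    exact image_eq_zero_of_notMem_tsupport fun h =>
      hx (h2 (tsupport_fderiv_apply_subset ℝ _ h))
  have hformula : ∀ x ∈ tsupport ψ, ∀ k, pd k (g k) x =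
      2 * ψ x * pd k ψ x * piconeField σ n ε k x + ψ x ^ 2 * pd k (piconeField σ n ε k) x := by
    intro x hx k
    have hb := ((contDiffAt_piconeField h0 h1 n k (hr x hx).1 (hr x hx).2 (hq x)
      (m := 1)).differentiableAt (by norm_num)).hasFDerivAt
    have h2 := ((hψ.differentiable x).hasFDerivAt.pow 2).mul hb
    have h3 : HasFDerivAt (g k) _ x := h2
    rw [pd, h3.fderiv]
    simp [pd]
    ring
  have hpt : ∀ x, ∑ k, pd k ψ x ^ 2 - firstRoot σ ^ 2 * ψ x ^ 2 - ∑ k, pd k (g k) x =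
      ∑ k, (pd k ψ x - ψ x * piconeField σ n ε k x) ^ 2 + ψ x ^ 2 * piconeRemainder σ n ε x := by
    intro x
    by_cases hx : x ∈ tsupport ψ
    · have hs0 : ‖x‖ ^ 2 + ε ^ 2 ≠ 0 := by positivity
      simp only [hformula x hx, pd_piconeField h0 h1 n _ (hr x hx).1 (hr x hx).2 (hq x),
        Fin.sum_univ_three]
      exact picone_algebra hs0 (hq x) (by rw [norm_sq_eq_sum_three])
        (by rw [← norm_sq_eq_sum_three, hn, one_pow]) (inner_eq_sum_three n x).symm
    · simp [hsupp x hx, hpz x hx, hpg x hx]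
  have hint : Integrable fun x => ∑ k, pd k ψ x ^ 2 - firstRoot σ ^ 2 * ψ x ^ 2 := by
    refine Integrable.sub (integrable_finsetSum _ fun k _ => ?_) (Integrable.const_mul ?_ _)
    · simpa only [sq] using (hψ.pd k).integrable_mul (hψ.pd k).1.continuous
    · simpa only [sq] using hψ.integrable_mul hψ.1.continuous
  rw [← integral_congr_ae (Eventually.of_forall hpt),
    integral_sub hint (integrable_finsetSum _ fun k _ => hpi k),
    integral_finsetSum _ fun k _ => hpi k]
  simp [fun k => integral_pd_eq_zero (hgC k) (hgc k) k]

/-- **Picone's identity** for test functions vanishing on the plane orthogonal to `n`. -/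
theorem picone_identity (h0 : 0 ≤ σ) (h1 : σ < 1) (hn : ‖n‖ = 1)
    (hψ : IsTestFunction (shell σ) ψ) (hz : ∀ x, inner ℝ n x = 0 → ψ x = 0) :
    (∀ k, MemLp (piconeDefect σ n ψ k) 2 volume) ∧
    ∫ x, (∑ k, pd k ψ x ^ 2 - firstRoot σ ^ 2 * ψ x ^ 2) =
      ∫ x, ∑ k, piconeDefect σ n ψ k x ^ 2 := by
  obtain ⟨C, hC0, hC1, hC2, hC3⟩ := exists_bound_of_vanish hn hψ hz
  obtain ⟨s₁, s₂, hs₁, hs₁', hs₂0, hs₂, hrad⟩ := exists_radii_of_compact h0 hψ.2.1 hψ.2.2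
  -- Since `s₂² + (1 - s₂)² < 1`, the argument of `profileLog` stays below `1` for all `ε ≤ δ`.
  set δ : ℝ := 1 - s₂ with hδ
  have hδ0 : 0 < δ := by linarith
  have hs₂δ : s₂ ^ 2 + δ ^ 2 < 1 := by nlinarith
  obtain ⟨M₀, hM₀⟩ := exists_profileLog_bound h0 h1 (s₁ := s₁ ^ 2)
    (fun h => pow_lt_pow_left₀ (hs₁' h) h0 (by norm_num)) hs₂δ
  obtain ⟨M, hM0, hM⟩ : ∃ M, 0 ≤ M ∧ ∀ s, 0 < s → (0 < σ → s₁ ^ 2 ≤ s) → s ≤ s₂ ^ 2 + δ ^ 2 →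
      |profileLog σ s| ≤ M :=
    ⟨max M₀ 0, le_max_right _ _, fun s a b c => (hM₀ s a b c).trans (le_max_left _ _)⟩
  have hsupp : ∀ x, x ∉ tsupport ψ → ψ x = 0 := fun x => image_eq_zero_of_notMem_tsupport
  have hpz : ∀ x, x ∉ tsupport ψ → ∀ k, pd k ψ x = 0 := fun x hx k =>
    image_eq_zero_of_notMem_tsupport fun h => hx (tsupport_fderiv_apply_subset ℝ _ h)
  have hball : ∀ x ∈ tsupport ψ, x ∈ Metric.closedBall (0 : E3) 1 := fun x hx => by
    rw [mem_closedBall_zero_iff]; exact (hrad x hx).2.trans hs₂.le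
  -- uniform bounds
  have hMb : ∀ x ∈ tsupport ψ, ∀ ε, |ε| ≤ δ → x ≠ 0 →
      |profileLog σ (‖x‖ ^ 2 + ε ^ 2)| ≤ M := by
    intro x hx ε hε hx0
    have he : ε ^ 2 ≤ δ ^ 2 := by rw [← sq_abs]; exact pow_le_pow_left₀ (abs_nonneg _) hε 2
    have hxp : 0 < ‖x‖ := norm_pos_iff.2 hx0
    refine hM _ (by positivity) (fun h => ?_) ?_
    · have := pow_le_pow_left₀ hs₁ (hrad x hx).1 2
      nlinarith [sq_nonneg ε]
    · have := pow_le_pow_left₀ (norm_nonneg x) (hrad x hx).2 2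
      linarith
  have hdef : ∀ x ∈ tsupport ψ, ∀ ε, |ε| ≤ δ → x ≠ 0 → ∀ k,
      |pd k ψ x - ψ x * piconeField σ n ε k x| ≤ 2 * C + C * M := by
    intro x hx ε hε hx0 k
    have hxk : |x k| ≤ 1 := (PiLp.norm_apply_le x k).trans ((hrad x hx).2.trans hs₂.le)
    have hnk : |n k| ≤ 1 := by
      have := PiLp.norm_apply_le n k
      rw [hn] at this
      exact this
    have hA : |ψ x * (profileLog σ (‖x‖ ^ 2 + ε ^ 2) * x k)| ≤ C * M := by
      rw [abs_mul, abs_mul]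
      calc |ψ x| * (|profileLog σ (‖x‖ ^ 2 + ε ^ 2)| * |x k|) ≤ C * (M * 1) := by
            gcongr
            · exact hC1 x
            · exact hMb x hx ε hε hx0
        _ = C * M := by ring
    -- The linear vanishing of `ψ` on the plane absorbs the singular factor `l / (l² + ε²)`.
    have hB : |ψ x * (inner ℝ n x / (inner ℝ n x ^ 2 + ε ^ 2) * n k)| ≤ C := by
      rw [abs_mul, abs_mul, abs_div, abs_of_nonneg (by positivity : 0 ≤ inner ℝ n x ^ 2 + ε ^ 2)]
      have h3 := (abs_div_sq_add_sq_le (l := inner ℝ n x) (ε := ε)).2.1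
      calc |ψ x| * (|inner ℝ n x| / (inner ℝ n x ^ 2 + ε ^ 2) * |n k|)
          ≤ (C * |inner ℝ n x|) * (|inner ℝ n x| / (inner ℝ n x ^ 2 + ε ^ 2) * 1) := by
            gcongr
            exact hC2 x
        _ = C * (|inner ℝ n x| * (|inner ℝ n x| / (inner ℝ n x ^ 2 + ε ^ 2))) := by ring
        _ ≤ C * 1 := by gcongr
        _ = C := mul_one C
    unfold piconeField
    rw [mul_add]
    have := abs_sub (pd k ψ x) (ψ x * (profileLog σ (‖x‖ ^ 2 + ε ^ 2) * x k) +
      ψ x * (inner ℝ n x / (inner ℝ n x ^ 2 + ε ^ 2) * n k))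
    have h4 := abs_add_le (ψ x * (profileLog σ (‖x‖ ^ 2 + ε ^ 2) * x k))
      (ψ x * (inner ℝ n x / (inner ℝ n x ^ 2 + ε ^ 2) * n k))
    linarith [hC3 k x]
  have hrem : ∀ x ∈ tsupport ψ, ∀ ε, |ε| ≤ δ → x ≠ 0 →
      |ψ x ^ 2 * piconeRemainder σ n ε x| ≤ C ^ 2 * (7 * M + firstRoot σ ^ 2 + 1) := by
    intro x hx ε hε hx0
    have hb := hMb x hx ε hε hx0
    obtain ⟨q1, -, q3⟩ := abs_div_sq_add_sq_le (l := inner ℝ n x) (ε := ε)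
    have q2 : ε ^ 2 / (‖x‖ ^ 2 + ε ^ 2) ≤ 1 := (abs_div_sq_add_sq_le (l := ‖x‖) (ε := ε)).1
    have hψ2 : ψ x ^ 2 ≤ C ^ 2 := by
      rw [← sq_abs]; exact pow_le_pow_left₀ (abs_nonneg _) (hC1 x) 2
    have hψl : ψ x ^ 2 ≤ C ^ 2 * inner ℝ n x ^ 2 := by
      rw [← sq_abs, ← sq_abs (inner ℝ n x), ← mul_pow]
      exact pow_le_pow_left₀ (abs_nonneg _) (hC2 x) 2
    have t1 : |2 * profileLog σ (‖x‖ ^ 2 + ε ^ 2) * (ε ^ 2 / (inner ℝ n x ^ 2 + ε ^ 2))| ≤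
        2 * M := by
      rw [abs_mul, abs_mul, abs_of_pos (by norm_num : (0 : ℝ) < 2), abs_of_nonneg
        (by positivity : 0 ≤ ε ^ 2 / (inner ℝ n x ^ 2 + ε ^ 2))]
      calc 2 * |profileLog σ (‖x‖ ^ 2 + ε ^ 2)| * (ε ^ 2 / (inner ℝ n x ^ 2 + ε ^ 2))
          ≤ 2 * M * 1 := by gcongr
        _ = 2 * M := by ring
    have t2 : |ε ^ 2 / (‖x‖ ^ 2 + ε ^ 2) *
        (5 * profileLog σ (‖x‖ ^ 2 + ε ^ 2) + firstRoot σ ^ 2)| ≤ 5 * M + firstRoot σ ^ 2 := by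
      rw [abs_mul, abs_of_nonneg (by positivity : 0 ≤ ε ^ 2 / (‖x‖ ^ 2 + ε ^ 2))]
      have h5 : |5 * profileLog σ (‖x‖ ^ 2 + ε ^ 2) + firstRoot σ ^ 2| ≤
          5 * M + firstRoot σ ^ 2 := by
        refine (abs_add_le _ _).trans ?_
        rw [abs_mul, abs_of_pos (by norm_num : (0 : ℝ) < 5),
          abs_of_nonneg (sq_nonneg (firstRoot σ))]
        linarith
      calc _ ≤ 1 * (5 * M + firstRoot σ ^ 2) := by gcongr
        _ = _ := one_mul _
    have t3 : |ψ x ^ 2 * (ε ^ 2 / (inner ℝ n x ^ 2 + ε ^ 2) ^ 2)| ≤ C ^ 2 := by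
      -- The most singular error term is controlled by the square of the same linear vanishing.
      rw [abs_of_nonneg (by positivity)]
      calc _ ≤ C ^ 2 * inner ℝ n x ^ 2 * (ε ^ 2 / (inner ℝ n x ^ 2 + ε ^ 2) ^ 2) := by gcongr
        _ = C ^ 2 * (inner ℝ n x ^ 2 * (ε ^ 2 / (inner ℝ n x ^ 2 + ε ^ 2) ^ 2)) := by ring
        _ ≤ C ^ 2 * 1 := by gcongr
        _ = C ^ 2 := mul_one _
    unfold piconeRemainder
    rw [mul_sub]
    refine (abs_sub _ _).trans ?_
    have t4 : |ψ x ^ 2 * (2 * profileLog σ (‖x‖ ^ 2 + ε ^ 2) * (ε ^ 2 / (inner ℝ n x ^ 2 + ε ^ 2))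
        - ε ^ 2 / (‖x‖ ^ 2 + ε ^ 2) * (5 * profileLog σ (‖x‖ ^ 2 + ε ^ 2) + firstRoot σ ^ 2))| ≤
        C ^ 2 * (2 * M + (5 * M + firstRoot σ ^ 2)) := by
      rw [abs_mul, abs_of_nonneg (sq_nonneg (ψ x))]
      have := (abs_sub (2 * profileLog σ (‖x‖ ^ 2 + ε ^ 2) * (ε ^ 2 / (inner ℝ n x ^ 2 + ε ^ 2)))
        (ε ^ 2 / (‖x‖ ^ 2 + ε ^ 2) * (5 * profileLog σ (‖x‖ ^ 2 + ε ^ 2) + firstRoot σ ^ 2)))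
      exact mul_le_mul hψ2 (this.trans (add_le_add t1 t2)) (abs_nonneg _) (sq_nonneg C)
    calc _ ≤ C ^ 2 * (2 * M + (5 * M + firstRoot σ ^ 2)) + C ^ 2 := add_le_add t4 t3
      _ = _ := by ring
  have hn0 : n ≠ 0 := fun h => by rw [h, norm_zero] at hn; exact zero_ne_one hn
  have hne0 : ∀ x : E3, inner ℝ n x ≠ 0 → x ≠ 0 := fun x hx h => hx (by rw [h, inner_zero_right])
  set ε : ℕ → ℝ := fun j => δ / (j + 1) with hεd
  have hε0 : ∀ j, 0 < ε j := fun j => by positivity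
  have hεδ : ∀ j, ε j ≤ δ := fun j => by
    have : (1 : ℝ) ≤ j + 1 := by linarith [(Nat.cast_nonneg j : (0 : ℝ) ≤ j)]
    exact div_le_self hδ0.le this
  have hεt : Tendsto ε atTop (𝓝 0) := by
    have := (tendsto_one_div_add_atTop_nhds_zero_nat (𝕜 := ℝ)).const_mul δ
    simpa [hεd, div_eq_mul_inv] using this
  have hε2 : Tendsto (fun j => ε j ^ 2) atTop (𝓝 0) := by simpa using hεt.pow 2
  have hrj : ∀ j, ∀ x ∈ tsupport ψ, σ ^ 2 < ‖x‖ ^ 2 + ε j ^ 2 ∧ ‖x‖ ^ 2 + ε j ^ 2 < 1 := by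
    intro j x hx
    have h2 := pow_le_pow_left₀ (norm_nonneg x) (hrad x hx).2 2
    have h3 := pow_le_pow_left₀ (hε0 j).le (hεδ j) 2
    refine ⟨?_, by linarith⟩
    rcases h0.eq_or_lt with h | h
    · rw [← h]; nlinarith [sq_nonneg ‖x‖, pow_pos (hε0 j) 2]
    · have := pow_lt_pow_left₀ (hs₁' h) h0 (by norm_num : 2 ≠ 0)
      have := pow_le_pow_left₀ hs₁ (hrad x hx).1 2
      nlinarith [sq_nonneg (ε j)]
  have hfield : ∀ x, x ∈ tsupport ψ → inner ℝ n x ≠ 0 →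
      Tendsto (fun j => profileLog σ (‖x‖ ^ 2 + ε j ^ 2)) atTop (𝓝 (profileLog σ (‖x‖ ^ 2 + 0 ^ 2)))
        ∧ ∀ k, Tendsto (fun j => piconeField σ n (ε j) k x) atTop (𝓝 (piconeField σ n 0 k x)) := by
    intro x hx hl
    have hx0 : 0 < ‖x‖ := norm_pos_iff.2 (hne0 x hl)
    have hlo : σ ^ 2 < ‖x‖ ^ 2 := by
      rcases h0.eq_or_lt with h | h
      · rw [← h]; nlinarith
      · exact pow_lt_pow_left₀ ((hs₁' h).trans_le (hrad x hx).1) h0 (by norm_num)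
    have hup : ‖x‖ ^ 2 < 1 := by
      have := (hrad x hx).2.trans_lt hs₂
      nlinarith
    have t1 : Tendsto (fun j => ‖x‖ ^ 2 + ε j ^ 2) atTop (𝓝 (‖x‖ ^ 2 + 0 ^ 2)) := by
      have := hε2.const_add (‖x‖ ^ 2)
      simpa using this
    have t2 : Tendsto (fun j => profileLog σ (‖x‖ ^ 2 + ε j ^ 2)) atTop
        (𝓝 (profileLog σ (‖x‖ ^ 2 + 0 ^ 2))) := by
      refine Tendsto.comp (ContinuousAt.tendsto ?_) t1
      exact (hasDerivAt_profileLog h0 h1 (by simpa using hlo) (by simpa using hup)).continuousAt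
    refine ⟨t2, fun k => ?_⟩
    have t3 : Tendsto (fun j => inner ℝ n x ^ 2 + ε j ^ 2) atTop
        (𝓝 (inner ℝ n x ^ 2 + 0 ^ 2)) := by
      have := hε2.const_add (inner ℝ n x ^ 2)
      simpa using this
    exact (t2.mul_const _).add ((tendsto_const_nhds.div t3 (by simpa using hl)).mul_const _)
  have haemeas : ∀ k, AEStronglyMeasurable (piconeDefect σ n ψ k) volume := by
    intro k
    have : Measurable (profileLog σ) := by
      unfold profileLog radialNum; fun_prop
    have h2 : Measurable (piconeField σ n 0 k) := by
      unfold piconeField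
      refine ((this.comp (by fun_prop)).mul (by fun_prop)).add ?_
      exact ((by fun_prop : Measurable fun x : E3 => inner ℝ n x).div (by fun_prop)).mul_const _
    exact ((hψ.pd k).1.continuous.measurable.sub
      (hψ.1.continuous.measurable.mul h2)).aestronglyMeasurable
  refine ⟨fun k => ?_, ?_⟩
  · have : IsFiniteMeasure (volume.restrict (Metric.closedBall (0 : E3) 1)) :=
      isFiniteMeasure_restrict.2 (isCompact_closedBall _ _).measure_lt_top.ne
    have h : MemLp (piconeDefect σ n ψ k) 2 (volume.restrict (Metric.closedBall (0 : E3) 1)) := by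
      refine MemLp.of_bound (haemeas k).restrict (2 * C + C * M) ?_
      refine ae_restrict_of_ae ?_
      filter_upwards [ae_inner_ne_zero hn0] with x hl
      by_cases hx : x ∈ tsupport ψ
      · exact hdef x hx 0 (by simpa using hδ0.le) (hne0 x hl) k
      · simp only [piconeDefect, hsupp x hx, hpz x hx, zero_mul, sub_self, norm_zero]
        positivity
    rw [← memLp_indicator_iff_restrict measurableSet_closedBall] at h
    refine h.ae_eq (Eventually.of_forall fun x => ?_)
    by_cases hx : x ∈ tsupport ψ
    · exact indicator_of_mem (hball x hx) _
    · have : piconeDefect σ n ψ k x = 0 := by simp [piconeDefect, hsupp x hx, hpz x hx]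
      rw [this]; exact indicator_apply_eq_zero.2 fun _ => this
  · set K := 3 * (2 * C + C * M) ^ 2 + |C ^ 2 * (7 * M + firstRoot σ ^ 2 + 1)| with hK
    have hK0 : 0 ≤ K := by positivity
    -- Dominated convergence as `ε → 0`; the pointwise limit is taken off the plane, which has
    -- measure zero.
    have hlim := tendsto_integral_of_dominated_convergence (μ := (volume : Measure E3))
      (F := fun j x => ∑ k, (pd k ψ x - ψ x * piconeField σ n (ε j) k x) ^ 2 +
        ψ x ^ 2 * piconeRemainder σ n (ε j) x)
      (f := fun x => ∑ k, piconeDefect σ n ψ k x ^ 2)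
      ((Metric.closedBall (0 : E3) 1).indicator fun _ => K) ?_ ?_ ?_ ?_
    · refine tendsto_nhds_unique (tendsto_const_nhds.congr fun j => ?_) hlim
      exact picone_regularized h0 h1 hn hψ (hε0 j) (hrj j)
    · intro j
      have hm : Measurable (profileLog σ) := by
        unfold profileLog radialNum; fun_prop
      have h3 : Measurable fun x : E3 => profileLog σ (‖x‖ ^ 2 + ε j ^ 2) := hm.comp (by fun_prop)
      have h4 : Measurable fun x : E3 => (inner ℝ n x : ℝ) := by fun_prop
      have h2 : ∀ k, Measurable (piconeField σ n (ε j) k) := fun k => by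
        unfold piconeField
        exact (h3.mul (by fun_prop)).add ((h4.div (by fun_prop)).mul_const _)
      have h5 : Measurable (piconeRemainder σ n (ε j)) := by
        unfold piconeRemainder
        fun_prop
      refine Measurable.aestronglyMeasurable (Measurable.add (Finset.measurable_sum _ fun k _ => ?_)
        ((hψ.1.continuous.measurable.pow_const 2).mul h5))
      exact ((hψ.pd k).1.continuous.measurable.sub
        (hψ.1.continuous.measurable.mul (h2 k))).pow_const 2
    · exact (integrable_indicator_iff measurableSet_closedBall).2
        (integrableOn_const (isCompact_closedBall _ _).measure_lt_top.ne)
    · intro j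
      filter_upwards [ae_inner_ne_zero hn0] with x hl
      by_cases hx : x ∈ tsupport ψ
      · rw [indicator_of_mem (hball x hx)]
        have hj : |ε j| ≤ δ := by rw [abs_of_pos (hε0 j)]; exact hεδ j
        have hd := fun k => hdef x hx (ε j) hj (hne0 x hl) k
        have hrm := hrem x hx (ε j) hj (hne0 x hl)
        refine (norm_add_le _ _).trans (add_le_add ?_ (hrm.trans (le_abs_self _)))
        rw [Real.norm_eq_abs, abs_of_nonneg (Finset.sum_nonneg fun k _ => sq_nonneg _)]
        calc _ ≤ ∑ k : Fin 3, (2 * C + C * M) ^ 2 := Finset.sum_le_sum fun k _ => by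
              rw [← sq_abs]; exact pow_le_pow_left₀ (abs_nonneg _) (hd k) 2
          _ = _ := by simp
      · simp only [hsupp x hx, hpz x hx]
        simp [indicator_nonneg, hK0]
    · filter_upwards [ae_inner_ne_zero hn0] with x hl
      by_cases hx : x ∈ tsupport ψ
      · obtain ⟨t1, t2⟩ := hfield x hx hl
        have hx0 : 0 < ‖x‖ := norm_pos_iff.2 (hne0 x hl)
        have hrm : Tendsto (fun j => piconeRemainder σ n (ε j) x) atTop (𝓝 0) := by
          have a1 : Tendsto (fun j => ε j ^ 2 / (inner ℝ n x ^ 2 + ε j ^ 2)) atTop (𝓝 0) := by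
            exact tendsto_div_zero hε2 (hε2.const_add (inner ℝ n x ^ 2)) (by simpa using hl)
          have a2 : Tendsto (fun j => ε j ^ 2 / (‖x‖ ^ 2 + ε j ^ 2)) atTop (𝓝 0) := by
            exact tendsto_div_zero hε2 (hε2.const_add (‖x‖ ^ 2)) (by simpa using hx0.ne')
          have a3 : Tendsto (fun j => ε j ^ 2 / (inner ℝ n x ^ 2 + ε j ^ 2) ^ 2) atTop (𝓝 0) := by
            exact tendsto_div_zero hε2 ((hε2.const_add (inner ℝ n x ^ 2)).pow 2) (by simpa using hl)
          have := (((t1.const_mul 2).mul a1).sub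
            (a2.mul ((t1.const_mul 5).add_const (firstRoot σ ^ 2)))).sub a3
          simpa [piconeRemainder] using this
        have h6 : Tendsto (fun j => ∑ k, (pd k ψ x - ψ x * piconeField σ n (ε j) k x) ^ 2) atTop
            (𝓝 (∑ k, piconeDefect σ n ψ k x ^ 2)) :=
          tendsto_finsetSum _ fun k _ => ((((t2 k).const_mul (ψ x)).const_sub _).pow 2)
        simpa using h6.add (hrm.const_mul (ψ x ^ 2))
      · simp [hsupp x hx, hpz x hx, piconeDefect]

end

end

noncomputable section

/-! ### The case of equality -/

/-- The reflection in the plane orthogonal to `n`. -/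
abbrev planeReflection (n : E3) : E3 ≃ₗᵢ[ℝ] E3 := (ℝ ∙ n)ᗮ.reflection

theorem planeReflection_apply {n : E3} (hn : ‖n‖ = 1) (x : E3) :
    planeReflection n x = x - (2 * inner ℝ n x) • n := by
  rw [planeReflection, Submodule.reflection_orthogonal_apply, Submodule.reflection_singleton_apply]
  simp [hn, two_smul, two_mul, add_smul]

theorem inner_planeReflection {n : E3} (hn : ‖n‖ = 1) (x : E3) :
    inner ℝ n (planeReflection n x) = - inner ℝ n x := by
  rw [planeReflection_apply hn, inner_sub_right, inner_smul_right, real_inner_self_eq_norm_sq, hn]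
  ring

theorem planeReflection_planeReflection (n x : E3) :
    planeReflection n (planeReflection n x) = x := Submodule.reflection_reflection _ x

theorem mem_shell_comp_isometry {σ : ℝ} (Q : E3 ≃ₗᵢ[ℝ] E3) {x : E3} :
    Q x ∈ shell σ ↔ x ∈ shell σ := by simp [shell]

/-- A subsequence converges almost everywhere. -/
theorem L2Lim.ae_eq_zero_of_forall {F : Type*} [NormedAddCommGroup F] [InnerProductSpace ℝ F]
    {φ : ℕ → E3 → F} {f : E3 → F} (h : L2Lim φ f) {S : Set E3}
    (hz : ∀ j, ∀ x ∉ S, φ j x = 0) : ∀ᵐ x, x ∉ S → f x = 0 := by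
  obtain ⟨ns, -, hns⟩ := (tendstoInMeasure_of_tendsto_Lp h.choose_spec.choose_spec).exists_seq_tendsto_ae
  have hae : ∀ᵐ x, ∀ j, (h.choose j).toLp (φ j) x = φ j x :=
    ae_all_iff.2 fun j => (h.choose j).coeFn_toLp
  filter_upwards [hns, hae, h.choose_spec.choose.coeFn_toLp] with x h1 h2 h3 hx
  rw [h3] at h1
  refine (tendsto_nhds_unique h1 ?_)
  simp [h2, hz _ x hx]

/-- The half shell is the continuous image of a convex set, an interval of radii times a half space,
under `(r, v) ↦ r v / |v|`. -/
theorem isPreconnected_half_shell {σ : ℝ} (h0 : 0 ≤ σ) (n : E3) :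
    IsPreconnected {x | x ∈ shell σ ∧ 0 < inner ℝ n x} := by
  have hV : Convex ℝ {v : E3 | 0 < inner ℝ n v} :=
    convex_halfSpace_gt (innerSL ℝ n).toLinearMap.isLinear 0
  have hP : IsPreconnected (Ioo σ 1 ×ˢ {v : E3 | 0 < inner ℝ n v}) :=
    ((convex_Ioo σ 1).prod hV).isPreconnected
  have hne : ∀ v : E3, 0 < inner ℝ n v → 0 < ‖v‖ := fun v hv =>
    norm_pos_iff.2 fun h => by simp [h] at hv
  have himg := hP.image (fun p : ℝ × E3 => (p.1 / ‖p.2‖) • p.2) (by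
    refine ContinuousOn.smul (ContinuousOn.div continuousOn_fst
      continuousOn_snd.norm fun p hp => (hne _ hp.2).ne') continuousOn_snd)
  convert himg using 1
  ext x
  constructor
  · rintro ⟨hx, hl⟩
    have hx0 := hne x hl
    refine ⟨(‖x‖, x), ⟨⟨?_, hx.2⟩, hl⟩, ?_⟩
    · rcases h0.eq_or_lt with h | h
      · rw [← h]; exact hx0
      · exact hx.1 h
    · simp [div_self hx0.ne']
  · rintro ⟨⟨r, v⟩, ⟨hr, hv⟩, rfl⟩
    have hv0 := hne v hv
    have hr0 : 0 < r := h0.trans_lt hr.1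
    have hnorm : ‖(r / ‖v‖) • v‖ = r := by
      rw [norm_smul, Real.norm_eq_abs, abs_of_pos (div_pos hr0 hv0), div_mul_cancel₀ _ hv0.ne']
    refine ⟨⟨fun _ => by rw [hnorm]; exact hr.1, by rw [hnorm]; exact hr.2⟩, ?_⟩
    simp only [inner_smul_right]
    exact mul_pos (div_pos hr0 hv0) hv

theorem contDiffAt_profile_norm (σ : ℝ) {x : E3} (hx : x ≠ 0) {m : WithTop ℕ∞} :
    ContDiffAt ℝ m (fun x : E3 => profile σ ‖x‖) x := by
  have hnum : ContDiff ℝ m (radialNum (phaseShift σ)) := by unfold radialNum; fun_prop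
  have hno : ContDiffAt ℝ m (fun x : E3 => ‖x‖) x := contDiffAt_norm ℝ hx
  unfold profile
  exact (hnum.contDiffAt.comp x (contDiffAt_const.mul hno)).div (hno.pow 3)
    (pow_ne_zero 3 (norm_ne_zero_iff.2 hx))

theorem pd_profile_norm (σ : ℝ) {x : E3} (hx : x ≠ 0) (k : Fin 3) :
    pd k (fun x : E3 => profile σ ‖x‖) x = profileDeriv σ ‖x‖ * (x k / ‖x‖) := by
  have hn := norm_ne_zero_iff.2 hx
  have h1 : HasFDerivAt (fun x : E3 => ‖x‖) (fderiv ℝ (fun x : E3 => ‖x‖) x) x :=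
    ((contDiffAt_norm ℝ hx (n := 1)).differentiableAt (by norm_num)).hasFDerivAt
  have h2 := (hasDerivAt_profile (σ := σ) hn).comp_hasFDerivAt x h1
  have h3 : HasFDerivAt (fun x : E3 => profile σ ‖x‖) _ x := h2
  rw [pd, h3.fderiv]
  have h4 := (hasStrictFDerivAt_norm_sq x).hasFDerivAt
  have h5 := h1.pow 2
  have h6 := congrArg (fun L : E3 →L[ℝ] ℝ => L (EuclideanSpace.single k (1 : ℝ))) (h5.unique h4)
  have e1 : inner ℝ x (EuclideanSpace.single k (1 : ℝ)) = x k := by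
    simp [EuclideanSpace.inner_single_right]
  simp [e1] at h6
  simp only [smul_apply, smul_eq_mul]
  congr 1
  rw [eq_div_iff hn]
  linarith

theorem fderiv_apply_eq_sum_pd (η : E3 → ℝ) (x v : E3) :
    fderiv ℝ η x v = ∑ k, v k * pd k η x := by
  have : v = ∑ k, v k • EuclideanSpace.single k (1 : ℝ) := by
    ext i; fin_cases i <;> simp [Fin.sum_univ_three]
  conv_lhs => rw [this]
  simp [pd, map_sum]

section
variable {σ : ℝ} {n : E3}

/-- The first eigenfunction of the half shell. -/
def halfProfile (σ : ℝ) (n x : E3) : ℝ := profile σ ‖x‖ * inner ℝ n x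

theorem norm_mem_of_mem_shell (h0 : 0 ≤ σ) {x : E3} (hx : x ∈ shell σ) (hx0 : x ≠ 0) :
    σ < ‖x‖ ∧ ‖x‖ < 1 := by
  refine ⟨?_, hx.2⟩
  rcases h0.eq_or_lt with h | h
  · rw [← h]; exact norm_pos_iff.2 hx0
  · exact hx.1 h

theorem contDiffAt_halfProfile {x : E3} (hx : x ≠ 0) {m : WithTop ℕ∞} :
    ContDiffAt ℝ m (halfProfile σ n) x :=
  (contDiffAt_profile_norm σ hx).mul (contDiff_const.inner ℝ contDiff_id).contDiffAt

theorem pd_halfProfile {x : E3} (hx : x ≠ 0) (k : Fin 3) :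
    pd k (halfProfile σ n) x =
      profileDeriv σ ‖x‖ * (x k / ‖x‖) * inner ℝ n x + profile σ ‖x‖ * n k := by
  have hin : HasFDerivAt (fun x : E3 => inner ℝ n x) (innerSL ℝ n) x := (innerSL ℝ n).hasFDerivAt
  have h := ((contDiffAt_profile_norm σ hx (m := 1)).differentiableAt
    (by norm_num)).hasFDerivAt.mul hin
  have h3 : HasFDerivAt (halfProfile σ n) _ x := h
  have e2 : inner ℝ n (EuclideanSpace.single k (1 : ℝ)) = n k := by
    simp [EuclideanSpace.inner_single_right]
  have := pd_profile_norm σ hx k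
  rw [pd] at this
  rw [pd, h3.fderiv]
  simp [this, e2]
  ring

/-- Explains `piconeField`: without regularization it is the logarithmic gradient of `halfProfile`.
-/
theorem pd_halfProfile_eq (h0 : 0 ≤ σ) (h1 : σ < 1) {x : E3} (hx : x ∈ shell σ)
    (hl : inner ℝ n x ≠ 0) (k : Fin 3) :
    pd k (halfProfile σ n) x = halfProfile σ n x * piconeField σ n 0 k x := by
  have hx0 : x ≠ 0 := fun h => hl (by simp [h])
  have hn := norm_ne_zero_iff.2 hx0
  obtain ⟨hr, hr1⟩ := norm_mem_of_mem_shell h0 hx hx0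
  rw [pd_halfProfile hx0, profileDeriv_eq h0 h1 hr hr1, piconeField, halfProfile]
  field_simp
  ring_nf

/-- This is the weak form of `∇f = f ∇h/h` on the half shell. For `ψ j` the pairing equals minus
that of the Picone defect with `θ`, and by Cauchy–Schwarz it is bounded by the energy, which tends
to zero. -/
theorem integral_mul_weak_eq_zero (h0 : 0 ≤ σ) (h1 : σ < 1) (hn : ‖n‖ = 1) {ψ : ℕ → E3 → ℝ}
    {f : E3 → ℝ} (ht : ∀ j, IsTestFunction (shell σ) (ψ j))
    (hz : ∀ j x, inner ℝ n x = 0 → ψ j x = 0) (hlim : L2Lim ψ f)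
    (hE : Tendsto (fun j => ∫ x, (∑ k, pd k (ψ j) x ^ 2 - firstRoot σ ^ 2 * ψ j x ^ 2)) atTop (𝓝 0))
    {θ : E3 → ℝ} (hθ : IsTestFunction {x | x ∈ shell σ ∧ 0 < inner ℝ n x} θ) (k : Fin 3) :
    MemLp (fun x => pd k θ x + θ x * piconeField σ n 0 k x) 2 volume ∧
    ∫ x, f x * (pd k θ x + θ x * piconeField σ n 0 k x) = 0 := by
  have hbC : ∀ x ∈ tsupport θ, ContDiffAt ℝ 1 (piconeField σ n 0 k) x := by
    intro x hx
    obtain ⟨hxs, hl⟩ := hθ.2.2 hx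
    obtain ⟨hr, hr1⟩ := norm_mem_of_mem_shell h0 hxs fun h => by simp [h] at hl
    refine contDiffAt_piconeField h0 h1 n k ?_ ?_ ?_
    · simpa using pow_lt_pow_left₀ hr h0 (by norm_num : 2 ≠ 0)
    · simpa using (pow_lt_one₀ (norm_nonneg x) hr1 (by norm_num : 2 ≠ 0))
    · simpa using hl.ne'
  have hθb : ContDiff ℝ 1 fun x => θ x * piconeField σ n 0 k x :=
    contDiff_mul_of_tsupport (hθ.1.of_le (by simp)) hbC
  have hθbc : HasCompactSupport fun x => θ x * piconeField σ n 0 k x := hθ.2.1.mul_right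
  have hL : MemLp (fun x => pd k θ x + θ x * piconeField σ n 0 k x) 2 volume :=
    (hθ.pd k).memLp.add (hθb.continuous.memLp_of_hasCompactSupport hθbc)
  refine ⟨hL, ?_⟩
  have t1 : Tendsto (fun j => ∫ x, ψ j x * (pd k θ x + θ x * piconeField σ n 0 k x)) atTop
      (𝓝 (∫ x, f x * (pd k θ x + θ x * piconeField σ n 0 k x))) := by
    have := hlim.inner (l2Lim_const hL)
    simpa [mul_comm] using this
  refine tendsto_nhds_unique t1 ?_
  have e : ∀ j, ∫ x, ψ j x * (pd k θ x + θ x * piconeField σ n 0 k x) =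
      - ∫ x, inner ℝ (piconeDefect σ n (ψ j) k x) (θ x) := by
    intro j
    have i1 : Integrable fun x => ψ j x * pd k θ x := (ht j).integrable_mul (hθ.pd k).1.continuous
    have i2 : Integrable fun x => ψ j x * (θ x * piconeField σ n 0 k x) :=
      (ht j).integrable_mul hθb.continuous
    have i3 : Integrable fun x => pd k (ψ j) x * θ x := ((ht j).pd k).integrable_mul hθ.1.continuous
    have s1 : ∫ x, ψ j x * (pd k θ x + θ x * piconeField σ n 0 k x) =
        (∫ x, ψ j x * pd k θ x) + ∫ x, ψ j x * (θ x * piconeField σ n 0 k x) := by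
      rw [← integral_add i1 i2]; simp_rw [mul_add]
    have s2 : ∫ x, inner ℝ (piconeDefect σ n (ψ j) k x) (θ x) =
        (∫ x, pd k (ψ j) x * θ x) - ∫ x, ψ j x * (θ x * piconeField σ n 0 k x) := by
      rw [← integral_sub i3 i2]
      refine integral_congr_ae (Eventually.of_forall fun x => ?_)
      simp [piconeDefect]
      ring
    rw [s1, s2, (ht j).integral_mul_pd (hθ.1.of_le (by simp)) k]
    ring
  simp_rw [e]
  rw [← neg_zero]
  refine Tendsto.neg ?_
  have hle : ∀ j, (∫ x, inner ℝ (piconeDefect σ n (ψ j) k x) (θ x)) ^ 2 ≤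
      (∫ x, (∑ k, pd k (ψ j) x ^ 2 - firstRoot σ ^ 2 * ψ j x ^ 2)) * ∫ x, ‖θ x‖ ^ 2 := by
    intro j
    obtain ⟨hm, hp⟩ := picone_identity h0 h1 hn (ht j) (hz j)
    refine (integral_inner_sq_le (hm k) hθ.memLp).trans ?_
    rw [hp]
    refine mul_le_mul_of_nonneg_right ?_ (integral_nonneg fun x => by positivity)
    refine integral_mono_of_nonneg (Eventually.of_forall fun x => by positivity)
      (integrable_finsetSum _ fun k _ => (hm k).integrable_sq) (Eventually.of_forall fun x => ?_)
    simp only [Real.norm_eq_abs, sq_abs]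
    exact Finset.single_le_sum (f := fun k => piconeDefect σ n (ψ j) k x ^ 2)
      (fun k _ => sq_nonneg _) (Finset.mem_univ k)
  have hE' := hE.mul_const (∫ x, ‖θ x‖ ^ 2)
  rw [zero_mul] at hE'
  have hsq := squeeze_zero (fun j => sq_nonneg _) hle hE'
  have := hsq.sqrt
  simp only [Real.sqrt_sq_eq_abs, Real.sqrt_zero] at this
  exact (tendsto_zero_iff_abs_tendsto_zero _).2 this

/-- A limit of test functions, odd under the reflection in the plane orthogonal to `n`, whose
energies tend to the minimum is a multiple of `W(|x|) ⟨n, x⟩`. -/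
theorem ae_eq_halfProfile_of_energy_tendsto (h0 : 0 ≤ σ) (h1 : σ < 1) (hn : ‖n‖ = 1)
    {ψ : ℕ → E3 → ℝ} {f : E3 → ℝ} (ht : ∀ j, IsTestFunction (shell σ) (ψ j))
    (hodd : ∀ j x, ψ j (planeReflection n x) = - ψ j x) (hlim : L2Lim ψ f)
    (hE : Tendsto (fun j => ∫ x, (∑ k, pd k (ψ j) x ^ 2 - firstRoot σ ^ 2 * ψ j x ^ 2))
      atTop (𝓝 0)) :
    ∃ c : ℝ, f =ᵐ[volume] (shell σ).indicator fun x => c * halfProfile σ n x := by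
  have hz : ∀ j x, inner ℝ n x = 0 → ψ j x = 0 := fun j x hx => by
    have := hodd j x
    rw [planeReflection_apply hn, hx] at this
    simp at this
    linarith
  set U : Set E3 := {x | x ∈ shell σ ∧ 0 < inner ℝ n x} with hU
  have hUo : IsOpen U := by
    have hin : Continuous fun x : E3 => (inner ℝ n x : ℝ) := continuous_const.inner continuous_id
    exact (isOpen_shell σ).inter (isOpen_Ioi.preimage hin)
  have hx0 : ∀ x ∈ U, x ≠ 0 := fun x hx h => by simp [hU, h] at hx
  have hpos : ∀ x ∈ U, 0 < halfProfile σ n x := fun x hx => by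
    obtain ⟨hr, hr1⟩ := norm_mem_of_mem_shell h0 hx.1 (hx0 x hx)
    exact mul_pos (profile_pos h0 h1 hr hr1) hx.2
  have hinvC : ∀ x ∈ U, ContDiffAt ℝ ∞ (fun x => (halfProfile σ n x)⁻¹) x := fun x hx =>
    (contDiffAt_halfProfile (hx0 x hx)).inv (hpos x hx).ne'
  have hkey : ∀ η : E3 → ℝ, IsTestFunction U η → ∀ k,
      Integrable (fun x => f x * (halfProfile σ n x)⁻¹ * pd k η x) ∧
      ∫ x, f x * (halfProfile σ n x)⁻¹ * pd k η x = 0 := by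
    intro η hη k
    -- Testing with `η / h` turns `∇f = f ∇h/h` into the vanishing of the weak gradient of `f / h`.
    set θ : E3 → ℝ := fun x => η x * (halfProfile σ n x)⁻¹ with hθd
    have hsub : tsupport θ ⊆ tsupport η := tsupport_mul_subset_left
    have hθ : IsTestFunction U θ :=
      ⟨contDiff_mul_of_tsupport hη.1 fun x hx => hinvC x (hη.2.2 hx), hη.2.1.mul_right,
        hsub.trans hη.2.2⟩
    have e : ∀ x, pd k θ x + θ x * piconeField σ n 0 k x = (halfProfile σ n x)⁻¹ * pd k η x := by
      intro x
      by_cases hx : x ∈ tsupport η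
      · have hxU := hη.2.2 hx
        have hp := (hpos x hxU).ne'
        have hh := ((contDiffAt_halfProfile (σ := σ) (n := n) (hx0 x hxU)
          (m := 1)).differentiableAt (by norm_num)).hasFDerivAt
        have hi := (hasDerivAt_inv hp).comp_hasFDerivAt x hh
        have h2 := (hη.differentiable x).hasFDerivAt.mul hi
        have h3 : HasFDerivAt θ _ x := h2
        have h4 := pd_halfProfile_eq h0 h1 hxU.1 hxU.2.ne' k
        rw [pd] at h4
        rw [pd, h3.fderiv]
        simp [h4, hθd, pd]
        field_simp
        ring
      · have h2 : pd k θ x = 0 := image_eq_zero_of_notMem_tsupport fun h =>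
          hx (hsub (tsupport_fderiv_apply_subset ℝ _ h))
        have h3 : pd k η x = 0 := image_eq_zero_of_notMem_tsupport fun h =>
          hx (tsupport_fderiv_apply_subset ℝ _ h)
        have h4 : η x = 0 := image_eq_zero_of_notMem_tsupport hx
        have h5 : θ x = 0 := by simp [hθd, h4]
        rw [h2, h3, h5]
        simp
    obtain ⟨hm, hi⟩ := integral_mul_weak_eq_zero h0 h1 hn ht hz hlim hE hθ k
    have e2 : ∀ x, f x * (halfProfile σ n x)⁻¹ * pd k η x =
        f x * (pd k θ x + θ x * piconeField σ n 0 k x) := fun x => by rw [e]; ring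
    simp_rw [e2]
    refine ⟨?_, hi⟩
    have := integrable_inner_of_memLp hlim.memLp hm
    simpa [mul_comm] using this
  have hloc : LocallyIntegrableOn (fun x => f x * (halfProfile σ n x)⁻¹) U := by
    have hfl : LocallyIntegrable f := hlim.memLp.locallyIntegrable (by norm_num)
    refine (hfl.locallyIntegrableOn U).mul_continuousOn ?_ hUo.isLocallyClosed
    exact fun x hx => (hinvC x hx).continuousAt.continuousWithinAt
  obtain ⟨c, hc⟩ := ae_eq_const_of_weak_gradient_eq_zero hUo (isPreconnected_half_shell h0 n) hloc
    (fun η hη v => by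
      simp_rw [fderiv_apply_eq_sum_pd, Finset.mul_sum]
      rw [integral_finsetSum _ fun k _ => by
        simpa [mul_left_comm] using ((hkey η hη k).1.const_mul (v k))]
      refine Finset.sum_eq_zero fun k _ => ?_
      have : ∀ x, f x * (halfProfile σ n x)⁻¹ * (v k * pd k η x) =
        v k * (f x * (halfProfile σ n x)⁻¹ * pd k η x) := fun x => by ring
      simp_rw [this]
      rw [integral_const_mul, (hkey η hη k).2, mul_zero])
  have hplus : ∀ᵐ x, x ∈ U → f x = c * halfProfile σ n x := by
    filter_upwards [hc] with x hx hxU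
    rw [← hx hxU]
    field_simp [(hpos x hxU).ne']
  -- Oddness survives the limit and carries the identification from one half shell to the other with
  -- the same constant.
  have hodd' : (fun x => f (planeReflection n x)) =ᵐ[volume] fun x => (-1 : ℝ) • f x := by
    refine (hlim.comp_isometry (planeReflection n)).unique ?_
    have := hlim.const_smul (-1)
    convert this using 3 with j x
    rw [hodd]; simp
  have hrefl := (planeReflection n).measurePreserving.quasiMeasurePreserving.ae hplus
  have hoff := hlim.ae_eq_zero_of_forall (S := shell σ) fun j x hx => (ht j).eq_zero hx
  have hn0 : n ≠ 0 := fun h => by rw [h, norm_zero] at hn; exact zero_ne_one hn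
  refine ⟨c, ?_⟩
  filter_upwards [hplus, hrefl, hodd', hoff, ae_inner_ne_zero hn0] with x a1 a2 a3 a4 a5
  by_cases hx : x ∈ shell σ
  · rw [indicator_of_mem hx]
    rcases lt_or_gt_of_ne a5 with h | h
    · have h2 := a2 ⟨(mem_shell_comp_isometry _).2 hx, by rw [inner_planeReflection hn]; linarith⟩
      rw [a3, halfProfile, inner_planeReflection hn, LinearIsometryEquiv.norm_map] at h2
      rw [halfProfile]
      simp only [smul_eq_mul] at h2
      linarith
    · exact a1 ⟨hx, h⟩
  · rw [indicator_of_notMem hx, a4 hx]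

end

end

noncomputable section

/-! ### Symmetries of solenoidal fields -/

/-- The matrix of a linear map, as an element of the space with the Frobenius inner product. -/
def frobeniusMatrix : (E3 →L[ℝ] E3) →ₗ[ℝ] Mat3 where
  toFun A := WithLp.toLp 2 (fun p => (A (EuclideanSpace.single p.2 (1 : ℝ))) p.1)
  map_add' A B := by ext p; simp
  map_smul' c A := by ext p; simp

theorem jacobian_eq (φ : E3 → E3) (x : E3) : jacobian φ x = frobeniusMatrix (fderiv ℝ φ x) := rfl

/-- The Frobenius product is the trace of the adjoint of `A` composed with `B`, so any orthonormal
basis computes it. This makes the Dirichlet form invariant under isometries. -/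
theorem inner_frobeniusMatrix (A B : E3 →L[ℝ] E3) (b : OrthonormalBasis (Fin 3) ℝ E3) :
    inner ℝ (frobeniusMatrix A) (frobeniusMatrix B) = ∑ k, inner ℝ (A (b k)) (B (b k)) := by
  have key : ∀ b : OrthonormalBasis (Fin 3) ℝ E3, ∑ k, inner ℝ (A (b k)) (B (b k)) =
      LinearMap.trace ℝ E3 ((A.adjoint ∘L B : E3 →L[ℝ] E3) : E3 →ₗ[ℝ] E3) := by
    intro b
    rw [LinearMap.trace_eq_sum_inner _ b]
    simp [ContinuousLinearMap.adjoint_inner_right]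
  rw [key b, ← key (EuclideanSpace.basisFun (Fin 3) ℝ)]
  simp only [frobeniusMatrix, LinearMap.coe_mk, AddHom.coe_mk, PiLp.inner_apply,
    EuclideanSpace.basisFun_apply]
  rw [Fintype.sum_prod_type, Finset.sum_comm]

theorem inner_frobeniusMatrix_conj (Q : E3 ≃ₗᵢ[ℝ] E3) (A B : E3 →L[ℝ] E3) :
    inner ℝ (frobeniusMatrix ((Q : E3 →L[ℝ] E3) ∘L A ∘L (Q.symm : E3 →L[ℝ] E3)))
      (frobeniusMatrix ((Q : E3 →L[ℝ] E3) ∘L B ∘L (Q.symm : E3 →L[ℝ] E3))) =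
    inner ℝ (frobeniusMatrix A) (frobeniusMatrix B) := by
  rw [inner_frobeniusMatrix _ _ (EuclideanSpace.basisFun (Fin 3) ℝ),
    inner_frobeniusMatrix A B ((EuclideanSpace.basisFun (Fin 3) ℝ).map Q.symm)]
  simp

/-- The action of an isometry on vector fields. -/
def act (Q : E3 ≃ₗᵢ[ℝ] E3) (φ : E3 → E3) (x : E3) : E3 := Q (φ (Q.symm x))

theorem fderiv_act (Q : E3 ≃ₗᵢ[ℝ] E3) {φ : E3 → E3} (hφ : Differentiable ℝ φ) (x : E3) :
    fderiv ℝ (act Q φ) x =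
      (Q : E3 →L[ℝ] E3) ∘L fderiv ℝ φ (Q.symm x) ∘L (Q.symm : E3 →L[ℝ] E3) := by
  have h1 : HasFDerivAt (fun x => Q.symm x) (Q.symm : E3 →L[ℝ] E3) x :=
    (Q.symm : E3 →L[ℝ] E3).hasFDerivAt
  have h2 := (hφ (Q.symm x)).hasFDerivAt.comp x h1
  have h3 := (Q : E3 →L[ℝ] E3).hasFDerivAt.comp x h2
  exact h3.fderiv

theorem divergence_eq_trace (φ : E3 → E3) (x : E3) :
    ∑ k : Fin 3, jacobian φ x (k, k) = LinearMap.trace ℝ E3 (fderiv ℝ φ x : E3 →ₗ[ℝ] E3) := by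
  rw [LinearMap.trace_eq_sum_inner _ (EuclideanSpace.basisFun (Fin 3) ℝ)]
  simp [jacobian, EuclideanSpace.inner_single_left]

theorem act_add (Q : E3 ≃ₗᵢ[ℝ] E3) (φ ψ : E3 → E3) :
    act Q (fun x => φ x + ψ x) = fun x => act Q φ x + act Q ψ x := by
  ext1 x; simp [act]

theorem act_smul (Q : E3 ≃ₗᵢ[ℝ] E3) (c : ℝ) (φ : E3 → E3) :
    act Q (fun x => c • φ x) = fun x => c • act Q φ x := by
  ext1 x; simp [act]

theorem act_sub (Q : E3 ≃ₗᵢ[ℝ] E3) (φ ψ : E3 → E3) :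
    act Q (fun x => φ x - ψ x) = fun x => act Q φ x - act Q ψ x := by
  ext1 x; simp [act]

theorem act_trans (Q R : E3 ≃ₗᵢ[ℝ] E3) (φ : E3 → E3) : act (Q.trans R) φ = act R (act Q φ) := rfl

theorem act_act_symm (Q : E3 ≃ₗᵢ[ℝ] E3) (φ : E3 → E3) : act Q (act Q.symm φ) = φ := by
  ext1 x; simp [act]

theorem inner_act (Q : E3 ≃ₗᵢ[ℝ] E3) (φ ψ : E3 → E3) (x : E3) :
    inner ℝ (act Q φ x) (act Q ψ x) = inner ℝ (φ (Q.symm x)) (ψ (Q.symm x)) := by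
  simp [act]

theorem IsSolenoidalTest.act {σ : ℝ} {φ : E3 → E3} (h : IsSolenoidalTest (shell σ) φ)
    (Q : E3 ≃ₗᵢ[ℝ] E3) : IsSolenoidalTest (shell σ) (act Q φ) := by
  have hts : tsupport (_root_.act Q φ) ⊆ Q.symm ⁻¹' tsupport φ := by
    refine closure_minimal (fun x hx => ?_) ((isClosed_tsupport φ).preimage Q.symm.continuous)
    refine subset_tsupport _ fun h0 => hx ?_
    simp [_root_.act, h0]
  refine ⟨⟨?_, ?_, fun x hx => ?_⟩, fun x => ?_⟩
  · exact Q.contDiff.comp (h.1.1.comp Q.symm.contDiff)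
  · exact (Q.symm.toHomeomorph.isCompact_preimage.2 h.1.2.1.isCompact).of_isClosed_subset
      (isClosed_tsupport _) hts
  · exact (mem_shell_comp_isometry Q.symm).1 (h.1.2.2 (hts hx))
  · rw [divergence_eq_trace, fderiv_act Q h.1.differentiable]
    have := h.2 (Q.symm x)
    rw [divergence_eq_trace] at this
    rw [← this]
    exact LinearMap.trace_conj' _ Q.toLinearEquiv

theorem jacobian_add {φ ψ : E3 → E3} (hφ : Differentiable ℝ φ) (hψ : Differentiable ℝ ψ) (x : E3) :
    jacobian (fun x => φ x + ψ x) x = jacobian φ x + jacobian ψ x := by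
  rw [jacobian_eq, jacobian_eq, jacobian_eq, ← map_add]
  congr 1
  exact fderiv_add (hφ x) (hψ x)

theorem jacobian_smul {φ : E3 → E3} (hφ : Differentiable ℝ φ) (c : ℝ) (x : E3) :
    jacobian (fun x => c • φ x) x = c • jacobian φ x := by
  rw [jacobian_eq, jacobian_eq, ← map_smul]
  congr 1
  exact fderiv_const_smul (hφ x) c

theorem jacobian_sub {φ ψ : E3 → E3} (hφ : Differentiable ℝ φ) (hψ : Differentiable ℝ ψ) (x : E3) :
    jacobian (fun x => φ x - ψ x) x = jacobian φ x - jacobian ψ x := by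
  rw [jacobian_eq, jacobian_eq, jacobian_eq, ← map_sub]
  congr 1
  exact fderiv_sub (hφ x) (hψ x)

theorem jacobian_apply {φ : E3 → E3} {x : E3} (hφ : DifferentiableAt ℝ φ x) (j k : Fin 3) :
    jacobian φ x (j, k) = pd k (fun y => φ y j) x := by
  have h : HasFDerivAt (fun y => φ y j) ((EuclideanSpace.proj j : E3 →L[ℝ] ℝ) ∘L fderiv ℝ φ x) x :=
    (EuclideanSpace.proj j : E3 →L[ℝ] ℝ).hasFDerivAt.comp x hφ.hasFDerivAt
  rw [pd, h.fderiv]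
  rfl

theorem inner_jacobian {φ ψ : E3 → E3} (hφ : Differentiable ℝ φ) (hψ : Differentiable ℝ ψ)
    (x : E3) : inner ℝ (jacobian φ x) (jacobian ψ x) =
      ∑ j, ∑ k, pd k (fun y => φ y j) x * pd k (fun y => ψ y j) x := by
  rw [PiLp.inner_apply, Fintype.sum_prod_type]
  refine Finset.sum_congr rfl fun j _ => Finset.sum_congr rfl fun k _ => ?_
  rw [jacobian_apply (hφ x), jacobian_apply (hψ x)]
  simp [mul_comm]

section
variable {Ω : Set E3} {φ ψ : E3 → E3}

theorem IsSolenoidalTest.add (hφ : IsSolenoidalTest Ω φ) (hψ : IsSolenoidalTest Ω ψ) :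
    IsSolenoidalTest Ω fun x => φ x + ψ x :=
  ⟨hφ.1.add hψ.1, fun x => by
    simp [jacobian_add hφ.1.differentiable hψ.1.differentiable, Finset.sum_add_distrib, hφ.2, hψ.2]⟩

theorem IsSolenoidalTest.const_smul (hφ : IsSolenoidalTest Ω φ) (c : ℝ) :
    IsSolenoidalTest Ω fun x => c • φ x :=
  ⟨hφ.1.const_smul c, fun x => by
    simp [jacobian_smul hφ.1.differentiable, ← Finset.mul_sum, hφ.2]⟩

theorem IsTestFunction.jacobian (hφ : IsTestFunction Ω φ) : IsTestFunction Ω (jacobian φ) := by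
  have hf : IsTestFunction Ω (fderiv ℝ φ) := ⟨hφ.1.fderiv_right (m := ∞) (by simp),
    hφ.2.1.fderiv ℝ, (tsupport_fderiv_subset ℝ).trans hφ.2.2⟩
  exact hf.clm_comp (LinearMap.toContinuousLinearMap frobeniusMatrix)

/-- The Dirichlet form of two vector fields. -/
def dirichlet (φ ψ : E3 → E3) : ℝ := ∫ x, inner ℝ (jacobian φ x) (jacobian ψ x)

theorem dirichlet_self (φ : E3 → E3) : dirichlet φ φ = ∫ x, ‖jacobian φ x‖ ^ 2 := by
  simp [dirichlet]

theorem inner_jacobian_act (Q : E3 ≃ₗᵢ[ℝ] E3) (hφ : Differentiable ℝ φ) (hψ : Differentiable ℝ ψ)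
    (x : E3) : inner ℝ (jacobian (act Q φ) x) (jacobian (act Q ψ) x) =
      inner ℝ (jacobian φ (Q.symm x)) (jacobian ψ (Q.symm x)) := by
  rw [jacobian_eq, jacobian_eq, fderiv_act Q hφ, fderiv_act Q hψ, inner_frobeniusMatrix_conj]
  rfl

theorem dirichlet_act (Q : E3 ≃ₗᵢ[ℝ] E3) (hφ : Differentiable ℝ φ) (hψ : Differentiable ℝ ψ) :
    dirichlet (act Q φ) (act Q ψ) = dirichlet φ ψ := by
  simp_rw [dirichlet, inner_jacobian_act Q hφ hψ]
  exact integral_comp_isometry Q.symm fun x => inner ℝ (jacobian φ x) (jacobian ψ x)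

theorem integral_inner_act (Q : E3 ≃ₗᵢ[ℝ] E3) (φ ψ : E3 → E3) :
    ∫ x, inner ℝ (act Q φ x) (act Q ψ x) = ∫ x, inner ℝ (φ x) (ψ x) := by
  simp_rw [inner_act]
  exact integral_comp_isometry Q.symm fun x => inner ℝ (φ x) (ψ x)

end

/-! ### Bounds and pairings along convergent sequences. -/

section
variable {F : Type*} [NormedAddCommGroup F] [InnerProductSpace ℝ F]

theorem L2Lim.exists_bound {φ : ℕ → E3 → F} {f : E3 → F} (h : L2Lim φ f) :
    ∃ C, ∀ j, ∫ x, ‖φ j x‖ ^ 2 ≤ C := by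
  obtain ⟨C, hC⟩ := h.normSq.bddAbove_range
  exact ⟨C, fun j => hC ⟨j, rfl⟩⟩

theorem L2Lim.tendsto_inner_sub {φ ψ : ℕ → E3 → F} {f : E3 → F} (h : L2Lim φ f)
    (hψ : ∀ j, MemLp (ψ j) 2 volume) {C : ℝ} (hC : ∀ j, ∫ x, ‖ψ j x‖ ^ 2 ≤ C) :
    Tendsto (fun j => ∫ x, Inner.inner ℝ (φ j x - f x) (ψ j x)) atTop (𝓝 0) := by
  have hC' := ((l2Lim_iff h.memLp_seq h.memLp).1 h).mul_const C
  rw [zero_mul] at hC'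
  have hsq := squeeze_zero (fun j => sq_nonneg _) (fun j =>
    (integral_inner_sq_le ((h.memLp_seq j).sub h.memLp) (hψ j)).trans
      (mul_le_mul_of_nonneg_left (hC j) (integral_nonneg fun x => by positivity))) hC'
  have := hsq.sqrt
  simp only [Real.sqrt_sq_eq_abs, Real.sqrt_zero] at this
  exact (tendsto_zero_iff_abs_tendsto_zero _).2 this

theorem l2Lim_of_eLpNorm {φ : ℕ → E3 → F} {f : E3 → F} (h : ∀ j, MemLp (φ j) 2 volume)
    (hf : MemLp f 2 volume)
    (hlim : Tendsto (fun j => eLpNorm (fun x => f x - φ j x) 2 volume) atTop (𝓝 0)) :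
    L2Lim φ f := by
  refine ⟨h, hf, ?_⟩
  rw [Lp.tendsto_Lp_iff_tendsto_eLpNorm'']
  refine hlim.congr fun j => ?_
  exact eLpNorm_sub_comm f (φ j) 2 volume

theorem L2Lim.tendsto_eLpNorm {φ : ℕ → E3 → F} {f : E3 → F} (h : L2Lim φ f) :
    Tendsto (fun j => eLpNorm (fun x => f x - φ j x) 2 volume) atTop (𝓝 0) := by
  obtain ⟨a, b, c⟩ := h
  rw [Lp.tendsto_Lp_iff_tendsto_eLpNorm''] at c
  refine c.congr fun j => ?_
  exact eLpNorm_sub_comm (φ j) f 2 volume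

end

/-- Solenoidal test fields, convergent to `u` in `W^1_2`, that are asymptotically stationary for
`∫ |∇u|² - μ ∫ |u|²`. -/
structure CritSeq (σ μ : ℝ) (φ : ℕ → E3 → E3) (u : E3 → E3) : Prop where
  test : ∀ j, IsSolenoidalTest (shell σ) (φ j)
  lim : L2Lim φ u
  jac : ∃ G, L2Lim (fun j => jacobian (φ j)) G
  -- Testing with bounded sequences rather than single fields allows `φ` to be tested with itself,
  -- and is stable under isometries.
  crit : ∀ ψ : ℕ → E3 → E3, (∀ j, IsSolenoidalTest (shell σ) (ψ j)) →
    (∃ C, ∀ j, ∫ x, ‖ψ j x‖ ^ 2 ≤ C) → (∃ C, ∀ j, dirichlet (ψ j) (ψ j) ≤ C) →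
    Tendsto (fun j => dirichlet (φ j) (ψ j) - μ * ∫ x, inner ℝ (φ j x) (ψ j x)) atTop (𝓝 0)

section
variable {σ μ : ℝ} {φ ψ : ℕ → E3 → E3} {u v : E3 → E3}

theorem dirichlet_add_left {Ω : Set E3} {φ₁ φ₂ ψ : E3 → E3} (h₁ : IsTestFunction Ω φ₁)
    (h₂ : IsTestFunction Ω φ₂) (h : IsTestFunction Ω ψ) :
    dirichlet (fun x => φ₁ x + φ₂ x) ψ = dirichlet φ₁ ψ + dirichlet φ₂ ψ := by
  simp_rw [dirichlet, jacobian_add h₁.differentiable h₂.differentiable, inner_add_left]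
  exact integral_add (integrable_inner_of_memLp h₁.jacobian.memLp h.jacobian.memLp)
    (integrable_inner_of_memLp h₂.jacobian.memLp h.jacobian.memLp)

theorem dirichlet_smul_left {Ω : Set E3} {φ₁ ψ : E3 → E3} (h₁ : IsTestFunction Ω φ₁) (c : ℝ) :
    dirichlet (fun x => c • φ₁ x) ψ = c * dirichlet φ₁ ψ := by
  simp_rw [dirichlet, jacobian_smul h₁.differentiable, real_inner_smul_left]
  exact integral_const_mul _ _

theorem CritSeq.add (h : CritSeq σ μ φ u) (h' : CritSeq σ μ ψ v) :
    CritSeq σ μ (fun j x => φ j x + ψ j x) (fun x => u x + v x) where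
  test j := (h.test j).add (h'.test j)
  lim := h.lim.add h'.lim
  jac := by
    obtain ⟨G, hG⟩ := h.jac
    obtain ⟨G', hG'⟩ := h'.jac
    refine ⟨fun x => G x + G' x, ?_⟩
    convert hG.add hG' using 3 with j x
    exact jacobian_add (h.test j).1.differentiable (h'.test j).1.differentiable x
  crit θ ht h1 h2 := by
    have := (h.crit θ ht h1 h2).add (h'.crit θ ht h1 h2)
    rw [add_zero] at this
    refine this.congr fun j => ?_
    simp_rw [inner_add_left]
    rw [dirichlet_add_left (h.test j).1 (h'.test j).1 (ht j).1, integral_add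
      (integrable_inner_of_memLp (h.test j).1.memLp (ht j).1.memLp)
      (integrable_inner_of_memLp (h'.test j).1.memLp (ht j).1.memLp)]
    ring

theorem CritSeq.const_smul (h : CritSeq σ μ φ u) (c : ℝ) :
    CritSeq σ μ (fun j x => c • φ j x) (fun x => c • u x) where
  test j := (h.test j).const_smul c
  lim := h.lim.const_smul c
  jac := by
    obtain ⟨G, hG⟩ := h.jac
    refine ⟨fun x => c • G x, ?_⟩
    convert hG.const_smul c using 3 with j x
    exact jacobian_smul (h.test j).1.differentiable c x
  crit θ ht h1 h2 := by
    have := (h.crit θ ht h1 h2).const_mul c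
    rw [mul_zero] at this
    refine this.congr fun j => ?_
    simp_rw [real_inner_smul_left]
    rw [dirichlet_smul_left (h.test j).1, integral_const_mul]
    ring

theorem L2Lim.act (h : L2Lim φ u) (Q : E3 ≃ₗᵢ[ℝ] E3) :
    L2Lim (fun j => act Q (φ j)) (act Q u) :=
  (h.comp_isometry Q.symm).clm_comp (Q : E3 →L[ℝ] E3)

/-- The Dirichlet form is invariant, so transformed Jacobians form a Cauchy sequence; stationarity
is transported by applying the inverse isometry to the test sequence. -/
theorem CritSeq.act (h : CritSeq σ μ φ u) (Q : E3 ≃ₗᵢ[ℝ] E3) :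
    CritSeq σ μ (fun j => act Q (φ j)) (act Q u) where
  test j := (h.test j).act Q
  lim := h.lim.act Q
  jac := by
    obtain ⟨G, hG⟩ := h.jac
    refine hG.exists_of_le (fun j => ((h.test j).act Q).1.jacobian.memLp) fun m n => ?_
    have hs := (h.test m).1.sub (h.test n).1
    have e := dirichlet_act Q hs.differentiable hs.differentiable
    rw [dirichlet_self, dirichlet_self, act_sub] at e
    simp_rw [jacobian_sub (h.test m).1.differentiable (h.test n).1.differentiable,
      jacobian_sub ((h.test m).act Q).1.differentiable ((h.test n).act Q).1.differentiable] at e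
    exact e.le
  crit θ ht h1 h2 := by
    have := h.crit (fun j => _root_.act Q.symm (θ j)) (fun j => (ht j).act _) (by
      obtain ⟨C, hC⟩ := h1
      refine ⟨C, fun j => ?_⟩
      simp_rw [← real_inner_self_eq_norm_sq] at hC ⊢
      rw [integral_inner_act]
      exact hC j) (by
      obtain ⟨C, hC⟩ := h2
      refine ⟨C, fun j => ?_⟩
      rw [dirichlet_act _ (ht j).1.differentiable (ht j).1.differentiable]
      exact hC j)
    refine this.congr fun j => ?_
    rw [← dirichlet_act Q (h.test j).1.differentiable ((ht j).act _).1.differentiable,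
      ← integral_inner_act Q, act_act_symm]

/-- The sequence is tested with itself. -/
theorem CritSeq.tendsto_dirichlet (h : CritSeq σ μ φ u) :
    Tendsto (fun j => dirichlet (φ j) (φ j)) atTop (𝓝 (μ * ∫ x, ‖u x‖ ^ 2)) := by
  obtain ⟨G, hG⟩ := h.jac
  have h1 := h.crit φ h.test h.lim.exists_bound (by
    simp_rw [dirichlet_self]; exact hG.exists_bound)
  have h2 := h1.add (h.lim.normSq.const_mul μ)
  rw [zero_add] at h2
  refine h2.congr fun j => ?_
  simp

theorem dirichlet_sub_eq_sum {Ω : Set E3} {φ : E3 → E3} (h : IsTestFunction Ω φ) (lam : ℝ) :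
    dirichlet φ φ - lam * ∫ x, ‖φ x‖ ^ 2 =
      ∑ i, ∫ x, (∑ k, pd k (fun y => φ y i) x ^ 2 - lam * φ x i ^ 2) := by
  have hi : ∀ i, Integrable fun x => φ x i ^ 2 := fun i => by
    simpa [sq] using (h.component i).integrable_mul (h.component i).1.continuous
  have hp : ∀ i k, Integrable fun x => pd k (fun y => φ y i) x ^ 2 := fun i k => by
    simpa [sq] using ((h.component i).pd k).integrable_mul ((h.component i).pd k).1.continuous
  have hp' : ∀ i, Integrable fun x => ∑ k, pd k (fun y => φ y i) x ^ 2 := fun i =>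
    integrable_finsetSum _ fun k _ => hp i k
  have hs : ∀ i ∈ Finset.univ, Integrable fun x =>
      ∑ k, pd k (fun y => φ y i) x ^ 2 - lam * φ x i ^ 2 := fun i _ =>
    (hp' i).sub ((hi i).const_mul lam)
  rw [dirichlet, ← integral_const_mul, ← integral_finsetSum _ hs]
  simp_rw [inner_jacobian h.differentiable h.differentiable]
  rw [← integral_sub]
  · refine integral_congr_ae (Eventually.of_forall fun x => ?_)
    simp only [EuclideanSpace.norm_sq_eq, Real.norm_eq_abs, sq_abs, Finset.sum_sub_distrib,
      Finset.mul_sum, ← sq]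
  · simpa [← sq] using integrable_finsetSum _ fun i _ => hp' i
  · simpa [EuclideanSpace.norm_sq_eq] using
      (integrable_finsetSum Finset.univ fun i _ => hi i).const_mul lam

theorem energy_nonneg (h0 : 0 ≤ σ) (h1 : σ < 1) {n : E3} (hn : ‖n‖ = 1) {f : E3 → ℝ}
    (hf : IsTestFunction (shell σ) f) (hodd : ∀ x, f (planeReflection n x) = - f x) :
    0 ≤ ∫ x, (∑ k, pd k f x ^ 2 - firstRoot σ ^ 2 * f x ^ 2) := by
  have hz : ∀ x, inner ℝ n x = 0 → f x = 0 := fun x hx => by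
    have := hodd x
    rw [planeReflection_apply hn, hx] at this
    simp at this
    linarith
  rw [(picone_identity h0 h1 hn hf hz).2]
  exact integral_nonneg fun x => by positivity

/-- Stationary sequences with odd components. -/
theorem CritSeq.ae_eq_of_odd (h0 : 0 ≤ σ) (h1 : σ < 1) (hμ : μ ≤ firstRoot σ ^ 2)
    (h : CritSeq σ μ φ u) {n : Fin 3 → E3} (hn : ∀ i, ‖n i‖ = 1)
    (hodd : ∀ i j x, φ j (planeReflection (n i) x) i = - φ j x i) :
    (∃ c : Fin 3 → ℝ, ∀ i, (fun x => u x i) =ᵐ[volume]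
      (shell σ).indicator fun x => c i * halfProfile σ (n i) x) ∧
    (μ < firstRoot σ ^ 2 → u =ᵐ[volume] 0) := by
  set E : Fin 3 → ℕ → ℝ := fun i j =>
    ∫ x, (∑ k, pd k (fun y => φ j y i) x ^ 2 - firstRoot σ ^ 2 * φ j x i ^ 2) with hE
  have hE0 : ∀ i j, 0 ≤ E i j := fun i j =>
    energy_nonneg h0 h1 (hn i) ((h.test j).1.component i) (hodd i j)
  -- The limit is nonpositive because `μ ≤ κ²`, while every summand is nonnegative; hence each
  -- component energy tends to zero, and `u = 0` if `μ < κ²`.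
  have hsum : Tendsto (fun j => ∑ i, E i j) atTop
      (𝓝 ((μ - firstRoot σ ^ 2) * ∫ x, ‖u x‖ ^ 2)) := by
    have := h.tendsto_dirichlet.sub (h.lim.normSq.const_mul (firstRoot σ ^ 2))
    rw [sub_mul]
    refine this.congr fun j => ?_
    rw [dirichlet_sub_eq_sum (h.test j).1]
  have hu0 : 0 ≤ ∫ x, ‖u x‖ ^ 2 := integral_nonneg fun x => by positivity
  have hge := ge_of_tendsto' hsum fun j => Finset.sum_nonneg fun i _ => hE0 i j
  have hle : (μ - firstRoot σ ^ 2) * ∫ x, ‖u x‖ ^ 2 ≤ 0 :=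
    mul_nonpos_of_nonpos_of_nonneg (by linarith) hu0
  have heq := le_antisymm hle hge
  rw [heq] at hsum
  have hEi : ∀ i, Tendsto (E i) atTop (𝓝 0) := fun i =>
    squeeze_zero (hE0 i) (fun j => Finset.single_le_sum (f := fun i => E i j)
      (fun i _ => hE0 i j) (Finset.mem_univ i)) hsum
  refine ⟨?_, fun hlt => ?_⟩
  · choose c hc using fun i => ae_eq_halfProfile_of_energy_tendsto h0 h1 (hn i)
      (fun j => (h.test j).1.component i) (hodd i)
      (h.lim.clm_comp (EuclideanSpace.proj i : E3 →L[ℝ] ℝ)) (hEi i)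
    exact ⟨c, hc⟩
  · rcases mul_eq_zero.1 heq with h2 | h2
    · exact absurd h2 (by linarith)
    · exact integral_normSq_eq_zero h.lim.memLp h2

end

end

noncomputable section

/-! ### Eigenfields and stationary sequences -/

section
variable {σ μ : ℝ} {φ : ℕ → E3 → E3} {u v : E3 → E3}

theorem IsSolenoidalTest.memV {Ω : Set E3} {ψ : E3 → E3} (h : IsSolenoidalTest Ω ψ) :
    MemV Ω ψ (jacobian ψ) := by
  refine ⟨⟨h.1.memLp.restrict _, h.1.jacobian.memLp.restrict _, fun η hη j k => ?_⟩,
    fun ε hε => ⟨ψ, h, by simpa using hε, by simpa using hε⟩⟩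
  rw [setIntegral_eq_integral_of_forall_compl_eq_zero fun x hx => by simp [h.1.eq_zero hx],
    setIntegral_eq_integral_of_forall_compl_eq_zero fun x hx => by simp [hη.eq_zero hx]]
  have := (h.1.component j).integral_mul_pd (hη.1.of_le (by simp)) k
  simp_rw [jacobian_apply (h.1.differentiable _)]
  exact this

theorem measurableSet_shell (σ : ℝ) : MeasurableSet (shell σ) := (isOpen_shell σ).measurableSet

theorem memLp_indicator_shell {F : Type*} [NormedAddCommGroup F] {f : E3 → F}
    (h : MemLp f 2 (volume.restrict (shell σ))) : MemLp ((shell σ).indicator f) 2 volume :=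
  (memLp_indicator_iff_restrict (measurableSet_shell σ)).2 h

theorem tendsto_eLpNorm_indicator {F : Type*} [NormedAddCommGroup F] {f : E3 → F}
    {φ : ℕ → E3 → F} (hφ : ∀ j, ∀ x ∉ shell σ, φ j x = 0) {ε : ℕ → ℝ≥0∞}
    (hε : Tendsto ε atTop (𝓝 0))
    (h : ∀ j, eLpNorm (fun x => f x - φ j x) 2 (volume.restrict (shell σ)) < ε j) :
    Tendsto (fun j => eLpNorm (fun x => (shell σ).indicator f x - φ j x) 2 volume) atTop (𝓝 0) := by
  refine tendsto_of_tendsto_of_tendsto_of_le_of_le tendsto_const_nhds hε (fun _ => zero_le)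
    fun j => ?_
  refine le_of_eq_of_le ?_ (h j).le
  rw [← eLpNorm_indicator_eq_eLpNorm_restrict (measurableSet_shell σ)]
  congr 1
  ext1 x
  by_cases hx : x ∈ shell σ
  · simp [hx]
  · simp [hx, hφ j x hx]

theorem tendsto_natCast_add_one_inv : Tendsto (fun j : ℕ => ((j : ℝ≥0∞) + 1)⁻¹) atTop (𝓝 0) := by
  have := (tendsto_add_atTop_iff_nat 1).2 ENNReal.tendsto_inv_nat_nhds_zero
  simpa using this

/-- Elements of `V` are limits of solenoidal test fields. -/
theorem MemV.exists_l2Lim {G : E3 → Mat3} (h : MemV (shell σ) u G) :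
    ∃ φ : ℕ → E3 → E3, (∀ j, IsSolenoidalTest (shell σ) (φ j)) ∧
      L2Lim φ ((shell σ).indicator u) ∧
      L2Lim (fun j => jacobian (φ j)) ((shell σ).indicator G) := by
  choose φ h1 h2 h3 using fun j : ℕ => h.2 ((j : ℝ≥0∞) + 1)⁻¹ (by simp)
  refine ⟨φ, h1, ?_, ?_⟩
  · exact l2Lim_of_eLpNorm (fun j => (h1 j).1.memLp) (memLp_indicator_shell h.1.1)
      (tendsto_eLpNorm_indicator (fun j x hx => (h1 j).1.eq_zero hx) tendsto_natCast_add_one_inv h2)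
  · exact l2Lim_of_eLpNorm (fun j => (h1 j).1.jacobian.memLp) (memLp_indicator_shell h.1.2.1)
      (tendsto_eLpNorm_indicator (fun j x hx => (h1 j).1.jacobian.eq_zero hx)
        tendsto_natCast_add_one_inv h3)

/-- The eigenvalue equation holds exactly for each `ψ j`; replacing the eigenfield by its
approximation costs a pairing of a null sequence with a bounded one. -/
theorem exists_critSeq (h : InStokesEigenspace (shell σ) μ u) :
    ∃ φ, CritSeq σ μ φ ((shell σ).indicator u) := by
  obtain ⟨-, G, hV, hG⟩ := h
  obtain ⟨φ, h1, h2, h3⟩ := hV.exists_l2Lim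
  refine ⟨φ, h1, h2, ⟨_, h3⟩, fun ψ ht ⟨C, hC⟩ ⟨C', hC'⟩ => ?_⟩
  simp_rw [dirichlet_self] at hC'
  have a1 := h3.tendsto_inner_sub (fun j => (ht j).1.jacobian.memLp) hC'
  have a2 := (h2.tendsto_inner_sub (fun j => (ht j).1.memLp) hC).const_mul μ
  have a3 := a1.sub a2
  rw [mul_zero, sub_zero] at a3
  refine a3.congr fun j => ?_
  have e := hG (ψ j) (jacobian (ψ j)) (ht j).memV
  rw [← integral_indicator (measurableSet_shell σ), ← integral_indicator (measurableSet_shell σ)] at e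
  have e1 : ∀ x, (shell σ).indicator (fun x => (inner ℝ (G x) (jacobian (ψ j) x) : ℝ)) x =
      inner ℝ ((shell σ).indicator G x) (jacobian (ψ j) x) := fun x => by
    by_cases hx : x ∈ shell σ <;> simp [hx]
  have e2 : ∀ x, (shell σ).indicator (fun x => (inner ℝ (μ • u x) (ψ j x) : ℝ)) x =
      μ * inner ℝ ((shell σ).indicator u x) (ψ j x) := fun x => by
    by_cases hx : x ∈ shell σ <;> simp [hx, real_inner_smul_left]
  simp_rw [e1, e2, integral_const_mul] at e
  simp_rw [inner_sub_left]
  rw [integral_sub (integrable_inner_of_memLp (h1 j).1.jacobian.memLp (ht j).1.jacobian.memLp)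
    (integrable_inner_of_memLp h3.memLp (ht j).1.jacobian.memLp),
    integral_sub (integrable_inner_of_memLp (h1 j).1.memLp (ht j).1.memLp)
    (integrable_inner_of_memLp h2.memLp (ht j).1.memLp), e, dirichlet]
  ring

/-! ### Parity classes -/

/-- The reflection that changes the sign of the `i`-th coordinate. -/
abbrev coordReflection (i : Fin 3) : E3 ≃ₗᵢ[ℝ] E3 :=
  planeReflection (EuclideanSpace.single i (1 : ℝ))

theorem norm_single_one (i : Fin 3) : ‖(EuclideanSpace.single i (1 : ℝ) : E3)‖ = 1 := by simp

theorem coordReflection_apply (i j : Fin 3) (x : E3) :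
    coordReflection i x j = if j = i then - x j else x j := by
  rw [coordReflection, planeReflection_apply (norm_single_one i)]
  by_cases h : j = i
  · subst h
    simp [EuclideanSpace.inner_single_left]
    ring
  · simp [h]

theorem act_planeReflection (n : E3) (φ : E3 → E3) (x : E3) :
    act (planeReflection n) φ x = planeReflection n (φ (planeReflection n x)) := by
  rw [act, planeReflection, Submodule.reflection_symm]

theorem act_planeReflection_self (n : E3) (φ : E3 → E3) :
    act (planeReflection n) (act (planeReflection n) φ) = φ := by
  ext1 x
  simp [act_planeReflection]

theorem act_comm {Q R : E3 ≃ₗᵢ[ℝ] E3} (h : ∀ x, Q (R x) = R (Q x)) (φ : E3 → E3) :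
    act Q (act R φ) = act R (act Q φ) := by
  have h' : ∀ x, R.symm (Q.symm x) = Q.symm (R.symm x) := fun x => by
    apply Q.injective
    apply R.injective
    rw [← h]
    simp
  ext1 x
  simp [act, h, h']

theorem coordReflection_comm (i j : Fin 3) (x : E3) :
    coordReflection i (coordReflection j x) = coordReflection j (coordReflection i x) := by
  ext k
  simp only [coordReflection_apply]
  split_ifs <;> rfl

/-- The even or odd part of a field. -/
def parityPart (Q : E3 ≃ₗᵢ[ℝ] E3) (ε : ℝ) (φ : E3 → E3) (x : E3) : E3 :=
  (1 / 2 : ℝ) • (φ x + ε • act Q φ x)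

theorem CritSeq.parityPart (h : CritSeq σ μ φ u) (Q : E3 ≃ₗᵢ[ℝ] E3) (ε : ℝ) :
    CritSeq σ μ (fun j => parityPart Q ε (φ j)) (parityPart Q ε u) :=
  (h.add ((h.act Q).const_smul ε)).const_smul (1 / 2)

theorem parityPart_add (Q : E3 ≃ₗᵢ[ℝ] E3) (φ : E3 → E3) (x : E3) :
    parityPart Q 1 φ x + parityPart Q (-1) φ x = φ x := by
  simp only [parityPart]
  module

theorem act_parityPart (n : E3) {ε : ℝ} (hε : ε * ε = 1) (φ : E3 → E3) :
    act (planeReflection n) (parityPart (planeReflection n) ε φ) =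
      fun x => ε • parityPart (planeReflection n) ε φ x := by
  unfold parityPart
  rw [act_smul, act_add, act_smul, act_planeReflection_self]
  ext1 x
  simp only [smul_smul, smul_add, mul_left_comm ε, hε, mul_one]
  module

/-- Commuting symmetries can be split off one after another without spoiling parities already
achieved. -/
theorem act_parityPart_of_comm {Q R : E3 ≃ₗᵢ[ℝ] E3} (h : ∀ x, Q (R x) = R (Q x)) {ε δ : ℝ}
    {φ : E3 → E3} (hφ : act R φ = fun x => δ • φ x) :
    act R (parityPart Q ε φ) = fun x => δ • parityPart Q ε φ x := by
  unfold parityPart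
  rw [act_smul, act_add, act_smul, ← act_comm h, hφ, act_smul]
  ext1 x
  module

/-- Fields of the form `W(|x|) C x` with a matrix `C`, and zero if `μ` is below the first
eigenvalue. -/
def IsRadialLinear (σ μ : ℝ) (u : E3 → E3) : Prop :=
  (∃ C : Fin 3 → Fin 3 → ℝ, ∀ i, (fun x => u x i) =ᵐ[volume]
    (shell σ).indicator fun x => profile σ ‖x‖ * ∑ k, C i k * x k) ∧
  (μ < firstRoot σ ^ 2 → u =ᵐ[volume] 0)

theorem IsRadialLinear.add (hu : IsRadialLinear σ μ u) (hv : IsRadialLinear σ μ v) :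
    IsRadialLinear σ μ fun x => u x + v x := by
  obtain ⟨⟨C, hC⟩, h1⟩ := hu
  obtain ⟨⟨D, hD⟩, h2⟩ := hv
  refine ⟨⟨fun i k => C i k + D i k, fun i => ?_⟩, fun h => ?_⟩
  · filter_upwards [hC i, hD i] with x a b
    simp only [PiLp.add_apply, a, b]
    by_cases hx : x ∈ shell σ
    · simp [hx, add_mul, Finset.sum_add_distrib, mul_add]
    · simp [hx]
  · filter_upwards [h1 h, h2 h] with x a b
    simp [a, b]

theorem isRadialLinear_of_parityPart {n : E3}
    (h1 : IsRadialLinear σ μ (parityPart (planeReflection n) 1 u))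
    (h2 : IsRadialLinear σ μ (parityPart (planeReflection n) (-1) u)) : IsRadialLinear σ μ u := by
  have := h1.add h2
  simpa only [parityPart_add] using this

theorem isRadialLinear_of_zero (h : u =ᵐ[volume] 0) : IsRadialLinear σ μ u := by
  refine ⟨⟨0, fun i => ?_⟩, fun _ => h⟩
  filter_upwards [h] with x hx
  simp [hx]

/-- The fields with parity `ε i` under the reflection of the `i`-th coordinate. -/
def HasParity (ε : Fin 3 → ℝ) (φ : ℕ → E3 → E3) : Prop :=
  ∀ i j, act (coordReflection i) (φ j) = fun x => ε i • φ j x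

/-- The three coordinate reflections commute. Taking parts of either sign for each of them writes
the field as a sum of eight limits of definite parity, and the target property is additive. -/
theorem isRadialLinear_of_parity_classes
    (H : ∀ ε : Fin 3 → ℝ, (∀ i, ε i = 1 ∨ ε i = -1) → ∀ φ u, CritSeq σ μ φ u →
      HasParity ε φ → IsRadialLinear σ μ u) (h : CritSeq σ μ φ u) : IsRadialLinear σ μ u := by
  have hsq : ∀ {e : ℝ}, e = 1 ∨ e = -1 → e * e = 1 := by rintro e (rfl | rfl) <;> norm_num
  have key : ∀ e₀ e₁ e₂ : ℝ, (e₀ = 1 ∨ e₀ = -1) → (e₁ = 1 ∨ e₁ = -1) → (e₂ = 1 ∨ e₂ = -1) →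
      IsRadialLinear σ μ (parityPart (coordReflection 2) e₂
        (parityPart (coordReflection 1) e₁ (parityPart (coordReflection 0) e₀ u))) := by
    intro e₀ e₁ e₂ h0 h1 h2
    refine H ![e₀, e₁, e₂] (by intro i; fin_cases i; exacts [h0, h1, h2]) _ _
      (((h.parityPart (coordReflection 0) e₀).parityPart (coordReflection 1) e₁).parityPart
        (coordReflection 2) e₂) fun i j => ?_
    fin_cases i
    · exact act_parityPart_of_comm (coordReflection_comm 2 0)
        (act_parityPart_of_comm (coordReflection_comm 1 0) (act_parityPart _ (hsq h0) _))
    · exact act_parityPart_of_comm (coordReflection_comm 2 1) (act_parityPart _ (hsq h1) _)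
    · have := act_parityPart (EuclideanSpace.single 2 1) (hsq h2)
        (parityPart (coordReflection 1) e₁ (parityPart (coordReflection 0) e₀ (φ j)))
      exact this
  have p := Or.inl (b := (1 : ℝ) = -1) (rfl : (1 : ℝ) = 1)
  have m := Or.inr (a := (-1 : ℝ) = 1) (rfl : (-1 : ℝ) = -1)
  have k2 := fun e₀ e₁ h0 h1 =>
    isRadialLinear_of_parityPart (key e₀ e₁ 1 h0 h1 p) (key e₀ e₁ (-1) h0 h1 m)
  have k1 := fun e₀ h0 => isRadialLinear_of_parityPart (k2 e₀ 1 h0 p) (k2 e₀ (-1) h0 m)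
  exact isRadialLinear_of_parityPart (k1 1 p) (k1 (-1) m)

/-- The reflection also acts on values: in its own direction the component changes sign once more,
hence the extra minus. -/
theorem HasParity.component {ε : Fin 3 → ℝ} (h : HasParity ε φ) (i m j : Fin 3) (n : ℕ) (x : E3)
    (hij : m = i) : φ n (coordReflection m x) j = (if j = i then - ε i else ε i) * φ n x j := by
  subst hij
  have := congrFun (h m n) x
  rw [act_planeReflection] at this
  have h2 := congrArg (fun v : E3 => v j) this
  simp only [coordReflection_apply, PiLp.smul_apply, smul_eq_mul] at h2
  split_ifs at h2 ⊢ <;> linarith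

/-- `m` selects for each component a coordinate in which that component is odd; each then becomes a
multiple of `W(|x|)` times that coordinate. -/
theorem isRadialLinear_of_choice (h0 : 0 ≤ σ) (h1 : σ < 1) (hμ : μ ≤ firstRoot σ ^ 2)
    (h : CritSeq σ μ φ u) {ε : Fin 3 → ℝ} (hp : HasParity ε φ) (m : Fin 3 → Fin 3)
    (hm : ∀ j, (if j = m j then - ε (m j) else ε (m j)) = -1) : IsRadialLinear σ μ u := by
  obtain ⟨⟨c, hc⟩, hz⟩ := h.ae_eq_of_odd h0 h1 hμ (n := fun i => EuclideanSpace.single (m i) 1)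
    (fun i => norm_single_one _) fun i j x => by
      have := hp.component (m i) (m i) i j x rfl
      rw [hm] at this
      simpa using this
  refine ⟨⟨fun i k => if k = m i then c i else 0, fun i => ?_⟩, hz⟩
  filter_upwards [hc i] with x hx
  rw [hx]
  congr 1
  ext1 y
  simp [halfProfile, EuclideanSpace.inner_single_left]
  ring

/-- The permutation of two coordinates. -/
def coordSwap (i j : Fin 3) : E3 ≃ₗᵢ[ℝ] E3 :=
  LinearIsometryEquiv.piLpCongrLeft 2 ℝ ℝ (Equiv.swap i j)

theorem coordSwap_apply (i j k : Fin 3) (x : E3) : coordSwap i j x k = x (Equiv.swap i j k) := by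
  simp [coordSwap, LinearIsometryEquiv.piLpCongrLeft_apply, Equiv.piCongrLeft']

theorem ae_eq_zero_of_act {Q : E3 ≃ₗᵢ[ℝ] E3} (hu : MemLp u 2 volume)
    (h : act Q u =ᵐ[volume] 0) : u =ᵐ[volume] 0 := by
  refine integral_normSq_eq_zero hu ?_
  have e := integral_inner_act Q u u
  simp_rw [real_inner_self_eq_norm_sq] at e
  rw [← e]
  refine integral_eq_zero_of_ae ?_
  filter_upwards [h] with x hx
  simp [hx]

theorem coordReflection_coordSwap (i j k : Fin 3) (x : E3) :
    coordReflection k (coordSwap i j x) = coordSwap i j (coordReflection (Equiv.swap i j k) x) := by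
  ext l
  simp only [coordReflection_apply, coordSwap_apply]
  simp [(Equiv.swap i j).injective.eq_iff]

theorem HasParity.swap {ε : Fin 3 → ℝ} (h : HasParity ε φ) (i k : Fin 3) :
    HasParity (fun l => ε (Equiv.swap i k l)) (fun j => act (coordSwap i k) (φ j)) := by
  intro l j
  have e : act (coordReflection l) (act (coordSwap i k) (φ j)) =
      act (coordSwap i k) (act (coordReflection (Equiv.swap i k l)) (φ j)) := by
    rw [← act_trans, ← act_trans]
    congr 1
    ext1 x
    exact coordReflection_coordSwap i k l x
  rw [e, h, act_smul]

/-- The critical parity class is the only one that needs separate consideration. -/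
theorem isRadialLinear_of_third_class (h0 : 0 ≤ σ) (h1 : σ < 1) (hμ : μ ≤ firstRoot σ ^ 2)
    (H : ∀ φ u, CritSeq σ μ φ u → HasParity ![1, 1, -1] φ → u =ᵐ[volume] 0)
    (h : CritSeq σ μ φ u) : IsRadialLinear σ μ u := by
  refine isRadialLinear_of_parity_classes (fun ε hε φ u h hp => ?_) h
  -- Classes with exactly one sign `-1` are moved to the standard one by a coordinate permutation.
  -- They alone escape `isRadialLinear_of_choice`: the component along the exceptional axis is even
  -- in all three coordinates.
  have hswap : ∀ i : Fin 3, (∀ l, ε (Equiv.swap i 2 l) = ![1, 1, -1] l) → IsRadialLinear σ μ u := by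
    intro i hi
    have hp' := hp.swap i 2
    rw [funext hi] at hp'
    exact isRadialLinear_of_zero (ae_eq_zero_of_act h.lim.memLp (H _ _ (h.act _) hp'))
  rcases hε 0 with e0 | e0 <;> rcases hε 1 with e1 | e1 <;> rcases hε 2 with e2 | e2
  · exact isRadialLinear_of_choice h0 h1 hμ h hp ![0, 1, 2]
      (by intro j; fin_cases j <;> simp [e0, e1, e2])
  · exact hswap 2 (by intro l; fin_cases l <;> simp [e0, e1, e2])
  · exact hswap 1 (by intro l; fin_cases l <;> simp [Equiv.swap_apply_def, e0, e1, e2])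
  · exact isRadialLinear_of_choice h0 h1 hμ h hp ![1, 2, 1]
      (by intro j; fin_cases j <;> simp [e0, e1, e2])
  · exact hswap 0 (by intro l; fin_cases l <;> simp [Equiv.swap_apply_def, e0, e1, e2])
  · exact isRadialLinear_of_choice h0 h1 hμ h hp ![2, 2, 0]
      (by intro j; fin_cases j <;> simp [e0, e1, e2])
  · exact isRadialLinear_of_choice h0 h1 hμ h hp ![1, 0, 0]
      (by intro j; fin_cases j <;> simp [e0, e1, e2])
  · exact isRadialLinear_of_choice h0 h1 hμ h hp ![1, 2, 0]
      (by intro j; fin_cases j <;> simp [e0, e1, e2])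

end

end

noncomputable section

/-! ### Smooth parametric integrals -/

section
variable {F : Type*} [NormedAddCommGroup F] [NormedSpace ℝ F]

theorem hasFDerivAt_intervalIntegral {f : E3 × ℝ → F} (hf : ContDiff ℝ 1 f) (a b : ℝ) (x₀ : E3) :
    HasFDerivAt (fun x => ∫ t in a..b, f (x, t))
      (∫ t in a..b, fderiv ℝ f (x₀, t) ∘L ContinuousLinearMap.inl ℝ E3 ℝ) x₀ := by
  have hc : Continuous fun p : E3 × ℝ => fderiv ℝ f p ∘L ContinuousLinearMap.inl ℝ E3 ℝ :=
    (hf.continuous_fderiv (by norm_num)).clm_comp continuous_const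
  obtain ⟨M, hM⟩ := ((isCompact_closedBall x₀ 1).prod (isCompact_uIcc (a := a) (b := b))
    ).exists_bound_of_continuousOn hc.continuousOn
  refine intervalIntegral.hasFDerivAt_integral_of_dominated_of_fderiv_le
    (F' := fun x t => fderiv ℝ f (x, t) ∘L ContinuousLinearMap.inl ℝ E3 ℝ) (bound := fun _ => M)
    (Metric.closedBall_mem_nhds x₀ one_pos) ?_ ?_ ?_ ?_ ?_ ?_
  · exact Eventually.of_forall fun x =>
      (hf.continuous.comp (by fun_prop : Continuous fun t : ℝ => (x, t))).aestronglyMeasurable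
  · exact (hf.continuous.comp (by fun_prop : Continuous fun t : ℝ => (x₀, t))).intervalIntegrable _ _
  · exact (hc.comp (by fun_prop : Continuous fun t : ℝ => (x₀, t))).aestronglyMeasurable
  · exact Eventually.of_forall fun t ht x hx => hM (x, t) ⟨hx, uIoc_subset_uIcc ht⟩
  · exact intervalIntegrable_const
  · refine Eventually.of_forall fun t ht x hx => ?_
    have h1 := (hf.differentiable (by norm_num) (x, t)).hasFDerivAt
    have h2 : HasFDerivAt (fun y : E3 => (y, t)) (ContinuousLinearMap.inl ℝ E3 ℝ) x :=
      hasFDerivAt_prodMk_left x t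
    exact h1.comp x h2

end

/-- The derivative of a parametric integral is again one, with values in continuous linear maps; the
value space therefore varies during the induction. -/
theorem contDiff_intervalIntegral_nat (n : ℕ) : ∀ {F : Type} [NormedAddCommGroup F]
    [NormedSpace ℝ F] [CompleteSpace F] {f : E3 × ℝ → F}, ContDiff ℝ ∞ f → ∀ (a b : ℝ),
    ContDiff ℝ n (fun x => ∫ t in a..b, f (x, t)) := by
  induction n with
  | zero =>
    intro F _ _ _ f hf a b
    exact contDiff_zero.2 (continuous_iff_continuousAt.2 fun x =>
      (hasFDerivAt_intervalIntegral (hf.of_le (by simp)) a b x).continuousAt)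
  | succ n ih =>
    intro F _ _ _ f hf a b
    rw [Nat.cast_add, Nat.cast_one, contDiff_succ_iff_hasFDerivAt]
    exact ⟨_, ih ((hf.fderiv_right (m := ∞) (by simp)).clm_comp contDiff_const) a b,
      hasFDerivAt_intervalIntegral (hf.of_le (by simp)) a b⟩

theorem contDiff_intervalIntegral {F : Type} [NormedAddCommGroup F]
    [NormedSpace ℝ F] [CompleteSpace F] {f : E3 × ℝ → F} (hf : ContDiff ℝ ∞ f) (a b : ℝ) :
    ContDiff ℝ ∞ (fun x => ∫ t in a..b, f (x, t)) :=
  contDiff_infty.2 fun n => contDiff_intervalIntegral_nat n hf a b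

theorem fderiv_intervalIntegral_apply {F : Type} [NormedAddCommGroup F]
    [NormedSpace ℝ F] [CompleteSpace F] {f : E3 × ℝ → F} (hf : ContDiff ℝ 1 f) (a b : ℝ)
    (x v : E3) : fderiv ℝ (fun x => ∫ t in a..b, f (x, t)) x v =
      ∫ t in a..b, fderiv ℝ (fun y => f (y, t)) x v := by
  rw [(hasFDerivAt_intervalIntegral hf a b x).fderiv]
  have hc : Continuous fun t : ℝ => fderiv ℝ f (x, t) ∘L ContinuousLinearMap.inl ℝ E3 ℝ :=
    ((hf.continuous_fderiv (by norm_num)).clm_comp continuous_const).comp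
      (by fun_prop : Continuous fun t : ℝ => (x, t))
  rw [ContinuousLinearMap.intervalIntegral_apply (hc.intervalIntegrable a b)]
  refine intervalIntegral.integral_congr fun t _ => ?_
  have h1 := (hf.differentiable (by norm_num) (x, t)).hasFDerivAt
  have h2 : HasFDerivAt (fun y : E3 => (y, t)) (ContinuousLinearMap.inl ℝ E3 ℝ) x :=
    hasFDerivAt_prodMk_left x t
  have h3 : HasFDerivAt (fun y => f (y, t)) _ x := h1.comp x h2
  simp only [h3.fderiv]

/-! ### Rotations about the third axis -/

/-- The rotation by the angle `t` about the third axis. -/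
def axisRotation (t : ℝ) : E3 ≃ₗᵢ[ℝ] E3 :=
  -- Composing two reflections doubles the angle between the mirrors, hence `t / 2`. Both mirrors
  -- contain the third axis, so invariance under vertical reflections yields invariance under
  -- rotations.
  (coordReflection 0).trans (planeReflection !₂[Real.cos (t / 2), Real.sin (t / 2), 0])

theorem norm_horizontal (s : ℝ) : ‖(!₂[Real.cos s, Real.sin s, 0] : E3)‖ = 1 := by
  rw [EuclideanSpace.norm_eq]
  simp [Fin.sum_univ_three]

theorem axisRotation_apply (t : ℝ) (x : E3) : axisRotation t x =
    !₂[Real.cos t * x 0 - Real.sin t * x 1, Real.sin t * x 0 + Real.cos t * x 1, x 2] := by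
  have h1 : Real.cos t = Real.cos (t / 2) ^ 2 - Real.sin (t / 2) ^ 2 := by
    rw [← Real.cos_two_mul', mul_div_cancel₀ _ two_ne_zero]
  have h2 : Real.sin t = 2 * Real.sin (t / 2) * Real.cos (t / 2) := by
    rw [← Real.sin_two_mul, mul_div_cancel₀ _ two_ne_zero]
  have h3 := Real.sin_sq_add_cos_sq (t / 2)
  rw [axisRotation, LinearIsometryEquiv.trans_apply, planeReflection_apply (norm_horizontal _),
    inner_eq_sum_three, h1, h2]
  ext i
  fin_cases i <;> simp [coordReflection_apply] <;> grind

theorem axisRotation_add (s t : ℝ) (x : E3) :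
    axisRotation s (axisRotation t x) = axisRotation (s + t) x := by
  simp only [axisRotation_apply, Real.cos_add, Real.sin_add]
  ext i
  fin_cases i <;> simp <;> ring

theorem axisRotation_add_two_pi (t : ℝ) (x : E3) :
    axisRotation (t + 2 * Real.pi) x = axisRotation t x := by
  simp only [axisRotation_apply, Real.cos_add_two_pi, Real.sin_add_two_pi]

theorem axisRotation_symm_apply (t : ℝ) (x : E3) :
    (axisRotation t).symm x = axisRotation (-t) x := by
  apply (axisRotation t).injective
  rw [axisRotation_add]
  simp [axisRotation_apply]
  ext i
  fin_cases i <;> simp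

theorem act_axisRotation (t : ℝ) (φ : E3 → E3) (x : E3) :
    act (axisRotation t) φ x = axisRotation t (φ (axisRotation (-t) x)) := by
  rw [act, axisRotation_symm_apply]

theorem act_axisRotation_add (s t : ℝ) (φ : E3 → E3) :
    act (axisRotation s) (act (axisRotation t) φ) = act (axisRotation (s + t)) φ := by
  ext1 x
  have h : -t + -s = -(s + t) := by ring
  simp only [act_axisRotation, axisRotation_add, h]

theorem act_axisRotation_periodic (φ : E3 → E3) (x : E3) :
    Function.Periodic (fun t => act (axisRotation t) φ x) (2 * Real.pi) := by
  intro t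
  have h : -t = -(t + 2 * Real.pi) + 2 * Real.pi := by ring
  simp only [act_axisRotation]
  rw [h, axisRotation_add_two_pi, axisRotation_add_two_pi]

/-- Every point can be rotated into the half plane through the third axis. -/
theorem exists_axisRotation (x : E3) : ∃ t, axisRotation t x 1 = 0 := by
  refine ⟨-(Complex.arg ⟨x 0, x 1⟩), ?_⟩
  have h1 := Complex.norm_mul_cos_arg ⟨x 0, x 1⟩
  have h2 := Complex.norm_mul_sin_arg ⟨x 0, x 1⟩
  simp only [axisRotation_apply, Real.cos_neg, Real.sin_neg]
  simp only at h1 h2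
  simp only [Matrix.cons_val_one, Matrix.cons_val_zero]
  linear_combination Real.sin (Complex.arg ⟨x 0, x 1⟩) * h1 -
    Real.cos (Complex.arg ⟨x 0, x 1⟩) * h2

theorem coordReflection_axisRotation {i : Fin 3} (hi : i ≠ 2) (t : ℝ) (x : E3) :
    coordReflection i (axisRotation t x) = axisRotation (-t) (coordReflection i x) := by
  ext k
  fin_cases i <;> fin_cases k <;> simp [coordReflection_apply, axisRotation_apply] at hi ⊢ <;> ring

/-- The rotational average of a vector field. -/
def rotationAverage (φ : E3 → E3) (x : E3) : E3 :=
  (2 * Real.pi)⁻¹ • ∫ t in (0 : ℝ)..2 * Real.pi, act (axisRotation t) φ x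

theorem contDiff_axisRotation {m : WithTop ℕ∞} {f : E3 × ℝ → E3} {g : E3 × ℝ → ℝ}
    (hf : ContDiff ℝ m f) (hg : ContDiff ℝ m g) :
    ContDiff ℝ m fun p : E3 × ℝ => axisRotation (g p) (f p) := by
  have hx : ∀ k : Fin 3, ContDiff ℝ m fun p : E3 × ℝ => f p k := fun k =>
    (EuclideanSpace.proj k : E3 →L[ℝ] ℝ).contDiff.comp hf
  have hc : ContDiff ℝ m fun p : E3 × ℝ => Real.cos (g p) := Real.contDiff_cos.comp hg
  have hs : ContDiff ℝ m fun p : E3 × ℝ => Real.sin (g p) := Real.contDiff_sin.comp hg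
  simp only [axisRotation_apply]
  refine contDiff_euclidean.2 (Fin.forall_fin_succ.2 ⟨?_, Fin.forall_fin_succ.2 ⟨?_,
    Fin.forall_fin_one.2 ?_⟩⟩)
  · exact (hc.mul (hx 0)).sub (hs.mul (hx 1))
  · exact (hs.mul (hx 0)).add (hc.mul (hx 1))
  · exact hx 2

theorem contDiff_act_axisRotation {φ : E3 → E3} {m : WithTop ℕ∞} (hφ : ContDiff ℝ m φ) :
    ContDiff ℝ m fun p : E3 × ℝ => act (axisRotation p.2) φ p.1 := by
  simp only [act_axisRotation]
  exact contDiff_axisRotation (hφ.comp (contDiff_axisRotation contDiff_fst contDiff_snd.neg))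
    contDiff_snd

theorem contDiff_rotationAverage {φ : E3 → E3} (hφ : ContDiff ℝ ∞ φ) :
    ContDiff ℝ ∞ (rotationAverage φ) := by
  have h := contDiff_intervalIntegral (contDiff_act_axisRotation hφ) 0 (2 * Real.pi)
  exact h.const_smul _

theorem continuous_act_axisRotation {φ : E3 → E3} (hφ : Continuous φ) :
    Continuous fun p : E3 × ℝ => act (axisRotation p.2) φ p.1 :=
  (contDiff_zero.1 (contDiff_act_axisRotation (contDiff_zero.2 hφ)))

theorem intervalIntegrable_act_axisRotation {φ : E3 → E3} (hφ : Continuous φ) (x : E3) (a b : ℝ) :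
    IntervalIntegrable (fun t => act (axisRotation t) φ x) volume a b :=
  ((continuous_act_axisRotation hφ).comp
    (by fun_prop : Continuous fun t : ℝ => (x, t))).intervalIntegrable a b

theorem rotationAverage_eq_zero {φ : E3 → E3} {x : E3} (h : ∀ y, ‖y‖ = ‖x‖ → φ y = 0) :
    rotationAverage φ x = 0 := by
  have : ∀ t, act (axisRotation t) φ x = 0 := fun t => by
    rw [act_axisRotation, h _ (LinearIsometryEquiv.norm_map _ _), map_zero]
  simp [rotationAverage, this]

/-- The rotation shifts the integration variable, and the integrand has period `2 π`. -/
theorem act_rotationAverage {φ : E3 → E3} (hφ : Continuous φ) (t : ℝ) :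
    act (axisRotation t) (rotationAverage φ) = rotationAverage φ := by
  ext1 x
  have h1 : ∀ y, axisRotation t (∫ s in (0 : ℝ)..2 * Real.pi, act (axisRotation s) φ y) =
      ∫ s in (0 : ℝ)..2 * Real.pi, axisRotation t (act (axisRotation s) φ y) := fun y =>
    ((axisRotation t : E3 →L[ℝ] E3).intervalIntegral_comp_comm
      (intervalIntegrable_act_axisRotation hφ y _ _)).symm
  have h2 : ∀ s, axisRotation t (act (axisRotation s) φ (axisRotation (-t) x)) =
      act (axisRotation (s + t)) φ x := fun s => by
    rw [← act_axisRotation, act_axisRotation_add, add_comm]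
  rw [act_axisRotation, rotationAverage, map_smul, h1, rotationAverage]
  simp_rw [h2]
  rw [intervalIntegral.integral_comp_add_right (fun s => act (axisRotation s) φ x)]
  congr 1
  have := (act_axisRotation_periodic φ x).intervalIntegral_add_eq t 0
  simpa [add_comm] using this

/-- A mirror containing the axis reverses rotations, so the integration variable changes sign, and
periodicity restores the interval. -/
theorem coordReflection_rotationAverage {φ : E3 → E3} (hφ : Continuous φ) {i : Fin 3} (hi : i ≠ 2)
    (h : act (coordReflection i) φ = φ) :
    act (coordReflection i) (rotationAverage φ) = rotationAverage φ := by
  ext1 x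
  have h1 : ∀ y, coordReflection i (∫ s in (0 : ℝ)..2 * Real.pi, act (axisRotation s) φ y) =
      ∫ s in (0 : ℝ)..2 * Real.pi, coordReflection i (act (axisRotation s) φ y) := fun y =>
    ((coordReflection i : E3 →L[ℝ] E3).intervalIntegral_comp_comm
      (intervalIntegrable_act_axisRotation hφ y _ _)).symm
  have h2 : ∀ s, coordReflection i (act (axisRotation s) φ (coordReflection i x)) =
      act (axisRotation (-s)) φ x := fun s => by
    conv_rhs => rw [← h]
    simp only [act_axisRotation, act_planeReflection, coordReflection_axisRotation hi, neg_neg]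
  rw [act_planeReflection, rotationAverage, map_smul, h1, rotationAverage]
  simp_rw [h2]
  rw [intervalIntegral.integral_comp_neg (fun s => act (axisRotation s) φ x)]
  congr 1
  have := (act_axisRotation_periodic φ x).intervalIntegral_add_eq (-(2 * Real.pi)) 0
  simpa using this

end

/-! ### Rotational averages of solenoidal test fields. -/

noncomputable section

section
variable {σ : ℝ} {φ ψ w : E3 → E3}

theorem isTestFunction_of_radii {F : Type*} [NormedAddCommGroup F] [NormedSpace ℝ F] {f : E3 → F}
    (hf : ContDiff ℝ ∞ f) {s₁ s₂ : ℝ} (hs₁ : 0 < σ → σ < s₁) (hs₂ : s₂ < 1)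
    (h1 : ∀ x, ‖x‖ < s₁ → f x = 0) (h2 : ∀ x, s₂ < ‖x‖ → f x = 0) :
    IsTestFunction (shell σ) f := by
  have hc : IsClosed {x : E3 | s₁ ≤ ‖x‖ ∧ ‖x‖ ≤ s₂} :=
    (isClosed_Icc (a := s₁) (b := s₂)).preimage continuous_norm
  have hsub : tsupport f ⊆ {x : E3 | s₁ ≤ ‖x‖ ∧ ‖x‖ ≤ s₂} := by
    refine closure_minimal (fun x hx => ?_) hc
    by_contra h
    simp only [mem_ofPred_eq, not_and_or, not_le] at h
    exact hx (h.elim (h1 x) (h2 x))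
  refine ⟨hf, ?_, fun x hx => ⟨fun h => (hs₁ h).trans_le (hsub hx).1, (hsub hx).2.trans_lt hs₂⟩⟩
  exact (isCompact_closedBall (0 : E3) s₂).of_isClosed_subset (isClosed_tsupport f)
    fun x hx => by simpa using (hsub hx).2

theorem continuous_pd_slice {f : E3 × ℝ → ℝ} (hf : ContDiff ℝ 1 f) (k : Fin 3) (x : E3) :
    Continuous fun t => pd k (fun y => f (y, t)) x := by
  have hc : Continuous fun t : ℝ => fderiv ℝ f (x, t) (EuclideanSpace.single k (1 : ℝ), 0) :=
    ((hf.continuous_fderiv (by norm_num)).clm_apply continuous_const).comp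
      (by fun_prop : Continuous fun t : ℝ => (x, t))
  refine hc.congr fun t => ?_
  have h1 := (hf.differentiable (by norm_num) (x, t)).hasFDerivAt
  have h2 : HasFDerivAt (fun y : E3 => (y, t)) (ContinuousLinearMap.inl ℝ E3 ℝ) x :=
    hasFDerivAt_prodMk_left x t
  have h3 : HasFDerivAt (fun y => f (y, t)) _ x := h1.comp x h2
  rw [pd, h3.fderiv]
  simp

/-- Rotations preserve norms, so the support stays between the same two radii; the divergence is
differentiated under the integral, and every rotated field is solenoidal. -/
theorem IsSolenoidalTest.rotationAverage (h0 : 0 ≤ σ) (h : IsSolenoidalTest (shell σ) φ) :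
    IsSolenoidalTest (shell σ) (rotationAverage φ) := by
  obtain ⟨s₁, s₂, -, hs₁, -, hs₂, hr⟩ := exists_radii_of_compact h0 h.1.2.1 h.1.2.2
  have hz : ∀ x, ¬ (s₁ ≤ ‖x‖ ∧ ‖x‖ ≤ s₂) → φ x = 0 := fun x hx =>
    image_eq_zero_of_notMem_tsupport fun hx' => hx (hr x hx')
  have hT : IsTestFunction (shell σ) (_root_.rotationAverage φ) := by
    refine isTestFunction_of_radii (contDiff_rotationAverage h.1.1) hs₁ hs₂ (fun x hx => ?_)
      fun x hx => ?_
    · exact rotationAverage_eq_zero fun y hy => hz y fun h => by linarith [h.1]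
    · exact rotationAverage_eq_zero fun y hy => hz y fun h => by linarith [h.2]
  refine ⟨hT, fun x => ?_⟩
  have hf : ∀ k : Fin 3, ContDiff ℝ 1 fun p : E3 × ℝ => _root_.act (axisRotation p.2) φ p.1 k :=
    fun k => (EuclideanSpace.proj k : E3 →L[ℝ] ℝ).contDiff.comp
      (contDiff_act_axisRotation (h.1.1.of_le (by simp)))
  have hcomp : ∀ k : Fin 3, (fun y => _root_.rotationAverage φ y k) = fun y => (2 * Real.pi)⁻¹ *
      ∫ t in (0 : ℝ)..2 * Real.pi, _root_.act (axisRotation t) φ y k := fun k => by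
    ext1 y
    rw [_root_.rotationAverage, PiLp.smul_apply, smul_eq_mul]
    congr 1
    exact ((EuclideanSpace.proj k : E3 →L[ℝ] ℝ).intervalIntegral_comp_comm
      (intervalIntegrable_act_axisRotation h.1.1.continuous y _ _)).symm
  have hk : ∀ k : Fin 3, jacobian (_root_.rotationAverage φ) x (k, k) = (2 * Real.pi)⁻¹ *
      ∫ t in (0 : ℝ)..2 * Real.pi, pd k (fun y => _root_.act (axisRotation t) φ y k) x := fun k => by
    rw [jacobian_apply (hT.differentiable x), hcomp, pd]
    have hd := (hasFDerivAt_intervalIntegral (hf k) 0 (2 * Real.pi) x).differentiableAt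
    rw [fderiv_const_mul hd]
    simp only [smul_apply, smul_eq_mul]
    rw [fderiv_intervalIntegral_apply (hf k)]
    rfl
  simp_rw [hk, ← Finset.mul_sum]
  rw [← intervalIntegral.integral_finsetSum fun k _ =>
    (continuous_pd_slice (hf k) k x).intervalIntegrable _ _]
  have hd : ∀ t, ∑ k : Fin 3, pd k (fun y => _root_.act (axisRotation t) φ y k) x = 0 := fun t => by
    have h2 := h.act (axisRotation t)
    have := h2.2 x
    simp_rw [jacobian_apply (h2.1.differentiable x)] at this
    exact this
  simp [hd]

theorem integrable_inner_act_axisRotation (hφ : Continuous φ) {M : ℝ} (hM : ∀ x, ‖φ x‖ ≤ M)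
    (hψ : Continuous ψ) (hc : HasCompactSupport ψ) :
    Integrable (fun p : ℝ × E3 => (inner ℝ (act (axisRotation p.1) φ p.2) (ψ p.2) : ℝ))
      ((volume.restrict (Ioc 0 (2 * Real.pi))).prod volume) := by
  have hi : Integrable fun x => ‖ψ x‖ := (hψ.integrable_of_hasCompactSupport hc).norm
  have hR := (continuous_act_axisRotation hφ).comp (continuous_swap (X := ℝ) (Y := E3))
  simp only [Function.comp_def, Prod.snd_swap, Prod.fst_swap] at hR
  refine ((integrable_const M).mul_prod hi).mono' ?_ (Eventually.of_forall fun p => ?_)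
  · exact Continuous.aestronglyMeasurable (Continuous.inner hR (hψ.comp continuous_snd))
  · refine (norm_inner_le_norm _ _).trans (mul_le_mul_of_nonneg_right ?_ (norm_nonneg _))
    rw [act_axisRotation, LinearIsometryEquiv.norm_map]
    exact hM _

theorem integral_inner_rotationAverage (hφ : Continuous φ) {M : ℝ} (hM : ∀ x, ‖φ x‖ ≤ M)
    (hψ : Continuous ψ) (hc : HasCompactSupport ψ) :
    ∫ x, inner ℝ (rotationAverage φ x) (ψ x) = (2 * Real.pi)⁻¹ *
      ∫ t in (0 : ℝ)..2 * Real.pi, ∫ x, inner ℝ (act (axisRotation t) φ x) (ψ x) := by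
  have hpi : (0 : ℝ) ≤ 2 * Real.pi := by positivity
  rw [intervalIntegral.integral_of_le hpi, integral_integral_swap
    (integrable_inner_act_axisRotation hφ hM hψ hc), ← integral_const_mul]
  refine integral_congr_ae (Eventually.of_forall fun x => ?_)
  simp only [rotationAverage]
  rw [real_inner_smul_left, real_inner_comm, intervalIntegral.integral_of_le hpi, ← integral_inner]
  · simp_rw [real_inner_comm (ψ x)]
  · have := intervalIntegrable_act_axisRotation hφ x 0 (2 * Real.pi)
    rwa [intervalIntegrable_iff_integrableOn_Ioc_of_le hpi] at this

/-- Averaging is an orthogonal projection in `L_2`: the average is itself invariant, so each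
rotation of `φ` has the same pairing with it. -/
theorem integral_inner_rotationAverage_self (h0 : 0 ≤ σ) (h : IsSolenoidalTest (shell σ) φ) :
    ∫ x, inner ℝ (rotationAverage φ x) (φ x) = ∫ x, ‖rotationAverage φ x‖ ^ 2 := by
  obtain ⟨M, hM⟩ := h.1.exists_bound
  have hw := (h.rotationAverage h0).1
  have h1 := integral_inner_rotationAverage h.1.1.continuous hM hw.1.continuous hw.2.1
  have h2 : ∀ t, ∫ x, inner ℝ (act (axisRotation t) φ x) (rotationAverage φ x) =
      ∫ x, inner ℝ (φ x) (rotationAverage φ x) := fun t => by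
    conv_lhs => rw [← act_rotationAverage h.1.1.continuous t]
    exact integral_inner_act _ _ _
  simp_rw [h2] at h1
  simp only [real_inner_self_eq_norm_sq, intervalIntegral.integral_const, sub_zero,
    smul_eq_mul] at h1
  rw [h1, ← mul_assoc, inv_mul_cancel₀ (by positivity), one_mul]
  simp_rw [real_inner_comm]

end

/-! ### The azimuthal vector potential of an axially symmetric field -/

/-- The linear map `(x₀, x₁, x₂) ↦ (s x₀, s x₁, x₂)`. -/
def horizontalScale (s : ℝ) (x : E3) : E3 := !₂[s * x 0, s * x 1, x 2]

theorem contDiff_coord (k : Fin 3) {m : WithTop ℕ∞} : ContDiff ℝ m fun x : E3 => x k :=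
  (EuclideanSpace.proj k : E3 →L[ℝ] ℝ).contDiff

theorem contDiff_vec3 {X : Type*} [NormedAddCommGroup X] [NormedSpace ℝ X] {m : WithTop ℕ∞}
    {a b c : X → ℝ} (ha : ContDiff ℝ m a) (hb : ContDiff ℝ m b) (hc : ContDiff ℝ m c) :
    ContDiff ℝ m fun x => (!₂[a x, b x, c x] : E3) :=
  contDiff_euclidean.2 (Fin.forall_fin_succ.2 ⟨ha, Fin.forall_fin_succ.2 ⟨hb,
    Fin.forall_fin_one.2 hc⟩⟩)

theorem hasDerivAt_vec3 {a b c : ℝ → ℝ} {a' b' c' t : ℝ} (ha : HasDerivAt a a' t)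
    (hb : HasDerivAt b b' t) (hc : HasDerivAt c c' t) :
    HasDerivAt (fun t => (!₂[a t, b t, c t] : E3)) !₂[a', b', c'] t := by
  have e : ∀ a b c : ℝ, (!₂[a, b, c] : E3) = a • EuclideanSpace.single 0 1 +
      b • EuclideanSpace.single 1 1 + c • EuclideanSpace.single 2 1 := fun a b c => by
    ext i; fin_cases i <;> simp
  simp_rw [e]
  exact ((ha.smul_const _).add (hb.smul_const _)).add (hc.smul_const _)

theorem contDiff_horizontalScale {m : WithTop ℕ∞} :
    ContDiff ℝ m fun p : E3 × ℝ => horizontalScale p.2 p.1 :=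
  contDiff_vec3 (contDiff_snd.mul ((contDiff_coord 0).comp contDiff_fst))
    (contDiff_snd.mul ((contDiff_coord 1).comp contDiff_fst)) ((contDiff_coord 2).comp contDiff_fst)

theorem HasDerivAt.comp_curve {g : E3 → ℝ} (hg : Differentiable ℝ g) {γ : ℝ → E3} {v : E3} {t : ℝ}
    (h : HasDerivAt γ v t) : HasDerivAt (fun t => g (γ t)) (∑ k, v k * pd k g (γ t)) t := by
  have := (hg (γ t)).hasFDerivAt.comp_hasDerivAt t h
  rwa [fderiv_apply_eq_sum_pd] at this

theorem hasDerivAt_horizontalScale {g : E3 → ℝ} (hg : Differentiable ℝ g) (x : E3) (s : ℝ) :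
    HasDerivAt (fun s => g (horizontalScale s x))
      (x 0 * pd 0 g (horizontalScale s x) + x 1 * pd 1 g (horizontalScale s x)) s := by
  have h : HasDerivAt (fun s => horizontalScale s x) !₂[x 0, x 1, 0] s :=
    hasDerivAt_vec3 (by simpa using (hasDerivAt_id s).mul_const (x 0))
      (by simpa using (hasDerivAt_id s).mul_const (x 1)) (hasDerivAt_const s _)
  refine (h.comp_curve hg).congr_deriv ?_
  simp [Fin.sum_univ_three]

theorem pd_comp_horizontalScale {g : E3 → ℝ} (hg : Differentiable ℝ g) (x : E3) (s : ℝ)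
    (k : Fin 3) : pd k (fun y => g (horizontalScale s y)) x =
      (if k = 2 then 1 else s) * pd k g (horizontalScale s x) := by
  have hlin : IsLinearMap ℝ (horizontalScale s) :=
    ⟨fun x y => by ext i; fin_cases i <;> simp [horizontalScale, mul_add],
      fun c x => by ext i; fin_cases i <;> simp [horizontalScale, mul_left_comm]⟩
  have h1 : HasFDerivAt (horizontalScale s) (LinearMap.toContinuousLinearMap (hlin.mk' _)) x :=
    (LinearMap.toContinuousLinearMap (hlin.mk' _)).hasFDerivAt
  have h2 : HasFDerivAt (fun y => g (horizontalScale s y)) _ x := (hg _).hasFDerivAt.comp x h1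
  rw [pd, h2.fderiv, pd, ← smul_eq_mul, ← map_smul]
  simp only [ContinuousLinearMap.comp_apply]
  congr 1
  ext i
  fin_cases k <;> fin_cases i <;> simp [horizontalScale]

/-- The flux density: `2 π ρ²` times it is the flux of `g e₂` through the horizontal disc of radius
`ρ` about the third axis, for axially symmetric `g`. -/
def axialFlux (g : E3 → ℝ) (x : E3) : ℝ := ∫ s in (0 : ℝ)..1, s * g (horizontalScale s x)

section
variable {g : E3 → ℝ}

theorem contDiff_axialFlux_integrand {m : WithTop ℕ∞} (hg : ContDiff ℝ m g) :
    ContDiff ℝ m fun p : E3 × ℝ => p.2 * g (horizontalScale p.2 p.1) :=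
  contDiff_snd.mul (hg.comp contDiff_horizontalScale)

theorem contDiff_axialFlux (hg : ContDiff ℝ ∞ g) : ContDiff ℝ ∞ (axialFlux g) :=
  contDiff_intervalIntegral (contDiff_axialFlux_integrand hg) 0 1

theorem pd_axialFlux (hg : ContDiff ℝ 1 g) (k : Fin 3) (x : E3) : pd k (axialFlux g) x =
    ∫ s in (0 : ℝ)..1, s * ((if k = 2 then 1 else s) * pd k g (horizontalScale s x)) := by
  have h := fderiv_intervalIntegral_apply (contDiff_axialFlux_integrand hg) 0 1 x
    (EuclideanSpace.single k (1 : ℝ))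
  refine h.trans (intervalIntegral.integral_congr fun s _ => ?_)
  have hd : DifferentiableAt ℝ (fun y => g (horizontalScale s y)) x :=
    ((hg.comp contDiff_horizontalScale).comp
      (contDiff_id.prodMk contDiff_const : ContDiff ℝ 1 fun y : E3 => (y, s))).differentiable
      (by norm_num) x
  have := pd_comp_horizontalScale (hg.differentiable (by norm_num)) x s k
  simp only
  rw [fderiv_const_mul hd, smul_apply, smul_eq_mul, ← this, pd]

theorem continuous_horizontalScale (x : E3) : Continuous fun s => horizontalScale s x :=
  (contDiff_horizontalScale (m := 0)).continuous.comp (by fun_prop : Continuous fun s : ℝ => (x, s))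

theorem continuous_pd (hg : ContDiff ℝ 1 g) (k : Fin 3) : Continuous (pd k g) :=
  (hg.continuous_fderiv (by norm_num)).clm_apply continuous_const

/-- Integrate the derivative of `s² g(s x₀, s x₁, x₂)` over the unit interval. The left side is the
third component of the curl of `azimuthalPotential`. -/
theorem two_mul_axialFlux (hg : ContDiff ℝ 1 g) (x : E3) :
    2 * axialFlux g x + x 0 * pd 0 (axialFlux g) x + x 1 * pd 1 (axialFlux g) x = g x := by
  have hc := continuous_horizontalScale x
  have c0 := (continuous_pd hg 0).comp hc
  have c1 := (continuous_pd hg 1).comp hc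
  have cg := hg.continuous.comp hc
  simp only [Function.comp_def] at c0 c1 cg
  have hF : ∀ s : ℝ, HasDerivAt (fun s => s ^ 2 * g (horizontalScale s x))
      (2 * (s * g (horizontalScale s x)) + x 0 * (s * (s * pd 0 g (horizontalScale s x))) +
        x 1 * (s * (s * pd 1 g (horizontalScale s x)))) s := fun s =>
    ((hasDerivAt_pow 2 s).mul (hasDerivAt_horizontalScale (hg.differentiable (by norm_num)) x s)
      ).congr_deriv (by simp; ring)
  have h := intervalIntegral.integral_eq_sub_of_hasDerivAt (fun s _ => hF s)
    ((by fun_prop : Continuous fun s => (2 * (s * g (horizontalScale s x)) +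
      x 0 * (s * (s * pd 0 g (horizontalScale s x))) +
        x 1 * (s * (s * pd 1 g (horizontalScale s x))))).intervalIntegrable 0 1)
  rw [intervalIntegral.integral_add, intervalIntegral.integral_add,
    intervalIntegral.integral_const_mul, intervalIntegral.integral_const_mul,
    intervalIntegral.integral_const_mul] at h
  · rw [pd_axialFlux hg, pd_axialFlux hg, axialFlux]
    simp only [Fin.reduceEq, if_false]
    rw [h]
    have : horizontalScale 1 x = x := by ext i; fin_cases i <;> simp [horizontalScale]
    simp [this]
  all_goals exact Continuous.intervalIntegrable (by fun_prop) _ _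

/-- These are the horizontal components of the curl formula. Along the horizontal ray to the axis,
`s w_i` has derivative `w_i + (x₀ ∂₀ + x₁ ∂₁) w_i`. Zero divergence and the absence of an azimuthal
component turn this into `-x_i ∂₂ w₂`, which integrates to the flux derivative. -/
theorem horizontal_eq_pd_axialFlux {w : E3 → E3} (hw : ContDiff ℝ 1 w)
    (hdiv : ∀ x, ∑ k, pd k (fun y => w y k) x = 0) (hm : ∀ x, x 0 * w x 1 = x 1 * w x 0) (x : E3) :
    w x 0 = - (x 0 * pd 2 (axialFlux fun y => w y 2) x) ∧
      w x 1 = - (x 1 * pd 2 (axialFlux fun y => w y 2) x) := by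
  have hwk : ∀ k : Fin 3, ContDiff ℝ 1 fun y => w y k := fun k => (contDiff_coord k).comp hw
  have hd : ∀ k : Fin 3, Differentiable ℝ fun y => w y k := fun k =>
    (hwk k).differentiable (by norm_num)
  have hp : ∀ (k j i : Fin 3) (y : E3), pd k (fun y => y i * w y j) y =
      (if i = k then w y j else 0) + y i * pd k (fun y => w y j) y := by
    intro k j i y
    have h1 := (EuclideanSpace.proj i : E3 →L[ℝ] ℝ).hasFDerivAt (x := y)
    have h2 : HasFDerivAt (fun y : E3 => y i * w y j) _ y := h1.mul (hd j y).hasFDerivAt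
    rw [pd, h2.fderiv]
    by_cases hik : i = k
    · subst hik; simp [pd]; ring
    · simp [pd, hik]
  have hm' : (fun y : E3 => y 0 * w y 1) = fun y => y 1 * w y 0 := funext hm
  -- The relation `x₀ w₁ = x₁ w₀` is differentiated, to exchange derivatives of the two horizontal
  -- components.
  have m0 : ∀ y, w y 1 + y 0 * pd 0 (fun y => w y 1) y = y 1 * pd 0 (fun y => w y 0) y := fun y => by
    have := congrArg (fun f => pd 0 f y) hm'
    simpa [hp] using this
  have m1 : ∀ y, y 0 * pd 1 (fun y => w y 1) y = w y 0 + y 1 * pd 1 (fun y => w y 0) y := fun y => by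
    have := congrArg (fun f => pd 1 f y) hm'
    simpa [hp] using this
  have hone : horizontalScale 1 x = x := by ext i; fin_cases i <;> simp [horizontalScale]
  have hc := continuous_horizontalScale x
  have c2 := (continuous_pd (hwk 2) 2).comp hc
  simp only [Function.comp_def] at c2
  have key : ∀ i : Fin 3, i ≠ 2 → (∀ y : E3, w y i + (y 0 * pd 0 (fun y => w y i) y +
      y 1 * pd 1 (fun y => w y i) y) = - (y i * pd 2 (fun y => w y 2) y)) →
      w x i = - (x i * pd 2 (axialFlux fun y => w y 2) x) := by
    intro i hi hy
    have hsi : ∀ s, horizontalScale s x i = s * x i := fun s => by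
      fin_cases i <;> simp [horizontalScale] at hi ⊢
    have hF : ∀ s : ℝ, HasDerivAt (fun s => s * w (horizontalScale s x) i)
        (- x i * (s * (1 * pd 2 (fun y => w y 2) (horizontalScale s x)))) s := fun s =>
      ((hasDerivAt_id s).mul (hasDerivAt_horizontalScale (hd i) x s)).congr_deriv (by
        have := hy (horizontalScale s x)
        rw [hsi] at this
        simp only [horizontalScale] at this ⊢
        simp at this ⊢
        linear_combination this)
    have h := intervalIntegral.integral_eq_sub_of_hasDerivAt (fun s _ => hF s)
      (Continuous.intervalIntegrable (by fun_prop) 0 1)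
    rw [intervalIntegral.integral_const_mul] at h
    rw [pd_axialFlux (hwk 2)]
    simp only [if_true]
    simp only [hone] at h
    linarith
  refine ⟨key 0 (by decide) fun y => ?_, key 1 (by decide) fun y => ?_⟩
  · have := hdiv y
    rw [Fin.sum_univ_three] at this
    linear_combination y 0 * this - m1 y
  · have := hdiv y
    rw [Fin.sum_univ_three] at this
    linear_combination y 1 * this + m0 y

end

end

noncomputable section

/-! ### The curl -/

/-- The antisymmetric part of a matrix, as a vector. -/
def curlMap : Mat3 →ₗ[ℝ] E3 where
  toFun J := !₂[J (2, 1) - J (1, 2), J (0, 2) - J (2, 0), J (1, 0) - J (0, 1)]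
  map_add' J K := by ext i; fin_cases i <;> simp <;> ring
  map_smul' c J := by ext i; fin_cases i <;> simp <;> ring

/-- The curl of a vector field. -/
def curl (φ : E3 → E3) (x : E3) : E3 := curlMap (jacobian φ x)

section
variable {σ : ℝ} {Ω : Set E3} {φ ψ w : E3 → E3}

theorem IsTestFunction.curl (h : IsTestFunction Ω φ) : IsTestFunction Ω (curl φ) :=
  h.jacobian.clm_comp (LinearMap.toContinuousLinearMap curlMap)

theorem curl_apply (h : Differentiable ℝ φ) (x : E3) : curl φ x =
    !₂[pd 1 (fun y => φ y 2) x - pd 2 (fun y => φ y 1) x,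
      pd 2 (fun y => φ y 0) x - pd 0 (fun y => φ y 2) x,
      pd 0 (fun y => φ y 1) x - pd 1 (fun y => φ y 0) x] := by
  simp [curl, curlMap, jacobian_apply (h x)]

theorem IsSolenoidalTest.divergence (h : IsSolenoidalTest Ω φ) (x : E3) :
    ∑ k, pd k (fun y => φ y k) x = 0 := by
  have := h.2 x
  simp_rw [jacobian_apply (h.1.differentiable x)] at this
  exact this

/-- Pointwise, `|∇φ|² - |curl φ|²` is the sum of all `∂_k φ_j ∂_j φ_k`; after two integrations by
parts its integral is that of the squared divergence. -/
theorem IsSolenoidalTest.integral_normSq_curl (h : IsSolenoidalTest Ω φ) :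
    ∫ x, ‖curl φ x‖ ^ 2 = dirichlet φ φ := by
  have hi : ∀ j k l m : Fin 3, Integrable fun x => pd k (fun y => φ y j) x * pd m (fun y => φ y l) x :=
    fun j k l m => ((h.1.component j).pd k).integrable_mul ((h.1.component l).pd m).1.continuous
  have hz : ∫ x, ∑ j, ∑ k, pd k (fun y => φ y j) x * pd j (fun y => φ y k) x = 0 := by
    have e : ∀ j k, ∫ x, pd k (fun y => φ y j) x * pd j (fun y => φ y k) x =
        ∫ x, pd j (fun y => φ y j) x * pd k (fun y => φ y k) x := fun j k =>
      (h.1.component j).integral_pd_mul_pd_comm (h.1.component k) k j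
    have swap : ∀ {F : Fin 3 → Fin 3 → E3 → ℝ}, (∀ j k, Integrable (F j k)) →
        ∫ x, ∑ j, ∑ k, F j k x = ∑ j, ∑ k, ∫ x, F j k x := fun hF => by
      rw [integral_finsetSum _ fun j _ => integrable_finsetSum _ fun k _ => hF j k]
      exact Finset.sum_congr rfl fun j _ => integral_finsetSum _ fun k _ => hF j k
    rw [swap fun j k => hi j k k j]
    rw [Finset.sum_congr rfl fun j _ => Finset.sum_congr rfl fun k _ => e j k,
      ← swap fun j k => hi j j k k]
    simp_rw [← Finset.mul_sum, h.divergence]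
    simp
  rw [dirichlet, ← sub_eq_zero, ← integral_sub, ← neg_eq_zero, ← hz, ← integral_neg]
  · refine integral_congr_ae (Eventually.of_forall fun x => ?_)
    simp only [curl_apply h.1.differentiable, norm_sq_eq_sum_three,
      inner_jacobian h.1.differentiable h.1.differentiable, Fin.sum_univ_three]
    simp
    ring
  · exact (memLp_two_iff_integrable_sq_norm h.1.curl.memLp.1).1 h.1.curl.memLp
  · exact integrable_inner_of_memLp h.1.jacobian.memLp h.1.jacobian.memLp

theorem integral_inner_curl (hφ : IsTestFunction Ω φ) (hψ : IsTestFunction Ω ψ) :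
    ∫ x, inner ℝ (φ x) (curl ψ x) = ∫ x, inner ℝ (curl φ x) (ψ x) := by
  have hi : ∀ j l m : Fin 3, Integrable fun x => φ x j * pd m (fun y => ψ y l) x :=
    fun j l m => (hφ.component j).integrable_mul ((hψ.component l).pd m).1.continuous
  have hi' : ∀ j k l : Fin 3, Integrable fun x => pd k (fun y => φ y j) x * ψ x l :=
    fun j k l => ((hφ.component j).pd k).integrable_mul (hψ.component l).1.continuous
  have e : ∀ j l m : Fin 3, ∫ x, φ x j * pd m (fun y => ψ y l) x =
      - ∫ x, pd m (fun y => φ y j) x * ψ x l := fun j l m =>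
    (hφ.component j).integral_mul_pd ((hψ.component l).1.of_le (by simp)) m
  have h1 : ∀ x, inner ℝ (φ x) (curl ψ x) =
      (φ x 0 * pd 1 (fun y => ψ y 2) x - φ x 0 * pd 2 (fun y => ψ y 1) x) +
      (φ x 1 * pd 2 (fun y => ψ y 0) x - φ x 1 * pd 0 (fun y => ψ y 2) x) +
      (φ x 2 * pd 0 (fun y => ψ y 1) x - φ x 2 * pd 1 (fun y => ψ y 0) x) := fun x => by
    rw [curl_apply hψ.differentiable, inner_eq_sum_three]
    simp
    ring
  have h2 : ∀ x, inner ℝ (curl φ x) (ψ x) =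
      (pd 1 (fun y => φ y 2) x * ψ x 0 - pd 2 (fun y => φ y 1) x * ψ x 0) +
      (pd 2 (fun y => φ y 0) x * ψ x 1 - pd 0 (fun y => φ y 2) x * ψ x 1) +
      (pd 0 (fun y => φ y 1) x * ψ x 2 - pd 1 (fun y => φ y 0) x * ψ x 2) := fun x => by
    rw [curl_apply hφ.differentiable, inner_eq_sum_three]
    simp
    ring
  have six : ∀ {a b c d e f : E3 → ℝ}, Integrable a → Integrable b → Integrable c → Integrable d →
      Integrable e → Integrable f → ∫ x, (a x - b x + (c x - d x) + (e x - f x)) =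
        (∫ x, a x) - (∫ x, b x) + ((∫ x, c x) - ∫ x, d x) + ((∫ x, e x) - ∫ x, f x) :=
    fun {a b c d e f} ha hb hc hd he hf => by
      have hab : Integrable fun x => a x - b x := ha.sub hb
      have hcd : Integrable fun x => c x - d x := hc.sub hd
      have hef : Integrable fun x => e x - f x := he.sub hf
      have habcd : Integrable fun x => a x - b x + (c x - d x) := hab.add hcd
      rw [integral_add habcd hef, integral_add hab hcd, integral_sub ha hb,
        integral_sub hc hd, integral_sub he hf]
  simp_rw [h1, h2]
  rw [six (hi _ _ _) (hi _ _ _) (hi _ _ _) (hi _ _ _) (hi _ _ _) (hi _ _ _),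
    six (hi' _ _ _) (hi' _ _ _) (hi' _ _ _) (hi' _ _ _) (hi' _ _ _) (hi' _ _ _)]
  simp_rw [e]
  ring

/-- Solenoidal test fields are orthogonal to gradients. -/
theorem IsSolenoidalTest.integral_mul_gradient (h : IsSolenoidalTest Ω φ) {η : E3 → ℝ}
    (hη : ContDiff ℝ 1 η) : ∫ x, ∑ k, φ x k * pd k η x = 0 := by
  rw [integral_finsetSum _ fun k _ => (h.1.component k).integrable_mul (continuous_pd hη k)]
  simp_rw [fun k => (h.1.component k).integral_mul_pd hη k]
  rw [Finset.sum_neg_distrib, ← integral_finsetSum _ fun k _ =>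
    ((h.1.component k).pd k).integrable_mul hη.continuous]
  simp_rw [← Finset.sum_mul, h.divergence]
  simp

theorem pd_coord (i k : Fin 3) (x : E3) : pd k (fun y : E3 => y i) x = if i = k then 1 else 0 := by
  have h1 : HasFDerivAt (fun y : E3 => y i) (EuclideanSpace.proj i : E3 →L[ℝ] ℝ) x :=
    (EuclideanSpace.proj i : E3 →L[ℝ] ℝ).hasFDerivAt
  rw [pd, h1.fderiv]
  by_cases h : i = k
  · subst h; simp
  · simp [h]

/-- A constant field is the gradient of a coordinate function. -/
theorem IsSolenoidalTest.integral_component (h : IsSolenoidalTest Ω φ) (i : Fin 3) :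
    ∫ x, φ x i = 0 := by
  simpa [pd_coord] using h.integral_mul_gradient (contDiff_coord i)

theorem IsSolenoidalTest.integral_pd_mul_coord (h : IsSolenoidalTest Ω φ) (i j k : Fin 3) :
    ∫ x, pd k (fun y => φ y j) x * x i = 0 := by
  have := (h.1.component j).integral_mul_pd (contDiff_coord i) k
  rw [eq_comm, neg_eq_iff_eq_neg] at this
  rw [this]
  simp only [pd_coord]
  by_cases hik : i = k
  · simp [hik, h.integral_component]
  · simp [hik]

/-- Integration by parts leaves mean values of components, which vanish. This orthogonality excludes
the case of equality in `ae_eq_zero_of_third_class`. -/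
theorem IsSolenoidalTest.integral_curl_mul_coord (h : IsSolenoidalTest Ω φ) (i j : Fin 3) :
    ∫ x, curl φ x j * x i = 0 := by
  have hi : ∀ j k : Fin 3, Integrable fun x : E3 => pd k (fun y => φ y j) x * x i := fun j k =>
    ((h.1.component j).pd k).integrable_mul (contDiff_coord i (m := 0)).continuous
  simp_rw [curl_apply h.1.differentiable]
  fin_cases j <;> simp only [Fin.zero_eta, Fin.mk_one, Fin.reduceFinMk, Matrix.cons_val_zero,
    Matrix.cons_val_one, Matrix.cons_val, sub_mul] <;>
  rw [integral_sub (hi _ _) (hi _ _), h.integral_pd_mul_coord, h.integral_pd_mul_coord, sub_zero]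

/-! ### The azimuthal potential -/

/-- The azimuthal vector potential of an axially symmetric field. -/
def azimuthalPotential (w : E3 → E3) (x : E3) : E3 :=
  !₂[-(axialFlux (fun y => w y 2) x * x 1), axialFlux (fun y => w y 2) x * x 0, 0]

/-- Axially symmetric solenoidal test fields without azimuthal component. -/
structure IsMeridional (σ : ℝ) (w : E3 → E3) : Prop where
  test : IsSolenoidalTest (shell σ) w
  rot : ∀ t, act (axisRotation t) w = w
  refl : ∀ i : Fin 3, i ≠ 2 → act (coordReflection i) w = w

/-- Rotate the point into the plane `x₁ = 0`. The reflection in this plane fixes the point, hence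
forces the component of the field normal to the plane to vanish; then rotate back. -/
theorem IsMeridional.horizontal (h : IsMeridional σ w) (x : E3) : x 0 * w x 1 = x 1 * w x 0 := by
  obtain ⟨t, ht⟩ := exists_axisRotation x
  set y := axisRotation t x with hy
  have hx : x = axisRotation (-t) y := by
    rw [hy, axisRotation_add]
    simp [axisRotation_apply]
    ext i
    fin_cases i <;> simp
  have hs : coordReflection 1 y = y := by
    ext i
    fin_cases i <;> simp [coordReflection_apply, ht]
  have h1 : w y 1 = 0 := by
    have := congrFun (h.refl 1 (by decide)) y
    rw [act_planeReflection, hs] at this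
    have := congrArg (fun v : E3 => v 1) this
    simp only [coordReflection_apply, if_true] at this
    linarith
  have h2 : w x = axisRotation (-t) (w y) := by
    have := congrFun (h.rot (-t)) x
    rw [act_axisRotation, neg_neg] at this
    exact this.symm
  rw [h2, axisRotation_apply, hx, axisRotation_apply]
  simp [h1, ht]
  ring

theorem IsMeridional.axialFlux_rot (h : IsMeridional σ w) (t : ℝ) (x : E3) :
    axialFlux (fun y => w y 2) (axisRotation t x) = axialFlux (fun y => w y 2) x := by
  refine intervalIntegral.integral_congr fun s _ => ?_
  have e : horizontalScale s (axisRotation t x) = axisRotation t (horizontalScale s x) := by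
    ext i; fin_cases i <;> simp [horizontalScale, axisRotation_apply] <;> ring
  have := congrFun (h.rot t) (axisRotation t (horizontalScale s x))
  rw [act_axisRotation, axisRotation_add, neg_add_cancel] at this
  have h0 : ∀ y, axisRotation 0 y = y := fun y => by
    ext i; fin_cases i <;> simp [axisRotation_apply]
  rw [h0] at this
  have := congrArg (fun v : E3 => v 2) this
  simp only [e]
  rw [← this, axisRotation_apply]
  rfl

theorem IsMeridional.axialFlux_refl (h : IsMeridional σ w) {i : Fin 3} (hi : i ≠ 2) (x : E3) :
    axialFlux (fun y => w y 2) (coordReflection i x) = axialFlux (fun y => w y 2) x := by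
  refine intervalIntegral.integral_congr fun s _ => ?_
  have e : horizontalScale s (coordReflection i x) = coordReflection i (horizontalScale s x) := by
    ext j
    fin_cases j <;> fin_cases i <;> simp [horizontalScale, coordReflection_apply]
  have := congrFun (h.refl i hi) (coordReflection i (horizontalScale s x))
  rw [act_planeReflection, planeReflection_planeReflection] at this
  have := congrArg (fun v : E3 => v 2) this
  simp only [coordReflection_apply, hi.symm, if_false] at this
  simp only [e, ← this]

theorem norm_horizontalScale_le {s : ℝ} (h0 : 0 ≤ s) (h1 : s ≤ 1) (x : E3) :
    ‖horizontalScale s x‖ ≤ ‖x‖ := by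
  refine abs_le_of_sq_le_sq' ?_ (norm_nonneg _) |>.2
  rw [norm_sq_eq_sum_three, norm_sq_eq_sum_three]
  have hs : s ^ 2 ≤ 1 := pow_le_one₀ h0 h1
  simp [horizontalScale]
  nlinarith [sq_nonneg (x 0), sq_nonneg (x 1), mul_le_mul_of_nonneg_right hs (sq_nonneg (x 0)),
    mul_le_mul_of_nonneg_right hs (sq_nonneg (x 1))]

theorem axialFlux_eq_zero {g : E3 → ℝ} {x : E3}
    (h : ∀ s, 0 ≤ s → s ≤ 1 → g (horizontalScale s x) = 0) : axialFlux g x = 0 := by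
  rw [axialFlux, intervalIntegral.integral_congr (g := fun _ => (0 : ℝ))]
  · simp
  · intro s hs
    rw [uIcc_of_le zero_le_one] at hs
    simp [h s hs.1 hs.2]

theorem IsMeridional.smooth_flux (h : IsMeridional σ w) :
    ContDiff ℝ ∞ (axialFlux fun y => w y 2) :=
  contDiff_axialFlux (h.test.1.component 2).1

/-- Near the centre the discs defining the flux shrink within the hole of the support. Outside, off
the axis, the flux is constant along a vertical ray, because `∂₂` of it is proportional to a
horizontal component of `w`; far along the ray the whole disc misses the support. On the axis the
factors `x₀`, `x₁` vanish. -/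
theorem IsMeridional.isTestFunction_azimuthalPotential (h0 : 0 ≤ σ) (h : IsMeridional σ w) :
    IsTestFunction (shell σ) (azimuthalPotential w) := by
  obtain ⟨s₁, s₂, -, hs₁, hs₂0, hs₂, hr⟩ := exists_radii_of_compact h0 h.test.1.2.1 h.test.1.2.2
  have hz : ∀ x, ¬ (s₁ ≤ ‖x‖ ∧ ‖x‖ ≤ s₂) → w x = 0 := fun x hx =>
    image_eq_zero_of_notMem_tsupport fun hx' => hx (hr x hx')
  have hsm := h.smooth_flux
  refine isTestFunction_of_radii (contDiff_vec3 ((hsm.mul (contDiff_coord 1)).neg)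
    (hsm.mul (contDiff_coord 0)) contDiff_const) hs₁ hs₂ (fun x hx => ?_) fun x hx => ?_
  · have : axialFlux (fun y => w y 2) x = 0 := axialFlux_eq_zero fun s hs hs1 => by
      rw [hz _ fun h => by linarith [h.1, norm_horizontalScale_le hs hs1 x]]; rfl
    ext i; fin_cases i <;> simp [azimuthalPotential, this]
  · by_cases hax : x 0 = 0 ∧ x 1 = 0
    · ext i; fin_cases i <;> simp [azimuthalPotential, hax]
    -- The ray points away from the plane `x₂ = 0`, so that the norm does not decrease along it.
    obtain ⟨ς, hς, hςx⟩ : ∃ ς : ℝ, ς ^ 2 = 1 ∧ 0 ≤ ς * x 2 := by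
      rcases le_total 0 (x 2) with h | h
      · exact ⟨1, by norm_num, by linarith⟩
      · exact ⟨-1, by norm_num, by linarith⟩
    set γ : ℝ → E3 := fun τ => !₂[x 0, x 1, x 2 + τ * ς] with hγ
    have hnorm : ∀ τ, ‖γ τ‖ ^ 2 = ‖x‖ ^ 2 + (2 * τ * (ς * x 2) + τ ^ 2) := fun τ => by
      simp only [hγ, norm_sq_eq_sum_three]
      simp
      linear_combination τ ^ 2 * hς
    have hout : ∀ τ, 0 ≤ τ → s₂ < ‖γ τ‖ := fun τ hτ => by
      refine hx.trans_le (abs_le_of_sq_le_sq' ?_ (norm_nonneg _)).2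
      rw [hnorm]
      nlinarith [mul_nonneg hτ hςx, sq_nonneg τ]
    have hD : ∀ τ, 0 ≤ τ → pd 2 (axialFlux fun y => w y 2) (γ τ) = 0 := fun τ hτ => by
      have hw0 := hz (γ τ) fun h => by linarith [hout τ hτ, h.2]
      obtain ⟨e0, e1⟩ := horizontal_eq_pd_axialFlux (h.test.1.1.of_le (by simp))
        h.test.divergence h.horizontal (γ τ)
      rw [hw0] at e0 e1
      simp [hγ] at e0 e1
      by_contra hne
      exact hax ⟨e0.resolve_right hne, e1.resolve_right hne⟩
    have hder : ∀ τ, HasDerivAt (fun τ => axialFlux (fun y => w y 2) (γ τ))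
        (ς * pd 2 (axialFlux fun y => w y 2) (γ τ)) τ := fun τ => by
      have hγ' : HasDerivAt γ !₂[0, 0, ς] τ := hasDerivAt_vec3 (hasDerivAt_const _ _)
        (hasDerivAt_const _ _) (by simpa using ((hasDerivAt_id τ).mul_const ς).const_add (x 2))
      refine (hγ'.comp_curve (hsm.differentiable (by simp))).congr_deriv ?_
      simp [Fin.sum_univ_three]
    -- After a unit step the height is at least `1 > s₂`, so every scaled point lies outside the
    -- support; the mean value theorem compares the two ends.
    obtain ⟨c, hc, hc'⟩ := exists_hasDerivAt_eq_slope _ _ one_pos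
      (fun τ _ => (hder τ).continuousAt.continuousWithinAt) fun τ _ => hder τ
    rw [hD c hc.1.le, mul_zero, sub_zero, div_one] at hc'
    have hfar : axialFlux (fun y => w y 2) (γ 1) = 0 := axialFlux_eq_zero fun s hs hs1 => by
      have : s₂ < ‖horizontalScale s (γ 1)‖ := by
        refine hs₂.trans_le (abs_le_of_sq_le_sq' ?_ (norm_nonneg _)).2
        rw [norm_sq_eq_sum_three]
        simp [horizontalScale, hγ]
        nlinarith [sq_nonneg (s * x 0), sq_nonneg (s * x 1), sq_nonneg (x 2)]
      rw [hz _ fun h => by linarith [h.2]]; rfl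
    have hγ0 : γ 0 = x := by ext i; fin_cases i <;> simp [hγ]
    rw [hfar, hγ0] at hc'
    have : axialFlux (fun y => w y 2) x = 0 := by linarith
    ext i; fin_cases i <;> simp [azimuthalPotential, this]

theorem IsMeridional.pd_azimuthalPotential (h : IsMeridional σ w) (k : Fin 3) (x : E3) :
    pd k (fun y => azimuthalPotential w y 0) x =
      -(pd k (axialFlux fun y => w y 2) x * x 1 +
        axialFlux (fun y => w y 2) x * if 1 = k then 1 else 0) ∧
    pd k (fun y => azimuthalPotential w y 1) x =
      pd k (axialFlux fun y => w y 2) x * x 0 +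
        axialFlux (fun y => w y 2) x * (if 0 = k then 1 else 0) ∧
    pd k (fun y => azimuthalPotential w y 2) x = 0 := by
  have hd := h.smooth_flux.differentiable (by simp) x
  have hp : ∀ i : Fin 3, pd k (fun y : E3 => axialFlux (fun y => w y 2) y * y i) x =
      pd k (axialFlux fun y => w y 2) x * x i +
        axialFlux (fun y => w y 2) x * (if i = k then 1 else 0) := fun i => by
    have hc : DifferentiableAt ℝ (fun y : E3 => y i) x :=
      (contDiff_coord i (m := 1)).differentiable (by norm_num) x
    rw [← pd_coord i k x, pd, fderiv_fun_mul hd hc]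
    simp [pd]
    ring
  refine ⟨?_, hp 0, ?_⟩
  · rw [← hp 1]
    simp [azimuthalPotential, pd]
  · simp [azimuthalPotential, pd]

/-- The divergence is the derivative of the flux density along the rotation, under which the density
is invariant. -/
theorem IsMeridional.isSolenoidalTest_azimuthalPotential (h0 : 0 ≤ σ) (h : IsMeridional σ w) :
    IsSolenoidalTest (shell σ) (azimuthalPotential w) := by
  have hT := h.isTestFunction_azimuthalPotential h0
  refine ⟨hT, fun x => ?_⟩
  simp_rw [jacobian_apply (hT.differentiable x), Fin.sum_univ_three]
  rw [(h.pd_azimuthalPotential 0 x).1, (h.pd_azimuthalPotential 1 x).2.1,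
    (h.pd_azimuthalPotential 2 x).2.2]
  have hγ : HasDerivAt (fun t => axisRotation t x) !₂[-x 1, x 0, 0] 0 := by
    simp only [axisRotation_apply]
    refine hasDerivAt_vec3 ?_ ?_ (hasDerivAt_const _ _)
    · exact (((Real.hasDerivAt_cos 0).mul_const _).sub
        ((Real.hasDerivAt_sin 0).mul_const _)).congr_deriv (by simp)
    · exact (((Real.hasDerivAt_sin 0).mul_const _).add
        ((Real.hasDerivAt_cos 0).mul_const _)).congr_deriv (by simp)
  have h1 := hγ.comp_curve (h.smooth_flux.differentiable (by simp))
  simp_rw [h.axialFlux_rot] at h1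
  have h2 := h1.unique (hasDerivAt_const 0 _)
  have hr : axisRotation 0 x = x := by ext i; fin_cases i <;> simp [axisRotation_apply]
  rw [hr, Fin.sum_univ_three] at h2
  simp at h2 ⊢
  linarith

theorem IsMeridional.curl_azimuthalPotential (h0 : 0 ≤ σ) (h : IsMeridional σ w) :
    curl (azimuthalPotential w) = w := by
  have hT := h.isTestFunction_azimuthalPotential h0
  ext1 x
  rw [curl_apply hT.differentiable]
  simp_rw [(h.pd_azimuthalPotential _ x).1, (h.pd_azimuthalPotential _ x).2.1,
    (h.pd_azimuthalPotential _ x).2.2]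
  have h3 := two_mul_axialFlux ((h.test.1.component 2).1.of_le (by simp) : ContDiff ℝ 1 _) x
  obtain ⟨e0, e1⟩ := horizontal_eq_pd_axialFlux (h.test.1.1.of_le (by simp))
    h.test.divergence h.horizontal x
  ext i
  fin_cases i
  · simp [e0]; ring
  · simp [e1]; ring
  · simp; linarith

theorem IsMeridional.azimuthalPotential_odd (h : IsMeridional σ w) (x : E3) :
    azimuthalPotential w (coordReflection 1 x) 0 = - azimuthalPotential w x 0 ∧
    azimuthalPotential w (coordReflection 0 x) 1 = - azimuthalPotential w x 1 := by
  simp [azimuthalPotential, h.axialFlux_refl (show (1 : Fin 3) ≠ 2 by decide),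
    h.axialFlux_refl (show (0 : Fin 3) ≠ 2 by decide), coordReflection_apply]

end

end

noncomputable section

/-! ### The critical parity class -/

section
variable {σ μ : ℝ} {φ : ℕ → E3 → E3} {u : E3 → E3}

theorem HasParity.act_eq (hp : HasParity ![1, 1, -1] φ) {i : Fin 3} (hi : i ≠ 2) (j : ℕ) :
    act (coordReflection i) (φ j) = φ j := by
  have := hp i j
  fin_cases i
  · simpa using this
  · simpa using this
  · exact absurd rfl hi

theorem halfProfile_comp_isometry (σ : ℝ) (n : E3) (Q : E3 ≃ₗᵢ[ℝ] E3) {c : ℝ} {x : E3}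
    (h : inner ℝ n (Q x) = c * inner ℝ n x) : halfProfile σ n (Q x) = c * halfProfile σ n x := by
  rw [halfProfile, halfProfile, LinearIsometryEquiv.norm_map, h]
  ring

/-- In the critical class, stationary limits are invariant under horizontal reflections. -/
theorem ae_eq_act_of_horizontal (h0 : 0 ≤ σ) (h1 : σ < 1) (hμ : μ ≤ firstRoot σ ^ 2)
    (h : CritSeq σ μ φ u) (hp : HasParity ![1, 1, -1] φ) {n : E3} (hn : ‖n‖ = 1) (hn2 : n 2 = 0) :
    act (planeReflection n) u =ᵐ[volume] u := by
  set S := planeReflection n with hS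
  have hSx : ∀ x, S x = x - (2 * inner ℝ n x) • n := planeReflection_apply hn
  have hS2 : ∀ x, S x 2 = x 2 := fun x => by simp [hSx, hn2]
  have hc2 : ∀ x, S (coordReflection 2 x) = coordReflection 2 (S x) := fun x => by
    have e : inner ℝ n (coordReflection 2 x) = inner ℝ n x := by
      simp [inner_eq_sum_three, coordReflection_apply, hn2]
    rw [hSx, hSx, e]
    ext k
    fin_cases k <;> simp [coordReflection_apply, hn2]
  -- The half turn about the third axis. It leaves the class invariant and commutes with `S`, so it
  -- also fixes the `S`-odd part.
  set Q : E3 ≃ₗᵢ[ℝ] E3 := (coordReflection 1).trans (coordReflection 0) with hQ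
  have hQx : ∀ x, Q x = !₂[-x 0, -x 1, x 2] := fun x => by
    ext k; fin_cases k <;> simp [hQ, coordReflection_apply]
  have hcQ : ∀ x, S (Q x) = Q (S x) := fun x => by
    have e : inner ℝ n (Q x) = - inner ℝ n x := by
      simp [inner_eq_sum_three, hQx, hn2]; ring
    rw [hSx, hSx, e]
    ext k
    fin_cases k <;> simp [hQx, hn2] <;> ring
  -- In the `S`-odd part every component is odd in some plane: the horizontal ones in `x₂`, the
  -- third under `S`, which does not change third components.
  have hψ := h.parityPart S (-1)
  have a1 : ∀ j, act S (parityPart S (-1) (φ j)) = fun x => (-1 : ℝ) • parityPart S (-1) (φ j) x :=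
    fun j => act_parityPart n (by norm_num) _
  have a2 : ∀ j, act (coordReflection 2) (parityPart S (-1) (φ j)) =
      fun x => (-1 : ℝ) • parityPart S (-1) (φ j) x :=
    fun j => act_parityPart_of_comm hc2 (by simpa using hp 2 j)
  have a3 : ∀ j, act Q (parityPart S (-1) (φ j)) =
      fun x => (1 : ℝ) • parityPart S (-1) (φ j) x := fun j =>
    act_parityPart_of_comm hcQ (by
      rw [hQ, act_trans, hp.act_eq (by decide), hp.act_eq (by decide)]; simp)
  set m : Fin 3 → E3 := ![EuclideanSpace.single 2 1, EuclideanSpace.single 2 1, n] with hm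
  have hodd2 : ∀ (i : Fin 3) j x, i ≠ 2 →
      parityPart S (-1) (φ j) (coordReflection 2 x) i = - parityPart S (-1) (φ j) x i := by
    intro i j x hi
    have := congrFun (a2 j) x
    rw [act_planeReflection] at this
    have := congrArg (fun v : E3 => v i) this
    simpa [coordReflection_apply, hi] using this
  obtain ⟨⟨c, hc⟩, -⟩ := hψ.ae_eq_of_odd h0 h1 hμ (n := m)
    (by intro i; fin_cases i; exacts [norm_single_one 2, norm_single_one 2, hn]) (by
      intro i j x
      fin_cases i
      · exact hodd2 0 j x (by decide)
      · exact hodd2 1 j x (by decide)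
      · have := congrFun (a1 j) x
        rw [act_planeReflection] at this
        have := congrArg (fun v : E3 => v 2) this
        rw [← hS, hS2] at this
        have h2 : parityPart S (-1) (φ j) (S x) 2 = - parityPart S (-1) (φ j) x 2 := by
          simpa using this
        exact h2)
  have hQv : act Q (parityPart S (-1) u) =ᵐ[volume] parityPart S (-1) u := by
    refine (hψ.lim.act Q).unique ?_
    simp_rw [a3, one_smul]
    exact hψ.lim
  have hc' := fun i => Q.symm.measurePreserving.quasiMeasurePreserving.ae (hc i)
  have hQs : ∀ x, Q.symm x = Q x := fun x => by
    apply Q.injective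
    rw [LinearIsometryEquiv.apply_symm_apply]
    ext k; fin_cases k <;> simp [hQx]
  -- The identified components have the wrong parity under the half turn: multiples of `W x₂` are
  -- even where invariance demands odd, and multiples of `W ⟨n, x⟩` are odd where it demands even.
  -- So the `S`-odd part of `u` is zero.
  have hv0 : parityPart S (-1) u =ᵐ[volume] 0 := by
    filter_upwards [hQv, ae_all_iff.2 hc, ae_all_iff.2 hc'] with x b1 b2 b3
    rw [act, hQs] at b1
    rw [hQs] at b3
    have hi : ∀ i : Fin 3, i ≠ 2 → m i = EuclideanSpace.single 2 1 := fun i hi => by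
      fin_cases i <;> simp [hm] at hi ⊢
    have key : ∀ (i : Fin 3) (τ : ℝ), inner ℝ (m i) (Q x) = τ * inner ℝ (m i) x →
        parityPart S (-1) u (Q x) i = τ * parityPart S (-1) u x i := by
      intro i τ hτ
      rw [b3 i, b2 i]
      by_cases hx : x ∈ shell σ
      · rw [indicator_of_mem hx, indicator_of_mem ((mem_shell_comp_isometry Q).2 hx),
          halfProfile_comp_isometry σ _ Q hτ]
        ring
      · rw [indicator_of_notMem hx,
          indicator_of_notMem (fun h => hx ((mem_shell_comp_isometry Q).1 h)), mul_zero]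
    ext i
    have b4 := congrArg (fun v : E3 => v i) b1
    simp only [hQx (parityPart S (-1) u (Q x))] at b4
    fin_cases i
    · have := key 0 1 (by simp [hm, EuclideanSpace.inner_single_left, hQx])
      simp at b4 this ⊢
      linarith
    · have := key 1 1 (by simp [hm, EuclideanSpace.inner_single_left, hQx])
      simp at b4 this ⊢
      linarith
    · have := key 2 (-1) (by simp [hm, inner_eq_sum_three, hQx, hn2]; ring)
      simp at b4 this ⊢
      linarith
  filter_upwards [hv0] with x hx
  simp only [parityPart, Pi.zero_apply] at hx
  have := (smul_eq_zero.1 hx).resolve_left (by norm_num)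
  rw [neg_one_smul, ← sub_eq_add_neg, sub_eq_zero] at this
  exact this.symm

/-- The limit `u` is invariant under all rotations about the axis, so averaging loses no norm
asymptotically. The norm of the average is an average of pairings with rotated fields, to which
dominated convergence applies. -/
theorem tendsto_integral_rotationAverage (h0 : 0 ≤ σ) (h1 : σ < 1)
    (hμ : μ ≤ firstRoot σ ^ 2) (h : CritSeq σ μ φ u) (hp : HasParity ![1, 1, -1] φ) :
    Tendsto (fun j => ∫ x, ‖rotationAverage (φ j) x‖ ^ 2) atTop (𝓝 (∫ x, ‖u x‖ ^ 2)) := by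
  obtain ⟨C, hC⟩ := h.lim.exists_bound
  have hpi : (0 : ℝ) ≤ 2 * Real.pi := by positivity
  choose M hM using fun j => (h.test j).1.exists_bound
  simp_rw [← fun j => integral_inner_rotationAverage_self h0 (h.test j),
    fun j => integral_inner_rotationAverage (h.test j).1.1.continuous (hM j)
      (h.test j).1.1.continuous (h.test j).1.2.1]
  have hpt : ∀ t, Tendsto (fun j => ∫ x, inner ℝ (act (axisRotation t) (φ j) x) (φ j x)) atTop
      (𝓝 (∫ x, ‖u x‖ ^ 2)) := by
    intro t
    -- The class is invariant under the first reflection in the rotation, so only the second acts.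
    have e : ∀ j, act (axisRotation t) (φ j) =
        act (planeReflection !₂[Real.cos (t / 2), Real.sin (t / 2), 0]) (φ j) := fun j => by
      rw [axisRotation, act_trans, hp.act_eq (by decide)]
    simp_rw [e]
    have hs := ae_eq_act_of_horizontal h0 h1 hμ h hp (norm_horizontal (t / 2)) (by simp)
    have := (h.lim.act (planeReflection !₂[Real.cos (t / 2), Real.sin (t / 2), 0])).inner h.lim
    convert this using 2
    refine integral_congr_ae ?_
    filter_upwards [hs] with x hx
    rw [hx, real_inner_self_eq_norm_sq]
  have hlim : Tendsto (fun j => ∫ t in (0 : ℝ)..2 * Real.pi,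
      ∫ x, inner ℝ (act (axisRotation t) (φ j) x) (φ j x)) atTop
      (𝓝 (∫ _ in (0 : ℝ)..2 * Real.pi, ∫ x, ‖u x‖ ^ 2)) := by
    refine intervalIntegral.tendsto_integral_filter_of_dominated_convergence (fun _ => C) ?_ ?_
      intervalIntegrable_const (Eventually.of_forall fun t _ => hpt t)
    · refine Eventually.of_forall fun j => ?_
      rw [uIoc_of_le hpi]
      exact (integrable_inner_act_axisRotation (h.test j).1.1.continuous (hM j)
        (h.test j).1.1.continuous (h.test j).1.2.1).integral_prod_left.aestronglyMeasurable
    · refine Eventually.of_forall fun j => Eventually.of_forall fun t _ => ?_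
      have h2 := integral_inner_sq_le ((h.test j).act (axisRotation t)).1.memLp (h.test j).1.memLp
      have h3 : ∫ x, ‖act (axisRotation t) (φ j) x‖ ^ 2 = ∫ x, ‖φ j x‖ ^ 2 := by
        simp_rw [← real_inner_self_eq_norm_sq]
        exact integral_inner_act _ _ _
      rw [h3, ← sq] at h2
      have h4 : 0 ≤ ∫ x, ‖φ j x‖ ^ 2 := integral_nonneg fun x => by positivity
      exact (abs_le_of_sq_le_sq h2 h4).trans (hC j)
  have := hlim.const_mul (2 * Real.pi)⁻¹
  rw [intervalIntegral.integral_const, smul_eq_mul, sub_zero, ← mul_assoc,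
    inv_mul_cancel₀ (by positivity), one_mul] at this
  exact this

theorem volume_shell_pos (h0 : 0 ≤ σ) (h1 : σ < 1) : 0 < volume (shell σ) := by
  refine (isOpen_shell σ).measure_pos volume ⟨EuclideanSpace.single 0 ((σ + 1) / 2), ?_⟩
  have : ‖(EuclideanSpace.single 0 ((σ + 1) / 2) : E3)‖ = (σ + 1) / 2 := by
    simp [abs_of_nonneg (by linarith : 0 ≤ σ + 1)]
  simp only [shell, mem_ofPred_eq, this]
  exact ⟨fun _ => by linarith, by linarith⟩

theorem volume_shell_lt_top (σ : ℝ) : volume (shell σ) < ⊤ :=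
  (measure_mono fun x hx => by simpa using hx.2).trans_lt
    (measure_ball_lt_top (x := (0 : E3)) (r := 1))

theorem memLp_indicator_of_bound {F : Type*} [NormedAddCommGroup F] {f : E3 → F}
    (hf : AEStronglyMeasurable f (volume.restrict (shell σ))) {M : ℝ}
    (hM : ∀ x ∈ shell σ, ‖f x‖ ≤ M) : MemLp ((shell σ).indicator f) 2 volume := by
  refine memLp_indicator_shell ?_
  have : IsFiniteMeasure (volume.restrict (shell σ)) := ⟨by
    simpa using volume_shell_lt_top σ⟩
  exact MemLp.of_bound hf M ((ae_restrict_iff' (measurableSet_shell σ)).2 (ae_of_all _ hM))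

theorem memLp_indicator_inner (n : E3) :
    MemLp ((shell σ).indicator fun x => (inner ℝ n x : ℝ)) 2 volume := by
  refine memLp_indicator_of_bound (M := ‖n‖) (Continuous.aestronglyMeasurable
    (continuous_const.inner continuous_id)) fun x hx => ?_
  refine (norm_inner_le_norm n x).trans ?_
  exact mul_le_of_le_one_right (norm_nonneg _) hx.2.le

/-- The pairing of `W(|x|) ⟨n, x⟩` with `⟨n, x⟩` does not vanish. -/
theorem eq_zero_of_integral_halfProfile (h0 : 0 ≤ σ) (h1 : σ < 1) {n : E3} (hn : ‖n‖ = 1)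
    {f : E3 → ℝ} (hf : MemLp f 2 volume) {c : ℝ}
    (hc : f =ᵐ[volume] (shell σ).indicator fun x => c * halfProfile σ n x)
    (hi : ∫ x, f x * (shell σ).indicator (fun x => (inner ℝ n x : ℝ)) x = 0) : f =ᵐ[volume] 0 := by
  rcases eq_or_ne c 0 with rfl | hc0
  · filter_upwards [hc] with x hx
    rw [hx]
    simp
  exfalso
  set g : E3 → ℝ := (shell σ).indicator fun x => halfProfile σ n x * inner ℝ n x with hg
  have hpos : ∀ x ∈ shell σ, (inner ℝ n x : ℝ) ≠ 0 → 0 < halfProfile σ n x * inner ℝ n x := by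
    intro x hx hl
    obtain ⟨hr, hr1⟩ := norm_mem_of_mem_shell h0 hx fun h => hl (by simp [h])
    have := profile_pos h0 h1 hr hr1
    rw [halfProfile, mul_assoc]
    exact mul_pos this (mul_self_pos.2 hl)
  have hg0 : ∀ x, 0 ≤ g x := fun x => by
    by_cases hx : x ∈ shell σ
    · rw [hg, indicator_of_mem hx]
      by_cases hl : (inner ℝ n x : ℝ) = 0
      · simp [hl]
      · exact (hpos x hx hl).le
    · rw [hg, indicator_of_notMem hx]
  have hfg : (fun x => f x * (shell σ).indicator (fun x => (inner ℝ n x : ℝ)) x) =ᵐ[volume]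
      fun x => c * g x := by
    filter_upwards [hc] with x hx
    rw [hx]
    by_cases hxs : x ∈ shell σ
    · simp [hg, hxs, mul_assoc]
    · simp [hg, hxs]
  have hint : Integrable fun x => f x * (shell σ).indicator (fun x => (inner ℝ n x : ℝ)) x := by
    have := integrable_inner_of_memLp hf (memLp_indicator_inner (σ := σ) n)
    simpa [mul_comm] using this
  have hgi : Integrable g := by
    have := (hint.congr hfg).const_mul c⁻¹
    simpa [← mul_assoc, hc0] using this
  rw [integral_congr_ae hfg, integral_const_mul, mul_eq_zero, or_iff_right hc0,
    integral_eq_zero_iff_of_nonneg hg0 hgi] at hi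
  have hn0 : n ≠ 0 := fun h => by rw [h, norm_zero] at hn; exact zero_ne_one hn
  refine (volume_shell_pos h0 h1).ne' (measure_mono_null (fun x hx => ?_)
    (hi.and (ae_inner_ne_zero hn0)))
  rintro ⟨h2, h3⟩
  have := hpos x hx h3
  rw [hg, indicator_of_mem hx] at h2
  exact this.ne' h2

/-- Let `w = curl A` be the average of `φ`, `I = ∫ |w|²`, `a = ∫ |A|²`, `D = ∫ |∇φ|²`, `λ = κ²`.
Picone for `A` gives `I - λ a = E₀ + E₁ ≥ 0`. Since `∫ curl φ · A = I`, expanding `∫ |λ A - curl φ|²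
≥ 0` yields `λ (E₀ + E₁) ≤ D - λ I`. In the limit the right side is `(μ - λ) ∫ |u|² ≤ 0`, so the
estimates become sharp: `A` converges, its components are multiples of `W x₁` and `W x₀`, and
orthogonality of curls to linear functions makes these multiples zero. Then `I = E₀ + E₁ + λ a`
tends to zero. -/
theorem ae_eq_zero_of_third_class (h0 : 0 ≤ σ) (h1 : σ < 1) (hμ : μ ≤ firstRoot σ ^ 2)
    (h : CritSeq σ μ φ u) (hp : HasParity ![1, 1, -1] φ) : u =ᵐ[volume] 0 := by
  set lam := firstRoot σ ^ 2 with hlam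
  have hlam0 : 0 < lam := by have := firstRoot_pos σ; positivity
  set w : ℕ → E3 → E3 := fun j => rotationAverage (φ j) with hw
  have hM : ∀ j, IsMeridional σ (w j) := fun j =>
    ⟨(h.test j).rotationAverage h0, act_rotationAverage (h.test j).1.1.continuous, fun i hi =>
      coordReflection_rotationAverage (h.test j).1.1.continuous hi (hp.act_eq hi j)⟩
  set A : ℕ → E3 → E3 := fun j => azimuthalPotential (w j) with hA
  have hAt : ∀ j, IsSolenoidalTest (shell σ) (A j) := fun j =>
    (hM j).isSolenoidalTest_azimuthalPotential h0
  have hAc : ∀ j, curl (A j) = w j := fun j => (hM j).curl_azimuthalPotential h0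
  set I : ℕ → ℝ := fun j => ∫ x, ‖w j x‖ ^ 2 with hI
  set N : ℝ := ∫ x, ‖u x‖ ^ 2 with hN
  have hN0 : 0 ≤ N := integral_nonneg fun x => by positivity
  have hIlim : Tendsto I atTop (𝓝 N) := tendsto_integral_rotationAverage h0 h1 hμ h hp
  set a : ℕ → ℝ := fun j => ∫ x, ‖A j x‖ ^ 2 with ha
  set E : Fin 3 → ℕ → ℝ := fun i j =>
    ∫ x, (∑ k, pd k (fun y => A j y i) x ^ 2 - lam * A j x i ^ 2) with hE
  have hEsum : ∀ j, ∑ i, E i j = I j - lam * a j := fun j => by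
    rw [hE, ← dirichlet_sub_eq_sum (hAt j).1, ← (hAt j).integral_normSq_curl, hAc]
  have hA2 : ∀ j x, A j x 2 = 0 := fun j x => by simp [hA, azimuthalPotential]
  have hE2 : ∀ j, E 2 j = 0 := fun j => by simp [hE, hA2, pd]
  have hE0 : ∀ j, 0 ≤ E 0 j := fun j => energy_nonneg h0 h1 (norm_single_one 1)
    ((hAt j).1.component 0) fun x => ((hM j).azimuthalPotential_odd x).1
  have hE1 : ∀ j, 0 ≤ E 1 j := fun j => energy_nonneg h0 h1 (norm_single_one 0)
    ((hAt j).1.component 1) fun x => ((hM j).azimuthalPotential_odd x).2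
  simp_rw [Fin.sum_univ_three, hE2, add_zero] at hEsum
  set D : ℕ → ℝ := fun j => dirichlet (φ j) (φ j) with hD
  have hDlim : Tendsto D atTop (𝓝 (μ * N)) := h.tendsto_dirichlet
  have hIc : ∀ j, ∫ x, inner ℝ (curl (φ j) x) (A j x) = I j := fun j => by
    rw [← integral_inner_curl (h.test j).1 (hAt j).1, hAc]
    refine Eq.trans ?_ (integral_inner_rotationAverage_self h0 (h.test j))
    exact integral_congr_ae (Eventually.of_forall fun x => real_inner_comm _ _)
  have hdef : ∀ j, ∫ x, ‖lam • A j x - curl (φ j) x‖ ^ 2 = D j - 2 * lam * I j + lam ^ 2 * a j := by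
    intro j
    have e : ∀ x, ‖lam • A j x - curl (φ j) x‖ ^ 2 = lam ^ 2 * ‖A j x‖ ^ 2 +
        (-(2 * lam)) * inner ℝ (curl (φ j) x) (A j x) + ‖curl (φ j) x‖ ^ 2 := fun x => by
      rw [norm_sub_sq_real, norm_smul, real_inner_smul_left, real_inner_comm, mul_pow,
        Real.norm_eq_abs, sq_abs]
      ring
    have i1 : Integrable fun x => ‖A j x‖ ^ 2 :=
      (memLp_two_iff_integrable_sq_norm (hAt j).1.memLp.1).1 (hAt j).1.memLp
    have i2 : Integrable fun x => ‖curl (φ j) x‖ ^ 2 :=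
      (memLp_two_iff_integrable_sq_norm (h.test j).1.curl.memLp.1).1 (h.test j).1.curl.memLp
    have i3 := integrable_inner_of_memLp (h.test j).1.curl.memLp (hAt j).1.memLp
    have i4 : Integrable fun x => lam ^ 2 * ‖A j x‖ ^ 2 +
        (-(2 * lam)) * inner ℝ (curl (φ j) x) (A j x) := (i1.const_mul _).add (i3.const_mul _)
    simp_rw [e]
    rw [integral_add i4 i2,
      integral_add (i1.const_mul _) (i3.const_mul _), integral_const_mul, integral_const_mul,
      hIc, (h.test j).integral_normSq_curl]
    ring
  have hdef0 : ∀ j, 0 ≤ D j - 2 * lam * I j + lam ^ 2 * a j := fun j => by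
    rw [← hdef]
    exact integral_nonneg fun x => by positivity
  have hla : ∀ j, lam * a j ≤ I j := fun j => by linarith [hEsum j, hE0 j, hE1 j]
  have hDI : Tendsto (fun j => D j - lam * I j) atTop (𝓝 (μ * N - lam * N)) :=
    hDlim.sub (hIlim.const_mul lam)
  have hEle : ∀ j, lam * (E 0 j + E 1 j) ≤ D j - lam * I j := fun j => by
    rw [hEsum]; linarith [hdef0 j]
  have hge : 0 ≤ μ * N - lam * N := ge_of_tendsto' hDI fun j =>
    (mul_nonneg hlam0.le (add_nonneg (hE0 j) (hE1 j))).trans (hEle j)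
  have heq : μ * N - lam * N = 0 := le_antisymm (by nlinarith) hge
  rw [heq] at hDI
  have hDI' := hDI.const_mul lam⁻¹
  rw [mul_zero] at hDI'
  have hEs : ∀ j, E 0 j + E 1 j ≤ lam⁻¹ * (D j - lam * I j) := fun j => by
    rw [← div_eq_inv_mul, le_div_iff₀' hlam0]; exact hEle j
  have hE0lim : Tendsto (E 0) atTop (𝓝 0) :=
    squeeze_zero hE0 (fun j => by linarith [hEs j, hE1 j]) hDI'
  have hE1lim : Tendsto (E 1) atTop (𝓝 0) :=
    squeeze_zero hE1 (fun j => by linarith [hEs j, hE0 j]) hDI'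
  obtain ⟨G, hG⟩ := h.jac
  have hω : L2Lim (fun j => curl (φ j)) (fun x => curlMap (G x)) :=
    hG.clm_comp (LinearMap.toContinuousLinearMap curlMap)
  -- Sharpness makes `λ A - curl φ` a null sequence, so `A` inherits convergence from the Jacobians
  -- of `φ`.
  have hdl : L2Lim (fun j x => lam • A j x - curl (φ j) x) (fun _ => 0) := by
    refine (l2Lim_iff (fun j => ((hAt j).1.const_smul lam).memLp.sub (h.test j).1.curl.memLp)
      MemLp.zero').2 ?_
    have e : ∀ j, ∫ x, ‖lam • A j x - curl (φ j) x - 0‖ ^ 2 =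
        D j - 2 * lam * I j + lam ^ 2 * a j := fun j => by
      rw [← hdef]
      simp only [sub_zero]
    refine Tendsto.congr (fun j => (e j).symm) ?_
    refine squeeze_zero hdef0 (fun j => ?_) hDI
    nlinarith [hla j]
  set B : E3 → E3 := fun x => lam⁻¹ • curlMap (G x) with hB
  have hAlim : L2Lim A B := by
    have := (hdl.add hω).const_smul lam⁻¹
    simpa [smul_smul, inv_mul_cancel₀ hlam0.ne'] using this
  -- The limit of `A` is a multiple of a limit of curls, and these are orthogonal to the coordinate
  -- functions.
  have hpair : ∀ i k : Fin 3, ∫ x, B x i *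
      (shell σ).indicator (fun x => (inner ℝ (EuclideanSpace.single k (1 : ℝ)) x : ℝ)) x = 0 := by
    intro i k
    have hωi : L2Lim (fun j x => curl (φ j) x i) (fun x => curlMap (G x) i) :=
      hω.clm_comp (EuclideanSpace.proj i : E3 →L[ℝ] ℝ)
    have h2 := hωi.inner (l2Lim_const (memLp_indicator_inner (σ := σ) (EuclideanSpace.single k 1)))
    have h3 : ∀ j, ∫ x, inner ℝ (curl (φ j) x i)
        ((shell σ).indicator (fun x => (inner ℝ (EuclideanSpace.single k (1 : ℝ)) x : ℝ)) x) = 0 := by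
      intro j
      rw [← (h.test j).integral_curl_mul_coord k i]
      refine integral_congr_ae (Eventually.of_forall fun x => ?_)
      by_cases hx : x ∈ shell σ
      · simp [hx, EuclideanSpace.inner_single_left, mul_comm]
      · simp [hx, (h.test j).1.curl.eq_zero hx]
    simp_rw [h3] at h2
    have h4 := tendsto_nhds_unique h2 tendsto_const_nhds
    simp only [hB, PiLp.smul_apply, smul_eq_mul, mul_assoc, integral_const_mul]
    rw [mul_eq_zero]
    right
    rw [← h4]
    simp [mul_comm]
  have hBi : ∀ i, L2Lim (fun j x => A j x i) (fun x => B x i) := fun i =>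
    hAlim.clm_comp (EuclideanSpace.proj i : E3 →L[ℝ] ℝ)
  have hB0 : (fun x => B x 0) =ᵐ[volume] 0 := by
    obtain ⟨c, hc⟩ := ae_eq_halfProfile_of_energy_tendsto h0 h1 (norm_single_one 1)
      (fun j => (hAt j).1.component 0) (fun j x => ((hM j).azimuthalPotential_odd x).1) (hBi 0)
      hE0lim
    exact eq_zero_of_integral_halfProfile h0 h1 (norm_single_one 1) (hBi 0).memLp hc (hpair 0 1)
  have hB1 : (fun x => B x 1) =ᵐ[volume] 0 := by
    obtain ⟨c, hc⟩ := ae_eq_halfProfile_of_energy_tendsto h0 h1 (norm_single_one 0)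
      (fun j => (hAt j).1.component 1) (fun j x => ((hM j).azimuthalPotential_odd x).2) (hBi 1)
      hE1lim
    exact eq_zero_of_integral_halfProfile h0 h1 (norm_single_one 0) (hBi 1).memLp hc (hpair 1 0)
  have hB2 : (fun x => B x 2) =ᵐ[volume] 0 := by
    refine (hBi 2).unique ?_
    simp_rw [hA2]
    exact l2Lim_const MemLp.zero'
  have ha0 : Tendsto a atTop (𝓝 0) := by
    have h2 := hAlim.normSq
    have h3 : ∫ x, ‖B x‖ ^ 2 = 0 := by
      refine integral_eq_zero_of_ae ?_
      filter_upwards [hB0, hB1, hB2] with x b0 b1 b2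
      simp only [Pi.zero_apply] at b0 b1 b2
      rw [norm_sq_eq_sum_three, b0, b1, b2]
      simp
    rwa [h3] at h2
  have hI0 : Tendsto I atTop (𝓝 0) := by
    have h2 := (hE0lim.add hE1lim).add (ha0.const_mul lam)
    rw [mul_zero, add_zero, add_zero] at h2
    refine h2.congr fun j => ?_
    rw [hEsum]
    ring
  exact integral_normSq_eq_zero h.lim.memLp (tendsto_nhds_unique hIlim hI0)

theorem CritSeq.isRadialLinear (h0 : 0 ≤ σ) (h1 : σ < 1) (hμ : μ ≤ firstRoot σ ^ 2)
    (h : CritSeq σ μ φ u) : IsRadialLinear σ μ u :=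
  isRadialLinear_of_third_class h0 h1 hμ
    (fun _ _ h hp => ae_eq_zero_of_third_class h0 h1 hμ h hp) h

end

end

noncomputable section

/-! ### Solenoidal radial-linear fields -/

section
variable {σ μ : ℝ} {φ : ℕ → E3 → E3} {u : E3 → E3}

theorem integral_radial_mul_coord_of_ne (f : ℝ → ℝ) {i j : Fin 3} (h : i ≠ j) :
    ∫ x : E3, f ‖x‖ * (x i * x j) = 0 := by
  have e := integral_comp_isometry (coordReflection i) fun x : E3 => f ‖x‖ * (x i * x j)
  simp only [LinearIsometryEquiv.norm_map, coordReflection_apply, if_true, h.symm, if_false,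
    neg_mul, mul_neg, integral_neg] at e
  linarith

theorem integral_radial_mul_coord_sq (f : ℝ → ℝ) (i j : Fin 3) :
    ∫ x : E3, f ‖x‖ * (x i * x i) = ∫ x : E3, f ‖x‖ * (x j * x j) := by
  have e := integral_comp_isometry (coordSwap i j) fun x : E3 => f ‖x‖ * (x i * x i)
  simp only [LinearIsometryEquiv.norm_map, coordSwap_apply, Equiv.swap_apply_left] at e
  exact e.symm

/-- The profile, extended by zero. -/
def shellProfile (σ r : ℝ) : ℝ := if (0 < σ → σ < r) ∧ r < 1 then profile σ r else 0

theorem shellProfile_of_mem {x : E3} (hx : x ∈ shell σ) : shellProfile σ ‖x‖ = profile σ ‖x‖ :=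
  if_pos hx

theorem shellProfile_of_notMem {x : E3} (hx : x ∉ shell σ) : shellProfile σ ‖x‖ = 0 :=
  if_neg hx

theorem indicator_profile (σ : ℝ) (g : E3 → ℝ) (x : E3) :
    (shell σ).indicator (fun x => profile σ ‖x‖ * g x) x = shellProfile σ ‖x‖ * g x := by
  by_cases hx : x ∈ shell σ
  · rw [indicator_of_mem hx, shellProfile_of_mem hx]
  · rw [indicator_of_notMem hx, shellProfile_of_notMem hx, zero_mul]

theorem measurable_shellProfile (σ : ℝ) : Measurable (shellProfile σ) := by
  unfold shellProfile
  refine Measurable.ite ?_ ?_ measurable_const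
  · by_cases h : 0 < σ
    · simp only [h, true_imp_iff]
      exact (measurableSet_Ioi (a := σ)).inter (measurableSet_Iio (a := (1 : ℝ)))
    · simp only [h, false_imp_iff, true_and]
      exact measurableSet_Iio
  · unfold profile radialNum
    fun_prop

theorem exists_shellProfile_bound (h0 : 0 ≤ σ) : ∃ M, 0 < M ∧ ∀ r, 0 ≤ r → |shellProfile σ r| ≤ M := by
  obtain ⟨M, hM, hb⟩ := exists_profile_bound h0
  refine ⟨M, hM, fun r hr => ?_⟩
  unfold shellProfile
  split_ifs with h
  · rcases hr.eq_or_lt with rfl | hr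
    · simp [profile, hM.le]
    · refine (hb r ?_ h.2).1
      rcases h0.eq_or_lt with h' | h'
      · rw [← h']; exact hr
      · exact h.1 h'
  · simpa using hM.le

theorem integrable_shellProfile_mul_coord (h0 : 0 ≤ σ) (i j : Fin 3) :
    Integrable fun x : E3 => shellProfile σ ‖x‖ * (x i * x j) := by
  obtain ⟨M, hM, hb⟩ := exists_shellProfile_bound h0
  have h1 := memLp_indicator_inner (σ := σ) (EuclideanSpace.single i 1)
  have h2 : MemLp ((shell σ).indicator fun x => shellProfile σ ‖x‖ * x j) 2 volume := by
    refine memLp_indicator_of_bound (M := M) ?_ fun x hx => ?_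
    · exact ((measurable_shellProfile σ).comp measurable_norm).aestronglyMeasurable.mul
        (contDiff_coord j (m := 0)).continuous.aestronglyMeasurable
    · rw [norm_mul]
      refine (mul_le_mul (hb _ (norm_nonneg x)) ((PiLp.norm_apply_le x j).trans hx.2.le)
        (norm_nonneg _) hM.le).trans_eq (mul_one M)
  refine (integrable_inner_of_memLp h1 h2).congr (Eventually.of_forall fun x => ?_)
  by_cases hx : x ∈ shell σ
  · simp [hx, EuclideanSpace.inner_single_left]; ring
  · have : shellProfile σ ‖x‖ = 0 := if_neg hx
    simp [hx, this]

theorem integral_shellProfile_pos (h0 : 0 ≤ σ) (h1 : σ < 1) (i : Fin 3) :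
    ∫ x : E3, shellProfile σ ‖x‖ * (x i * x i) ≠ 0 := by
  intro hi
  set f : E3 → ℝ := (shell σ).indicator fun x => 1 * halfProfile σ (EuclideanSpace.single i 1) x
    with hf
  have hfx : ∀ x, f x = shellProfile σ ‖x‖ * x i := fun x => by
    rw [← indicator_profile σ (fun x => x i), hf]
    congr 1
    ext1 y
    simp [halfProfile, EuclideanSpace.inner_single_left]
  obtain ⟨M, hM, hb⟩ := exists_shellProfile_bound h0
  have hfL : MemLp f 2 volume := by
    refine memLp_indicator_of_bound (M := M) ?_ fun x hx => ?_
    · have : (fun x => 1 * halfProfile σ (EuclideanSpace.single i 1) x) =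
        fun x : E3 => profile σ ‖x‖ * x i := by
        ext1 y; simp [halfProfile, EuclideanSpace.inner_single_left]
      rw [this]
      refine Measurable.aestronglyMeasurable (Measurable.mul ?_
        (contDiff_coord i (m := 0)).continuous.measurable)
      unfold profile radialNum
      fun_prop
    · have := hfx x
      rw [hf, indicator_of_mem hx] at this
      rw [this, norm_mul]
      refine (mul_le_mul (hb _ (norm_nonneg x)) ((PiLp.norm_apply_le x i).trans hx.2.le)
        (norm_nonneg _) hM.le).trans_eq (mul_one M)
  have hz := eq_zero_of_integral_halfProfile h0 h1 (norm_single_one i) hfL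
    (Eventually.of_forall fun x => rfl) (by
      rw [← hi]
      refine integral_congr_ae (Eventually.of_forall fun x => ?_)
      simp only [hfx]
      by_cases hx : x ∈ shell σ
      · simp [hx, EuclideanSpace.inner_single_left]; ring
      · have : shellProfile σ ‖x‖ = 0 := if_neg hx
        simp [this])
  refine (volume_shell_pos h0 h1).ne' (measure_mono_null (fun x hx => ?_)
    (hz.and (ae_inner_ne_zero (n := EuclideanSpace.single i (1 : ℝ)) (by simp))))
  rintro ⟨h2, h3⟩
  have hxi : x i ≠ 0 := by simpa [EuclideanSpace.inner_single_left] using h3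
  obtain ⟨hr, hr1⟩ := norm_mem_of_mem_shell h0 hx fun h => hxi (by simp [h])
  have h4 : shellProfile σ ‖x‖ = profile σ ‖x‖ := if_pos hx
  rw [hfx, h4] at h2
  exact (mul_ne_zero (profile_pos h0 h1 hr hr1).ne' hxi) h2

/-- The matrix of a solenoidal radial-linear field is antisymmetric. -/
theorem antisymm_of_solenoidal (h0 : 0 ≤ σ) (h1 : σ < 1)
    (ht : ∀ j, IsSolenoidalTest (shell σ) (φ j)) (hlim : L2Lim φ u) {C : Fin 3 → Fin 3 → ℝ}
    (hC : ∀ i, (fun x => u x i) =ᵐ[volume]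
      (shell σ).indicator fun x => profile σ ‖x‖ * ∑ k, C i k * x k) (i j : Fin 3) :
    C i j + C j i = 0 := by
  have hcomp : ∀ i : Fin 3, L2Lim (fun n x => φ n x i) (fun x => u x i) := fun i =>
    hlim.clm_comp (EuclideanSpace.proj i : E3 →L[ℝ] ℝ)
  have hint : ∀ (n : ℕ) (i j : Fin 3), Integrable fun x => φ n x i * x j := fun n i j =>
    ((ht n).1.component i).integrable_mul (contDiff_coord j (m := 0)).continuous
  have hpair : ∀ i j : Fin 3, Tendsto (fun n => ∫ x, φ n x i * x j) atTop
      (𝓝 (C i j * ∫ x : E3, shellProfile σ ‖x‖ * (x 0 * x 0))) := by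
    intro i j
    have h2 := (hcomp i).inner (l2Lim_const (memLp_indicator_inner (σ := σ)
      (EuclideanSpace.single j 1)))
    have e1 : ∀ n, ∫ x, inner ℝ (φ n x i)
        ((shell σ).indicator (fun x => (inner ℝ (EuclideanSpace.single j (1 : ℝ)) x : ℝ)) x) =
        ∫ x, φ n x i * x j := fun n => by
      refine integral_congr_ae (Eventually.of_forall fun x => ?_)
      by_cases hx : x ∈ shell σ
      · simp [hx, EuclideanSpace.inner_single_left, mul_comm]
      · simp [hx, (ht n).1.eq_zero hx]
    have e2 : ∫ x, inner ℝ (u x i)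
        ((shell σ).indicator (fun x => (inner ℝ (EuclideanSpace.single j (1 : ℝ)) x : ℝ)) x) =
        C i j * ∫ x : E3, shellProfile σ ‖x‖ * (x 0 * x 0) := by
      have e3 : ∫ x, inner ℝ (u x i)
          ((shell σ).indicator (fun x => (inner ℝ (EuclideanSpace.single j (1 : ℝ)) x : ℝ)) x) =
          ∫ x : E3, ∑ k, C i k * (shellProfile σ ‖x‖ * (x k * x j)) := by
        refine integral_congr_ae ?_
        filter_upwards [hC i] with x hx
        rw [hx, indicator_profile]
        by_cases hxs : x ∈ shell σ
        · simp [hxs, EuclideanSpace.inner_single_left, Finset.mul_sum]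
          exact Finset.sum_congr rfl fun k _ => by ring
        · have : shellProfile σ ‖x‖ = 0 := if_neg hxs
          simp [this]
      rw [e3, integral_finsetSum _ fun k _ =>
        (integrable_shellProfile_mul_coord h0 k j).const_mul _]
      simp_rw [integral_const_mul]
      rw [Finset.sum_eq_single j]
      · rw [integral_radial_mul_coord_sq (shellProfile σ) j 0]
      · intro k _ hk
        rw [integral_radial_mul_coord_of_ne _ hk, mul_zero]
      · simp
    simp_rw [e1] at h2
    rwa [e2] at h2
  -- The symmetric part of the first moments is the pairing with the gradient of `x_i x_j`.
  have hz : ∀ n, (∫ x, φ n x i * x j) + ∫ x, φ n x j * x i = 0 := by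
    intro n
    have h2 := (ht n).integral_mul_gradient (η := fun x => x i * x j)
      ((contDiff_coord i).mul (contDiff_coord j))
    rw [← integral_add (hint n i j) (hint n j i), ← h2]
    refine integral_congr_ae (Eventually.of_forall fun x => ?_)
    have hp : ∀ k, pd k (fun x : E3 => x i * x j) x =
        (if i = k then x j else 0) + (if j = k then x i else 0) := fun k => by
      have hi : DifferentiableAt ℝ (fun y : E3 => y i) x :=
        (contDiff_coord i (m := 1)).differentiable (by norm_num) x
      have hj : DifferentiableAt ℝ (fun y : E3 => y j) x :=
        (contDiff_coord j (m := 1)).differentiable (by norm_num) x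
      have ei := pd_coord i k x
      have ej := pd_coord j k x
      rw [pd] at ei ej
      rw [pd, fderiv_fun_mul hi hj]
      simp only [add_apply, smul_apply, smul_eq_mul, ei, ej]
      split_ifs <;> ring
    simp [hp, mul_add, Finset.sum_add_distrib]
  have h2 := (hpair i j).add (hpair j i)
  simp_rw [hz] at h2
  have h3 := tendsto_nhds_unique h2 tendsto_const_nhds
  rw [← add_mul] at h3
  exact (mul_eq_zero.1 h3).resolve_right (integral_shellProfile_pos h0 h1 0)

end

end

noncomputable section

/-! ### Cut-off eigenfunctions -/

section
variable {σ : ℝ}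

theorem l2Lim_of_bounded {φ : ℕ → E3 → ℝ} {f : E3 → ℝ}
    (hm : ∀ j, AEStronglyMeasurable (φ j) volume) {M : ℝ}
    (hM : ∀ j, ∀ᵐ x, |φ j x| ≤ (shell σ).indicator (fun _ => M) x)
    (hlim : ∀ᵐ x, Tendsto (fun j => φ j x) atTop (𝓝 (f x))) : L2Lim φ f := by
  have hc : MemLp ((shell σ).indicator fun _ : E3 => M) 2 volume :=
    memLp_indicator_of_bound aestronglyMeasurable_const (M := |M|) fun x _ => le_rfl
  have hmf : AEStronglyMeasurable f volume := aestronglyMeasurable_of_tendsto_ae atTop hm hlim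
  have hfM : ∀ᵐ x, |f x| ≤ (shell σ).indicator (fun _ => M) x := by
    filter_upwards [hlim, ae_all_iff.2 hM] with x h1 h2
    exact le_of_tendsto' h1.abs h2
  have h1 : ∀ j, MemLp (φ j) 2 volume := fun j => hc.mono' (hm j) (hM j)
  have h2 : MemLp f 2 volume := hc.mono' hmf hfM
  refine (l2Lim_iff h1 h2).2 ?_
  have hb : Integrable fun x => (2 * (shell σ).indicator (fun _ : E3 => M) x) ^ 2 := by
    have := (hc.const_mul 2).integrable_sq
    exact this
  have := tendsto_integral_of_dominated_convergence (F := fun j x => ‖φ j x - f x‖ ^ 2)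
    (f := fun _ => (0 : ℝ)) _ (fun j => ((h1 j).sub h2).1.norm.pow 2) hb (fun j => by
      filter_upwards [hM j, hfM] with x a b
      rw [norm_pow, norm_norm, Real.norm_eq_abs]
      exact pow_le_pow_left₀ (abs_nonneg _) ((abs_sub _ _).trans (by linarith)) 2) (by
      filter_upwards [hlim] with x hx
      have h3 : Tendsto (fun j => φ j x - f x) atTop (𝓝 0) := by
        simpa using hx.sub_const (f x)
      simpa using h3.norm.pow 2)
  simpa using this

theorem exists_deriv_smoothTransition_bound : ∃ K, 0 < K ∧
    ∀ y, |deriv Real.smoothTransition y| ≤ K ∧ (1 < y → deriv Real.smoothTransition y = 0) := by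
  have hc : Continuous (deriv Real.smoothTransition) :=
    (Real.smoothTransition.contDiff (n := 1)).continuous_deriv le_rfl
  obtain ⟨K, hK⟩ := (isCompact_Icc (a := (0 : ℝ)) (b := 1)).exists_bound_of_continuousOn
    hc.continuousOn
  have h1 : ∀ y : ℝ, 1 < y → deriv Real.smoothTransition y = 0 := fun y hy => by
    have : Real.smoothTransition =ᶠ[𝓝 y] fun _ => (1 : ℝ) := by
      filter_upwards [lt_mem_nhds hy] with z hz using Real.smoothTransition.one_of_one_le hz.le
    rw [this.deriv_eq, deriv_const]
  have h2 : ∀ y : ℝ, y < 0 → deriv Real.smoothTransition y = 0 := fun y hy => by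
    have : Real.smoothTransition =ᶠ[𝓝 y] fun _ => (0 : ℝ) := by
      filter_upwards [gt_mem_nhds hy] with z hz using Real.smoothTransition.zero_of_nonpos hz.le
    rw [this.deriv_eq, deriv_const]
  refine ⟨max K 1, by positivity, fun y => ⟨?_, h1 y⟩⟩
  rcases lt_or_ge y 0 with h | h
  · rw [h2 y h]; simp
  rcases lt_or_ge 1 y with h' | h'
  · rw [h1 y h']; simp
  · exact (hK y ⟨h, h'⟩).trans (le_max_left _ _)

/-- The cut-off factor. -/
def cutFactor (σ ε r : ℝ) : ℝ := Real.smoothTransition (2 * (r * profile σ r) / ε - 1)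

/-- The derivative of the cut-off factor. -/
def cutFactorDeriv (σ ε r : ℝ) : ℝ :=
  deriv Real.smoothTransition (2 * (r * profile σ r) / ε - 1) *
    (2 * (profile σ r + r * profileDeriv σ r) / ε)

theorem hasDerivAt_cutFactor {ε r : ℝ} (hr : r ≠ 0) :
    HasDerivAt (cutFactor σ ε) (cutFactorDeriv σ ε r) r := by
  have h1 : HasDerivAt (fun r => 2 * (r * profile σ r) / ε - 1)
      (2 * (profile σ r + r * profileDeriv σ r) / ε) r :=
    (((((hasDerivAt_id r).mul (hasDerivAt_profile hr)).const_mul 2).div_const ε).sub_const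
      1).congr_deriv (by simp)
  have h2 : HasDerivAt Real.smoothTransition _ (2 * (r * profile σ r) / ε - 1) :=
    ((Real.smoothTransition.contDiff (n := 1)).differentiable (by norm_num) _).hasDerivAt
  exact h2.comp r h1

theorem cutFactor_eq {ε r : ℝ} (hε : 0 < ε) (h : ε < r * profile σ r) :
    cutFactor σ ε r = 1 ∧ cutFactorDeriv σ ε r = 0 := by
  have hy : 1 < 2 * (r * profile σ r) / ε - 1 := by
    rw [lt_sub_iff_add_lt, lt_div_iff₀ hε]
    linarith
  obtain ⟨K, -, hK⟩ := exists_deriv_smoothTransition_bound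
  exact ⟨Real.smoothTransition.one_of_one_le hy.le, by rw [cutFactorDeriv, (hK _).2 hy, zero_mul]⟩

theorem cutFactor_eq_zero {ε r : ℝ} (hε : 0 < ε) (h : r * profile σ r < ε / 2) :
    cutFactor σ ε r = 0 := by
  refine Real.smoothTransition.zero_of_nonpos ?_
  rw [sub_nonpos, div_le_one hε]
  linarith

/-- Cutting off along level sets of `r W` is adapted to the boundary and, in the ball, to the
origin. The derivative has size `1/ε`, but only where `r W ≤ ε`, so the product is bounded uniformly
in `ε`. -/
theorem exists_cutFactorDeriv_bound (h0 : 0 ≤ σ) (h1 : σ < 1) : ∃ M, 0 < M ∧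
    ∀ ε r, 0 < ε → σ < r → r < 1 → |r * profile σ r * cutFactorDeriv σ ε r| ≤ M := by
  obtain ⟨M, hM, hb⟩ := exists_profile_bound h0
  obtain ⟨K, hK0, hK⟩ := exists_deriv_smoothTransition_bound
  refine ⟨4 * K * M, by positivity, fun ε r hε hr hr1 => ?_⟩
  rcases lt_or_ge ε (r * profile σ r) with h | h
  · rw [(cutFactor_eq hε h).2]
    simp only [mul_zero, abs_zero]
    positivity
  obtain ⟨b1, b2⟩ := hb r hr hr1
  have hp : 0 < r * profile σ r := mul_pos (h0.trans_lt hr) (profile_pos h0 h1 hr hr1)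
  have hs : |profile σ r + r * profileDeriv σ r| ≤ 2 * M := (abs_add_le _ _).trans (by linarith)
  have e : |r * profile σ r * cutFactorDeriv σ ε r| = (r * profile σ r / ε) *
      (2 * (|deriv Real.smoothTransition (2 * (r * profile σ r) / ε - 1)| *
        |profile σ r + r * profileDeriv σ r|)) := by
    rw [cutFactorDeriv, abs_mul, abs_of_pos hp, abs_mul, abs_div, abs_mul, abs_of_pos hε, abs_two]
    field_simp
  rw [e]
  have h3 : r * profile σ r / ε ≤ 1 := (div_le_one hε).2 h
  calc _ ≤ 1 * (2 * (K * (2 * M))) := by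
        gcongr
        exact (hK _).1
    _ = 4 * K * M := by ring

theorem contDiffAt_cutFactor_norm {ε : ℝ} {x : E3} (hx : x ≠ 0) {m : ℕ∞} :
    ContDiffAt ℝ m (fun x : E3 => cutFactor σ ε ‖x‖) x := by
  have hno : ContDiffAt ℝ m (fun x : E3 => ‖x‖) x := contDiffAt_norm ℝ hx
  have h1 : ContDiffAt ℝ m (fun x : E3 => 2 * (‖x‖ * profile σ ‖x‖) / ε - 1) x :=
    ((contDiffAt_const.mul (hno.mul (contDiffAt_profile_norm σ hx))).div_const ε).sub
      contDiffAt_const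
  exact Real.smoothTransition.contDiff.contDiffAt.comp x h1

/-- The cut-off profile. -/
def cutProfile (σ ε : ℝ) (x : E3) : ℝ := shellProfile σ ‖x‖ * cutFactor σ ε ‖x‖

/-- The radial derivative of the cut-off profile. -/
def cutProfileDeriv (σ ε r : ℝ) : ℝ :=
  profileDeriv σ r * cutFactor σ ε r + profile σ r * cutFactorDeriv σ ε r

theorem exists_radii_cutProfile (h0 : 0 ≤ σ) (h1 : σ < 1) {ε : ℝ} (hε : 0 < ε) :
    ∃ s₁ s₂, σ < s₁ ∧ s₂ < 1 ∧ (∀ x : E3, ‖x‖ < s₁ → cutProfile σ ε x = 0) ∧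
      ∀ x : E3, s₂ < ‖x‖ → cutProfile σ ε x = 0 := by
  obtain ⟨s₁, s₂, hs₁, hs₂, hs⟩ := exists_radii_of_le_mul_profile h0 h1 (half_pos hε)
  have key : ∀ x : E3, ¬ (s₁ ≤ ‖x‖ ∧ ‖x‖ ≤ s₂) → cutProfile σ ε x = 0 := by
    intro x hx
    by_cases hxs : x ∈ shell σ
    · rw [cutProfile, cutFactor_eq_zero hε, mul_zero]
      rcases eq_or_ne x 0 with rfl | hx0
      · simpa using hε
      obtain ⟨hr, hr1⟩ := norm_mem_of_mem_shell h0 hxs hx0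
      by_contra! hle
      exact hx (hs _ hr hr1 hle)
    · rw [cutProfile, shellProfile_of_notMem hxs, zero_mul]
  exact ⟨s₁, s₂, hs₁, hs₂, fun x hx => key x fun h => by linarith [h.1],
    fun x hx => key x fun h => by linarith [h.2]⟩

theorem cutProfile_eventuallyEq {ε : ℝ} {x : E3} (hx : x ∈ shell σ) :
    cutProfile σ ε =ᶠ[𝓝 x] fun x => profile σ ‖x‖ * cutFactor σ ε ‖x‖ := by
  filter_upwards [(isOpen_shell σ).mem_nhds hx] with y hy
  rw [cutProfile, shellProfile_of_mem hy]

theorem cutProfile_eventuallyEq_zero (h0 : 0 ≤ σ) (h1 : σ < 1) {ε : ℝ} (hε : 0 < ε) {x : E3}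
    (hx : x ∉ shell σ ∨ x = 0) : cutProfile σ ε =ᶠ[𝓝 x] fun _ => 0 := by
  obtain ⟨s₁, s₂, hs₁, hs₂, hz1, hz2⟩ := exists_radii_cutProfile h0 h1 hε
  have : ‖x‖ < s₁ ∨ s₂ < ‖x‖ := by
    rcases hx with hx | rfl
    · by_cases hx1 : ‖x‖ < 1
      · left
        by_contra! h
        exact hx ⟨fun _ => hs₁.trans_le h, hx1⟩
      · right; linarith
    · left; rw [norm_zero]; linarith
  rcases this with h | h
  · filter_upwards [continuous_norm.continuousAt.eventually (gt_mem_nhds h)] with y hy using hz1 y hy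
  · filter_upwards [continuous_norm.continuousAt.eventually (lt_mem_nhds h)] with y hy using hz2 y hy

theorem contDiff_cutProfile (h0 : 0 ≤ σ) (h1 : σ < 1) {ε : ℝ} (hε : 0 < ε) :
    ContDiff ℝ ∞ (cutProfile σ ε) := by
  refine contDiff_iff_contDiffAt.2 fun x => ?_
  by_cases hx : x ∉ shell σ ∨ x = 0
  · exact contDiffAt_const.congr_of_eventuallyEq (cutProfile_eventuallyEq_zero h0 h1 hε hx)
  · push Not at hx
    exact ((contDiffAt_profile_norm σ hx.2).mul (contDiffAt_cutFactor_norm hx.2)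
      ).congr_of_eventuallyEq (cutProfile_eventuallyEq hx.1)

theorem pd_norm {x : E3} (hx : x ≠ 0) (k : Fin 3) : pd k (fun x : E3 => ‖x‖) x = x k / ‖x‖ := by
  have hn := norm_ne_zero_iff.2 hx
  have h1 : HasFDerivAt (fun x : E3 => ‖x‖) (fderiv ℝ (fun x : E3 => ‖x‖) x) x :=
    ((contDiffAt_norm ℝ hx (n := 1)).differentiableAt (by norm_num)).hasFDerivAt
  have h6 := congrArg (fun L : E3 →L[ℝ] ℝ => L (EuclideanSpace.single k (1 : ℝ)))
    ((h1.pow 2).unique (hasStrictFDerivAt_norm_sq x).hasFDerivAt)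
  have e1 : inner ℝ x (EuclideanSpace.single k (1 : ℝ)) = x k := by
    simp [EuclideanSpace.inner_single_right]
  simp [e1] at h6
  rw [pd, eq_div_iff hn]
  linarith

theorem pd_radial {f : ℝ → ℝ} {f' : ℝ} {x : E3} (hx : x ≠ 0) (hf : HasDerivAt f f' ‖x‖)
    (k : Fin 3) : pd k (fun x : E3 => f ‖x‖) x = f' * (x k / ‖x‖) := by
  have h1 : HasFDerivAt (fun x : E3 => ‖x‖) (fderiv ℝ (fun x : E3 => ‖x‖) x) x :=
    ((contDiffAt_norm ℝ hx (n := 1)).differentiableAt (by norm_num)).hasFDerivAt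
  have h3 : HasFDerivAt (fun x : E3 => f ‖x‖) _ x := hf.comp_hasFDerivAt x h1
  rw [pd, h3.fderiv, ← pd_norm hx]
  rfl

theorem pd_cutProfile {ε : ℝ} {x : E3} (hx : x ∈ shell σ) (hx0 : x ≠ 0) (k : Fin 3) :
    pd k (cutProfile σ ε) x = cutProfileDeriv σ ε ‖x‖ * (x k / ‖x‖) := by
  have hn := norm_ne_zero_iff.2 hx0
  rw [pd, (cutProfile_eventuallyEq hx).fderiv_eq]
  exact pd_radial hx0 ((hasDerivAt_profile hn).mul (hasDerivAt_cutFactor hn)) k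

theorem pd_cutProfile_eq_zero (h0 : 0 ≤ σ) (h1 : σ < 1) {ε : ℝ} (hε : 0 < ε) {x : E3}
    (hx : x ∉ shell σ ∨ x = 0) (k : Fin 3) : pd k (cutProfile σ ε) x = 0 := by
  rw [pd, (cutProfile_eventuallyEq_zero h0 h1 hε hx).fderiv_eq]
  simp

/-- The gradient is radial. With an antisymmetric matrix this makes the cut-off fields solenoidal.
-/
theorem pd_cutProfile_symm (h0 : 0 ≤ σ) (h1 : σ < 1) {ε : ℝ} (hε : 0 < ε) (x : E3) (i k : Fin 3) :
    pd i (cutProfile σ ε) x * x k = pd k (cutProfile σ ε) x * x i := by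
  by_cases hx : x ∉ shell σ ∨ x = 0
  · rw [pd_cutProfile_eq_zero h0 h1 hε hx, pd_cutProfile_eq_zero h0 h1 hε hx]
    ring
  · push Not at hx
    rw [pd_cutProfile hx.1 hx.2, pd_cutProfile hx.1 hx.2]
    ring

/-- The cut-off eigenfunction of the half shell. -/
def cutHalfProfile (σ ε : ℝ) (n x : E3) : ℝ := cutProfile σ ε x * inner ℝ n x

theorem isTestFunction_cutHalfProfile (h0 : 0 ≤ σ) (h1 : σ < 1) {ε : ℝ} (hε : 0 < ε) (n : E3) :
    IsTestFunction (shell σ) (cutHalfProfile σ ε n) := by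
  obtain ⟨s₁, s₂, hs₁, hs₂, hz1, hz2⟩ := exists_radii_cutProfile h0 h1 hε
  refine isTestFunction_of_radii ((contDiff_cutProfile h0 h1 hε).mul
    (contDiff_const.inner ℝ contDiff_id)) (fun _ => hs₁) hs₂ (fun x hx => ?_) fun x hx => ?_
  · rw [cutHalfProfile, hz1 x hx, zero_mul]
  · rw [cutHalfProfile, hz2 x hx, zero_mul]

theorem pd_cutHalfProfile (h0 : 0 ≤ σ) (h1 : σ < 1) {ε : ℝ} (hε : 0 < ε) (n x : E3) (k : Fin 3) :
    pd k (cutHalfProfile σ ε n) x =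
      pd k (cutProfile σ ε) x * inner ℝ n x + cutProfile σ ε x * n k := by
  have hin : HasFDerivAt (fun x : E3 => inner ℝ n x) (innerSL ℝ n) x := (innerSL ℝ n).hasFDerivAt
  have h := (((contDiff_cutProfile h0 h1 hε).differentiable (by simp)) x).hasFDerivAt.mul hin
  have h3 : HasFDerivAt (cutHalfProfile σ ε n) _ x := h
  have e2 : inner ℝ n (EuclideanSpace.single k (1 : ℝ)) = n k := by
    simp [EuclideanSpace.inner_single_right]
  rw [pd, h3.fderiv]
  simp [e2, pd]
  ring

theorem abs_coord_div_norm_le (x : E3) (k : Fin 3) : |x k / ‖x‖| ≤ 1 := by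
  rw [abs_div, abs_norm]
  exact div_le_one_of_le₀ (PiLp.norm_apply_le x k) (norm_nonneg x)

/-- The scale of the cut-off. -/
def cutScale (j : ℕ) : ℝ := 1 / ((j : ℝ) + 1)

theorem cutScale_pos (j : ℕ) : 0 < cutScale j := by unfold cutScale; positivity

theorem tendsto_cutScale : Tendsto cutScale atTop (𝓝 0) := tendsto_one_div_add_atTop_nhds_zero_nat

theorem eventually_cutFactor_eq (h0 : 0 ≤ σ) (h1 : σ < 1) {r : ℝ} (hr : σ < r) (hr1 : r < 1) :
    ∀ᶠ j in atTop, cutFactor σ (cutScale j) r = 1 ∧ cutFactorDeriv σ (cutScale j) r = 0 := by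
  have hp : 0 < r * profile σ r := mul_pos (h0.trans_lt hr) (profile_pos h0 h1 hr hr1)
  filter_upwards [tendsto_cutScale.eventually (gt_mem_nhds hp)] with j hj
  exact cutFactor_eq (cutScale_pos j) hj

theorem ae_ne_zero : ∀ᵐ x : E3, x ≠ 0 := by
  filter_upwards [ae_inner_ne_zero (n := EuclideanSpace.single 0 (1 : ℝ)) (by simp)] with x hx h
  exact hx (by simp [h])

theorem cutFactor_mem (ε r : ℝ) : |cutFactor σ ε r| ≤ 1 := by
  rw [cutFactor, abs_of_nonneg (Real.smoothTransition.nonneg _)]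
  exact Real.smoothTransition.le_one _

theorem l2Lim_cutHalfProfile (h0 : 0 ≤ σ) (h1 : σ < 1) (n : E3) :
    L2Lim (fun j => cutHalfProfile σ (cutScale j) n) ((shell σ).indicator (halfProfile σ n)) := by
  obtain ⟨M, hM, hb⟩ := exists_shellProfile_bound h0
  refine l2Lim_of_bounded (σ := σ) (M := M * ‖n‖) (fun j =>
    (isTestFunction_cutHalfProfile h0 h1 (cutScale_pos j) n).1.continuous.aestronglyMeasurable)
    (fun j => Eventually.of_forall fun x => ?_) ?_
  · by_cases hx : x ∈ shell σ
    · rw [indicator_of_mem hx, cutHalfProfile, cutProfile, abs_mul, abs_mul]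
      have h3 : |(inner ℝ n x : ℝ)| ≤ ‖n‖ := (norm_inner_le_norm (𝕜 := ℝ) n x).trans
        (mul_le_of_le_one_right (norm_nonneg _) hx.2.le)
      calc _ ≤ M * 1 * ‖n‖ := by
            gcongr
            · exact hb _ (norm_nonneg x)
            · exact cutFactor_mem _ _
        _ = M * ‖n‖ := by ring
    · rw [indicator_of_notMem hx, cutHalfProfile, cutProfile, shellProfile_of_notMem hx]
      simp
  · filter_upwards [ae_ne_zero] with x hx0
    by_cases hx : x ∈ shell σ
    · obtain ⟨hr, hr1⟩ := norm_mem_of_mem_shell h0 hx hx0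
      refine tendsto_const_nhds.congr' ?_
      filter_upwards [eventually_cutFactor_eq h0 h1 hr hr1] with j hj
      rw [indicator_of_mem hx, cutHalfProfile, cutProfile, hj.1, shellProfile_of_mem hx, mul_one,
        halfProfile]
    · simp [hx, cutHalfProfile, cutProfile, shellProfile_of_notMem hx]

theorem exists_l2Lim_pd_cutHalfProfile (h0 : 0 ≤ σ) (h1 : σ < 1) (n : E3) (k : Fin 3) :
    ∃ G, L2Lim (fun j => pd k (cutHalfProfile σ (cutScale j) n)) G := by
  obtain ⟨M, hM, hb⟩ := exists_profile_bound h0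
  obtain ⟨M', hM', hb'⟩ := exists_cutFactorDeriv_bound h0 h1
  refine ⟨(shell σ).indicator (fun x => profileDeriv σ ‖x‖ * (x k / ‖x‖) * inner ℝ n x +
    profile σ ‖x‖ * n k), l2Lim_of_bounded (σ := σ) (M := (2 * M + M') * ‖n‖) (fun j =>
    ((isTestFunction_cutHalfProfile h0 h1 (cutScale_pos j) n).pd
      k).1.continuous.aestronglyMeasurable) (fun j => ?_) ?_⟩
  · filter_upwards [ae_ne_zero] with x hx0
    rw [pd_cutHalfProfile h0 h1 (cutScale_pos j)]
    by_cases hx : x ∈ shell σ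
    · obtain ⟨hr, hr1⟩ := norm_mem_of_mem_shell h0 hx hx0
      obtain ⟨b1, b2⟩ := hb _ hr hr1
      have b3 := hb' (cutScale j) _ (cutScale_pos j) hr hr1
      have h3 : |(inner ℝ n x : ℝ)| ≤ ‖x‖ * ‖n‖ := (norm_inner_le_norm (𝕜 := ℝ) n x).trans_eq (mul_comm _ _)
      have h4 : |n k| ≤ ‖n‖ := PiLp.norm_apply_le n k
      have h5 : |‖x‖ * cutProfileDeriv σ (cutScale j) ‖x‖| ≤ M + M' := by
        have e : ‖x‖ * cutProfileDeriv σ (cutScale j) ‖x‖ =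
            ‖x‖ * profileDeriv σ ‖x‖ * cutFactor σ (cutScale j) ‖x‖ +
            ‖x‖ * profile σ ‖x‖ * cutFactorDeriv σ (cutScale j) ‖x‖ := by
          rw [cutProfileDeriv]; ring
        rw [e]
        refine (abs_add_le _ _).trans (add_le_add ?_ b3)
        rw [abs_mul]
        exact (mul_le_mul b2 (cutFactor_mem _ _) (abs_nonneg _) hM.le).trans_eq (mul_one M)
      rw [indicator_of_mem hx, pd_cutProfile hx hx0, cutProfile, shellProfile_of_mem hx]
      refine (abs_add_le _ _).trans ?_
      rw [abs_mul, abs_mul, abs_mul, abs_mul]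
      rw [abs_mul, abs_norm] at h5
      have h6 := abs_coord_div_norm_le x k
      have h7 := cutFactor_mem (σ := σ) (cutScale j) ‖x‖
      calc _ ≤ |cutProfileDeriv σ (cutScale j) ‖x‖| * 1 * (‖x‖ * ‖n‖) + M * 1 * ‖n‖ := by gcongr
        _ = (‖x‖ * |cutProfileDeriv σ (cutScale j) ‖x‖|) * ‖n‖ + M * ‖n‖ := by ring
        _ ≤ (M + M') * ‖n‖ + M * ‖n‖ := by gcongr
        _ = (2 * M + M') * ‖n‖ := by ring
    · rw [indicator_of_notMem hx, pd_cutProfile_eq_zero h0 h1 (cutScale_pos j) (Or.inl hx),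
        cutProfile, shellProfile_of_notMem hx]
      simp
  · filter_upwards [ae_ne_zero] with x hx0
    by_cases hx : x ∈ shell σ
    · obtain ⟨hr, hr1⟩ := norm_mem_of_mem_shell h0 hx hx0
      refine tendsto_const_nhds.congr' ?_
      filter_upwards [eventually_cutFactor_eq h0 h1 hr hr1] with j hj
      rw [pd_cutHalfProfile h0 h1 (cutScale_pos j), indicator_of_mem hx, pd_cutProfile hx hx0,
        cutProfile, cutProfileDeriv, hj.1, hj.2, shellProfile_of_mem hx]
      ring
    · have e : ∀ j, pd k (cutHalfProfile σ (cutScale j) n) x = 0 := fun j => by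
        rw [pd_cutHalfProfile h0 h1 (cutScale_pos j),
          pd_cutProfile_eq_zero h0 h1 (cutScale_pos j) (Or.inl hx), cutProfile,
          shellProfile_of_notMem hx]
        simp
      simp_rw [e, indicator_of_notMem hx]
      exact tendsto_const_nhds

theorem cutHalfProfile_odd {n : E3} (hn : ‖n‖ = 1) (ε : ℝ) (x : E3) :
    cutHalfProfile σ ε n (planeReflection n x) = - cutHalfProfile σ ε n x := by
  rw [cutHalfProfile, cutHalfProfile, inner_planeReflection hn, cutProfile, cutProfile,
    LinearIsometryEquiv.norm_map]
  ring

/-- The logarithmic gradient cancels everything except the derivative of the cut-off factor. -/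
theorem piconeDefect_cutHalfProfile (h0 : 0 ≤ σ) (h1 : σ < 1) {ε : ℝ} (hε : 0 < ε) (n : E3)
    {x : E3} (hl : (inner ℝ n x : ℝ) ≠ 0) (k : Fin 3) :
    piconeDefect σ n (cutHalfProfile σ ε n) k x = (shell σ).indicator (fun x =>
      profile σ ‖x‖ * cutFactorDeriv σ ε ‖x‖ * (x k / ‖x‖) * inner ℝ n x) x := by
  have hx0 : x ≠ 0 := fun h => hl (by simp [h])
  rw [piconeDefect, pd_cutHalfProfile h0 h1 hε]
  by_cases hx : x ∈ shell σ
  · have e := pd_halfProfile_eq h0 h1 hx hl k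
    rw [pd_halfProfile hx0, halfProfile] at e
    rw [indicator_of_mem hx, pd_cutProfile hx hx0, cutHalfProfile, cutProfile,
      shellProfile_of_mem hx, cutProfileDeriv]
    linear_combination cutFactor σ ε ‖x‖ * e
  · rw [indicator_of_notMem hx, pd_cutProfile_eq_zero h0 h1 hε (Or.inl hx), cutHalfProfile,
      cutProfile, shellProfile_of_notMem hx]
    simp

/-- By Picone the energy is the squared norm of the defect, which is uniformly bounded and vanishes
eventually at almost every point. -/
theorem tendsto_energy_cutHalfProfile (h0 : 0 ≤ σ) (h1 : σ < 1) {n : E3} (hn : ‖n‖ = 1) :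
    Tendsto (fun j => ∫ x, (∑ k, pd k (cutHalfProfile σ (cutScale j) n) x ^ 2 -
      firstRoot σ ^ 2 * cutHalfProfile σ (cutScale j) n x ^ 2)) atTop (𝓝 0) := by
  have hn0 : n ≠ 0 := fun h => by rw [h, norm_zero] at hn; exact zero_ne_one hn
  have hz : ∀ j x, (inner ℝ n x : ℝ) = 0 → cutHalfProfile σ (cutScale j) n x = 0 := fun j x hx => by
    rw [cutHalfProfile, hx, mul_zero]
  have hp := fun j => picone_identity h0 h1 hn
    (isTestFunction_cutHalfProfile h0 h1 (cutScale_pos j) n) (hz j)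
  obtain ⟨M, hM, hb⟩ := exists_cutFactorDeriv_bound h0 h1
  have hL : ∀ k, L2Lim (fun j => piconeDefect σ n (cutHalfProfile σ (cutScale j) n) k)
      (fun _ => 0) := by
    intro k
    refine l2Lim_of_bounded (σ := σ) (M := M) (fun j => ((hp j).1 k).1) (fun j => ?_) ?_
    · filter_upwards [ae_inner_ne_zero hn0] with x hl
      rw [piconeDefect_cutHalfProfile h0 h1 (cutScale_pos j) n hl]
      by_cases hx : x ∈ shell σ
      · obtain ⟨hr, hr1⟩ := norm_mem_of_mem_shell h0 hx fun h => hl (by simp [h])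
        rw [indicator_of_mem hx, indicator_of_mem hx]
        have h3 : |(inner ℝ n x : ℝ)| ≤ ‖x‖ := by
          have := norm_inner_le_norm (𝕜 := ℝ) n x
          rwa [hn, one_mul] at this
        have b3 := hb (cutScale j) _ (cutScale_pos j) hr hr1
        rw [abs_mul, abs_mul]
        rw [mul_assoc, abs_mul, abs_norm] at b3
        have h6 := abs_coord_div_norm_le x k
        calc _ ≤ |profile σ ‖x‖ * cutFactorDeriv σ (cutScale j) ‖x‖| * 1 * ‖x‖ := by gcongr
          _ = ‖x‖ * |profile σ ‖x‖ * cutFactorDeriv σ (cutScale j) ‖x‖| := by ring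
          _ ≤ M := b3
      · simp [hx]
    · filter_upwards [ae_inner_ne_zero hn0] with x hl
      simp_rw [fun j => piconeDefect_cutHalfProfile h0 h1 (cutScale_pos j) n hl k]
      by_cases hx : x ∈ shell σ
      · obtain ⟨hr, hr1⟩ := norm_mem_of_mem_shell h0 hx fun h => hl (by simp [h])
        refine tendsto_const_nhds.congr' ?_
        filter_upwards [eventually_cutFactor_eq h0 h1 hr hr1] with j hj
        rw [indicator_of_mem hx, hj.2]
        ring
      · simp [hx]
  have hs := tendsto_finsetSum Finset.univ fun k _ => (hL k).normSq
  simp only [norm_zero, ne_eq, OfNat.ofNat_ne_zero, not_false_eq_true, zero_pow, integral_zero,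
    Finset.sum_const_zero] at hs
  refine hs.congr fun j => ?_
  rw [(hp j).2, integral_finsetSum _ fun k _ => ((hp j).1 k).integrable_sq]
  simp only [Real.norm_eq_abs, sq_abs]

end

end

noncomputable section

/-! ### Convergence of components -/

section
variable {F : Type*} [NormedAddCommGroup F] [InnerProductSpace ℝ F]

theorem L2Lim.sum {ι : Type*} (s : Finset ι) {φ : ι → ℕ → E3 → F} {f : ι → E3 → F}
    (h : ∀ i ∈ s, L2Lim (φ i) (f i)) :
    L2Lim (fun j x => ∑ i ∈ s, φ i j x) (fun x => ∑ i ∈ s, f i x) := by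
  classical
  induction s using Finset.induction_on with
  | empty => simpa using l2Lim_const (f := fun _ : E3 => (0 : F)) MemLp.zero'
  | insert a s ha ih =>
    simp_rw [Finset.sum_insert ha]
    exact (h a (Finset.mem_insert_self a s)).add
      (ih fun i hi => h i (Finset.mem_insert_of_mem hi))

theorem l2Lim_of_components {ι : Type*} [Fintype ι] [DecidableEq ι]
    {φ : ℕ → E3 → EuclideanSpace ℝ ι} {g : ι → E3 → ℝ}
    (h : ∀ i, L2Lim (fun j x => φ j x i) (g i)) :
    L2Lim φ (fun x => WithLp.toLp 2 fun i => g i x) := by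
  have e : ∀ v : EuclideanSpace ℝ ι, v = ∑ i, v i • EuclideanSpace.single i (1 : ℝ) := fun v => by
    ext i
    simp [Finset.sum_apply, Pi.single_apply]
  have hs := L2Lim.sum Finset.univ fun i _ => (h i).clm_comp
    (ContinuousLinearMap.toSpanSingleton ℝ (EuclideanSpace.single i (1 : ℝ) : EuclideanSpace ℝ ι))
  simp only [ContinuousLinearMap.toSpanSingleton_apply] at hs
  have e1 : φ = fun j x => ∑ i, φ j x i • EuclideanSpace.single i (1 : ℝ) := by
    ext1 j; ext1 x; exact e _
  have e2 : (fun x => WithLp.toLp 2 fun i => g i x) =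
      fun x => ∑ i, g i x • EuclideanSpace.single i (1 : ℝ) := by
    ext1 x; exact e _
  rw [e1, e2]
  exact hs

end

/-! ### The scalar energy form -/

section
variable {σ : ℝ} {Ω : Set E3} {f g h : E3 → ℝ}

/-- The symmetric bilinear form of `-Δ - lam`. -/
def energyForm (lam : ℝ) (f g : E3 → ℝ) : ℝ :=
  ∫ x, (∑ k, pd k f x * pd k g x - lam * (f x * g x))

theorem IsTestFunction.integrable_energyForm (hf : IsTestFunction Ω f) (hg : IsTestFunction Ω g)
    (lam : ℝ) : Integrable fun x => ∑ k, _root_.pd k f x * _root_.pd k g x - lam * (f x * g x) :=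
  (integrable_finsetSum _ fun k _ => (hf.pd k).integrable_mul (hg.pd k).1.continuous).sub
    ((hf.integrable_mul hg.1.continuous).const_mul lam)

theorem pd_linear_comb (hf : Differentiable ℝ f) (hg : Differentiable ℝ g) (a b : ℝ) (k : Fin 3)
    (x : E3) : pd k (fun x => a * f x + b * g x) x = a * pd k f x + b * pd k g x := by
  have h : HasFDerivAt (fun x => a * f x + b * g x) _ x :=
    ((hf x).hasFDerivAt.const_mul a).add ((hg x).hasFDerivAt.const_mul b)
  rw [pd, h.fderiv]
  rfl

theorem IsTestFunction.linear_comb (hf : IsTestFunction Ω f) (hg : IsTestFunction Ω g) (a b : ℝ) :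
    IsTestFunction Ω fun x => a * f x + b * g x := (hf.const_smul a).add (hg.const_smul b)

theorem energyForm_comm (lam : ℝ) (f g : E3 → ℝ) : energyForm lam f g = energyForm lam g f := by
  simp only [energyForm, mul_comm]

theorem energyForm_linear_comb (hf : IsTestFunction Ω f) (hg : IsTestFunction Ω g)
    (hh : IsTestFunction Ω h) (lam a b : ℝ) :
    energyForm lam (fun x => a * f x + b * g x) h =
      a * energyForm lam f h + b * energyForm lam g h := by
  rw [energyForm, energyForm, energyForm, ← integral_const_mul, ← integral_const_mul,
    ← integral_add ((hf.integrable_energyForm hh lam).const_mul a)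
      ((hg.integrable_energyForm hh lam).const_mul b)]
  congr 1
  ext x
  simp only [pd_linear_comb hf.differentiable hg.differentiable, Fin.sum_univ_three]
  ring

theorem energyForm_self (lam : ℝ) (f : E3 → ℝ) :
    energyForm lam f f = ∫ x, (∑ k, pd k f x ^ 2 - lam * f x ^ 2) := by
  simp only [energyForm, sq]

theorem pd_comp_coordReflection (hf : Differentiable ℝ f) (k l : Fin 3) (x : E3) :
    pd l (fun x => f (coordReflection k x)) x =
      (if l = k then -1 else 1) * pd l f (coordReflection k x) := by
  have hS : HasFDerivAt (fun x => coordReflection k x) (coordReflection k : E3 →L[ℝ] E3) x :=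
    (coordReflection k : E3 →L[ℝ] E3).hasFDerivAt
  have h : HasFDerivAt (fun x => f (coordReflection k x)) _ x :=
    (hf (coordReflection k x)).hasFDerivAt.comp x hS
  rw [pd, h.fderiv, pd]
  have e : coordReflection k (EuclideanSpace.single l (1 : ℝ)) =
      (if l = k then (-1 : ℝ) else 1) • EuclideanSpace.single l (1 : ℝ) := by
    ext i
    rw [coordReflection_apply]
    by_cases h : l = k <;> by_cases h' : i = l <;> simp [h, h']
    all_goals grind
  change fderiv ℝ f (coordReflection k x) (coordReflection k (EuclideanSpace.single l (1 : ℝ))) = _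
  rw [e, map_smul, smul_eq_mul]

theorem energyForm_comp_coordReflection (hf : Differentiable ℝ f) (hg : Differentiable ℝ g)
    (lam : ℝ) (k : Fin 3) :
    energyForm lam (fun x => f (coordReflection k x)) (fun x => g (coordReflection k x)) =
      energyForm lam f g := by
  rw [energyForm, energyForm, ← integral_comp_isometry (coordReflection k)
    fun x => ∑ k, pd k f x * pd k g x - lam * (f x * g x)]
  congr 1
  ext x
  congr 1
  refine Finset.sum_congr rfl fun l _ => ?_
  rw [pd_comp_coordReflection hf, pd_comp_coordReflection hg]
  split_ifs <;> ring

theorem IsTestFunction.comp_coordReflection (hf : IsTestFunction (shell σ) f) (k : Fin 3) :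
    IsTestFunction (shell σ) fun x => f (coordReflection k x) := by
  refine ⟨hf.1.comp (coordReflection k).contDiff,
    hf.2.1.comp_homeomorph (coordReflection k).toHomeomorph, fun x hx => ?_⟩
  have := hf.2.2 (tsupport_comp_subset_preimage f (coordReflection k).continuous hx)
  exact (mem_shell_comp_isometry (coordReflection k)).1 this

/-- Cauchy–Schwarz for a form that is semidefinite only on functions odd in the plane, through the
discriminant. -/
theorem energyForm_sq_le (h0 : 0 ≤ σ) (h1 : σ < 1) {n : E3} (hn : ‖n‖ = 1)
    (hf : IsTestFunction (shell σ) f) (hg : IsTestFunction (shell σ) g)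
    (hf' : ∀ x, f (planeReflection n x) = - f x) (hg' : ∀ x, g (planeReflection n x) = - g x) :
    energyForm (firstRoot σ ^ 2) f g ^ 2 ≤
      energyForm (firstRoot σ ^ 2) f f * energyForm (firstRoot σ ^ 2) g g := by
  set lam := firstRoot σ ^ 2
  have key : ∀ t : ℝ, 0 ≤ energyForm lam f f * (t * t) + (2 * energyForm lam f g) * t +
      energyForm lam g g := fun t => by
    have hfg := hf.linear_comb hg t 1
    have h := energy_nonneg h0 h1 hn hfg fun x => by rw [hf', hg']; ring
    rw [← energyForm_self, energyForm_linear_comb hf hg hfg, energyForm_comm lam f,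
      energyForm_comm lam g, energyForm_linear_comb hf hg hf, energyForm_linear_comb hf hg hg,
      energyForm_comm lam g f] at h
    linarith
  have := discrim_le_zero key
  rw [discrim] at this
  linarith

/-- The weak eigenvalue equation for `W x_k`. The even part of `f` does not pair with the odd
cut-off functions; for the odd part, Cauchy–Schwarz applies and the energy of the cut-off functions
tends to zero. -/
theorem tendsto_energyForm_cutHalfProfile (h0 : 0 ≤ σ) (h1 : σ < 1) (k : Fin 3)
    (hf : IsTestFunction (shell σ) f) :
    Tendsto (fun j => energyForm (firstRoot σ ^ 2)
      (cutHalfProfile σ (cutScale j) (EuclideanSpace.single k 1)) f) atTop (𝓝 0) := by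
  set lam := firstRoot σ ^ 2
  set q := fun j => cutHalfProfile σ (cutScale j) (EuclideanSpace.single k 1) with hq
  have hn := norm_single_one k
  have hqt : ∀ j, IsTestFunction (shell σ) (q j) := fun j =>
    isTestFunction_cutHalfProfile h0 h1 (cutScale_pos j) _
  have hqo : ∀ j x, q j (coordReflection k x) = - q j x := fun j x => cutHalfProfile_odd hn _ x
  have hf' := hf.comp_coordReflection k
  have hg := hf.linear_comb hf' 1 (-1)
  set g := fun x => 1 * f x + -1 * f (coordReflection k x) with hg_def
  have hgo : ∀ x, g (coordReflection k x) = - g x := fun x => by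
    simp [hg_def, coordReflection]
  have e : ∀ j, energyForm lam (q j) f = 1 / 2 * energyForm lam (q j) g := fun j => by
    have e1 := energyForm_comp_coordReflection (hqt j).differentiable hf.differentiable lam k
    have e2 := energyForm_linear_comb (hqt j) (hqt j) hf' lam (-1) 0
    have e3 : (fun x => -1 * q j x + 0 * q j x) = fun x => q j (coordReflection k x) := by
      ext1 x; rw [hqo]; ring
    rw [e3, e1] at e2
    rw [energyForm_comm lam (q j) g, energyForm_linear_comb hf hf' (hqt j), energyForm_comm lam f,
      energyForm_comm lam _ (q j)]
    linarith
  have hE := (tendsto_energy_cutHalfProfile h0 h1 hn).mul_const (energyForm lam g g)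
  rw [zero_mul] at hE
  have hsq := squeeze_zero (fun j => sq_nonneg _) (fun j => (energyForm_sq_le h0 h1 hn (hqt j) hg
    (hqo j) hgo).trans_eq (by rw [energyForm_self])) hE
  have h2 : Tendsto (fun j => energyForm lam (q j) g) atTop (𝓝 0) := by
    have := hsq.sqrt
    rw [Real.sqrt_zero] at this
    exact (tendsto_zero_iff_abs_tendsto_zero _).2 (this.congr fun j => Real.sqrt_sq_eq_abs _)
  have h3 := h2.const_mul (1 / 2)
  rw [mul_zero] at h3
  exact h3.congr fun j => (e j).symm

end

/-! ### Weak eigenfunctions from limits of test fields -/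

section
variable {σ μ : ℝ} {φ : ℕ → E3 → E3} {u v : E3 → E3} {G : E3 → Mat3}

theorem exists_eLpNorm_restrict_lt {F : Type*} [NormedAddCommGroup F] [InnerProductSpace ℝ F]
    {φ : ℕ → E3 → F} {f g : E3 → F} (h : L2Lim φ f) {s : Set E3} (hg : g =ᵐ[volume.restrict s] f)
    {ε : ℝ≥0∞} (hε : 0 < ε) :
    ∀ᶠ j in atTop, eLpNorm (fun x => g x - φ j x) 2 (volume.restrict s) < ε := by
  filter_upwards [h.tendsto_eLpNorm.eventually_lt_const hε] with j hj
  refine lt_of_le_of_lt ?_ hj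
  rw [eLpNorm_congr_ae (g := fun x => f x - φ j x) (by filter_upwards [hg] with x hx; rw [hx])]
  exact eLpNorm_mono_measure _ Measure.restrict_le_self

theorem memSobolev_of_l2Lim (ht : ∀ j, IsSolenoidalTest (shell σ) (φ j)) (hu : L2Lim φ u)
    (hG : L2Lim (fun j => jacobian (φ j)) G) (hv : v =ᵐ[volume.restrict (shell σ)] u) :
    MemSobolev (shell σ) v G := by
  refine ⟨(memLp_congr_ae hv).2 (hu.memLp.restrict _), hG.memLp.restrict _, fun η hη j k => ?_⟩
  have a1 := (hu.clm_comp (EuclideanSpace.proj j : E3 →L[ℝ] ℝ)).inner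
    (l2Lim_const (hη.pd k).memLp)
  have a2 := (hG.clm_comp (EuclideanSpace.proj (j, k) : Mat3 →L[ℝ] ℝ)).inner
    (l2Lim_const hη.memLp)
  have e1 : ∫ x in shell σ, v x j * fderiv ℝ η x (EuclideanSpace.single k (1 : ℝ)) =
      ∫ x, u x j * pd k η x := by
    rw [← setIntegral_eq_integral_of_forall_compl_eq_zero (s := shell σ)
      (f := fun x => u x j * pd k η x) fun x hx => by rw [(hη.pd k).eq_zero hx, mul_zero]]
    refine integral_congr_ae ?_
    filter_upwards [hv] with x hx
    rw [hx, pd]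
  have e2 : ∫ x in shell σ, G x (j, k) * η x = ∫ x, G x (j, k) * η x :=
    setIntegral_eq_integral_of_forall_compl_eq_zero fun x hx => by rw [hη.eq_zero hx, mul_zero]
  rw [e1, e2]
  have hin : ∀ a b : ℝ, inner ℝ a b = a * b := fun a b => by simp [mul_comm]
  simp only [hin, PiLp.proj_apply] at a1 a2
  refine tendsto_nhds_unique a1 ((a2.neg).congr fun n => ?_)
  rw [((ht n).1.component j).integral_mul_pd (hη.1.of_le (by simp)) k]
  simp_rw [jacobian_apply ((ht n).1.differentiable _)]

/-- Test fields are dense in `V`, so the equation for test fields extends to all of `V`, and the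
approximating sequence itself witnesses the memberships in `H` and `V`. -/
theorem inStokesEigenspace_of_l2Lim (ht : ∀ j, IsSolenoidalTest (shell σ) (φ j)) (hu : L2Lim φ u)
    (hG : L2Lim (fun j => jacobian (φ j)) G)
    (hw : ∀ ψ, IsSolenoidalTest (shell σ) ψ →
      ∫ x, inner ℝ (G x) (jacobian ψ x) = μ * ∫ x, inner ℝ (u x) (ψ x))
    (hv : v =ᵐ[volume.restrict (shell σ)] u) : InStokesEigenspace (shell σ) μ v := by
  have hS := memSobolev_of_l2Lim ht hu hG hv
  refine ⟨⟨hS.1.const_smul μ, fun ε hε => ?_⟩, G, ⟨hS, fun ε hε => ?_⟩, fun w K hwK => ?_⟩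
  · obtain ⟨j, hj⟩ := (exists_eLpNorm_restrict_lt (hu.const_smul μ) (s := shell σ)
      (g := fun x => μ • v x) (by filter_upwards [hv] with x hx; rw [hx]) hε).exists
    exact ⟨_, (ht j).const_smul μ, hj⟩
  · obtain ⟨j, h1, h2⟩ := ((exists_eLpNorm_restrict_lt hu hv hε).and
      (exists_eLpNorm_restrict_lt hG (s := shell σ) (ae_eq_refl G) hε)).exists
    exact ⟨_, ht j, h1, h2⟩
  · obtain ⟨ψ, hψ, h1, h2⟩ := hwK.exists_l2Lim
    have a1 := (l2Lim_const hG.memLp).inner h2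
    have a2 := ((l2Lim_const hu.memLp).inner h1).const_mul μ
    have h := tendsto_nhds_unique a1 (a2.congr fun n => (hw (ψ n) (hψ n)).symm)
    have e1 : ∀ {F : Type} [NormedAddCommGroup F] [InnerProductSpace ℝ F] (a b : E3 → F),
        ∫ x, inner ℝ (a x) ((shell σ).indicator b x) = ∫ x in shell σ, inner ℝ (a x) (b x) := by
      intro F _ _ a b
      rw [← integral_indicator (measurableSet_shell σ)]
      congr 1
      ext x
      by_cases hx : x ∈ shell σ <;> simp [hx]
    rw [e1, e1] at h
    rw [h, ← integral_const_mul]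
    exact integral_congr_ae (by filter_upwards [hv] with x hx; rw [hx, real_inner_smul_left])

end

end

noncomputable section

/-! ### The first eigenspace -/

section
variable {σ μ : ℝ} {u : E3 → E3} {C : Fin 3 → Fin 3 → ℝ}

theorem pd_sum {f : Fin 3 → E3 → ℝ} (hf : ∀ k, Differentiable ℝ (f k)) (c : Fin 3 → ℝ) (l : Fin 3)
    (x : E3) : pd l (fun x => ∑ k, c k * f k x) x = ∑ k, c k * pd l (f k) x := by
  have h : HasFDerivAt (fun x => ∑ k, c k * f k x) _ x :=
    HasFDerivAt.fun_sum fun k _ => ((hf k) x).hasFDerivAt.const_mul (c k)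
  rw [pd, h.fderiv]
  simp [pd]

theorem energyForm_sum {Ω : Set E3} {f : Fin 3 → E3 → ℝ} {g : E3 → ℝ}
    (hf : ∀ k, IsTestFunction Ω (f k)) (hg : IsTestFunction Ω g) (lam : ℝ) (c : Fin 3 → ℝ) :
    energyForm lam (fun x => ∑ k, c k * f k x) g = ∑ k, c k * energyForm lam (f k) g := by
  simp_rw [energyForm, ← integral_const_mul]
  rw [← integral_finsetSum _ fun k _ => ((hf k).integrable_energyForm hg lam).const_mul (c k)]
  congr 1
  ext x
  simp_rw [pd_sum (fun k => (hf k).differentiable) c]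
  simp only [Fin.sum_univ_three]
  ring

theorem dirichlet_sub_eq_sum_energyForm {Ω : Set E3} {φ ψ : E3 → E3} (hφ : IsTestFunction Ω φ)
    (hψ : IsTestFunction Ω ψ) (lam : ℝ) :
    dirichlet φ ψ - lam * ∫ x, inner ℝ (φ x) (ψ x) =
      ∑ i, energyForm lam (fun x => φ x i) (fun x => ψ x i) := by
  simp_rw [energyForm]
  rw [dirichlet, ← integral_const_mul,
    ← integral_sub (integrable_inner_of_memLp hφ.jacobian.memLp hψ.jacobian.memLp)
      ((integrable_inner_of_memLp hφ.memLp hψ.memLp).const_mul lam),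
    ← integral_finsetSum _ fun i _ =>
      (hφ.component i).integrable_energyForm (hψ.component i) lam]
  congr 1
  ext x
  rw [inner_jacobian hφ.differentiable hψ.differentiable, inner_eq_sum_three]
  simp only [Fin.sum_univ_three]
  ring

/-- The truncated radial-linear field with matrix `C`. -/
def cutLinearField (σ ε : ℝ) (C : Fin 3 → Fin 3 → ℝ) (x : E3) : E3 :=
  WithLp.toLp 2 fun i => ∑ k, C i k * cutHalfProfile σ ε (EuclideanSpace.single k 1) x

theorem isTestFunction_cutLinearField (h0 : 0 ≤ σ) (h1 : σ < 1) {ε : ℝ} (hε : 0 < ε)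
    (C : Fin 3 → Fin 3 → ℝ) : IsTestFunction (shell σ) (cutLinearField σ ε C) := by
  obtain ⟨s₁, s₂, hs₁, hs₂, hz1, hz2⟩ := exists_radii_cutProfile h0 h1 hε
  refine isTestFunction_of_radii ?_ (fun _ => hs₁) hs₂ (fun x hx => ?_) fun x hx => ?_
  · refine contDiff_euclidean.2 fun i => ?_
    change ContDiff ℝ ∞ fun x => ∑ k, C i k * cutHalfProfile σ ε (EuclideanSpace.single k 1) x
    exact ContDiff.sum fun k _ => contDiff_const.mul (isTestFunction_cutHalfProfile h0 h1 hε _).1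
  · ext i
    simp [cutLinearField, cutHalfProfile, hz1 x hx]
  · ext i
    simp [cutLinearField, cutHalfProfile, hz2 x hx]

theorem jacobian_cutLinearField (h0 : 0 ≤ σ) (h1 : σ < 1) {ε : ℝ} (hε : 0 < ε)
    (C : Fin 3 → Fin 3 → ℝ) (x : E3) (i l : Fin 3) :
    jacobian (cutLinearField σ ε C) x (i, l) =
      ∑ k, C i k * pd l (cutHalfProfile σ ε (EuclideanSpace.single k 1)) x := by
  rw [jacobian_apply ((isTestFunction_cutLinearField h0 h1 hε C).differentiable x)]
  exact pd_sum (f := fun k => cutHalfProfile σ ε (EuclideanSpace.single k 1))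
    (fun k => (isTestFunction_cutHalfProfile h0 h1 hε _).differentiable) (C i) l x

/-- The divergence is the trace of `C` times the profile plus the radial derivative times `⟨C x, x⟩
/ |x|`; both vanish. -/
theorem isSolenoidalTest_cutLinearField (h0 : 0 ≤ σ) (h1 : σ < 1) {ε : ℝ} (hε : 0 < ε)
    (hC : ∀ i j, C i j + C j i = 0) : IsSolenoidalTest (shell σ) (cutLinearField σ ε C) := by
  refine ⟨isTestFunction_cutLinearField h0 h1 hε C, fun x => ?_⟩
  simp only [jacobian_cutLinearField h0 h1 hε, pd_cutHalfProfile h0 h1 hε, Fin.sum_univ_three,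
    EuclideanSpace.inner_single_left]
  have s01 := pd_cutProfile_symm h0 h1 hε x 0 1
  have s02 := pd_cutProfile_symm h0 h1 hε x 0 2
  have s12 := pd_cutProfile_symm h0 h1 hε x 1 2
  have c00 : C 0 0 = 0 := by linarith [hC 0 0]
  have c11 : C 1 1 = 0 := by linarith [hC 1 1]
  have c22 : C 2 2 = 0 := by linarith [hC 2 2]
  have c10 : C 1 0 = - C 0 1 := by linarith [hC 0 1]
  have c20 : C 2 0 = - C 0 2 := by linarith [hC 0 2]
  have c21 : C 2 1 = - C 1 2 := by linarith [hC 1 2]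
  simp [c00, c11, c22, c10, c20, c21]
  linear_combination C 0 1 * s01 + C 0 2 * s02 + C 1 2 * s12

/-- The radial-linear field with matrix `C`. -/
def linearField (σ : ℝ) (C : Fin 3 → Fin 3 → ℝ) (x : E3) : E3 :=
  WithLp.toLp 2 fun i => profile σ ‖x‖ * ∑ k, C i k * x k

theorem inStokesEigenspace_linearField (h0 : 0 ≤ σ) (h1 : σ < 1) (hC : ∀ i j, C i j + C j i = 0)
    (hu : u =ᵐ[volume.restrict (shell σ)] linearField σ C) :
    InStokesEigenspace (shell σ) (firstRoot σ ^ 2) u := by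
  set φ := fun j => cutLinearField σ (cutScale j) C
  have ht : ∀ j, IsSolenoidalTest (shell σ) (φ j) := fun j =>
    isSolenoidalTest_cutLinearField h0 h1 (cutScale_pos j) hC
  have hlim : L2Lim φ (fun x => WithLp.toLp 2 fun i => ∑ k, C i k •
      (shell σ).indicator (halfProfile σ (EuclideanSpace.single k 1)) x) :=
    l2Lim_of_components fun i => L2Lim.sum Finset.univ fun k _ =>
      (l2Lim_cutHalfProfile h0 h1 (EuclideanSpace.single k 1)).const_smul (C i k)
  choose G hG using fun k : Fin 3 =>
    exists_l2Lim_pd_cutHalfProfile h0 h1 (EuclideanSpace.single k 1)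
  have hjac : L2Lim (fun j => jacobian (φ j)) (fun x => WithLp.toLp 2 fun p =>
      ∑ k, C p.1 k • G k p.2 x) := by
    refine l2Lim_of_components fun p => ?_
    have := L2Lim.sum Finset.univ fun k _ => (hG k p.2).const_smul (C p.1 k)
    convert this using 3 with j x
    exact jacobian_cutLinearField h0 h1 (cutScale_pos j) C x p.1 p.2
  refine inStokesEigenspace_of_l2Lim ht hlim hjac (fun ψ hψ => ?_) ?_
  · have a1 := hjac.inner (l2Lim_const hψ.1.jacobian.memLp)
    have a2 := (hlim.inner (l2Lim_const hψ.1.memLp)).const_mul (firstRoot σ ^ 2)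
    refine sub_eq_zero.1 (tendsto_nhds_unique (a1.sub a2) ?_)
    have hs : Tendsto (fun j => ∑ i, ∑ k, C i k * energyForm (firstRoot σ ^ 2)
        (cutHalfProfile σ (cutScale j) (EuclideanSpace.single k 1)) (fun x => ψ x i)) atTop
        (𝓝 (∑ i : Fin 3, ∑ k : Fin 3, C i k * 0)) :=
      tendsto_finsetSum _ fun i _ => tendsto_finsetSum _ fun k _ =>
        (tendsto_energyForm_cutHalfProfile h0 h1 k (hψ.1.component i)).const_mul (C i k)
    simp only [mul_zero, Finset.sum_const_zero] at hs
    refine hs.congr fun j => ?_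
    have e := dirichlet_sub_eq_sum_energyForm (ht j).1 hψ.1 (firstRoot σ ^ 2)
    rw [dirichlet] at e
    rw [e]
    refine Finset.sum_congr rfl fun i _ => ?_
    exact (energyForm_sum (fun k => isTestFunction_cutHalfProfile h0 h1 (cutScale_pos j)
      (EuclideanSpace.single k 1)) (hψ.1.component i) (firstRoot σ ^ 2) (C i)).symm
  · filter_upwards [hu, ae_restrict_mem (measurableSet_shell σ)] with x hx hm
    rw [hx, linearField]
    congr 1
    ext i
    simp only [indicator_of_mem hm, halfProfile, Finset.mul_sum, smul_eq_mul]
    refine Finset.sum_congr rfl fun k _ => ?_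
    simp [EuclideanSpace.inner_single_left]
    ring

theorem ae_eq_restrict_of_indicator {F : Type*} [Zero F] {f g : E3 → F}
    (h : (shell σ).indicator f =ᵐ[volume] (shell σ).indicator g) :
    f =ᵐ[volume.restrict (shell σ)] g := by
  filter_upwards [ae_restrict_of_ae h, ae_restrict_mem (measurableSet_shell σ)] with x hx hm
  simpa [hm] using hx

theorem exists_linearField (h0 : 0 ≤ σ) (h1 : σ < 1)
    (hu : InStokesEigenspace (shell σ) (firstRoot σ ^ 2) u) :
    ∃ C : Fin 3 → Fin 3 → ℝ, (∀ i j, C i j + C j i = 0) ∧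
      u =ᵐ[volume.restrict (shell σ)] linearField σ C := by
  obtain ⟨φ, hφ⟩ := exists_critSeq hu
  obtain ⟨C, hC⟩ := (hφ.isRadialLinear h0 h1 le_rfl).1
  refine ⟨C, antisymm_of_solenoidal h0 h1 hφ.test hφ.lim hC, ae_eq_restrict_of_indicator ?_⟩
  filter_upwards [hC 0, hC 1, hC 2] with x e0 e1 e2
  by_cases hx : x ∈ shell σ
  · simp only [indicator_of_mem hx] at e0 e1 e2 ⊢
    ext i
    fin_cases i
    · exact e0
    · exact e1
    · exact e2
  · simp [hx]

theorem ae_eq_zero_of_lt (h0 : 0 ≤ σ) (h1 : σ < 1) (hμ : μ < firstRoot σ ^ 2)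
    (hu : InStokesEigenspace (shell σ) μ u) : u =ᵐ[volume.restrict (shell σ)] 0 := by
  obtain ⟨φ, hφ⟩ := exists_critSeq hu
  refine ae_eq_restrict_of_indicator ?_
  filter_upwards [(hφ.isRadialLinear h0 h1 hμ.le).2 hμ] with x hx
  simp [hx]

/-- The infinitesimal rotations. -/
def axialField (α : SignType) (x : E3) : E3 :=
  match α with
  | .zero => !₂[-x 1, x 0, 0]
  | .neg => !₂[x 2, 0, -x 0]
  | .pos => !₂[0, x 2, -x 1]

theorem surfaceField_eq (α : SignType) (x : E3) : surfaceField α x = ‖x‖⁻¹ • axialField α x := by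
  cases α <;> rfl

theorem sum_signType {M : Type*} [AddCommMonoid M] (f : SignType → M) :
    ∑ α, f α = f .zero + f .neg + f .pos := by
  change f .zero + (f .neg + (f .pos + 0)) = _
  rw [add_zero, add_assoc]

/-- The first eigenspace. -/
theorem inStokesEigenspace_iff (h0 : 0 ≤ σ) (h1 : σ < 1) :
    InStokesEigenspace (shell σ) (firstRoot σ ^ 2) u ↔
      ∃ c : SignType → ℝ, u =ᵐ[volume.restrict (shell σ)]
        fun x => ∑ α, c α • profile σ ‖x‖ • axialField α x := by
  constructor
  · intro hu
    obtain ⟨C, hC, h⟩ := exists_linearField h0 h1 hu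
    refine ⟨fun α => match α with | .zero => - C 0 1 | .neg => C 0 2 | .pos => C 1 2, ?_⟩
    filter_upwards [h] with x hx
    rw [hx, sum_signType]
    have c00 : C 0 0 = 0 := by linarith [hC 0 0]
    have c11 : C 1 1 = 0 := by linarith [hC 1 1]
    have c22 : C 2 2 = 0 := by linarith [hC 2 2]
    have c10 : C 1 0 = - C 0 1 := by linarith [hC 0 1]
    have c20 : C 2 0 = - C 0 2 := by linarith [hC 0 2]
    have c21 : C 2 1 = - C 1 2 := by linarith [hC 1 2]
    ext i
    fin_cases i <;>
      simp [linearField, axialField, Fin.sum_univ_three, c00, c11, c22, c10, c20, c21] <;> ring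
  · rintro ⟨c, h⟩
    refine inStokesEigenspace_linearField h0 h1
      (C := ![![0, - c .zero, c .neg], ![c .zero, 0, c .pos], ![- c .neg, - c .pos, 0]])
      (fun i j => ?_) ?_
    · fin_cases i <;> fin_cases j <;> simp
    · filter_upwards [h] with x hx
      rw [hx, sum_signType]
      ext i
      fin_cases i <;> simp [linearField, axialField, Fin.sum_univ_three] <;> ring

end

end

noncomputable section

/-! ### Orthonormal bases of the first eigenspaces -/

section
variable {σ : ℝ}

/-- The second moment of the squared profile. -/
def profileMoment (σ : ℝ) : ℝ := ∫ x : E3, shellProfile σ ‖x‖ ^ 2 * (x 0 * x 0)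

theorem indicator_halfProfile_single (σ : ℝ) (i : Fin 3) (x : E3) :
    (shell σ).indicator (halfProfile σ (EuclideanSpace.single i 1)) x =
      shellProfile σ ‖x‖ * x i := by
  rw [← indicator_profile σ (fun x => x i)]
  congr 1
  ext1 y
  simp [halfProfile, EuclideanSpace.inner_single_left]

theorem memLp_shellProfile_mul_coord (h0 : 0 ≤ σ) (h1 : σ < 1) (i : Fin 3) :
    MemLp (fun x : E3 => shellProfile σ ‖x‖ * x i) 2 volume := by
  simpa only [← indicator_halfProfile_single] using
    (l2Lim_cutHalfProfile h0 h1 (EuclideanSpace.single i 1)).memLp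

theorem integrable_shellProfile_sq_mul (h0 : 0 ≤ σ) (h1 : σ < 1) (i j : Fin 3) :
    Integrable fun x : E3 => shellProfile σ ‖x‖ ^ 2 * (x i * x j) := by
  refine (integrable_inner_of_memLp (memLp_shellProfile_mul_coord h0 h1 i)
    (memLp_shellProfile_mul_coord h0 h1 j)).congr (Eventually.of_forall fun x => ?_)
  simp only [RCLike.inner_apply, conj_trivial]
  ring

theorem profileMoment_pos (h0 : 0 ≤ σ) (h1 : σ < 1) : 0 < profileMoment σ := by
  refine lt_of_le_of_ne (integral_nonneg fun x =>
    mul_nonneg (sq_nonneg _) (mul_self_nonneg _)) fun h => ?_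
  have hz := integral_normSq_eq_zero (memLp_shellProfile_mul_coord h0 h1 0) (by
    rw [h, profileMoment]
    congr 1
    ext x
    rw [Real.norm_eq_abs, sq_abs]
    ring)
  refine integral_shellProfile_pos h0 h1 0 (integral_eq_zero_of_ae ?_)
  filter_upwards [hz] with x hx
  rw [← mul_assoc, hx]
  simp

/-- The form is chosen for radial integration: squares of coordinates have equal moments, and a
product of distinct coordinates integrates to zero. -/
theorem inner_axialField (α β : SignType) : ∃ a b : Fin 3, ∃ c d : ℝ,
    (∀ x : E3, inner ℝ (axialField α x) (axialField β x) = c * (x a * x a + x b * x b) +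
      d * (x a * x b)) ∧ a ≠ b ∧ c = if α = β then 1 else 0 := by
  have h := fun (x : E3) => inner_eq_sum_three (axialField α x) (axialField β x)
  cases α <;> cases β
  · exact ⟨0, 1, 1, 0, fun x => by rw [h]; simp [axialField]; ring, by decide, by simp⟩
  · exact ⟨1, 2, 0, -1, fun x => by rw [h]; simp [axialField]; try ring, by decide, by simp⟩
  · exact ⟨0, 2, 0, 1, fun x => by rw [h]; simp [axialField]; try ring, by decide, by simp⟩
  · exact ⟨1, 2, 0, -1, fun x => by rw [h]; simp [axialField]; try ring, by decide, by simp⟩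
  · exact ⟨0, 2, 1, 0, fun x => by rw [h]; simp [axialField]; try ring, by decide, by simp⟩
  · exact ⟨0, 1, 0, 1, fun x => by rw [h]; simp [axialField]; try ring, by decide, by simp⟩
  · exact ⟨0, 2, 0, 1, fun x => by rw [h]; simp [axialField]; try ring, by decide, by simp⟩
  · exact ⟨0, 1, 0, 1, fun x => by rw [h]; simp [axialField]; try ring, by decide, by simp⟩
  · exact ⟨1, 2, 1, 0, fun x => by rw [h]; simp [axialField]; try ring, by decide, by simp⟩

theorem integral_inner_axialField (h0 : 0 ≤ σ) (h1 : σ < 1) (α β : SignType) :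
    ∫ x in shell σ, inner ℝ (profile σ ‖x‖ • axialField α x) (profile σ ‖x‖ • axialField β x) =
      if α = β then 2 * profileMoment σ else 0 := by
  obtain ⟨a, b, c, d, h, hab, hc⟩ := inner_axialField α β
  have e : ∫ x in shell σ, inner ℝ (profile σ ‖x‖ • axialField α x)
      (profile σ ‖x‖ • axialField β x) =
      ∫ x : E3, (c * (shellProfile σ ‖x‖ ^ 2 * (x a * x a) +
        shellProfile σ ‖x‖ ^ 2 * (x b * x b)) + d * (shellProfile σ ‖x‖ ^ 2 * (x a * x b))) := by
    rw [← integral_indicator (measurableSet_shell σ)]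
    congr 1
    ext x
    by_cases hx : x ∈ shell σ
    · rw [indicator_of_mem hx, real_inner_smul_left, real_inner_smul_right, h,
        shellProfile_of_mem hx]
      ring
    · rw [indicator_of_notMem hx, shellProfile_of_notMem hx]
      ring
  have ha := integrable_shellProfile_sq_mul h0 h1 a a
  have hb := integrable_shellProfile_sq_mul h0 h1 b b
  have hi : Integrable fun x : E3 => c * (shellProfile σ ‖x‖ ^ 2 * (x a * x a) +
      shellProfile σ ‖x‖ ^ 2 * (x b * x b)) := (ha.add hb).const_mul c
  rw [e, integral_add hi ((integrable_shellProfile_sq_mul h0 h1 a b).const_mul d),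
    integral_const_mul, integral_const_mul, integral_add ha hb,
    integral_radial_mul_coord_of_ne (fun r => shellProfile σ r ^ 2) hab,
    integral_radial_mul_coord_sq (fun r => shellProfile σ r ^ 2) a 0,
    integral_radial_mul_coord_sq (fun r => shellProfile σ r ^ 2) b 0, hc, ← profileMoment]
  split_ifs <;> ring

/-- Positive factors drop out under normalization, so Bessel prefactors never have to be compared,
and the limit `σ → 0` can be taken in terms of the profile. -/
theorem normalizeL2_eq (h0 : 0 ≤ σ) (h1 : σ < 1) {W : E3 → E3} {α : SignType} {s : ℝ} (hs : 0 < s)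
    (hW : ∀ x ∈ shell σ, W x = s • profile σ ‖x‖ • axialField α x) {x y : E3}
    (hx : W x = s • y) :
    normalizeL2 (shell σ) W x = (√(2 * profileMoment σ))⁻¹ • y := by
  have e : ∫ y in shell σ, ‖W y‖ ^ 2 = s ^ 2 * (2 * profileMoment σ) := by
    have h := integral_inner_axialField h0 h1 α α
    rw [if_pos rfl] at h
    rw [← h, ← integral_const_mul]
    refine setIntegral_congr_fun (measurableSet_shell σ) fun y hy => ?_
    simp only [hW y hy, real_inner_self_eq_norm_sq, norm_smul s, mul_pow, Real.norm_eq_abs, sq_abs]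
  rw [normalizeL2, e, Real.sqrt_mul (sq_nonneg s), Real.sqrt_sq hs.le, hx, smul_smul]
  congr 1
  field_simp

theorem isOrthonormalEigenbasis_of_eq (h0 : 0 ≤ σ) (h1 : σ < 1) {w : SignType → E3 → E3}
    (hw : ∀ α, ∀ x ∈ shell σ,
      w α x = (√(2 * profileMoment σ))⁻¹ • profile σ ‖x‖ • axialField α x) :
    IsOrthonormalEigenbasis (shell σ) (firstRoot σ ^ 2) w := by
  have hm := profileMoment_pos h0 h1
  have hs : 0 < √(2 * profileMoment σ) := Real.sqrt_pos.2 (by positivity)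
  refine ⟨fun α β => ?_, fun u => ?_⟩
  · have e : ∫ x in shell σ, inner ℝ (w α x) (w β x) = (2 * profileMoment σ)⁻¹ *
        ∫ x in shell σ, inner ℝ (profile σ ‖x‖ • axialField α x)
          (profile σ ‖x‖ • axialField β x) := by
      rw [← integral_const_mul]
      refine setIntegral_congr_fun (measurableSet_shell σ) fun x hx => ?_
      simp only [hw α x hx, hw β x hx]
      rw [real_inner_smul_left, real_inner_smul_right, ← mul_assoc, ← mul_inv,
        Real.mul_self_sqrt (by positivity)]
    rw [e, integral_inner_axialField h0 h1]
    split_ifs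
    · field_simp
    · simp
  · rw [inStokesEigenspace_iff h0 h1]
    constructor
    · rintro ⟨c, hc⟩
      refine ⟨fun α => c α * √(2 * profileMoment σ), ?_⟩
      filter_upwards [hc, ae_restrict_mem (measurableSet_shell σ)] with x hx hm
      rw [hx]
      refine Finset.sum_congr rfl fun α _ => ?_
      rw [hw α x hm, smul_smul (c α * _), mul_inv_cancel_right₀ hs.ne']
    · rintro ⟨c, hc⟩
      refine ⟨fun α => c α * (√(2 * profileMoment σ))⁻¹, ?_⟩
      filter_upwards [hc, ae_restrict_mem (measurableSet_shell σ)] with x hx hm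
      rw [hx]
      refine Finset.sum_congr rfl fun α _ => ?_
      rw [hw α x hm, smul_smul (c α)]

theorem isLeast_stokesEigenvalues (h0 : 0 ≤ σ) (h1 : σ < 1) :
    IsLeast (stokesEigenvalues (shell σ)) (firstRoot σ ^ 2) := by
  refine ⟨⟨fun x => profile σ ‖x‖ • axialField .zero x, (inStokesEigenspace_iff h0 h1).2
    ⟨fun α => if α = .zero then 1 else 0, ?_⟩, fun h => ?_⟩, fun μ hμ => ?_⟩
  · refine Eventually.of_forall fun x => ?_
    simp
  · have e := integral_inner_axialField h0 h1 .zero .zero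
    rw [if_pos rfl, integral_eq_zero_of_ae (by
      filter_upwards [h] with x hx
      rw [hx]
      simp)] at e
    linarith [profileMoment_pos h0 h1]
  · obtain ⟨u, hu, hne⟩ := hμ
    by_contra! hlt
    exact hne (ae_eq_zero_of_lt h0 h1 hlt hu)

theorem unitBall3_eq : unitBall3 = shell 0 := shell_zero.symm

theorem annulus3_eq (h0 : 0 < σ) : annulus3 σ = shell σ := (shell_of_pos h0).symm

theorem firstStokesEigenvalue_shell (h0 : 0 ≤ σ) (h1 : σ < 1) :
    firstStokesEigenvalue (shell σ) = firstRoot σ ^ 2 :=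
  (isLeast_stokesEigenvalues h0 h1).csInf_eq

theorem besselPrefactor_mul {k r : ℝ} (hk : 0 < k) (hr : 0 < r) :
    besselPrefactor (k * r) = besselPrefactor k * √r * r / r ^ 3 := by
  have e : (k * r / 2) ^ (3 / 2 : ℝ) = (k / 2) ^ (3 / 2 : ℝ) * (√r * r) := by
    rw [mul_div_right_comm, Real.mul_rpow (by positivity) hr.le, Real.sqrt_eq_rpow]
    congr 1
    nth_rewrite 3 [← Real.rpow_one r]
    rw [← Real.rpow_add hr]
    norm_num
  rw [besselPrefactor, besselPrefactor, e]
  field_simp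

theorem ballField_eq (α : SignType) (x : E3) :
    ballField α x = besselPrefactor (firstRoot 0) • profile 0 ‖x‖ • axialField α x := by
  have hk := firstRoot_pos 0
  rcases eq_or_ne x 0 with rfl | hx
  · simp [ballField, profile]
  · have hr : 0 < ‖x‖ := norm_pos_iff.2 hx
    rw [ballField, kappaBall_eq, surfaceField_eq, smul_smul, smul_smul,
      besselJ_three_halves (by positivity), besselPrefactor_mul hk hr, profile, phaseShift_zero,
      radialNum, sub_zero]
    congr 1
    have hs : √‖x‖ ≠ 0 := (Real.sqrt_pos.2 hr).ne'
    generalize √‖x‖ = q at hs ⊢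
    field_simp

/-- The factor between `annulusField` and the profile. -/
def annulusScale (σ : ℝ) : ℝ :=
  besselPrefactor (firstRoot σ * σ) * √(1 + (firstRoot σ * σ) ^ 2) * besselPrefactor (firstRoot σ)

theorem annulusScale_pos (h0 : 0 < σ) : 0 < annulusScale σ := by
  have hk := firstRoot_pos σ
  have h1 := besselPrefactor_pos hk
  have h2 := besselPrefactor_pos (mul_pos hk h0)
  unfold annulusScale
  positivity

/-- In amplitude and phase form, the values at `κ σ` become cosine and sine of the phase shift, and
the addition theorems assemble `radialNum`. The remaining factor is positive, so the signs of the
eigenfields agree with those in the ball. -/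
theorem annulusField_eq (h0 : 0 < σ) (h1 : σ < 1) (α : SignType) {x : E3} (hx : σ ≤ ‖x‖) :
    annulusField σ α x = annulusScale σ • profile σ ‖x‖ • axialField α x := by
  have hk := firstRoot_pos σ
  have hr : 0 < ‖x‖ := h0.trans_le hx
  rw [annulusField, if_pos hx, kappaAnnulus_eq h0 h1, surfaceField_eq, smul_smul, smul_smul,
    besselJ_three_halves (by positivity), besselJ_three_halves (by positivity),
    besselJ_neg_three_halves (by positivity), besselJ_neg_three_halves (by positivity),
    besselPrefactor_mul hk hr, sin_sub_mul_cos (firstRoot σ * σ), cos_add_mul_sin (firstRoot σ * σ),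
    ← phaseShift, profile, radialNum, Real.sin_sub, Real.cos_sub, annulusScale]
  congr 1
  have hs : √‖x‖ ≠ 0 := (Real.sqrt_pos.2 hr).ne'
  generalize √‖x‖ = q at hs ⊢
  field_simp
  ring

theorem ballEigenfield_eq (α : SignType) (x : E3) :
    ballEigenfield α x = (√(2 * profileMoment 0))⁻¹ • profile 0 ‖x‖ • axialField α x := by
  rw [ballEigenfield, unitBall3_eq]
  exact normalizeL2_eq le_rfl one_pos (besselPrefactor_pos (firstRoot_pos 0))
    (fun x _ => ballField_eq α x) (ballField_eq α x)

theorem annulusEigenfield_eq (h0 : 0 < σ) (h1 : σ < 1) (α : SignType) {x : E3} (hx : σ ≤ ‖x‖) :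
    annulusEigenfield σ α x = (√(2 * profileMoment σ))⁻¹ • profile σ ‖x‖ • axialField α x := by
  rw [annulusEigenfield, annulus3_eq h0]
  exact normalizeL2_eq h0.le h1 (annulusScale_pos h0)
    (fun x hx => annulusField_eq h0 h1 α (hx.1 h0).le) (annulusField_eq h0 h1 α hx)

end

end

noncomputable section

/-! ### The limit of small inner radius -/

theorem tendsto_firstRoot : Tendsto firstRoot (𝓝[>] 0) (𝓝 (firstRoot 0)) := by
  have h := firstRoot_continuousOn 0 ⟨le_rfl, one_pos⟩
  refine Tendsto.mono_left h (nhdsWithin_le_iff.2 ?_)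
  filter_upwards [Ioo_mem_nhdsGT (one_pos (α := ℝ))] with σ hσ
  exact ⟨hσ.1.le, hσ.2⟩

theorem tendsto_phaseShift : Tendsto phaseShift (𝓝[>] 0) (𝓝 0) := by
  have hc : Continuous besselPhase := continuous_id.sub Real.continuous_arctan
  have h := (hc.tendsto (firstRoot 0 * 0)).comp
    (tendsto_firstRoot.mul (tendsto_id.mono_left nhdsWithin_le_nhds))
  rw [mul_zero, besselPhase, Real.arctan_zero, sub_zero] at h
  exact h

theorem tendsto_profile (r : ℝ) :
    Tendsto (fun σ => profile σ r) (𝓝[>] 0) (𝓝 (profile 0 r)) := by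
  have hc : Continuous fun p : ℝ × ℝ => radialNum p.1 p.2 := by unfold radialNum; fun_prop
  have h := (hc.tendsto (0, firstRoot 0 * r)).comp
    (tendsto_phaseShift.prodMk_nhds (tendsto_firstRoot.mul_const r))
  have e : profile 0 r = radialNum 0 (firstRoot 0 * r) / r ^ 3 := by rw [profile, phaseShift_zero]
  rw [e]
  exact h.div_const _

theorem shellProfile_sq_mul_le {σ : ℝ} (h0 : 0 ≤ σ) (x : E3) :
    shellProfile σ ‖x‖ ^ 2 * (x 0 * x 0) ≤
      (Metric.ball (0 : E3) 1).indicator (fun _ => firstRoot σ ^ 4) x := by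
  by_cases hx : x ∈ shell σ
  · have hb : x ∈ Metric.ball (0 : E3) 1 := by simpa using hx.2
    rw [indicator_of_mem hb, shellProfile_of_mem hx]
    rcases eq_or_ne x 0 with rfl | hx0
    · simp only [PiLp.zero_apply, mul_zero]
      positivity
    have hr : 0 < ‖x‖ := norm_pos_iff.2 hx0
    have h1 := abs_radialNum_le h0 (norm_mem_of_mem_shell h0 hx hx0).1.le
    have h2 : |x 0| ≤ ‖x‖ := PiLp.norm_apply_le x 0
    have h3 : |profile σ ‖x‖ * x 0| ≤ firstRoot σ ^ 2 := by
      rw [abs_mul, profile, abs_div, abs_of_pos (pow_pos hr 3)]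
      calc _ ≤ firstRoot σ ^ 2 * ‖x‖ ^ 2 / ‖x‖ ^ 3 * ‖x‖ := by gcongr
        _ = firstRoot σ ^ 2 := by field_simp
    calc _ = |profile σ ‖x‖ * x 0| ^ 2 := by rw [sq_abs]; ring
      _ ≤ (firstRoot σ ^ 2) ^ 2 := by gcongr
      _ = firstRoot σ ^ 4 := by ring
  · rw [shellProfile_of_notMem hx]
    simp only [ne_eq, OfNat.ofNat_ne_zero, not_false_eq_true, zero_pow, zero_mul]
    exact indicator_nonneg (fun _ _ => by positivity) x

theorem tendsto_profileMoment : Tendsto profileMoment (𝓝[>] 0) (𝓝 (profileMoment 0)) := by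
  refine tendsto_integral_filter_of_dominated_convergence
    -- By monotonicity of `firstRoot`, its value at `1 / 2` bounds all smaller `σ`; any number below
    -- `1` would serve.
    ((Metric.ball (0 : E3) 1).indicator fun _ => firstRoot (1 / 2) ^ 4) ?_ ?_ ?_ ?_
  · refine Eventually.of_forall fun σ => ?_
    exact ((((measurable_shellProfile σ).comp measurable_norm).pow_const 2).mul
      (((contDiff_coord 0 (m := 0)).continuous.measurable).mul
        ((contDiff_coord 0 (m := 0)).continuous.measurable))).aestronglyMeasurable
  · filter_upwards [Ioo_mem_nhdsGT (show (0 : ℝ) < 1 / 2 by norm_num)] with σ hσ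
    refine Eventually.of_forall fun x => ?_
    rw [Real.norm_of_nonneg (mul_nonneg (sq_nonneg _) (mul_self_nonneg _))]
    refine (shellProfile_sq_mul_le hσ.1.le x).trans (indicator_le_indicator ?_)
    have := firstRoot_pos σ
    have := firstRoot_monotoneOn ⟨hσ.1.le, hσ.2.trans (by norm_num)⟩
      (⟨by norm_num, by norm_num⟩ : (1 / 2 : ℝ) ∈ Ico (0 : ℝ) 1) hσ.2.le
    gcongr
  · exact (integrable_indicator_iff Metric.isOpen_ball.measurableSet).2
      (integrableOn_const measure_ball_lt_top.ne)
  · filter_upwards [ae_ne_zero] with x hx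
    have hr : 0 < ‖x‖ := norm_pos_iff.2 hx
    refine Tendsto.mul_const _ (Tendsto.pow ?_ 2)
    by_cases h1 : ‖x‖ < 1
    · rw [shellProfile_of_mem (σ := 0) ⟨fun h => (lt_irrefl _ h).elim, h1⟩]
      refine (tendsto_profile ‖x‖).congr' ?_
      filter_upwards [Ioo_mem_nhdsGT hr] with σ hσ
      exact (shellProfile_of_mem ⟨fun _ => hσ.2, h1⟩).symm
    · have h : ∀ σ, shellProfile σ ‖x‖ = 0 := fun σ => shellProfile_of_notMem fun hx => h1 hx.2
      simp only [h]
      exact tendsto_const_nhds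

theorem continuous_axialField (α : SignType) : Continuous (axialField α) := by
  have h := fun k => (contDiff_coord k (m := 0)).continuous
  cases α
  · exact (contDiff_vec3 (m := 0) (contDiff_coord 1).neg (contDiff_coord 0)
      contDiff_const).continuous
  · exact (contDiff_vec3 (m := 0) (contDiff_coord 2) contDiff_const
      (contDiff_coord 0).neg).continuous
  · exact (contDiff_vec3 (m := 0) contDiff_const (contDiff_coord 2)
      (contDiff_coord 1).neg).continuous

/-- For `σ < δ` the fields are one jointly continuous expression in three parameters and a point of
a compact set, so convergence of the parameters gives uniform convergence. -/
theorem tendstoUniformlyOn_annulusEigenfield (α : SignType) {δ : ℝ} (hδ : 0 < δ) :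
    TendstoUniformlyOn (fun σ => annulusEigenfield σ α) (ballEigenfield α) (𝓝[>] 0)
      {x : E3 | δ ≤ ‖x‖ ∧ ‖x‖ ≤ 1} := by
  set S : Set E3 := {x : E3 | δ ≤ ‖x‖ ∧ ‖x‖ ≤ 1}
  have hS : IsCompact S := by
    refine (isCompact_closedBall (0 : E3) 1).of_isClosed_subset
      ((isClosed_le continuous_const continuous_norm).inter
        (isClosed_le continuous_norm continuous_const)) fun x hx => ?_
    simpa using hx.2
  have : CompactSpace S := isCompact_iff_compactSpace.1 hS
  set f : ℝ × ℝ × ℝ → S → E3 := fun p x =>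
    p.1 • (radialNum p.2.1 (p.2.2 * ‖(x : E3)‖) / ‖(x : E3)‖ ^ 3) • axialField α x with hf
  have hcont : Continuous ↿f := by
    have hx : Continuous fun q : (ℝ × ℝ × ℝ) × S => (q.2 : E3) :=
      continuous_subtype_val.comp continuous_snd
    have hn := hx.norm
    refine Continuous.smul (by fun_prop) (Continuous.smul (Continuous.div ?_ (hn.pow 3) ?_)
      ((continuous_axialField α).comp hx))
    · unfold radialNum
      fun_prop
    · exact fun q => pow_ne_zero 3 (hδ.trans_le q.2.2.1).ne'
  have hm : √(2 * profileMoment 0) ≠ 0 :=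
    (Real.sqrt_pos.2 (mul_pos two_pos (profileMoment_pos le_rfl one_pos))).ne'
  have hp : Tendsto (fun σ => ((√(2 * profileMoment σ))⁻¹, phaseShift σ, firstRoot σ)) (𝓝[>] 0)
      (𝓝 ((√(2 * profileMoment 0))⁻¹, 0, firstRoot 0)) :=
    ((tendsto_profileMoment.const_mul 2).sqrt.inv₀ hm).prodMk_nhds
      (tendsto_phaseShift.prodMk_nhds tendsto_firstRoot)
  have hu := Continuous.tendstoUniformly f hcont ((√(2 * profileMoment 0))⁻¹, 0, firstRoot 0)
  have hu' : TendstoUniformly (fun σ => f ((√(2 * profileMoment σ))⁻¹, phaseShift σ, firstRoot σ))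
      (f ((√(2 * profileMoment 0))⁻¹, 0, firstRoot 0)) (𝓝[>] 0) := fun s hs => hp.eventually (hu s hs)
  have hb : ∀ x : S, f ((√(2 * profileMoment 0))⁻¹, 0, firstRoot 0) x = ballEigenfield α x :=
    fun x => by rw [ballEigenfield_eq, profile, phaseShift_zero]
  rw [tendstoUniformlyOn_iff_tendstoUniformly_comp_coe]
  intro s hs
  filter_upwards [hu' s hs, Ioo_mem_nhdsGT (lt_min hδ one_pos)] with σ hσ hσ' x
  have h := hσ x
  rw [hb] at h
  have e : annulusEigenfield σ α x = f ((√(2 * profileMoment σ))⁻¹, phaseShift σ, firstRoot σ) x :=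
    annulusEigenfield_eq hσ'.1 (hσ'.2.trans_le (min_le_right _ _)) α
      ((hσ'.2.le.trans (min_le_left _ _)).trans x.2.1)
  simp only [Function.comp_apply, e]
  exact h

theorem exists_volume_ball_le {ε : ℝ} (hε : 0 < ε) :
    ∃ δ : ℝ, 0 < δ ∧ δ < 1 ∧ volume (Metric.ball (0 : E3) δ) ≤ ENNReal.ofReal ε := by
  have h1 : Tendsto (fun δ : ℝ => ENNReal.ofReal (δ ^ 3) * volume (Metric.ball (0 : E3) 1)) (𝓝[>] 0)
      (𝓝 (ENNReal.ofReal ((0 : ℝ) ^ 3) * volume (Metric.ball (0 : E3) 1))) := by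
    refine ENNReal.Tendsto.mul_const ?_ (Or.inr measure_ball_lt_top.ne)
    have hc : Continuous fun δ : ℝ => ENNReal.ofReal (δ ^ 3) :=
      ENNReal.continuous_ofReal.comp (continuous_pow 3)
    exact (hc.tendsto 0).mono_left nhdsWithin_le_nhds
  have h2 : ENNReal.ofReal ((0 : ℝ) ^ 3) * volume (Metric.ball (0 : E3) 1) < ENNReal.ofReal ε := by
    simpa using hε
  have hev : ∀ᶠ δ : ℝ in 𝓝[>] 0, δ ∈ Ioo (0 : ℝ) 1 := Ioo_mem_nhdsGT one_pos
  obtain ⟨δ, hδ, hlt⟩ := (hev.and (h1.eventually_lt_const h2)).exists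
  refine ⟨δ, hδ.1, hδ.2, ?_⟩
  rw [Measure.addHaar_ball _ _ hδ.1.le]
  simpa using hlt.le

theorem mainTheorem5 :
    -- the unit ball
    (IsLeast ballZeros kappaBall ∧
      IsLeast (stokesEigenvalues unitBall3) (firstStokesEigenvalue unitBall3) ∧
      firstStokesEigenvalue unitBall3 = kappaBall ^ 2 ∧
      IsOrthonormalEigenbasis unitBall3 (firstStokesEigenvalue unitBall3) ballEigenfield) ∧
    -- the annuli
    (∀ σ ∈ Ioo (0 : ℝ) 1,
      IsLeast (annulusZeros σ) (kappaAnnulus σ) ∧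
      IsLeast (stokesEigenvalues (annulus3 σ)) (firstStokesEigenvalue (annulus3 σ)) ∧
      firstStokesEigenvalue (annulus3 σ) = kappaAnnulus σ ^ 2 ∧
      IsOrthonormalEigenbasis (annulus3 σ) (firstStokesEigenvalue (annulus3 σ))
        (annulusEigenfield σ)) ∧
    -- monotonicity and continuity in `σ`
    MonotoneOn (fun σ : ℝ => firstStokesEigenvalue (annulus3 σ)) (Ioo 0 1) ∧
    ContinuousOn (fun σ : ℝ => firstStokesEigenvalue (annulus3 σ)) (Ioo 0 1) ∧
    (∀ σ ∈ Ioo (0 : ℝ) 1,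
      firstStokesEigenvalue unitBall3 ≤ firstStokesEigenvalue (annulus3 σ)) ∧
    -- the limit `σ → 0` of the first eigenvalues
    Tendsto (fun σ : ℝ => firstStokesEigenvalue (annulus3 σ)) (𝓝[>] 0)
      (𝓝 (firstStokesEigenvalue unitBall3)) ∧
    Tendsto (fun σ : ℝ => kappaAnnulus σ ^ 2) (𝓝[>] 0) (𝓝 (kappaBall ^ 2)) ∧
    -- pointwise and almost uniform convergence of the eigenfunctions on the closed unit ball
    (∀ α : SignType, ∀ x ∈ Metric.closedBall (0 : E3) 1,
      Tendsto (fun σ : ℝ => annulusEigenfield σ α x) (𝓝[>] 0) (𝓝 (ballEigenfield α x))) ∧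
    (∀ α : SignType, ∀ ε : ℝ, 0 < ε →
      ∃ A : Set E3, MeasurableSet A ∧ A ⊆ Metric.closedBall (0 : E3) 1 ∧
        volume A ≤ ENNReal.ofReal ε ∧
        TendstoUniformlyOn (fun σ : ℝ => annulusEigenfield σ α) (ballEigenfield α) (𝓝[>] 0)
          (Metric.closedBall (0 : E3) 1 \ A)) := by
  have hB : firstStokesEigenvalue unitBall3 = firstRoot 0 ^ 2 := by
    rw [unitBall3_eq, firstStokesEigenvalue_shell le_rfl one_pos]
  have hA : ∀ σ ∈ Ioo (0 : ℝ) 1, firstStokesEigenvalue (annulus3 σ) = firstRoot σ ^ 2 :=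
    fun σ hσ => by rw [annulus3_eq hσ.1, firstStokesEigenvalue_shell hσ.1.le hσ.2]
  have hI : ∀ σ ∈ Ioo (0 : ℝ) 1, σ ∈ Ico (0 : ℝ) 1 := fun σ hσ => ⟨hσ.1.le, hσ.2⟩
  have hmono : ∀ σ ∈ Ico (0 : ℝ) 1, ∀ τ ∈ Ico (0 : ℝ) 1, σ ≤ τ →
      firstRoot σ ^ 2 ≤ firstRoot τ ^ 2 := fun σ hσ τ hτ h =>
    pow_le_pow_left₀ (firstRoot_pos σ).le (firstRoot_monotoneOn hσ hτ h) 2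
  have hev : ∀ᶠ σ : ℝ in 𝓝[>] 0, σ ∈ Ioo (0 : ℝ) 1 := Ioo_mem_nhdsGT one_pos
  refine ⟨⟨?_, ?_, ?_, ?_⟩, fun σ hσ => ⟨?_, ?_, ?_, ?_⟩, fun σ hσ τ hτ h => ?_, ?_,
    fun σ hσ => ?_, ?_, ?_, fun α x hx => ?_, fun α ε hε => ?_⟩
  · rw [kappaBall_eq]
    exact isLeast_ballZeros
  · rw [hB, unitBall3_eq]
    exact isLeast_stokesEigenvalues le_rfl one_pos
  · rw [hB, kappaBall_eq]
  · rw [hB, unitBall3_eq]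
    exact isOrthonormalEigenbasis_of_eq le_rfl one_pos fun α x _ => ballEigenfield_eq α x
  · rw [kappaAnnulus_eq hσ.1 hσ.2]
    exact isLeast_annulusZeros hσ.1 hσ.2
  · rw [hA σ hσ, annulus3_eq hσ.1]
    exact isLeast_stokesEigenvalues hσ.1.le hσ.2
  · rw [hA σ hσ, kappaAnnulus_eq hσ.1 hσ.2]
  · rw [hA σ hσ, annulus3_eq hσ.1]
    exact isOrthonormalEigenbasis_of_eq hσ.1.le hσ.2 fun α x hx =>
      annulusEigenfield_eq hσ.1 hσ.2 α (hx.1 hσ.1).le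
  · simp only [hA σ hσ, hA τ hτ]
    exact hmono σ (hI σ hσ) τ (hI τ hτ) h
  · exact ((firstRoot_continuousOn.mono hI).pow 2).congr hA
  · rw [hB, hA σ hσ]
    exact hmono 0 ⟨le_rfl, one_pos⟩ σ (hI σ hσ) hσ.1.le
  · rw [hB]
    refine (tendsto_firstRoot.pow 2).congr' ?_
    filter_upwards [hev] with σ hσ using (hA σ hσ).symm
  · rw [kappaBall_eq]
    refine (tendsto_firstRoot.pow 2).congr' ?_
    filter_upwards [hev] with σ hσ
    rw [kappaAnnulus_eq hσ.1 hσ.2]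
  · rcases eq_or_ne x 0 with rfl | hx0
    -- The origin lies in the hole of every annulus, so all fields vanish there.
    · have e : ballEigenfield α 0 = 0 := by simp [ballEigenfield_eq, profile]
      rw [e]
      refine tendsto_const_nhds.congr' ?_
      filter_upwards [hev] with σ hσ
      simp [annulusEigenfield, normalizeL2, annulusField, hσ.1.not_ge]
    · exact (tendstoUniformlyOn_annulusEigenfield α (norm_pos_iff.2 hx0)).tendsto_at
        ⟨le_rfl, by simpa using hx⟩
  · obtain ⟨δ, hδ, hδ1, hv⟩ := exists_volume_ball_le hε
    -- The exceptional set is a small ball about the origin, the only place where uniformity is not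
    -- claimed.
    refine ⟨Metric.ball 0 δ, Metric.isOpen_ball.measurableSet,
      Metric.ball_subset_closedBall.trans (Metric.closedBall_subset_closedBall hδ1.le), hv,
      (tendstoUniformlyOn_annulusEigenfield α hδ).mono fun x hx => ⟨?_, ?_⟩⟩
    · simpa using hx.2
    · simpa using hx.1

end
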